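/- Let $(M,g)$ be a smooth four-dimensional Lorentzian manifold of signature $(+,-,-,-)$ with a spin structure. All fields are smooth. We use two-component spinors with the standard conventions: $\epsilon_{AB}=-\epsilon_{BA}$ is the spin metric, $\psi^A=\epsilon^{AB}\psi_B$, $\psi_B=\psi^A\epsilon_{AB}$, $g_{ab}=\epsilon_{AB}\bar\epsilon_{A'B'}$, round brackets denote symmetrization (indices between vertical bars are excluded), and $\nabla_{AA'}$ is the Levi-Civita (spin) connection. The Weyl spinor $\Psi_{ABCD}=\Psi_{(ABCD)}$ and the Ricci spinor $\Phi_{ABA'B'}=\Phi_{(AB)(A'B')}$ are defined by $$\nabla_{A'(A}\nabla_{B)}{}^{A'}\kappa^D=X_{ABC}{}^D\kappa^C,\qquad \Psi_{ABCD}=X_{(ABCD)},\qquad \nabla_{A(A'}\nabla^{A}{}_{B')}\kappa^D=\Phi_{A'B'C}{}^{D}\kappa^C .$$ A Killing spinor of valence $(k,l)$ is a symmetric (complex) spinor field $L_{A_1\cdots A_k}{}^{A'_1\cdots A'_l}$ with $$\nabla_{(A_1}{}^{(A'_1}L_{A_2\cdots A_{k+1})}{}^{A'_2\cdots A'_{l+1})}=0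 ;$$ a conformal Killing vector is a Killing spinor of valence $(1,1)$. A Killing spinor $L_{AB}{}^{A'B'}$ of valence $(2,2)$ satisfies condition (A0) if there is a complex function $Q$ on $M$ with $$\nabla_{AA'}Q=\tfrac13\Psi_{ABCD}\nabla^{(B|B'|}L^{CD)}{}_{A'B'}+\tfrac13\bar\Psi_{A'B'C'D'}\nabla^{B(B'}L_{AB}{}^{C'D')}+L^{BC}{}_{A'}{}^{B'}\nabla_{(A}{}^{C'}\Phi_{BC)B'C'}+L_A{}^{BB'C'}\nabla^C{}_{(A'}\Phi_{|BC|B'C')},$$ and condition (A1) if there is a complex vector field $P_A{}^{A'}$ on $M$ with $$\nabla_{(A}{}^{(A'}P_{B)}{}^{B')}=L^{CDA'B'}\Psi_{ABCD}-L_{AB}{}^{C'D'}\bar\Psi^{A'B'}{}_{C'D'} .$$ A Killing spinor $L_{ABC}{}^{A'}$ of valence $(3,1)$ satisfies condition (A1/2*) if $$\begin{aligned}0={}&\tfrac34\Psi_{ABCD}\nabla^{FA'}L^{CD}{}_{FA'}+\tfrac56\Psi_B{}^{CDF}\nabla_{(A}{}^{A'}L_{CDF)A'}+\tfrac56\Psi_A{}^{CDF}\nabla_{(B}{}^{A'}L_{CDF)A'}\\&-\tfrac35L_B{}^{CDA'}\nabla_{(A}{}^{B'}\Phi_{CD)A'B'}-\tfrac35L_A{}^{CDA'}\nabla_{(B}{}^{B'}\Phi_{CD)A'B'}+\tfrac43L^{CDFA'}\nabla_{(A|A'|}\Psi_{BCDF)}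 .\end{aligned}$$ **Proposition.** Let $\xi^{AA'}$ and $\zeta^{AA'}$ be (not necessarily distinct) conformal Killing vectors and let $\kappa_{AB}$ be a Killing spinor of valence $(2,0)$. Then: 1. $\xi_{(A}{}^{(A'}\zeta_{B)}{}^{B')}$ is a Killing spinor of valence $(2,2)$, and it satisfies conditions (A0) and (A1). 2. $\kappa_{AB}\bar\kappa_{A'B'}$ is a Killing spinor of valence $(2,2)$, and it satisfies conditions (A0) and (A1). 3. $\kappa_{(AB}\xi_{C)}{}^{C'}$ is a Killing spinor of valence $(3,1)$, and it satisfies condition (A1/2*). 4. $\kappa_{(AB}\kappa_{CD)}$ is a Killing spinor of valence $(4,0)$. -/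

import Mathlib

open scoped Manifold ContDiff

noncomputable section

namespace SpinGeometry

/-! ### Algebra of two-component spinor indices -/

/-- The components `ε_{AB}` and `ε^{AB}` of the spin metric in a normalized spin frame
(both are the same matrix, with `ε_{01} = ε^{01} = 1`).
Indices are raised by `ψ^A = ε^{AB} ψ_B` and lowered by `ψ_B = ψ^A ε_{AB}`. -/
def eps (A B : Fin 2) : ℂ := !![0, 1; -1, 0] A B

/-- The contraction `f_B{}^B = ε^{BE} f_{BE}`: the first slot is the lower index, the second slot
is the one that is raised. Used for both unprimed and primed indices. -/
def tr (f : Fin 2 → Fin 2 → ℂ) : ℂ := ∑ B, ∑ E, eps B E * f B E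

/-- The Infeld-van der Waerden symbols `σ^a_{AA'}`: the Pauli matrices divided by `√2`. -/
def sigma (a : Fin 4) : Matrix (Fin 2) (Fin 2) ℂ :=
  ((Real.sqrt 2 : ℝ) : ℂ)⁻¹ •
    (![!![1, 0; 0, 1], !![0, 1; 1, 0], !![0, -Complex.I; Complex.I, 0], !![1, 0; 0, -1]] a)

/-- The matrix `diag(1, -1, -1, -1)`. -/
def eta (a b : Fin 4) : ℝ := if a = b then (if a = 0 then 1 else -1) else 0

/-- Component arrays `φ_{A₁⋯A_k A'₁⋯A'_l}` of spinors with `k` unprimed and `l` primed indices,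
all of them in lower position. -/
abbrev Comp (k l : ℕ) : Type := (Fin k → Fin 2) → (Fin l → Fin 2) → ℂ

/-- Symmetrization over all unprimed indices. -/
def symU {k l : ℕ} (φ : Comp k l) : Comp k l := fun A A' =>
  ((k.factorial : ℂ))⁻¹ * ∑ s : Equiv.Perm (Fin k), φ (A ∘ s) A'

/-- Symmetrization over all primed indices. -/
def symP {k l : ℕ} (φ : Comp k l) : Comp k l := fun A A' =>
  ((l.factorial : ℂ))⁻¹ * ∑ s : Equiv.Perm (Fin l), φ A (A' ∘ s)

/-- The tensor product `φ_{A⋯A'⋯} ψ_{B⋯B'⋯}`. -/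
def tprod {k l m n : ℕ} (φ : Comp k l) (ψ : Comp m n) : Comp (k + m) (l + n) := fun A A' =>
  φ (A ∘ Fin.castAdd m) (A' ∘ Fin.castAdd n) * ψ (A ∘ Fin.natAdd k) (A' ∘ Fin.natAdd l)

/-- The symmetrized tensor product, e.g. `φ_{(A}{}^{(A'} ψ_{B)}{}^{B')}`. -/
def symProd {k l m n : ℕ} (φ : Comp k l) (ψ : Comp m n) : Comp (k + m) (l + n) :=
  symU (symP (tprod φ ψ))

/-- Complex conjugation of spinors; it exchanges primed and unprimed indices. -/
def bar {k l : ℕ} (φ : Comp k l) : Comp l k := fun A A' => star (φ A' A)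

/-! ### Lorentzian spin manifolds of dimension four -/

section Manifold

variable (M : Type*) [TopologicalSpace M] [ChartedSpace (EuclideanSpace ℝ (Fin 4)) M]
  [IsManifold (𝓡 4) ∞ M]

/-- A smooth Lorentzian metric of signature `(+,-,-,-)`. -/
structure LorentzMetric where
  /-- the scalar product on each tangent space -/
  val (x : M) : TangentSpace (𝓡 4) x →L[ℝ] TangentSpace (𝓡 4) x →L[ℝ] ℝ
  symm : ∀ (x : M) (v w : TangentSpace (𝓡 4) x), val x v w = val x w v
  signature : ∀ x : M, ∃ b : Module.Basis (Fin 4) ℝ (TangentSpace (𝓡 4) x),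
    ∀ a c, val x (b a) (b c) = eta a c
  smooth : ContMDiff (𝓡 4)
    ((𝓡 4).prod 𝓘(ℝ, EuclideanSpace ℝ (Fin 4) →L[ℝ] EuclideanSpace ℝ (Fin 4) →L[ℝ] ℝ)) ∞
    (fun x => Bundle.TotalSpace.mk'
      (EuclideanSpace ℝ (Fin 4) →L[ℝ] EuclideanSpace ℝ (Fin 4) →L[ℝ] ℝ) x (val x))

variable {M}

/-- The Hermitian matrix `v_{AA'} = ∑ₐ σ^a_{AA'} g(e_a, v)` of a tangent vector `v` with respect
to an orthonormal frame `e` at `x`. -/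
def hermitianMatrix (g : LorentzMetric M) (x : M) (e : Fin 4 → TangentSpace (𝓡 4) x)
    (v : TangentSpace (𝓡 4) x) : Matrix (Fin 2) (Fin 2) ℂ :=
  ∑ a, ((g.val x (e a) v : ℝ) : ℂ) • sigma a

/-- A spin structure on a Lorentzian four-manifold, given by local trivializations: an open cover
`U i` with smooth orthonormal frames (coming from spin frames over `U i`), and a smooth
`SL(2,ℂ)`-valued cocycle which lifts the Lorentz transformations relating these frames. The values
of frames and transition functions outside `U i` and `U i ∩ U j` are irrelevant. -/
structure SpinStructure (g : LorentzMetric M) (ι : Type*) where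
  /-- the open sets of the cover -/
  U : ι → Set M
  isOpen_U : ∀ i, IsOpen (U i)
  cover : ∀ x : M, ∃ i, x ∈ U i
  /-- the orthonormal frame over `U i` -/
  e : ι → Fin 4 → (x : M) → TangentSpace (𝓡 4) x
  smooth_e : ∀ i a, ContMDiffOn (𝓡 4) (𝓡 4).tangent ∞
    (fun x => (⟨x, e i a x⟩ : TangentBundle (𝓡 4) M)) (U i)
  orthonormal : ∀ i, ∀ x ∈ U i, ∀ a b, g.val x (e i a x) (e i b x) = eta a b
  /-- the change of spin frame from `U i` to `U j` -/
  t : ι → ι → M → Matrix.SpecialLinearGroup (Fin 2) ℂ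
  smooth_t : ∀ i j A B, ContMDiffOn (𝓡 4) 𝓘(ℝ, ℂ) ∞
    (fun x => (t i j x : Matrix (Fin 2) (Fin 2) ℂ) A B) (U i ∩ U j)
  cocycle : ∀ i j k, ∀ x ∈ U i ∩ U j ∩ U k, t i k x = t j k x * t i j x
  frame_change : ∀ i j, ∀ x ∈ U i ∩ U j, ∀ v : TangentSpace (𝓡 4) x,
    hermitianMatrix g x (fun a => e j a x) v =
      (t i j x : Matrix (Fin 2) (Fin 2) ℂ) * hermitianMatrix g x (fun a => e i a x) v *
        (t i j x : Matrix (Fin 2) (Fin 2) ℂ).conjTranspose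

namespace SpinStructure

variable {g : LorentzMetric M} {ι : Type*} (S : SpinStructure g ι)

/-- Families of local components: for each `i`, the components with respect to the spin frame over
`U i`, as functions of the point (only their values on `U i` matter). -/
abbrev Field (_S : SpinStructure g ι) (k l : ℕ) : Type _ := ι → M → Comp k l

/-- The local components are those of a globally defined smooth spinor field with `k` unprimed and
`l` primed indices. -/
structure IsSpinorField {k l : ℕ} (φ : S.Field k l) : Prop where
  smooth : ∀ i A A', ContMDiffOn (𝓡 4) 𝓘(ℝ, ℂ) ∞ (fun x => φ i x A A') (S.U i)
  transform : ∀ i j, ∀ x ∈ S.U i ∩ S.U j, ∀ A A',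
    φ j x A A' = ∑ B : Fin k → Fin 2, ∑ B' : Fin l → Fin 2,
      (∏ r, (S.t i j x : Matrix (Fin 2) (Fin 2) ℂ) (A r) (B r)) *
      (∏ r, star ((S.t i j x : Matrix (Fin 2) (Fin 2) ℂ) (A' r) (B' r))) * φ i x B B'

/-- Total symmetry in the unprimed and in the primed indices. -/
def IsSymmetric {k l : ℕ} (φ : S.Field k l) : Prop :=
  ∀ i, ∀ x ∈ S.U i, ∀ (s : Equiv.Perm (Fin k)) (s' : Equiv.Perm (Fin l)) A A',
    φ i x (A ∘ s) (A' ∘ s') = φ i x A A'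

/-! ### The Levi-Civita connection and its spin lift -/

/-- `g([e_a, e_b], e_c)`. -/
def bracket (i : ι) (a b c : Fin 4) (x : M) : ℝ :=
  g.val x (VectorField.mlieBracket (𝓡 4) (S.e i a) (S.e i b) x) (S.e i c x)

/-- The coefficients `g(∇_{e_a} e_b, e_c)` of the Levi-Civita connection in an orthonormal frame,
given by the Koszul formula. -/
def leviCivita (i : ι) (a b c : Fin 4) (x : M) : ℝ :=
  (1 / 2) * (S.bracket i a b c x - S.bracket i a c b x - S.bracket i b c a x)

/-- The coefficients `γ_{aB}{}^C` of the spin connection, `∇_{e_a} o_B = γ_{aB}{}^C o_C` for the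
spin frame `o_0, o_1` over `U i`: one has
`γ_{aB}{}^C = ε^{CD} γ_{aBD}` and `γ_{aBD} = ½ ε^{B'D'} g(∇_{e_a} e_{BB'}, e_{DD'})`, where
`e_{AA'} = ∑ₐ σ^a_{AA'} e_a`. -/
def spinConn (i : ι) (a : Fin 4) (B C : Fin 2) (x : M) : ℂ :=
  ∑ D, eps C D * ((1 / 2) * ∑ B', ∑ D', eps B' D' *
    ∑ b, ∑ c, sigma b B B' * sigma c D D' * (S.leviCivita i a b c x : ℂ))

/-- The derivative of a complex function along the frame vector `e_a`. -/
def frameDeriv (i : ι) (a : Fin 4) (f : M → ℂ) (x : M) : ℂ :=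
  (mfderiv (𝓡 4) 𝓘(ℝ, ℂ) f x (S.e i a x) : ℂ)

/-- The derivative of a complex function along the complex vector `e_{AA'} = ∑ₐ σ^a_{AA'} e_a`;
these are the components of `∇_{AA'} f`. -/
def nablaFun (i : ι) (A A' : Fin 2) (f : M → ℂ) (x : M) : ℂ :=
  ∑ a, sigma a A A' * S.frameDeriv i a f x

/-- `γ_{AA'B}{}^C = ∑ₐ σ^a_{AA'} γ_{aB}{}^C`. -/
def spinCoeff (i : ι) (A A' B C : Fin 2) (x : M) : ℂ := ∑ a, sigma a A A' * S.spinConn i a B C x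

/-- The covariant derivative `∇_{BB'} φ_{A₁⋯A_k A'₁⋯A'_l}`; the indices of the derivative are placed
first, i.e. `B, A₁, …, A_k` and `B', A'₁, …, A'_l`. -/
def nabla {k l : ℕ} (φ : S.Field k l) : S.Field (k + 1) (l + 1) := fun i x A A' =>
  S.nablaFun i (A 0) (A' 0) (fun y => φ i y (Fin.tail A) (Fin.tail A')) x
  - ∑ r : Fin k, ∑ C, S.spinCoeff i (A 0) (A' 0) (Fin.tail A r) C x *
      φ i x (Function.update (Fin.tail A) r C) (Fin.tail A')
  - ∑ r : Fin l, ∑ C, star (S.spinCoeff i (A' 0) (A 0) (Fin.tail A' r) C x) *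
      φ i x (Fin.tail A) (Function.update (Fin.tail A') r C)

/-! ### The four irreducible parts of the covariant derivative -/

/-- `(𝒟φ)_{A₁⋯A_k A'₁⋯A'_l} = ∇^{BB'} φ_{BA₁⋯A_k B'A'₁⋯A'_l}`. -/
def divOp {k l : ℕ} (φ : S.Field (k + 1) (l + 1)) : S.Field k l := fun i x A A' =>
  tr fun B C => tr fun B' C' =>
    S.nabla φ i x (Matrix.vecCons C (Matrix.vecCons B A)) (Matrix.vecCons C' (Matrix.vecCons B' A'))

/-- `(𝒞φ)_{A₁⋯A_{k+1} A'₁⋯A'_l} = ∇_{(A₁}{}^{B'} φ_{A₂⋯A_{k+1}) B'A'₁⋯A'_l}`. -/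
def curl {k l : ℕ} (φ : S.Field k (l + 1)) : S.Field (k + 1) l := fun i x =>
  symU fun A A' => tr fun B' C' =>
    S.nabla φ i x A (Matrix.vecCons C' (Matrix.vecCons B' A'))

/-- `(𝒞†φ)_{A₁⋯A_k A'₁⋯A'_{l+1}} = ∇^B{}_{(A'₁} φ_{|BA₁⋯A_k| A'₂⋯A'_{l+1})}`. -/
def curlDagger {k l : ℕ} (φ : S.Field (k + 1) l) : S.Field k (l + 1) := fun i x =>
  symP fun A A' => tr fun B C =>
    S.nabla φ i x (Matrix.vecCons C (Matrix.vecCons B A)) A'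

/-- `(𝒯φ)_{A₁⋯A_{k+1} A'₁⋯A'_{l+1}} = ∇_{(A₁(A'₁} φ_{A₂⋯A_{k+1}) A'₂⋯A'_{l+1})}`. -/
def twist {k l : ℕ} (φ : S.Field k l) : S.Field (k + 1) (l + 1) := fun i x =>
  symU (symP (S.nabla φ i x))

/-- A Killing spinor of valence `(k,l)`: a smooth symmetric spinor field `φ` with `𝒯φ = 0`. -/
structure IsKillingSpinor {k l : ℕ} (φ : S.Field k l) : Prop where
  isSpinorField : S.IsSpinorField φ
  isSymmetric : S.IsSymmetric φ
  twist_eq_zero : ∀ i, ∀ x ∈ S.U i, ∀ A A', S.twist φ i x A A' = 0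

/-! ### Curvature spinors -/

/-- The curvature `R_{abC}{}^E` of the spin connection,
`(∇_{e_a} ∇_{e_b} - ∇_{e_b} ∇_{e_a} - ∇_{[e_a, e_b]}) o_C = R_{abC}{}^E o_E`. -/
def spinCurv (i : ι) (a b : Fin 4) (C E : Fin 2) (x : M) : ℂ :=
  S.frameDeriv i a (S.spinConn i b C E) x - S.frameDeriv i b (S.spinConn i a C E) x
  + ∑ D, (S.spinConn i b C D x * S.spinConn i a D E x
      - S.spinConn i a C D x * S.spinConn i b D E x)
  - ∑ c, ∑ d, ((eta c d * S.bracket i a b d x : ℝ) : ℂ) * S.spinConn i c C E x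

/-- `R_{AA'BB'CD} = R_{AA'BB'C}{}^E ε_{ED}`. -/
def spinCurvLow (i : ι) (A A' B B' C D : Fin 2) (x : M) : ℂ :=
  ∑ a, ∑ b, ∑ E, sigma a A A' * sigma b B B' * S.spinCurv i a b C E x * eps E D

/-- The curvature spinor `X_{ABCD}`, defined by
`R_{AA'BB'CD} = ε_{A'B'} X_{ABCD} + ε_{AB} Φ_{CDA'B'}`, i.e.
`∇_{A'(A} ∇_{B)}{}^{A'} κ^D = X_{ABC}{}^D κ^C`. -/
def curvX : S.Field 4 0 := fun i x A _ =>
  (1 / 2) * ∑ P, ∑ P', eps P P' * S.spinCurvLow i (A 0) P (A 1) P' (A 2) (A 3) x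

/-- The Weyl spinor `Ψ_{ABCD} = X_{(ABCD)}`. -/
def Psi : S.Field 4 0 := fun i x => symU (S.curvX i x)

/-- The Ricci spinor `Φ_{CDA'B'}`, defined by
`R_{AA'BB'CD} = ε_{A'B'} X_{ABCD} + ε_{AB} Φ_{CDA'B'}`, i.e.
`∇_{A(A'} ∇^A{}_{B')} κ^D = Φ_{A'B'C}{}^D κ^C`. -/
def Phi : S.Field 2 2 := fun i x A A' =>
  (1 / 2) * ∑ P, ∑ P', eps P P' * S.spinCurvLow i P (A' 0) P' (A' 1) (A 0) (A 1) x

/-- The conjugate Weyl spinor `Ψ̄_{A'B'C'D'}`. -/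
def PsiBar : S.Field 0 4 := fun i x => bar (S.Psi i x)

/-! ### The auxiliary conditions -/

/-- The right hand side of condition A0, a spinor with indices `A`, `A'`:
`⅓ Ψ_{ABCD} ∇^{(B|B'|} L^{CD)}{}_{A'B'} + ⅓ Ψ̄_{A'B'C'D'} ∇^{B(B'} L_{AB}{}^{C'D')}
 + L^{BC}{}_{A'}{}^{B'} ∇_{(A}{}^{C'} Φ_{BC)B'C'} + L_A{}^{BB'C'} ∇^C{}_{(A'} Φ_{|BC|B'C')}`. -/
def obstruction0 (L : S.Field 2 2) (i : ι) (x : M) (A A' : Fin 2) : ℂ :=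
  (1 / 3) * (tr fun B E => tr fun C F => tr fun D G =>
      S.Psi i x ![A, B, C, D] ![] * S.curl L i x ![E, F, G] ![A'])
  + (1 / 3) * (tr fun B' E' => tr fun C' F' => tr fun D' G' =>
      S.PsiBar i x ![] ![A', B', C', D'] * S.curlDagger L i x ![A] ![E', F', G'])
  + (tr fun B E => tr fun C F => tr fun B' E' =>
      S.curl S.Phi i x ![A, B, C] ![B'] * L i x ![E, F] ![A', E'])
  + (tr fun B E => tr fun B' E' => tr fun C' F' =>
      S.curlDagger S.Phi i x ![B] ![A', B', C'] * L i x ![A, E] ![E', F'])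

/-- Condition A0: there is a smooth complex function `Q` such that `∇_{AA'} Q` is the spinor
`obstruction0 L`. -/
def ConditionA0 (L : S.Field 2 2) : Prop :=
  ∃ Q : M → ℂ, ContMDiff (𝓡 4) 𝓘(ℝ, ℂ) ∞ Q ∧
    ∀ i, ∀ x ∈ S.U i, ∀ A A', S.nablaFun i A A' Q x = S.obstruction0 L i x A A'

/-- The right hand side of condition A1:
`L^{CD}{}_{A'B'} Ψ_{ABCD} - L_{AB}{}^{C'D'} Ψ̄_{A'B'C'D'}`. -/
def obstruction1 (L : S.Field 2 2) (i : ι) (x : M) (A B A' B' : Fin 2) : ℂ :=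
  (tr fun C E => tr fun D F => S.Psi i x ![A, B, C, D] ![] * L i x ![E, F] ![A', B'])
  - (tr fun C' E' => tr fun D' F' =>
      S.PsiBar i x ![] ![A', B', C', D'] * L i x ![A, B] ![E', F'])

/-- Condition A1: there is a smooth (complex) vector field `P_{AA'}` such that `∇_{(A(A'} P_{B)B')}`
is the spinor `obstruction1 L`. -/
def ConditionA1 (L : S.Field 2 2) : Prop :=
  ∃ P : S.Field 1 1, S.IsSpinorField P ∧
    ∀ i, ∀ x ∈ S.U i, ∀ A B A' B',
      S.twist P i x ![A, B] ![A', B'] = S.obstruction1 L i x A B A' B'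

/-- The right hand side of condition A1/2*, a spinor with indices `A`, `B`:
`¾ Ψ_{ABCD} ∇^{FA'} L^{CD}{}_{FA'} + ⅚ Ψ_B{}^{CDF} ∇_{(A}{}^{A'} L_{CDF)A'}
 + ⅚ Ψ_A{}^{CDF} ∇_{(B}{}^{A'} L_{CDF)A'} - ⅗ L_B{}^{CDA'} ∇_{(A}{}^{B'} Φ_{CD)A'B'}
 - ⅗ L_A{}^{CDA'} ∇_{(B}{}^{B'} Φ_{CD)A'B'} + (4/3) L^{CDFA'} ∇_{(A|A'|} Ψ_{BCDF)}`. -/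
def obstructionHalf (L : S.Field 3 1) (i : ι) (x : M) (A B : Fin 2) : ℂ :=
  (3 / 4) * (tr fun C E => tr fun D F => S.Psi i x ![A, B, C, D] ![] * S.divOp L i x ![E, F] ![])
  + (5 / 6) * (tr fun C E => tr fun D G => tr fun F H =>
      S.curl L i x ![A, C, D, F] ![] * S.Psi i x ![B, E, G, H] ![])
  + (5 / 6) * (tr fun C E => tr fun D G => tr fun F H =>
      S.curl L i x ![B, C, D, F] ![] * S.Psi i x ![A, E, G, H] ![])
  - (3 / 5) * (tr fun C E => tr fun D G => tr fun A' E' =>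
      S.curl S.Phi i x ![A, C, D] ![A'] * L i x ![B, E, G] ![E'])
  - (3 / 5) * (tr fun C E => tr fun D G => tr fun A' E' =>
      S.curl S.Phi i x ![B, C, D] ![A'] * L i x ![A, E, G] ![E'])
  + (4 / 3) * (tr fun C E => tr fun D G => tr fun F H => tr fun A' E' =>
      S.twist S.Psi i x ![A, B, C, D, F] ![A'] * L i x ![E, G, H] ![E'])

/-- Condition A1/2*: the spinor `obstructionHalf L` vanishes. -/
def ConditionHalf (L : S.Field 3 1) : Prop :=
  ∀ i, ∀ x ∈ S.U i, ∀ A B, S.obstructionHalf L i x A B = 0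

end SpinStructure

end Manifold

end SpinGeometry

end

/-! The Killing equations are of finite type, and the proof runs on their prolongations. For a
conformal Killing vector ξ the derivative ∇ξ consists of two symmetric spinors F, F' and a multiple
d of the divergence. The Ricci identity then expresses ∇F, ∇F' and the second derivative of d
through ξ, F, F', d, ∇d and the curvature (`IsCKV.n20`, `IsCKV.n11_omega`). For a Killing spinor κ
of valence (2,0), ∇κ is given by a spinor η, ∇η by κ, the curvature and a symmetric spinor τ, and ∇τ
by κ, η, the curvature and its derivative (`IsKS20.exists_n11`, `IsKS20.n_tau`).

The Killing equation for the products is then the Leibniz rule: every term of ∇ξ or ∇κ carries an ε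
which is skew in two of the indices being symmetrized.

For conditions A0 and A1 the potentials are written down explicitly as bilinear expressions in the
prolonged fields (`ckvPotential`, `ckvCopotential`, `ksPotential`, `ksCopotential`). Their
derivatives follow from the prolonged systems; in the case of A0 the remaining derivatives of Φ and
Λ are turned into divergences of Ψ by the contracted Bianchi identity `curl_phi`.

Condition A1/2* needs no potential. It is a linear combination of three identities: the
integrability condition κ_{(A}^E Ψ_{BCD)E} = 0 (`IsKS20.psi_eq`), its covariant derivative
contracted with ξ (`IsKS20.npsi_eq`), and the Lie derivative of Ψ along ξ (`IsCKV.lie_psi`). The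
combination is `obsHalf_eq_zero`.

All of this is polynomial algebra in components and is carried out in a `SpinCalculus` over a
commutative ring, where primed and unprimed spinors are independent and exchanged by `swap`. An open
set carrying a spin frame and a chart yields such a calculus on its ring of smooth functions
(`IsPatch.calculus`), and conjugation is a homomorphism from it to its swap (`isHom_conj`). The
prolonged fields are determined by ξ or κ and transform as spinors under a change of frame
(`IsGauge`), so the local potentials agree on overlaps and glue (`exists_function`,
`exists_vectorField`). -/

noncomputable section

/-! ### Spin calculus over a commutative ring: connection, Ricci and Bianchi identities -/

namespace SpinGeometry

set_option linter.unusedSectionVars false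

/-- The components of the spin metric in an arbitrary commutative ring. -/
def ep {R : Type*} [CommRing R] (A B : Fin 2) : R := !![0, 1; -1, 0] A B

section ep
variable {R : Type*} [CommRing R]
@[simp] lemma ep_zero_zero : (ep 0 0 : R) = 0 := rfl
@[simp] lemma ep_zero_one : (ep 0 1 : R) = 1 := rfl
@[simp] lemma ep_one_zero : (ep 1 0 : R) = -1 := rfl
@[simp] lemma ep_one_one : (ep 1 1 : R) = 0 := rfl
end ep

/-- A complexified spin calculus: derivations `D_{AA'}` of a commutative ring of functions together
with the coefficients `γ_{AA'B}{}^C` and `γ'_{AA'B'}{}^{C'}` of a torsion-free connection preserving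
the spin metrics. -/
structure SpinCalculus (R : Type*) [CommRing R] where
  /-- the derivations along the null tetrad -/
  D : Fin 2 → Fin 2 → Derivation ℤ R R
  /-- the connection on unprimed spinors -/
  γ : Fin 2 → Fin 2 → Fin 2 → Fin 2 → R
  /-- the connection on primed spinors -/
  γ' : Fin 2 → Fin 2 → Fin 2 → Fin 2 → R
  trace : ∀ A A', γ A A' 1 1 = -γ A A' 0 0
  trace' : ∀ A A', γ' A A' 1 1 = -γ' A A' 0 0
  torsion : ∀ A A' B B' f,
    D A A' (D B B' f) - ∑ X, γ A A' B X * D X B' f - ∑ X, γ' A A' B' X * D B X f =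
      D B B' (D A A' f) - ∑ X, γ B B' A X * D X A' f - ∑ X, γ' B B' A' X * D A X f
  -- This says that the tetrad is a frame. It turns identities between first-order operators into
  -- identities between their coefficients.
  separating : ∀ v : Fin 2 → Fin 2 → R,
    (∀ f, ∑ A, ∑ A', v A A' * D A A' f = 0) → ∀ A A', v A A' = 0
  /-- the number `1/6` -/
  sixth : R
  six_mul_sixth : 6 * sixth = 1

namespace SpinCalculus

variable {R : Type*} [CommRing R] (C : SpinCalculus R)

/-- Exchange of the roles of primed and unprimed indices. -/
def swap : SpinCalculus R where
  D A A' := C.D A' A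
  γ A A' := C.γ' A' A
  γ' A A' := C.γ A' A
  trace A A' := C.trace' A' A
  trace' A A' := C.trace A' A
  torsion A A' B B' f := by linear_combination C.torsion A' A B' B f
  separating v h A A' := C.separating (fun A A' => v A' A)
    (fun f => by rw [← h f, Finset.sum_comm]) A' A
  sixth := C.sixth
  six_mul_sixth := C.six_mul_sixth

/-- Cancellation rests on the inverse of 6 and not on the absence of zero divisors, which rings of
smooth functions do have. -/
lemma two_cancel (C : SpinCalculus R) {a b : R} (h : 2 * a = 2 * b) : a = b := by
  linear_combination 3 * C.sixth * h - (a - b) * C.six_mul_sixth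

lemma three_cancel (C : SpinCalculus R) {a b : R} (h : 3 * a = 3 * b) : a = b := by
  linear_combination 2 * C.sixth * h - (a - b) * C.six_mul_sixth

/-- The covariant derivative of a spinor `φ_{BB'}`. -/
def n11 (φ : Fin 2 → Fin 2 → R) (A A' B B' : Fin 2) : R :=
  C.D A A' (φ B B') - ∑ X, C.γ A A' B X * φ X B' - ∑ X, C.γ' A A' B' X * φ B X

/-- The covariant derivative of a spinor `φ_{BC}`. -/
def n20 (φ : Fin 2 → Fin 2 → R) (A A' B E : Fin 2) : R :=
  C.D A A' (φ B E) - ∑ X, C.γ A A' B X * φ X E - ∑ X, C.γ A A' E X * φ B X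

/-- The covariant derivative of a spinor `φ_{PP'QQ'}`. -/
def n22 (φ : Fin 2 → Fin 2 → Fin 2 → Fin 2 → R) (A A' P P' Q Q' : Fin 2) : R :=
  C.D A A' (φ P P' Q Q') - ∑ X, C.γ A A' P X * φ X P' Q Q' - ∑ X, C.γ' A A' P' X * φ P X Q Q'
    - ∑ X, C.γ A A' Q X * φ P P' X Q' - ∑ X, C.γ' A A' Q' X * φ P P' Q X

/-- The covariant derivative of a spinor `φ_{PP'QS}`. -/
def n31 (φ : Fin 2 → Fin 2 → Fin 2 → Fin 2 → R) (A A' P P' Q S : Fin 2) : R :=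
  C.D A A' (φ P P' Q S) - ∑ X, C.γ A A' P X * φ X P' Q S - ∑ X, C.γ' A A' P' X * φ P X Q S
    - ∑ X, C.γ A A' Q X * φ P P' X S - ∑ X, C.γ A A' S X * φ P P' Q X

/-- The covariant derivative of a spinor `φ_{PQST}`. -/
def n40 (φ : Fin 2 → Fin 2 → Fin 2 → Fin 2 → R) (A A' P Q S T : Fin 2) : R :=
  C.D A A' (φ P Q S T) - ∑ X, C.γ A A' P X * φ X Q S T - ∑ X, C.γ A A' Q X * φ P X S T
    - ∑ X, C.γ A A' S X * φ P Q X T - ∑ X, C.γ A A' T X * φ P Q S X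

/-- The curvature `R_{AA'BB'P}{}^E` of the connection on unprimed spinors. -/
def curv (A A' B B' P E : Fin 2) : R :=
  C.D A A' (C.γ B B' P E) - C.D B B' (C.γ A A' P E)
  + ∑ Q, (C.γ B B' P Q * C.γ A A' Q E - C.γ A A' P Q * C.γ B B' Q E)
  - (∑ X, C.γ A A' B X * C.γ X B' P E + ∑ X, C.γ' A A' B' X * C.γ B X P E
    - ∑ X, C.γ B B' A X * C.γ X A' P E - ∑ X, C.γ' B B' A' X * C.γ A X P E)

lemma curv_trace (A A' B B' : Fin 2) : C.curv A A' B B' 1 1 = -C.curv A A' B B' 0 0 := by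
  simp only [curv, trace, Fin.sum_univ_two, map_neg]
  ring

lemma curv_antisymm (A A' B B' P E : Fin 2) : C.curv A A' B B' P E = -C.curv B B' A A' P E := by
  simp only [curv, Fin.sum_univ_two]
  ring

/-- The second covariant derivative also differentiates the index pair of the first one. Vanishing
torsion, applied to the component function, absorbs those terms and leaves only curvature. -/
lemma ricci20 (φ : Fin 2 → Fin 2 → R) (A A' B B' P Q : Fin 2) :
    C.n31 (C.n20 φ) A A' B B' P Q - C.n31 (C.n20 φ) B B' A A' P Q =
      -∑ E, C.curv A A' B B' P E * φ E Q - ∑ E, C.curv A A' B B' Q E * φ P E := by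
  have h := C.torsion A A' B B' (φ P Q)
  simp only [n31, n20, curv, Fin.sum_univ_two, map_sub, map_add, Derivation.leibniz,
    smul_eq_mul] at *
  linear_combination h

lemma ricci11 (φ : Fin 2 → Fin 2 → R) (A A' B B' P P' : Fin 2) :
    C.n22 (C.n11 φ) A A' B B' P P' - C.n22 (C.n11 φ) B B' A A' P P' =
      -∑ E, C.curv A A' B B' P E * φ E P' - ∑ E, C.swap.curv A' A B' B P' E * φ P E := by
  have h := C.torsion A A' B B' (φ P P')
  simp only [n22, n11, curv, swap, Fin.sum_univ_two, map_sub, map_add, Derivation.leibniz,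
    smul_eq_mul] at *
  linear_combination h

lemma n11_D_symm (f : R) (A A' B B' : Fin 2) :
    C.n11 (fun A A' => C.D A A' f) A A' B B' = C.n11 (fun A A' => C.D A A' f) B B' A A' := by
  simpa only [n11] using C.torsion A A' B B' f

lemma n22_pair_symm {φ : Fin 2 → Fin 2 → Fin 2 → Fin 2 → R}
    (h : ∀ P P' Q Q', φ P P' Q Q' = φ Q Q' P P') (A A' P P' Q Q' : Fin 2) :
    C.n22 φ A A' P P' Q Q' = C.n22 φ A A' Q Q' P P' := by
  simp only [n22, Fin.sum_univ_two]
  rw [h P P' Q Q', h 0 P' Q Q', h 1 P' Q Q', h P 0 Q Q', h P 1 Q Q', h P P' 0 Q', h P P' 1 Q',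
    h P P' Q 0, h P P' Q 1]
  ring

/-- The coefficients of `[∇_{AA'}, ∇_{BB'}]` acting on the index pair `PP'`. -/
def curvPair (A A' B B' P P' E E' : Fin 2) : R :=
  C.curv A A' B B' P E * (if E' = P' then 1 else 0)
    + C.swap.curv A' A B' B P' E' * (if E = P then 1 else 0)

lemma sum_curvPair (A A' B B' P P' : Fin 2) (d : Fin 2 → Fin 2 → R) :
    ∑ E, ∑ E', C.curvPair A A' B B' P P' E E' * d E E' =
      ∑ E, C.curv A A' B B' P E * d E P' + ∑ E, C.swap.curv A' A B' B P' E * d P E := by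
  simp only [curvPair, add_mul, Finset.sum_add_distrib, mul_ite, ite_mul, mul_one, mul_zero,
    zero_mul, Finset.sum_ite_eq', Finset.sum_ite_irrel, Finset.sum_const_zero, Finset.mem_univ,
    if_true]

/-- The first Bianchi identity. -/
lemma bianchi_first (A A' B B' P P' E E' : Fin 2) :
    C.curvPair A A' B B' P P' E E' + C.curvPair B B' P P' A A' E E'
      + C.curvPair P P' A A' B B' E E' = 0 := by
  -- Take the cyclic sum of the commutators acting on the gradient of a function. As the Hessian is
  -- symmetric, the third derivatives cancel in pairs, and only curvature contracted with the
  -- gradient is left.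
  refine C.separating (fun E E' => C.curvPair A A' B B' P P' E E' + C.curvPair B B' P P' A A' E E'
      + C.curvPair P P' A A' B B' E E') (fun f => ?_) E E'
  have r1 := C.ricci11 (fun A A' => C.D A A' f) A A' B B' P P'
  have r2 := C.ricci11 (fun A A' => C.D A A' f) B B' P P' A A'
  have r3 := C.ricci11 (fun A A' => C.D A A' f) P P' A A' B B'
  have s := C.n22_pair_symm (C.n11_D_symm f)
  rw [s A A' B B' P P'] at r1
  rw [s B B' P P' A A'] at r2
  rw [s P P' A A' B B'] at r3
  simp only [add_mul, Finset.sum_add_distrib, sum_curvPair]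
  linear_combination r1 + r2 + r3

/-- The covariant derivative of the curvature. -/
def ncurv (X X' A A' B B' P E : Fin 2) : R :=
  C.D X X' (C.curv A A' B B' P E)
    - ∑ Y, C.γ X X' A Y * C.curv Y A' B B' P E - ∑ Y, C.γ' X X' A' Y * C.curv A Y B B' P E
    - ∑ Y, C.γ X X' B Y * C.curv A A' Y B' P E - ∑ Y, C.γ' X X' B' Y * C.curv A A' B Y P E
    - ∑ Y, C.γ X X' P Y * C.curv A A' B B' Y E + ∑ Y, C.curv A A' B B' P Y * C.γ X X' Y E

set_option maxHeartbeats 2000000 in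
set_option maxRecDepth 10000 in
/-- The second Bianchi identity. -/
lemma bianchi_second (X X' A A' B B' P E : Fin 2) :
    C.ncurv X X' A A' B B' P E + C.ncurv A A' B B' X X' P E + C.ncurv B B' X X' A A' P E = 0 := by
  have t1 := C.torsion X X' A A' (C.γ B B' P E)
  have t2 := C.torsion A A' B B' (C.γ X X' P E)
  have t3 := C.torsion B B' X X' (C.γ A A' P E)
  have h1 := C.sum_curvPair X X' A A' B B' (fun Y Y' => C.γ Y Y' P E)
  have h2 := C.sum_curvPair A A' B B' X X' (fun Y Y' => C.γ Y Y' P E)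
  have h3 := C.sum_curvPair B B' X X' A A' (fun Y Y' => C.γ Y Y' P E)
  -- Besides the commutators on the connection coefficients there remain terms in which curvature
  -- acts on the derivative slots. They cancel by the first Bianchi identity.
  have hb : ∑ Y, ∑ Y', C.curvPair X X' A A' B B' Y Y' * C.γ Y Y' P E
      + ∑ Y, ∑ Y', C.curvPair A A' B B' X X' Y Y' * C.γ Y Y' P E
      + ∑ Y, ∑ Y', C.curvPair B B' X X' A A' Y Y' * C.γ Y Y' P E = 0 := by
    simp only [← Finset.sum_add_distrib, ← add_mul, bianchi_first, zero_mul,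
      Finset.sum_const_zero]
  rw [h1, h2, h3] at hb
  clear h1 h2 h3
  simp only [ncurv, curv, swap, Fin.sum_univ_two, map_sub, map_add, Derivation.leibniz,
    smul_eq_mul] at t1 t2 t3 hb ⊢
  linear_combination t1 + t2 + t3 - hb

end SpinCalculus

/-! ### Spinor decomposition of the curvature -/

namespace SpinCalculus

variable {R : Type*} [CommRing R] (C : SpinCalculus R)

/-- The curvature `R_{AA'BB'PQ}` with lowered index. -/
def curvLow (A A' B B' P Q : Fin 2) : R := ∑ E, C.curv A A' B B' P E * ep E Q

lemma curvLow_antisymm (A A' B B' P Q : Fin 2) :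
    C.curvLow A A' B B' P Q = -C.curvLow B B' A A' P Q := by
  simp only [curvLow, Fin.sum_univ_two]
  rw [C.curv_antisymm A A' B B' P 0, C.curv_antisymm A A' B B' P 1]
  ring

/-- A trace-free connection has trace-free curvature, and trace-freeness becomes symmetry once the
index is lowered with ε. -/
lemma curvLow_symm (A A' B B' P Q : Fin 2) :
    C.curvLow A A' B B' P Q = C.curvLow A A' B B' Q P := by
  have h := C.curv_trace A A' B B'
  revert P Q
  simp [Fin.forall_fin_two, curvLow, h]

/-- Twice the curvature spinor `X_{ABPQ}`. -/
def X2 (A B P Q : Fin 2) : R := ∑ Y, ∑ Y', ep Y Y' * C.curvLow A Y B Y' P Q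

/-- Twice the curvature spinor `Φ_{PQA'B'}`. -/
def Phi2 (P Q A' B' : Fin 2) : R := ∑ Y, ∑ Y', ep Y Y' * C.curvLow Y A' Y' B' P Q

/-- A two-form splits into ε_{A'B'} times a symmetric unprimed part and ε_{AB} times a symmetric
primed part. The factor 2 appears because `X2` and `Phi2` are bare contractions. -/
lemma curvLow_decomp (A A' B B' P Q : Fin 2) :
    2 * C.curvLow A A' B B' P Q = ep A' B' * C.X2 A B P Q + ep A B * C.Phi2 P Q A' B' := by
  have h := fun A A' B B' => C.curvLow_antisymm A A' B B' P Q
  have h' := fun A A' => C.curvLow_antisymm A A' A A' P Q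
  revert A A' B B'
  simp only [Fin.forall_fin_two, X2, Phi2, Fin.sum_univ_two, ep_zero_zero, ep_zero_one,
    ep_one_zero, ep_one_one]
  grind

lemma bianchi_first_low (A A' B B' P P' E E' : Fin 2) :
    (C.curvLow A A' B B' P E * ep P' E' + C.swap.curvLow A' A B' B P' E' * ep P E)
    + (C.curvLow B B' P P' A E * ep A' E' + C.swap.curvLow B' B P' P A' E' * ep A E)
    + (C.curvLow P P' A A' B E * ep B' E' + C.swap.curvLow P' P A' A B' E' * ep B E) = 0 := by
  have key : ∀ A A' B B' P P' E E', C.curvLow A A' B B' P E * ep P' E' +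
      C.swap.curvLow A' A B' B P' E' * ep P E =
      ∑ Y, ∑ Y', C.curvPair A A' B B' P P' Y Y' * (ep Y E * ep Y' E') := by
    intro A A' B B' P P' E E'
    rw [C.sum_curvPair A A' B B' P P' (fun Y Y' => ep Y E * ep Y' E')]
    simp only [curvLow, Fin.sum_univ_two]
    ring
  simp only [key, ← Finset.sum_add_distrib, ← add_mul, bianchi_first, zero_mul,
    Finset.sum_const_zero]

lemma X2_symm_left (A B P Q : Fin 2) : C.X2 A B P Q = C.X2 B A P Q := by
  have h := fun A A' B B' => C.curvLow_antisymm A A' B B' P Q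
  simp only [X2, Fin.sum_univ_two, ep_zero_zero, ep_zero_one, ep_one_zero, ep_one_one]
  linear_combination h A 0 B 1 - h A 1 B 0

lemma X2_symm_right (A B P Q : Fin 2) : C.X2 A B P Q = C.X2 A B Q P := by
  simp only [X2, C.curvLow_symm _ _ _ _ P Q]

lemma Phi2_symm_right (P Q A' B' : Fin 2) : C.Phi2 P Q A' B' = C.Phi2 P Q B' A' := by
  have h := fun A A' B B' => C.curvLow_antisymm A A' B B' P Q
  simp only [Phi2, Fin.sum_univ_two, ep_zero_zero, ep_zero_one, ep_one_zero, ep_one_one]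
  linear_combination h 0 A' 1 B' - h 1 A' 0 B'

lemma Phi2_symm_left (P Q A' B' : Fin 2) : C.Phi2 P Q A' B' = C.Phi2 Q P A' B' := by
  simp only [Phi2, C.curvLow_symm _ _ _ _ P Q]

/-- The first Bianchi identity in terms of the curvature spinors. -/
lemma bianchi_first_spinor (A A' B B' P P' E E' : Fin 2) :
    ((ep A' B' * C.X2 A B P E + ep A B * C.Phi2 P E A' B') * ep P' E'
      + (ep A B * C.swap.X2 A' B' P' E' + ep A' B' * C.swap.Phi2 P' E' A B) * ep P E)
    + ((ep B' P' * C.X2 B P A E + ep B P * C.Phi2 A E B' P') * ep A' E'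
      + (ep B P * C.swap.X2 B' P' A' E' + ep B' P' * C.swap.Phi2 A' E' B P) * ep A E)
    + ((ep P' A' * C.X2 P A B E + ep P A * C.Phi2 B E P' A') * ep B' E'
      + (ep P A * C.swap.X2 P' A' B' E' + ep P' A' * C.swap.Phi2 B' E' P A) * ep B E) = 0 := by
  have h := C.bianchi_first_low A A' B B' P P' E E'
  simp only [← curvLow_decomp]
  linear_combination 2 * h

/-- The irreducible parts of the first Bianchi identity: 3 components of pair symmetry for X, 9 for
the agreement of Φ with its primed counterpart, and 1 for the agreement of the two scalar
curvatures. Four choices of indices already yield them. -/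
lemma bianchi_first_cons (C : SpinCalculus R) :
    (C.X2 0 0 0 1 = C.X2 0 1 0 0 ∧ C.X2 0 1 1 1 = C.X2 1 1 0 1 ∧ C.X2 0 0 1 1 = C.X2 1 1 0 0) ∧
    (∀ P Q A' B', C.Phi2 P Q A' B' = C.swap.Phi2 A' B' P Q) ∧
    C.X2 0 0 1 1 - C.X2 0 1 0 1 = C.swap.X2 0 0 1 1 - C.swap.X2 0 1 0 1 := by
  have h1 := C.bianchi_first_spinor 0 0 0 1 1 0
  have h2 := C.bianchi_first_spinor 0 0 0 1 1 1
  have h3 := C.bianchi_first_spinor 0 0 1 0 1 1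
  have h4 := C.bianchi_first_spinor 0 1 1 0 1 1
  have x1 := C.X2_symm_left 
  have x2 := C.X2_symm_right
  have x3 := C.Phi2_symm_left
  have x4 := C.Phi2_symm_right
  have y1 := C.swap.X2_symm_left 
  have y2 := C.swap.X2_symm_right
  have y3 := C.swap.Phi2_symm_left
  have y4 := C.swap.Phi2_symm_right
  have c2 := fun a b : R => C.two_cancel (a := a) (b := b)
  simp only [x1 1 0, x2 _ _ 1 0, x3 1 0, x4 _ _ 1 0, y1 1 0, y2 _ _ 1 0, y3 1 0, y4 _ _ 1 0, Fin.forall_fin_two, ep_zero_zero, ep_zero_one, ep_one_zero, ep_one_one, mul_zero, zero_mul, mul_one, one_mul, neg_mul, mul_neg, add_zero, zero_add, neg_neg] at h1 h2 h3 h4 ⊢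
  clear x1 x2 x3 x4 y1 y2 y3 y4
  have s := C.six_mul_sixth
  clear s
  and_intros
  all_goals first | grind only | (apply c2; grind only) | (apply c2; apply c2; grind only)

end SpinCalculus

/-! ### Components of Ψ, Φ, Λ and the first prolongation of a conformal Killing vector -/

namespace SpinCalculus

variable {R : Type*} [CommRing R] (C : SpinCalculus R)

/-- The independent components of the Weyl spinor, `Ψ_{ABCD} = psi (A + B + C + D)`. -/
def psi : ℕ → R
  | 0 => 3 * C.sixth * C.X2 0 0 0 0
  | 1 => 3 * C.sixth * C.X2 0 0 0 1
  -- Of the six placements of two ones, two give X_{0011} by pair symmetry and four give X_{0101}.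
  -- The factor also absorbs the 2 in `X2`.
  | 2 => C.sixth * (C.X2 0 0 1 1 + 2 * C.X2 0 1 0 1)
  | 3 => 3 * C.sixth * C.X2 0 1 1 1
  | _ => 3 * C.sixth * C.X2 1 1 1 1

/-- The independent components of the Ricci spinor, `Φ_{ABA'B'} = phi (A + B) (A' + B')`. -/
def phi (m n : ℕ) : R := 3 * C.sixth * C.Phi2 (if m = 2 then 1 else 0) (if m = 0 then 0 else 1)
  (if n = 2 then 1 else 0) (if n = 0 then 0 else 1)

/-- The scalar curvature spinor `Λ`. -/
def lam : R := C.sixth * (C.X2 0 0 1 1 - C.X2 0 1 0 1)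

lemma swap_lam : C.swap.lam = C.lam := by
  have h := C.bianchi_first_cons.2.2
  simp only [lam, ← h]; rfl

lemma swap_phi (m n : ℕ) : C.swap.phi m n = C.phi n m := by
  have h := C.bianchi_first_cons.2.1
  simp only [phi, h]; rfl

/-- Pair symmetry leaves of X only its totally symmetric part and one scalar, so Ψ, Φ and Λ exhaust
the curvature. -/
lemma curvLow_eq (A A' B B' P Q : Fin 2) :
    C.curvLow A A' B B' P Q =
      ep A' B' * (C.psi (A + B + P + Q) + C.lam * (ep A P * ep B Q + ep A Q * ep B P))
      + ep A B * C.phi (P + Q) (A' + B') := by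
  apply C.two_cancel
  rw [curvLow_decomp]
  have h1 := C.bianchi_first_cons.1
  have s := C.six_mul_sixth
  have hx : ∀ x : R, x = 2 * (3 * C.sixth * x) := fun x => by linear_combination (-x) * s
  have hX : ∀ A B P Q, C.X2 A B P Q = 2 * (C.psi (A + B + P + Q) +
      C.lam * (ep A P * ep B Q + ep A Q * ep B P)) := by
    have x1 := C.X2_symm_left
    have x2 := C.X2_symm_right
    simp only [x1 1 0, x2 _ _ 1 0, Fin.forall_fin_two]
    simp [psi, lam]
    simp only [← h1.1, ← h1.2.1, ← h1.2.2]
    and_intros <;> first | exact hx _ | linear_combination (-C.X2 0 0 1 1) * s |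
      linear_combination (-C.X2 0 1 0 1) * s
  have hP : ∀ P Q A B, C.Phi2 P Q A B = 2 * C.phi (P + Q) (A + B) := by
    have x3 := C.Phi2_symm_left
    have x4 := C.Phi2_symm_right
    simp only [x3 1 0, x4 _ _ 1 0, Fin.forall_fin_two]
    simp [phi]
    and_intros <;> exact hx _
  rw [hX, hP]
  ring

/-- In two dimensions a connection annihilates ε exactly when it is trace-free. -/
lemma ep_parallel (A A' B E : Fin 2) :
    C.γ A A' B 0 * ep 0 E + C.γ A A' B 1 * ep 1 E + C.γ A A' E 0 * ep B 0
      + C.γ A A' E 1 * ep B 1 = 0 := by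
  revert B E
  simp [Fin.forall_fin_two, C.trace A A']

lemma ep_parallel' (A A' B E : Fin 2) :
    C.γ' A A' B 0 * ep 0 E + C.γ' A A' B 1 * ep 1 E + C.γ' A A' E 0 * ep B 0
      + C.γ' A A' E 1 * ep B 1 = 0 := by
  revert B E
  simp [Fin.forall_fin_two, C.trace' A A']

@[simp] lemma D_ep (A A' B E : Fin 2) : C.D A A' (ep B E) = 0 := by
  revert B E
  simp [Fin.forall_fin_two]

@[simp] lemma D_two (A A' : Fin 2) : C.D A A' 2 = 0 := by
  simpa using (C.D A A').map_natCast 2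

@[simp] lemma D_four (A A' : Fin 2) : C.D A A' 4 = 0 := by
  simpa using (C.D A A').map_natCast 4

/-- `ξ` is a conformal Killing vector: its covariant derivative is
`ε_{A'B'} F_{AB} + ε_{AB} F'_{A'B'} + 2 ε_{AB} ε_{A'B'} d` with symmetric `F` and `F'`. -/
structure IsCKV (ξ F F' : Fin 2 → Fin 2 → R) (d : R) : Prop where
  eqn : ∀ A A' B B', C.n11 ξ A A' B B' =
    ep A' B' * F A B + ep A B * F' A' B' + 2 * (ep A B * ep A' B' * d)
  symm : F 1 0 = F 0 1
  symm' : F' 1 0 = F' 0 1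

lemma sum_curv (A A' B B' P : Fin 2) (φ : Fin 2 → R) :
    ∑ E, C.curv A A' B B' P E * φ E =
      C.curvLow A A' B B' P 1 * φ 0 - C.curvLow A A' B B' P 0 * φ 1 := by
  simp only [curvLow, Fin.sum_univ_two, ep_zero_zero, ep_zero_one, ep_one_zero, ep_one_one]
  ring

lemma n11_swap (φ : Fin 2 → Fin 2 → R) (A A' B B' : Fin 2) :
    C.swap.n11 (fun A A' => φ A' A) A' A B' B = C.n11 φ A A' B B' := by
  simp only [n11, swap]
  ring

variable {C} {ξ F F' : Fin 2 → Fin 2 → R} {d : R}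

lemma IsCKV.swap (h : C.IsCKV ξ F F' d) : C.swap.IsCKV (fun A A' => ξ A' A) F' F d where
  eqn A A' B B' := by
    rw [n11_swap C ξ A' A B' B, h.eqn]
    ring
  symm := h.symm'
  symm' := h.symm

set_option maxHeartbeats 1000000 in
lemma IsCKV.n22 (h : C.IsCKV ξ F F' d) (X X' A A' B B' : Fin 2) :
    C.n22 (C.n11 ξ) X X' A A' B B' = ep A' B' * C.n20 F X X' A B
      + ep A B * C.swap.n20 F' X' X A' B' + 2 * (ep A B * ep A' B' * C.D X X' d) := by
  have e : C.n11 ξ = fun A A' B B' =>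
      ep A' B' * F A B + ep A B * F' A' B' + 2 * (ep A B * ep A' B' * d) := by
    funext A A' B B'; exact h.eqn A A' B B'
  rw [e]
  have p := C.ep_parallel X X' A B
  have p' := C.ep_parallel' X X' A' B'
  simp only [SpinCalculus.n22, SpinCalculus.n20, SpinCalculus.swap, Fin.sum_univ_two,
    map_add, Derivation.leibniz, smul_eq_mul, D_ep, D_two, mul_zero, add_zero]
  linear_combination (-F' A' B' - 2 * ep A' B' * d) * p + (-F A B - 2 * ep A B * d) * p'

set_option maxHeartbeats 4000000 in
/-- The derivative of the exterior derivative of a conformal Killing vector. -/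
lemma IsCKV.n20 (h : C.IsCKV ξ F F' d) (A A' B E : Fin 2) :
    C.n20 F A A' B E = -∑ P, ∑ Q, ep P Q * C.psi (A + B + E + P) * ξ Q A'
      - ∑ P, ∑ Q, ep P Q * C.phi (B + E) (A' + P) * ξ A Q
      + ep A B * (C.D E A' d - C.lam * ξ E A') + ep A E * (C.D B A' d - C.lam * ξ B A') := by
  have H : ∀ A A' B B' P P' : Fin 2, _ := fun A A' B B' P P' => C.ricci11 ξ A A' B B' P P'
  have fs : ∀ X X', C.n20 F X X' 1 0 = C.n20 F X X' 0 1 := fun X X' => by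
    simp only [SpinCalculus.n20, Fin.sum_univ_two, h.symm]; ring
  have fs' : ∀ X X', C.swap.n20 F' X X' 1 0 = C.swap.n20 F' X X' 0 1 := fun X X' => by
    simp only [SpinCalculus.n20, Fin.sum_univ_two, h.symm']; ring
  simp only [h.n22, sum_curv, curvLow_eq, swap_lam, swap_phi] at H
  apply C.two_cancel
  apply C.two_cancel
  -- As ∇_aξ_b + ∇_bξ_a is pure trace, the sum of two commutators minus the third reduces to
  -- ∇_a(∇_bξ_c - ∇_cξ_b) plus derivatives of `d`. Contracting the primed pair of b and c isolates
  -- 4∇F.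
  have k := fun B' P' : Fin 2 => (H A A' B B' E P')
  have k1 := fun B' P' : Fin 2 => (H E P' A A' B B')
  have k2 := fun B' P' : Fin 2 => (H B B' E P' A A')
  have k01 := k 0 1
  have k10 := k 1 0
  have l01 := k1 0 1
  have l10 := k1 1 0
  have m01 := k2 0 1
  have m10 := k2 1 0
  clear H k k1 k2
  fin_cases A <;> fin_cases A' <;> fin_cases B <;> fin_cases E <;>
  simp [fs, fs', Fin.sum_univ_two] at * <;> 
  linear_combination k01 - k10 + (l01 - l10) - (m01 - m10)

end SpinCalculus

/-! ### Killing spinors of valence (2,0): integrability condition and derivative of η -/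

namespace SpinCalculus

variable {R : Type*} [CommRing R] (C : SpinCalculus R)

/-- `κ` is a Killing spinor of valence `(2,0)`: its covariant derivative is
`ε_{AB} η_{EA'} + ε_{AE} η_{BA'}`. -/
structure IsKS20 (κ η : Fin 2 → Fin 2 → R) : Prop where
  eqn : ∀ A A' B E, C.n20 κ A A' B E = ep A B * η E A' + ep A E * η B A'
  symm : κ 1 0 = κ 0 1

variable {C} {κ η : Fin 2 → Fin 2 → R}

lemma IsKS20.n31 (h : C.IsKS20 κ η) (X X' A A' B E : Fin 2) :
    C.n31 (C.n20 κ) X X' A A' B E =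
      ep A B * C.n11 η X X' E A' + ep A E * C.n11 η X X' B A' := by
  have e : C.n20 κ = fun A A' B E => ep A B * η E A' + ep A E * η B A' := by
    funext A A' B E; exact h.eqn A A' B E
  rw [e]
  have p := C.ep_parallel X X' A B
  have q := C.ep_parallel X X' A E
  simp only [SpinCalculus.n31, SpinCalculus.n11, Fin.sum_univ_two, 
    map_add, Derivation.leibniz, smul_eq_mul, D_ep, mul_zero, add_zero]
  linear_combination (-η E A') * p + (-η B A') * q

/-- The integrability condition `κ_{(A}{}^E Ψ_{BCD)E} = 0`. -/
lemma IsKS20.psi_eq (h : C.IsKS20 κ η) :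
    κ 0 0 * C.psi 1 = κ 0 1 * C.psi 0 ∧
    3 * κ 0 0 * C.psi 2 = 2 * κ 0 1 * C.psi 1 + κ 1 1 * C.psi 0 ∧
    κ 0 0 * C.psi 3 = κ 1 1 * C.psi 1 ∧
    κ 0 0 * C.psi 4 + 2 * κ 0 1 * C.psi 3 = 3 * κ 1 1 * C.psi 2 ∧
    κ 0 1 * C.psi 4 = κ 1 1 * C.psi 3 := by
  -- Only the part symmetric in all four unprimed indices is used below. The derivatives of η and
  -- the Φ and Λ terms contain an ε in two of these indices and drop out.
  have H := fun A B P Q => C.ricci20 κ A 0 B 1 P Q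
  have s := h.symm
  simp only [h.n31, sum_curv, curvLow_eq] at H
  have e0 := H 0 0 0 0
  have e1 := H 1 0 0 0
  have e2 := H 0 1 0 0
  have e3 := H 0 0 1 0
  have e4 := H 1 1 0 0
  have e5 := H 1 0 1 0
  have e6 := H 0 0 1 1
  have e7 := H 0 1 1 0
  have e8 := H 0 1 1 1
  have e9 := H 1 0 1 1
  have e10 := H 1 1 0 1
  have e11 := H 1 1 1 1
  clear H
  simp [s] at e0 e1 e2 e3 e4 e5 e6 e7 e8 e9 e10 e11
  refine ⟨C.two_cancel ?_, C.two_cancel ?_, C.two_cancel (C.three_cancel ?_), C.two_cancel ?_,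
    C.two_cancel ?_⟩
  · linear_combination e0
  · linear_combination e1 + e2 + 2 * e3
  · linear_combination e4 + 2 * e5 + e6 + 2 * e7
  · linear_combination e8 + e9 + 2 * e10
  · linear_combination e11

/-- The derivative of the spinor `η` of a valence `(2,0)` Killing spinor. -/
lemma IsKS20.exists_n11 (h : C.IsKS20 κ η) : ∃ τ : ℕ → R, ∀ A A' B B',
    4 * C.n11 η A A' B B' = -4 * ∑ P, ∑ Q, ep P Q * C.phi (A + P) (A' + B') * κ B Q
      + ep A' B' * (∑ P, ∑ Q, ∑ Y, ∑ Z, ep P Q * ep Y Z * C.psi (A + B + P + Y) * κ Q Z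
        - 4 * C.lam * κ A B)
      + 4 * (ep A B * τ (A' + B')) := by
  have H : ∀ A A' B B' P P' : Fin 2, _ := fun A A' B B' P P' => C.ricci20 κ A A' B B' P P'
  have s := h.symm
  simp only [h.n31, sum_curv, curvLow_eq] at H
  obtain ⟨p0, p1, p2, p3, p4⟩ := h.psi_eq
  have six := C.six_mul_sixth
  -- The witness is read off from the component A = 0, B = 1 of the claimed formula, symmetrized
  -- over the primed pair, which `m` encodes by its sum. The factor `3 * C.sixth` is one half.
  refine ⟨fun m => 3 * C.sixth * (C.n11 η 0 (if m = 2 then 1 else 0) 1 (if m = 0 then 0 else 1)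
      + C.n11 η 0 (if m = 0 then 0 else 1) 1 (if m = 2 then 1 else 0)) +
      ∑ P : Fin 2, ∑ Q, ep P Q * C.phi P m * κ 1 Q, fun A A' B B' => ?_⟩
  have k0 := H 0 A' 1 B' 0 0
  have k1 := H 1 A' 0 B' 1 1
  have k2 := H 0 B' 1 A' 0 1
  have k3 := H 0 A' 0 B' 1 1
  clear H
  generalize hθ : C.n11 η = θ at *
  set σ := θ 0 0 1 1 + θ 0 1 1 0
  fin_cases A <;> fin_cases B <;> fin_cases A' <;> fin_cases B' <;>
    simp [s] at k0 k1 k2 k3 ⊢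
  · linear_combination -2 * k0
  · linear_combination -2 * k0 + p1
  · linear_combination -2 * k0 - p1
  · linear_combination -2 * k0
  · linear_combination (-4 * θ 0 0 1 0) * six
  · linear_combination k3 - 2 * σ * six - p2
  · linear_combination k3 - 2 * σ * six + p2
  · linear_combination (-4 * θ 0 1 1 1) * six
  · linear_combination -4 * k2 + (4 * θ 0 0 1 0) * six
  · linear_combination -4 * k2 + k3 + 2 * σ * six - 5 * p2
  · linear_combination -4 * k2 + k3 + 2 * σ * six + 5 * p2
  · linear_combination -4 * k2 + (4 * θ 0 1 1 1) * six
  · linear_combination 2 * k1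
  · linear_combination 2 * k1 - p3
  · linear_combination 2 * k1 + p3
  · linear_combination 2 * k1

end SpinCalculus

/-! ### Derivatives of Ψ and Φ and the contracted second Bianchi identity -/

namespace SpinCalculus

variable {R : Type*} [CommRing R] (C : SpinCalculus R)

/-- The covariant derivative of the Weyl spinor. -/
def npsi (X X' : Fin 2) (n : ℕ) : R :=
  -- For n = 0 and n = 4 the out-of-range neighbours are multiplied by zero, so truncated
  -- subtraction and the default case of `psi` are harmless.
  C.D X X' (C.psi n) - (4 - n) * (C.γ X X' 0 0 * C.psi n + C.γ X X' 0 1 * C.psi (n + 1))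
    - n * (C.γ X X' 1 0 * C.psi (n - 1) + C.γ X X' 1 1 * C.psi n)

/-- The covariant derivative of the Ricci spinor. -/
def nphi (X X' : Fin 2) (m n : ℕ) : R :=
  C.D X X' (C.phi m n)
    - (2 - m) * (C.γ X X' 0 0 * C.phi m n + C.γ X X' 0 1 * C.phi (m + 1) n)
    - m * (C.γ X X' 1 0 * C.phi (m - 1) n + C.γ X X' 1 1 * C.phi m n)
    - (2 - n) * (C.γ' X X' 0 0 * C.phi m n + C.γ' X X' 0 1 * C.phi m (n + 1))
    - n * (C.γ' X X' 1 0 * C.phi m (n - 1) + C.γ' X X' 1 1 * C.phi m n)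

lemma n40_psi (X X' P Q S T : Fin 2) :
    C.n40 (fun P Q S T => C.psi (P + Q + S + T)) X X' P Q S T = C.npsi X X' (P + Q + S + T) := by
  revert P Q S T
  simp [Fin.forall_fin_two, n40, npsi]
  and_intros <;> ring

lemma n22_phi (X X' P P' Q Q' : Fin 2) :
    C.n22 (fun P P' Q Q' => C.phi (P + Q) (P' + Q')) X X' P P' Q Q' =
      C.nphi X X' (P + Q) (P' + Q') := by
  revert P P' Q Q'
  simp [Fin.forall_fin_two, n22, nphi]
  and_intros <;> ring

lemma swap_nphi (X X' : Fin 2) (m n : ℕ) : C.swap.nphi X X' m n = C.nphi X' X n m := by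
  simp only [nphi, swap_phi]
  simp only [swap]
  ring

set_option maxHeartbeats 1000000 in
-- Since ε is parallel, differentiating `curvLow_eq` only differentiates Ψ, Φ and Λ.
lemma ncurvLow_eq (X X' A A' B B' P Q : Fin 2) :
    ∑ E, C.ncurv X X' A A' B B' P E * ep E Q =
      ep A' B' * (C.npsi X X' (A + B + P + Q) +
        C.D X X' C.lam * (ep A P * ep B Q + ep A Q * ep B P))
      + ep A B * C.nphi X X' (P + Q) (A' + B') := by
  rw [← n40_psi, ← n22_phi]
  have e0 : ∀ A A' B B' P, C.curv A A' B B' P 0 = C.curvLow A A' B B' P 1 := by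
    intros; simp [curvLow]
  have e1 : ∀ A A' B B' P, C.curv A A' B B' P 1 = -C.curvLow A A' B B' P 0 := by
    intros; simp [curvLow]
  have t := C.trace X X'
  -- The connection term on the raised index becomes one on the lowered index `Q`, again because the
  -- connection is trace-free.
  have key : ∑ E, C.ncurv X X' A A' B B' P E * ep E Q = 
      C.D X X' (C.curvLow A A' B B' P Q)
      - ∑ Y, C.γ X X' A Y * C.curvLow Y A' B B' P Q - ∑ Y, C.γ' X X' A' Y * C.curvLow A Y B B' P Q
      - ∑ Y, C.γ X X' B Y * C.curvLow A A' Y B' P Q - ∑ Y, C.γ' X X' B' Y * C.curvLow A A' B Y P Q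
      - ∑ Y, C.γ X X' P Y * C.curvLow A A' B B' Y Q
      - ∑ Y, C.γ X X' Q Y * C.curvLow A A' B B' P Y := by
    revert Q
    simp [Fin.forall_fin_two, ncurv, e0, e1, t]
    constructor <;> ring
  have p1 := C.ep_parallel' X X' A' B'
  have p2 := C.ep_parallel X X' A B
  have p3 := C.ep_parallel X X' A P
  have p4 := C.ep_parallel X X' B Q
  have p5 := C.ep_parallel X X' A Q
  have p6 := C.ep_parallel X X' B P
  rw [key]
  simp only [curvLow_eq, n40, n22, Fin.sum_univ_two, map_add, Derivation.leibniz, smul_eq_mul,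
    D_ep, mul_zero, add_zero, zero_add]
  linear_combination (-(C.psi (A + B + P + Q)) - C.lam * (ep A P * ep B Q + ep A Q * ep B P)) * p1
    - C.phi (P + Q) (A' + B') * p2 - ep A' B' * C.lam * (ep B Q * p3 + ep A P * p4 + ep B P * p5
    + ep A Q * p6)

lemma bianchi_second_low (X X' A A' B B' P Q : Fin 2) :
    (ep A' B' * (C.npsi X X' (A + B + P + Q) +
        C.D X X' C.lam * (ep A P * ep B Q + ep A Q * ep B P))
      + ep A B * C.nphi X X' (P + Q) (A' + B'))
    + (ep B' X' * (C.npsi A A' (B + X + P + Q) +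
        C.D A A' C.lam * (ep B P * ep X Q + ep B Q * ep X P))
      + ep B X * C.nphi A A' (P + Q) (B' + X'))
    + (ep X' A' * (C.npsi B B' (X + A + P + Q) +
        C.D B B' C.lam * (ep X P * ep A Q + ep X Q * ep A P))
      + ep X A * C.nphi B B' (P + Q) (X' + A')) = 0 := by
  simp only [← ncurvLow_eq, ← Finset.sum_add_distrib, ← add_mul, bianchi_second, zero_mul,
    Finset.sum_const_zero]

/-- The contracted second Bianchi identity. -/
lemma curl_phi (A B E A' : Fin 2) :
    C.nphi A 1 (B + E) A' - C.nphi A 0 (B + E) (1 + A') =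
      C.npsi 1 A' (A + B + E) - C.npsi 0 A' (A + B + E + 1)
        + ep A B * C.D E A' C.lam + ep A E * C.D B A' C.lam := by
  have h0 := C.bianchi_second_low 0 0 0 1 1 A' B E
  have h1 := C.bianchi_second_low 0 A' 1 0 1 1 B E
  -- The first triple of tetrad vectors contains both derivatives with A = 0, the second both with A
  -- = 1. As `A'` varies, all four triples of the tetrad occur.
  fin_cases A <;> fin_cases A' <;> fin_cases B <;> fin_cases E <;> simp at h0 h1 ⊢ <;>
    first | linear_combination -h0 | linear_combination h1

end SpinCalculus

/-! ### Lie derivative of Ψ and second derivative of d for a conformal Killing vector -/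

namespace SpinCalculus

variable {R : Type*} [CommRing R] (C : SpinCalculus R)

lemma cancel (C : SpinCalculus R) {a b : R} (h : 24 * a = 24 * b) : a = b :=
  C.two_cancel (C.two_cancel (C.two_cancel (C.three_cancel (by linear_combination h))))

/-- The derivative of the divergence of a conformal Killing vector, up to a curvature term. -/
def omega (ξ : Fin 2 → Fin 2 → R) (d : R) (A A' : Fin 2) : R := C.D A A' d - C.lam * ξ A A'

variable {C} {ξ F F' : Fin 2 → Fin 2 → R} {d : R}

set_option maxHeartbeats 1000000 in
lemma IsCKV.n31_n20 (h : C.IsCKV ξ F F' d) (X X' A A' B E : Fin 2) :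
    C.n31 (C.n20 F) X X' A A' B E =
      -∑ P, ∑ Q, ep P Q * (C.npsi X X' (A + B + E + P) * ξ Q A'
        + C.psi (A + B + E + P) * C.n11 ξ X X' Q A')
      - ∑ P, ∑ Q, ep P Q * (C.nphi X X' (B + E) (A' + P) * ξ A Q
        + C.phi (B + E) (A' + P) * C.n11 ξ X X' A Q)
      + ep A B * C.n11 (C.omega ξ d) X X' E A' + ep A E * C.n11 (C.omega ξ d) X X' B A' := by
  have e : C.n20 F = fun A A' B E : Fin 2 => -∑ P, ∑ Q, ep P Q * C.psi (A + B + E + P) * ξ Q A'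
      - ∑ P, ∑ Q, ep P Q * C.phi (B + E) (A' + P) * ξ A Q
      + ep A B * C.omega ξ d E A' + ep A E * C.omega ξ d B A' := by
    funext A A' B E; exact h.n20 A A' B E
  rw [e]
  have p1 := C.ep_parallel X X' A B
  have p2 := C.ep_parallel X X' A E
  have f := fun P Q : Fin 2 => C.n22_phi X X' B P E Q
  simp only [← n40_psi, ← f]
  simp only [SpinCalculus.n31, SpinCalculus.n40, SpinCalculus.n22, SpinCalculus.n11,
    Fin.sum_univ_two, map_add, map_sub, map_neg, Derivation.leibniz, smul_eq_mul,
    ep_zero_zero, ep_zero_one, ep_one_zero, ep_one_one, D_ep, Fin.val_zero, Fin.val_one,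
    C.trace X X', C.trace' X X', zero_mul, mul_zero, add_zero, zero_add, one_mul, map_zero,
    Derivation.map_one_eq_zero]
  linear_combination (-C.omega ξ d E A') * p1 + (-C.omega ξ d B A') * p2

/-- The Ricci identity for F with its second derivatives replaced by the prolonged expression. Both
the Lie derivative of Ψ and the derivative of ω are components of this equation. -/
lemma IsCKV.ricci (h : C.IsCKV ξ F F' d) (X X' A A' B E : Fin 2) :
    (-∑ P, ∑ Q, ep P Q * (C.npsi X X' (A + B + E + P) * ξ Q A'
        + C.psi (A + B + E + P) * C.n11 ξ X X' Q A')
      - ∑ P, ∑ Q, ep P Q * (C.nphi X X' (B + E) (A' + P) * ξ A Q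
        + C.phi (B + E) (A' + P) * C.n11 ξ X X' A Q)
      + ep A B * C.n11 (C.omega ξ d) X X' E A' + ep A E * C.n11 (C.omega ξ d) X X' B A')
    - (-∑ P, ∑ Q, ep P Q * (C.npsi A A' (X + B + E + P) * ξ Q X'
        + C.psi (X + B + E + P) * C.n11 ξ A A' Q X')
      - ∑ P, ∑ Q, ep P Q * (C.nphi A A' (B + E) (X' + P) * ξ X Q
        + C.phi (B + E) (X' + P) * C.n11 ξ A A' X Q)
      + ep X B * C.n11 (C.omega ξ d) A A' E X' + ep X E * C.n11 (C.omega ξ d) A A' B X') =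
    -(C.curvLow X X' A A' B 1 * F 0 E - C.curvLow X X' A A' B 0 * F 1 E)
      - (C.curvLow X X' A A' E 1 * F B 0 - C.curvLow X X' A A' E 0 * F B 1) := by
  rw [← h.n31_n20, ← h.n31_n20, C.ricci20, sum_curv, sum_curv]

/-- The Hessian of `d` is symmetric, so the skew part of ∇ω stems from the term Λξ alone. -/
lemma IsCKV.n11_omega_antisymm (h : C.IsCKV ξ F F' d) (A A' B B' : Fin 2) :
    C.n11 (C.omega ξ d) A A' B B' - C.n11 (C.omega ξ d) B B' A A' =
      C.D B B' C.lam * ξ A A' - C.D A A' C.lam * ξ B B'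
        - C.lam * (C.n11 ξ A A' B B' - C.n11 ξ B B' A A') := by
  have t := C.n11_D_symm d A A' B B'
  simp only [n11, omega, map_sub, Derivation.leibniz, smul_eq_mul, Fin.sum_univ_two] at t ⊢
  linear_combination t

set_option maxHeartbeats 4000000 in
/-- The Lie derivative of the Weyl spinor along a conformal Killing vector. -/
lemma IsCKV.lie_psi (h : C.IsCKV ξ F F' d) :
    C.npsi 0 0 0 * ξ 1 1 - C.npsi 0 1 0 * ξ 1 0 - C.npsi 1 0 0 * ξ 0 1 + C.npsi 1 1 0 * ξ 0 0 =
      4 * (F 0 0 * C.psi 1 - F 0 1 * C.psi 0) - 4 * d * C.psi 0 ∧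
    C.npsi 0 0 1 * ξ 1 1 - C.npsi 0 1 1 * ξ 1 0 - C.npsi 1 0 1 * ξ 0 1 + C.npsi 1 1 1 * ξ 0 0 =
      3 * (F 0 0 * C.psi 2 - F 0 1 * C.psi 1) + 1 * (F 0 1 * C.psi 1 - F 1 1 * C.psi 0) - 4 * d * C.psi 1 ∧
    C.npsi 0 0 2 * ξ 1 1 - C.npsi 0 1 2 * ξ 1 0 - C.npsi 1 0 2 * ξ 0 1 + C.npsi 1 1 2 * ξ 0 0 =
      2 * (F 0 0 * C.psi 3 - F 0 1 * C.psi 2) + 2 * (F 0 1 * C.psi 2 - F 1 1 * C.psi 1) - 4 * d * C.psi 2 ∧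
    C.npsi 0 0 3 * ξ 1 1 - C.npsi 0 1 3 * ξ 1 0 - C.npsi 1 0 3 * ξ 0 1 + C.npsi 1 1 3 * ξ 0 0 =
      1 * (F 0 0 * C.psi 4 - F 0 1 * C.psi 3) + 3 * (F 0 1 * C.psi 3 - F 1 1 * C.psi 2) - 4 * d * C.psi 3 ∧
    C.npsi 0 0 4 * ξ 1 1 - C.npsi 0 1 4 * ξ 1 0 - C.npsi 1 0 4 * ξ 0 1 + C.npsi 1 1 4 * ξ 0 0 =
      4 * (F 0 1 * C.psi 4 - F 1 1 * C.psi 3) - 4 * d * C.psi 4 := by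
  have a0001 := h.n11_omega_antisymm 0 0 0 1
  have a0011 := h.n11_omega_antisymm 0 0 1 1
  have a0110 := h.n11_omega_antisymm 0 1 1 0
  have a1011 := h.n11_omega_antisymm 1 0 1 1
  have r000100 := h.ricci 0 0 0 1 0 0
  have r000101 := h.ricci 0 0 0 1 0 1
  have r000111 := h.ricci 0 0 0 1 1 1
  have r001101 := h.ricci 0 0 1 1 0 1
  have r011001 := h.ricci 0 1 1 0 0 1
  have r101101 := h.ricci 1 0 1 1 0 1
  have r101111 := h.ricci 1 0 1 1 1 1
  have b0000 := C.curl_phi 0 0 0 0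
  have b0001 := C.curl_phi 0 0 0 1
  have b0010 := C.curl_phi 0 0 1 0
  have b0011 := C.curl_phi 0 0 1 1
  have b0110 := C.curl_phi 0 1 1 0
  have b0111 := C.curl_phi 0 1 1 1
  have b1010 := C.curl_phi 1 0 1 0
  have b1011 := C.curl_phi 1 0 1 1
  have b1110 := C.curl_phi 1 1 1 0
  have b1111 := C.curl_phi 1 1 1 1
  simp only [curvLow_eq, h.eqn, h.symm, h.symm', ep_zero_zero, ep_zero_one, ep_one_zero, ep_one_one,
    Fin.val_zero, Fin.val_one, Nat.reduceAdd, zero_mul, mul_zero, zero_add, add_zero, sub_zero, zero_sub, mul_one,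
    one_mul, neg_mul, neg_zero, neg_neg, Fin.sum_univ_two, Fin.isValue] at a0001 a0011 a0110 a1011 r000100 r000101
  simp only [curvLow_eq, h.eqn, h.symm, h.symm', ep_zero_zero, ep_zero_one, ep_one_zero, ep_one_one,
    Fin.val_zero, Fin.val_one, Nat.reduceAdd, zero_mul, mul_zero, zero_add, add_zero, sub_zero, zero_sub, mul_one,
    one_mul, neg_mul, neg_zero, neg_neg, Fin.sum_univ_two, Fin.isValue] at r000111 r001101 r011001 r101101 r101111 b0000
  simp only [curvLow_eq, h.eqn, h.symm, h.symm', ep_zero_zero, ep_zero_one, ep_one_zero, ep_one_one,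
    Fin.val_zero, Fin.val_one, Nat.reduceAdd, zero_mul, mul_zero, zero_add, add_zero, sub_zero, zero_sub, mul_one,
    one_mul, neg_mul, neg_zero, neg_neg, Fin.sum_univ_two, Fin.isValue] at b0001 b0010 b0011 b0110 b0111 b1010
  simp only [curvLow_eq, h.eqn, h.symm, h.symm', ep_zero_zero, ep_zero_one, ep_one_zero, ep_one_one,
    Fin.val_zero, Fin.val_one, Nat.reduceAdd, zero_mul, mul_zero, zero_add, add_zero, sub_zero, zero_sub, mul_one,
    one_mul, neg_mul, neg_zero, neg_neg, Fin.sum_univ_two, Fin.isValue] at b1011 b1110 b1111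
  -- The components are solved linearly from the Ricci identity for F, the skew part of ∇ω and the
  -- contracted Bianchi identity, which removes ∇Φ. The factor 24 keeps all coefficients integral.
  refine ⟨C.cancel ?_, C.cancel ?_, C.cancel ?_, C.cancel ?_, C.cancel ?_⟩
  · linear_combination (-24) * r000100 + (24) * ξ 0 1 * b0000 + (-24) * ξ 0 0 * b0001
  · linear_combination (-24) * r000101 + (24) * a0001 + (24) * ξ 0 1 * b0010 + (-24) * ξ 0 0
        * b0011
  · linear_combination (-8) * r000111 + (8) * a0011 + (-8) * a0110 + (8) * ξ 0 1 * b0110 +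
        (-8) * ξ 0 0 * b0111 + (-8) * ξ 1 0 * b0011 + (-8) * ξ 0 0 * b1011 + (8) * r011001 + (8)
        * ξ 1 1 * b0010 + (-8) * r001101 + (8) * ξ 0 1 * b1010
  · linear_combination (-24) * a1011 + (-24) * ξ 1 0 * b1011 + (24) * ξ 1 1 * b1010 + (-24)
        * r101101
  · linear_combination (24) * ξ 1 1 * b1110 + (-24) * r101111 + (-24) * ξ 1 0 * b1111

set_option maxHeartbeats 8000000 in
/-- The second derivative of the divergence of a conformal Killing vector. -/
lemma IsCKV.n11_omega (h : C.IsCKV ξ F F' d) (A A' B B' : Fin 2) :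
    2 * C.n11 (C.omega ξ d) A A' B B' =
      -∑ P, ∑ Q, ∑ P', ∑ Q', ep P Q * ep P' Q' * C.nphi P P' (A + B) (A' + B') * ξ Q Q'
      - ∑ P, ∑ Q, ep P Q * (C.phi (A + P) (A' + B') * F B Q + C.phi (B + P) (A' + B') * F A Q)
      - ∑ P, ∑ Q, ep P Q * (C.phi (A + B) (A' + P) * F' B' Q + C.phi (A + B) (B' + P) * F' A' Q)
      - 4 * d * C.phi (A + B) (A' + B')
      + ep A B * ep A' B' * ∑ P, ∑ Q, ∑ P', ∑ Q', ep P Q * ep P' Q' * C.D P P' C.lam * ξ Q Q'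
      - 2 * C.lam * (ep A' B' * F A B + ep A B * F' A' B') - 2 * C.D A A' C.lam * ξ B B' := by
  have a0001 := h.n11_omega_antisymm 0 0 0 1
  have a0010 := h.n11_omega_antisymm 0 0 1 0
  have a0011 := h.n11_omega_antisymm 0 0 1 1
  have a0110 := h.n11_omega_antisymm 0 1 1 0
  have a0111 := h.n11_omega_antisymm 0 1 1 1
  have a1011 := h.n11_omega_antisymm 1 0 1 1
  have r000101 := h.ricci 0 0 0 1 0 1
  have r000111 := h.ricci 0 0 0 1 1 1
  have r001000 := h.ricci 0 0 1 0 0 0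
  have r001001 := h.ricci 0 0 1 0 0 1
  have r001011 := h.ricci 0 0 1 0 1 1
  have r001100 := h.ricci 0 0 1 1 0 0
  have r001101 := h.ricci 0 0 1 1 0 1
  have r001111 := h.ricci 0 0 1 1 1 1
  have r011001 := h.ricci 0 1 1 0 0 1
  have r011100 := h.ricci 0 1 1 1 0 0
  have r011101 := h.ricci 0 1 1 1 0 1
  have r011111 := h.ricci 0 1 1 1 1 1
  have r101101 := h.ricci 1 0 1 1 0 1
  have b0000 := C.curl_phi 0 0 0 0
  have b0001 := C.curl_phi 0 0 0 1
  have b0010 := C.curl_phi 0 0 1 0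
  have b0011 := C.curl_phi 0 0 1 1
  have b0110 := C.curl_phi 0 1 1 0
  have b0111 := C.curl_phi 0 1 1 1
  have b1000 := C.curl_phi 1 0 0 0
  have b1001 := C.curl_phi 1 0 0 1
  have b1010 := C.curl_phi 1 0 1 0
  have b1011 := C.curl_phi 1 0 1 1
  have b1110 := C.curl_phi 1 1 1 0
  have b1111 := C.curl_phi 1 1 1 1
  simp only [curvLow_eq, h.eqn, h.symm, h.symm', ep_zero_zero, ep_zero_one, ep_one_zero, ep_one_one,
    Fin.val_zero, Fin.val_one, Nat.reduceAdd, zero_mul, mul_zero, zero_add, add_zero, sub_zero, zero_sub, mul_one,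
    one_mul, neg_mul, neg_zero, neg_neg, Fin.sum_univ_two, Fin.isValue] at a0001 a0010 a0011 a0110 a0111 a1011
  simp only [curvLow_eq, h.eqn, h.symm, h.symm', ep_zero_zero, ep_zero_one, ep_one_zero, ep_one_one,
    Fin.val_zero, Fin.val_one, Nat.reduceAdd, zero_mul, mul_zero, zero_add, add_zero, sub_zero, zero_sub, mul_one,
    one_mul, neg_mul, neg_zero, neg_neg, Fin.sum_univ_two, Fin.isValue] at r000101 r000111 r001000 r001001 r001011 r001100
  simp only [curvLow_eq, h.eqn, h.symm, h.symm', ep_zero_zero, ep_zero_one, ep_one_zero, ep_one_one,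
    Fin.val_zero, Fin.val_one, Nat.reduceAdd, zero_mul, mul_zero, zero_add, add_zero, sub_zero, zero_sub, mul_one,
    one_mul, neg_mul, neg_zero, neg_neg, Fin.sum_univ_two, Fin.isValue] at r001101 r001111 r011001 r011100 r011101 r011111
  simp only [curvLow_eq, h.eqn, h.symm, h.symm', ep_zero_zero, ep_zero_one, ep_one_zero, ep_one_one,
    Fin.val_zero, Fin.val_one, Nat.reduceAdd, zero_mul, mul_zero, zero_add, add_zero, sub_zero, zero_sub, mul_one,
    one_mul, neg_mul, neg_zero, neg_neg, Fin.sum_univ_two, Fin.isValue] at r101101 b0000 b0001 b0010 b0011 b0110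
  simp only [curvLow_eq, h.eqn, h.symm, h.symm', ep_zero_zero, ep_zero_one, ep_one_zero, ep_one_one,
    Fin.val_zero, Fin.val_one, Nat.reduceAdd, zero_mul, mul_zero, zero_add, add_zero, sub_zero, zero_sub, mul_one,
    one_mul, neg_mul, neg_zero, neg_neg, Fin.sum_univ_two, Fin.isValue] at b0111 b1000 b1001 b1010 b1011 b1110
  simp only [curvLow_eq, h.eqn, h.symm, h.symm', ep_zero_zero, ep_zero_one, ep_one_zero, ep_one_one,
    Fin.val_zero, Fin.val_one, Nat.reduceAdd, zero_mul, mul_zero, zero_add, add_zero, sub_zero, zero_sub, mul_one,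
    one_mul, neg_mul, neg_zero, neg_neg, Fin.sum_univ_two, Fin.isValue] at b1111
  -- The same three families of identities are solved for ∇ω; this time the Bianchi identity removes
  -- ∇Ψ and leaves the derivative of Φ along ξ.
  apply C.cancel
  revert A A' B B'
  simp only [Fin.forall_fin_two, h.symm, h.symm', ep_zero_zero, ep_zero_one, ep_one_zero, ep_one_one,
    Fin.val_zero, Fin.val_one, Nat.reduceAdd, zero_mul, mul_zero, zero_add, add_zero, sub_zero, zero_sub, mul_one,
    one_mul, neg_mul, neg_zero, neg_neg, Fin.sum_univ_two, Fin.isValue]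
  and_intros
  · linear_combination (-24) * ξ 1 0 * b0000 + (-24) * r001000 + (24) * ξ 0 0 * b1000
  · linear_combination (-24) * a0001 + (24) * r000101 + (-24) * ξ 0 1 * b0010 + (24) * ξ 0 0
        * b0011 + (-24) * ξ 1 0 * b0001 + (-24) * r001100 + (24) * ξ 0 1 * b1000
  · linear_combination (24) * a0010 + (-24) * ξ 1 0 * b0010 + (-24) * r001001 + (24) * ξ 0 0
        * b1010
  · linear_combination (16) * a0011 + (8) * r000111 + (8) * a0110 + (-8) * ξ 0 1 * b0110 +
        (8) * ξ 0 0 * b0111 + (-16) * ξ 1 0 * b0011 + (-16) * r001101 + (16) * ξ 0 1 * b1010 +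
        (8) * ξ 0 0 * b1011 + (-8) * r011001 + (-8) * ξ 1 1 * b0010
  · linear_combination (-72) * a0001 + (24) * r000101 + (-24) * ξ 0 1 * b0010 + (24) * ξ 0 0
        * b0011 + (-24) * ξ 1 0 * b0001 + (-24) * r001100 + (24) * ξ 0 1 * b1000
  · linear_combination (-24) * ξ 1 1 * b0001 + (-24) * r011100 + (24) * ξ 0 1 * b1001
  · linear_combination (16) * a0110 + (8) * a0011 + (-8) * r000111 + (8) * ξ 0 1 * b0110 +
        (-8) * ξ 0 0 * b0111 + (-8) * ξ 1 0 * b0011 + (-8) * r001101 + (8) * ξ 0 1 * b1010 +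
        (16) * ξ 0 0 * b1011 + (-16) * r011001 + (-16) * ξ 1 1 * b0010
  · linear_combination (24) * a0111 + (-24) * ξ 1 1 * b0011 + (-24) * r011101 + (24) * ξ 0 1
        * b1011
  · linear_combination (-24) * ξ 1 0 * b0010 + (-24) * r001001 + (-24) * a0010 + (24) * ξ 0
        0 * b1010
  · linear_combination (8) * a0011 + (-8) * r000111 + (-32) * a0110 + (8) * ξ 0 1 * b0110 +
        (-8) * ξ 0 0 * b0111 + (-8) * ξ 1 0 * b0011 + (-8) * r001101 + (8) * ξ 0 1 * b1010 +
        (16) * ξ 0 0 * b1011 + (-16) * r011001 + (-16) * ξ 1 1 * b0010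
  · linear_combination (-24) * ξ 1 0 * b0110 + (-24) * r001011 + (24) * ξ 0 0 * b1110
  · linear_combination (72) * a1011 + (-24) * ξ 1 0 * b0111 + (-24) * r001111 + (24) * ξ 1 0
        * b1011 + (-24) * ξ 1 1 * b1010 + (24) * r101101 + (24) * ξ 0 1 * b1110
  · linear_combination (-32) * a0011 + (8) * r000111 + (8) * a0110 + (-8) * ξ 0 1 * b0110 +
        (8) * ξ 0 0 * b0111 + (-16) * ξ 1 0 * b0011 + (-16) * r001101 + (16) * ξ 0 1 * b1010 +
        (8) * ξ 0 0 * b1011 + (-8) * r011001 + (-8) * ξ 1 1 * b0010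
  · linear_combination (-24) * ξ 1 1 * b0011 + (-24) * r011101 + (-24) * a0111 + (24) * ξ 0
        1 * b1011
  · linear_combination (-24) * ξ 1 0 * b0111 + (24) * a1011 + (-24) * r001111 + (24) * ξ 1 0
        * b1011 + (-24) * ξ 1 1 * b1010 + (24) * r101101 + (24) * ξ 0 1 * b1110
  · linear_combination (-24) * ξ 1 1 * b0111 + (-24) * r011111 + (24) * ξ 0 1 * b1111

end SpinCalculus

/-! ### The derivative of τ -/

namespace SpinCalculus

variable {R : Type*} [CommRing R] (C : SpinCalculus R)

variable {C} {κ η : Fin 2 → Fin 2 → R} {τ : ℕ → R}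

/-- The expression for the derivative of `η` in terms of `τ`, for a Killing spinor of valence
`(2,0)`. -/
def IsTau (C : SpinCalculus R) (κ η : Fin 2 → Fin 2 → R) (τ : ℕ → R) : Prop :=
  ∀ A A' B B', 4 * C.n11 η A A' B B' =
      -4 * ∑ P, ∑ Q, ep P Q * C.phi (A + P) (A' + B') * κ B Q
      + ep A' B' * (∑ P, ∑ Q, ∑ Y, ∑ Z, ep P Q * ep Y Z * C.psi (A + B + P + Y) * κ Q Z
        - 4 * C.lam * κ A B)
      + 4 * (ep A B * τ (A' + B'))

set_option maxHeartbeats 4000000 in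
lemma IsTau.n22_n11 (hτ : C.IsTau κ η τ) (X X' A A' B B' : Fin 2) :
    4 * C.n22 (C.n11 η) X X' A A' B B' =
      -4 * ∑ P, ∑ Q, ep P Q * (C.nphi X X' (A + P) (A' + B') * κ B Q
        + C.phi (A + P) (A' + B') * C.n20 κ X X' B Q)
      + ep A' B' * (∑ P, ∑ Q, ∑ Y, ∑ Z, ep P Q * ep Y Z * (C.npsi X X' (A + B + P + Y) * κ Q Z
          + C.psi (A + B + P + Y) * C.n20 κ X X' Q Z)
        - 4 * (C.D X X' C.lam * κ A B + C.lam * C.n20 κ X X' A B))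
      + 4 * (ep A B * C.swap.n20 (fun A' B' => τ (A' + B')) X' X A' B') := by
  have e0 : 4 * C.n22 (C.n11 η) X X' A A' B B' =
      C.n22 (fun A A' B B' => 4 * C.n11 η A A' B B') X X' A A' B B' := by
    simp only [SpinCalculus.n22, Fin.sum_univ_two, Derivation.leibniz, smul_eq_mul, D_four]
    ring
  have e : (fun A A' B B' => 4 * C.n11 η A A' B B') = fun A A' B B' : Fin 2 =>
      -4 * ∑ P, ∑ Q, ep P Q * C.phi (A + P) (A' + B') * κ B Q
      + ep A' B' * (∑ P, ∑ Q, ∑ Y, ∑ Z, ep P Q * ep Y Z * C.psi (A + B + P + Y) * κ Q Z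
        - 4 * C.lam * κ A B)
      + 4 * (ep A B * τ (A' + B')) := by
    funext A A' B B'; exact hτ A A' B B'
  rw [e0, e]
  have p := C.ep_parallel X X' A B
  have p' := C.ep_parallel' X X' A' B'
  have f := fun P : Fin 2 => C.n22_phi X X' A A' P B'
  simp only [← n40_psi, ← f]
  simp only [SpinCalculus.n40, SpinCalculus.n22, SpinCalculus.n20, SpinCalculus.swap,
    Fin.sum_univ_two, map_add, map_sub, map_neg, Derivation.leibniz, smul_eq_mul, D_four,
    ep_zero_zero, ep_zero_one, ep_one_zero, ep_one_one, D_ep, Fin.val_zero, Fin.val_one,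
    C.trace X X', zero_mul, mul_zero, add_zero, zero_add, one_mul, map_zero,
    Derivation.map_one_eq_zero]
  linear_combination (-4 * τ (A' + B')) * p -
    (C.psi (A + B + 1 + 1) * κ 0 0 - C.psi (A + B + 0 + 1) * κ 1 0 - C.psi (A + B + 1 + 0) * κ 0 1
      + C.psi (A + B + 0 + 0) * κ 1 1 - 4 * C.lam * κ A B) * p'

lemma IsTau.ricci (hτ : C.IsTau κ η τ) (X X' A A' B B' : Fin 2) :
    (-4 * ∑ P, ∑ Q, ep P Q * (C.nphi X X' (A + P) (A' + B') * κ B Q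
        + C.phi (A + P) (A' + B') * C.n20 κ X X' B Q)
      + ep A' B' * (∑ P, ∑ Q, ∑ Y, ∑ Z, ep P Q * ep Y Z * (C.npsi X X' (A + B + P + Y) * κ Q Z
          + C.psi (A + B + P + Y) * C.n20 κ X X' Q Z)
        - 4 * (C.D X X' C.lam * κ A B + C.lam * C.n20 κ X X' A B))
      + 4 * (ep A B * C.swap.n20 (fun A' B' => τ (A' + B')) X' X A' B'))
    - (-4 * ∑ P, ∑ Q, ep P Q * (C.nphi A A' (X + P) (X' + B') * κ B Q
        + C.phi (X + P) (X' + B') * C.n20 κ A A' B Q)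
      + ep X' B' * (∑ P, ∑ Q, ∑ Y, ∑ Z, ep P Q * ep Y Z * (C.npsi A A' (X + B + P + Y) * κ Q Z
          + C.psi (X + B + P + Y) * C.n20 κ A A' Q Z)
        - 4 * (C.D A A' C.lam * κ X B + C.lam * C.n20 κ A A' X B))
      + 4 * (ep X B * C.swap.n20 (fun A' B' => τ (A' + B')) A' A X' B')) =
    -4 * (C.curvLow X X' A A' B 1 * η 0 B' - C.curvLow X X' A A' B 0 * η 1 B')
      - 4 * (C.swap.curvLow X' X A' A B' 1 * η B 0 - C.swap.curvLow X' X A' A B' 0 * η B 1) := by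
  rw [← hτ.n22_n11, ← hτ.n22_n11]
  have h := C.ricci11 η X X' A A' B B'
  rw [sum_curv, sum_curv] at h
  linear_combination 4 * h

set_option maxHeartbeats 8000000 in
/-- The derivative of `τ`. -/
lemma IsKS20.n_tau (h : C.IsKS20 κ η) (hτ : C.IsTau κ η τ) (X X' A' B' : Fin 2) :
    4 * C.swap.n20 (fun A' B' => τ (A' + B')) X' X A' B' =
      2 * ∑ P, ∑ Q, ∑ Y, ∑ Z, ep P Q * ep Y Z * C.nphi X X' (P + Y) (A' + B') * κ Q Z
      + ∑ P, ∑ Q, ∑ Y, ∑ Z, ep P Q * ep Y Z *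
        (C.nphi X A' (P + Y) (X' + B') + C.nphi X B' (P + Y) (X' + A')) * κ Q Z
      - 2 * ∑ P, ∑ Q, ∑ Y, ∑ Z, ep P Q * ep Y Z *
        (C.nphi P A' (X + Y) (X' + B') + C.nphi P B' (X + Y) (X' + A')) * κ Q Z
      - 4 * ∑ P, ∑ Q, ep P Q * C.swap.psi (X' + A' + B' + P) * η X Q
      - 4 * C.lam * (ep X' A' * η X B' + ep X' B' * η X A')
      - 4 * ∑ P, ∑ Q, ep P Q *
        (C.phi (X + P) (X' + B') * η Q A' + C.phi (X + P) (X' + A') * η Q B') := by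
  have s10 : ∀ X X', C.swap.n20 (fun A' B' => τ (A' + B')) X' X 1 0 =
      C.swap.n20 (fun A' B' => τ (A' + B')) X' X 0 1 := fun X X' => by
    simp [SpinCalculus.n20]; ring
  have r000110 := hτ.ricci 0 0 0 1 1 0
  have r000111 := hτ.ricci 0 0 0 1 1 1
  have r001000 := hτ.ricci 0 0 1 0 0 0
  have r001001 := hτ.ricci 0 0 1 0 0 1
  have r001010 := hτ.ricci 0 0 1 0 1 0
  have r001011 := hτ.ricci 0 0 1 0 1 1
  have r001100 := hτ.ricci 0 0 1 1 0 0
  have r001101 := hτ.ricci 0 0 1 1 0 1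
  have r001110 := hτ.ricci 0 0 1 1 1 0
  have r001111 := hτ.ricci 0 0 1 1 1 1
  have r011000 := hτ.ricci 0 1 1 0 0 0
  have r011001 := hτ.ricci 0 1 1 0 0 1
  have r011010 := hτ.ricci 0 1 1 0 1 0
  have r011011 := hτ.ricci 0 1 1 0 1 1
  have r011100 := hτ.ricci 0 1 1 1 0 0
  have r011101 := hτ.ricci 0 1 1 1 0 1
  have r011110 := hτ.ricci 0 1 1 1 1 0
  have r011111 := hτ.ricci 0 1 1 1 1 1
  have r101100 := hτ.ricci 1 0 1 1 0 0
  have r101101 := hτ.ricci 1 0 1 1 0 1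
  simp only [curvLow_eq, h.eqn, h.symm, s10, swap_phi, swap_lam, ep_zero_zero, ep_zero_one, ep_one_zero, ep_one_one,
    Fin.val_zero, Fin.val_one, Nat.reduceAdd, zero_mul, mul_zero, zero_add, add_zero, sub_zero, zero_sub, mul_one,
    one_mul, neg_mul, neg_zero, neg_neg, Fin.sum_univ_two, Fin.isValue] at r000110 r000111 r001000 r001001 r001010 r001011
  simp only [curvLow_eq, h.eqn, h.symm, s10, swap_phi, swap_lam, ep_zero_zero, ep_zero_one, ep_one_zero, ep_one_one,
    Fin.val_zero, Fin.val_one, Nat.reduceAdd, zero_mul, mul_zero, zero_add, add_zero, sub_zero, zero_sub, mul_one,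
    one_mul, neg_mul, neg_zero, neg_neg, Fin.sum_univ_two, Fin.isValue] at r001100 r001101 r001110 r001111 r011000 r011001
  simp only [curvLow_eq, h.eqn, h.symm, s10, swap_phi, swap_lam, ep_zero_zero, ep_zero_one, ep_one_zero, ep_one_one,
    Fin.val_zero, Fin.val_one, Nat.reduceAdd, zero_mul, mul_zero, zero_add, add_zero, sub_zero, zero_sub, mul_one,
    one_mul, neg_mul, neg_zero, neg_neg, Fin.sum_univ_two, Fin.isValue] at r011010 r011011 r011100 r011101 r011110 r011111
  simp only [curvLow_eq, h.eqn, h.symm, s10, swap_phi, swap_lam, ep_zero_zero, ep_zero_one, ep_one_zero, ep_one_one,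
    Fin.val_zero, Fin.val_one, Nat.reduceAdd, zero_mul, mul_zero, zero_add, add_zero, sub_zero, zero_sub, mul_one,
    one_mul, neg_mul, neg_zero, neg_neg, Fin.sum_univ_two, Fin.isValue] at r101100 r101101
  -- The derivative of τ enters the Ricci identity for η linearly, so it is treated as an array of
  -- unknowns and solved for component by component.
  generalize C.swap.n20 (fun A' B' => τ (A' + B')) = nτ at *
  apply C.two_cancel
  apply C.two_cancel
  revert X X' A' B'
  simp only [Fin.forall_fin_two, h.symm, s10, ep_zero_zero, ep_zero_one, ep_one_zero, ep_one_one,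
    Fin.val_zero, Fin.val_one, Nat.reduceAdd, zero_mul, mul_zero, zero_add, add_zero, sub_zero, zero_sub, mul_one,
    one_mul, neg_mul, neg_zero, neg_neg, Fin.sum_univ_two, Fin.isValue]
  and_intros
  · linear_combination (-4) * r001000
  · linear_combination (-1) * r001001 + (-2) * r001100 + (-1) * r011000 + (1) * r000110
  · linear_combination (-1) * r001001 + (-2) * r001100 + (-1) * r011000 + (1) * r000110
  · linear_combination (2) * r000111 + (-2) * r001101 + (-2) * r011100
  · linear_combination (-2) * r001001 + (-2) * r000110 + (-2) * r011000
  · linear_combination (-1) * r001101 + (-1) * r000111 + (-2) * r011001 + (-1) * r011100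
  · linear_combination (-1) * r001101 + (-1) * r000111 + (-2) * r011001 + (-1) * r011100
  · linear_combination (-4) * r011101
  · linear_combination (-4) * r001010
  · linear_combination (-1) * r001110 + (-1) * r001011 + (-2) * r011010 + (-1) * r101100
  · linear_combination (-1) * r001110 + (-1) * r001011 + (-2) * r011010 + (-1) * r101100
  · linear_combination (-2) * r011110 + (-2) * r011011 + (-2) * r101101
  · linear_combination (-2) * r001110 + (-2) * r001011 + (2) * r101100
  · linear_combination (-2) * r001111 + (-1) * r011110 + (-1) * r011011 + (1) * r101101
  · linear_combination (-2) * r001111 + (-1) * r011110 + (-1) * r011011 + (1) * r101101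
  · linear_combination (-4) * r011111

end SpinCalculus

/-! ### Change of spin frame -/

namespace SpinCalculus

variable {R : Type*} [CommRing R]

/-- The spin calculi `C` and `C₂` are related by the change of spin frame `t`, `t'`. -/
structure IsGauge (C C₂ : SpinCalculus R) (t t' : Fin 2 → Fin 2 → R) : Prop where
  det : t 0 0 * t 1 1 - t 0 1 * t 1 0 = 1
  det' : t' 0 0 * t' 1 1 - t' 0 1 * t' 1 0 = 1
  -- Only the derivations are assumed to correspond. The transformation law of the connection
  -- coefficients is derived from uniqueness of the torsion-free connection.
  D_eq : ∀ A A' f, C₂.D A A' f = ∑ B, ∑ B', t A B * t' A' B' * C.D B B' f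

namespace IsGauge

variable {C C₂ : SpinCalculus R} {t t' : Fin 2 → Fin 2 → R}

lemma swap (h : IsGauge C C₂ t t') : IsGauge C.swap C₂.swap t' t where
  det := h.det'
  det' := h.det
  D_eq A A' f := by
    simp only [SpinCalculus.swap, h.D_eq, Fin.sum_univ_two]
    ring

/-- The failure of the connection coefficients to transform as a connection. -/
def defect (C C₂ : SpinCalculus R) (t t' : Fin 2 → Fin 2 → R) (A A' B E : Fin 2) : R :=
  C₂.D A A' (t B E) + ∑ Z, ∑ Z', ∑ Y, t A Z * t' A' Z' * t B Y * C.γ Z Z' Y E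
    - ∑ X, C₂.γ A A' B X * t X E

set_option maxHeartbeats 4000000 in
-- Subtract the two torsion identities applied to one function. The second derivatives cancel, and
-- what is left is a vector field annihilating all functions.
lemma defect_torsion (h : IsGauge C C₂ t t') (A A' B B' E E' : Fin 2) :
    defect C C₂ t t' A A' B E * t' B' E' + defect C.swap C₂.swap t' t A' A B' E' * t B E
      - (defect C C₂ t t' B B' A E * t' A' E' + defect C.swap C₂.swap t' t B' B A' E' * t A E)
      = 0 := by
  refine C.separating (fun E E' => defect C C₂ t t' A A' B E * t' B' E' +
    defect C.swap C₂.swap t' t A' A B' E' * t B E - (defect C C₂ t t' B B' A E * t' A' E' +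
    defect C.swap C₂.swap t' t B' B A' E' * t A E)) (fun f => ?_) E E'
  have h2 := C₂.torsion A A' B B' f
  have e1 : ∀ A A' B B', C₂.D A A' (C₂.D B B' f) = ∑ E, ∑ E', (C₂.D A A' (t B E) * t' B' E'
      + C₂.D A A' (t' B' E') * t B E) * C.D E E' f + ∑ Z, ∑ Z', ∑ E, ∑ E',
        t A Z * t' A' Z' * t B E * t' B' E' * C.D Z Z' (C.D E E' f) := by
    intro A A' B B'
    rw [h.D_eq B B' f]
    simp only [Fin.sum_univ_two, map_add, Derivation.leibniz, smul_eq_mul]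
    simp only [h.D_eq A A' (C.D _ _ _), Fin.sum_univ_two]
    ring
  rw [e1, e1] at h2
  simp only [h.D_eq _ _ f] at h2
  have w := fun Z Z' E E' => congrArg (fun x => t A Z * t' A' Z' * t B E * t' B' E' * x)
    (C.torsion Z Z' E E' f)
  have hs : ∑ Z, ∑ Z', ∑ E, ∑ E', _ = ∑ Z, ∑ Z', ∑ E, ∑ E', _ :=
    Finset.sum_congr rfl fun Z _ => Finset.sum_congr rfl fun Z' _ => Finset.sum_congr rfl
      fun E _ => Finset.sum_congr rfl fun E' _ => w Z Z' E E'
  clear e1 w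
  simp only [defect, SpinCalculus.swap, Fin.sum_univ_two] at h2 hs ⊢
  linear_combination h2 - hs

/-- Differentiate det t = 1: the contraction of the defect with the inverse of `t` vanishes, both
connections being trace-free. -/
lemma defect_trace (h : IsGauge C C₂ t t') (A A' : Fin 2) :
    defect C C₂ t t' A A' 0 0 * t 1 1 - defect C C₂ t t' A A' 0 1 * t 1 0
      - defect C C₂ t t' A A' 1 0 * t 0 1 + defect C C₂ t t' A A' 1 1 * t 0 0 = 0 := by
  have hd : C₂.D A A' (t 0 0 * t 1 1 - t 0 1 * t 1 0) = 0 := by rw [h.det]; simp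
  simp only [map_sub, Derivation.leibniz, smul_eq_mul] at hd
  simp only [defect, Fin.sum_univ_two, C₂.trace A A', C.trace]
  linear_combination hd

/-- A trace-free difference of torsion-free connections vanishes. -/
lemma eq_zero_of_torsion (C : SpinCalculus R) {δ δ' : Fin 2 → Fin 2 → Fin 2 → Fin 2 → R}
    (T : ∀ A A', δ A A' 1 1 + δ A A' 0 0 = 0) (T' : ∀ A A', δ' A A' 1 1 + δ' A A' 0 0 = 0)
    (h : ∀ A A' B B' X X', δ A A' B X * (if B' = X' then 1 else 0)
      + δ' A A' B' X' * (if B = X then 1 else 0) - (δ B B' A X * (if A' = X' then 1 else 0)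
      + δ' B B' A' X' * (if A = X then 1 else 0)) = 0) (A A' B X : Fin 2) : δ A A' B X = 0 := by
  have t1 : ∀ A A', δ A A' 1 1 = -δ A A' 0 0 := fun A A' => by linear_combination T A A'
  have t2 : ∀ A A', δ' A A' 1 1 = -δ' A A' 0 0 := fun A A' => by linear_combination T' A A'
  -- Skew-symmetrization in the two vector slots is invertible on the 24 unknowns δ, δ', the algebra
  -- behind uniqueness of the Levi-Civita connection. Inverting it produces quarters, hence the two
  -- cancellations.
  apply C.two_cancel
  apply C.two_cancel
  have E000100 := h 0 0 0 1 0 0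
  have E000101 := h 0 0 0 1 0 1
  have E000110 := h 0 0 0 1 1 0
  have E000111 := h 0 0 0 1 1 1
  have E001000 := h 0 0 1 0 0 0
  have E001010 := h 0 0 1 0 1 0
  have E001100 := h 0 0 1 1 0 0
  have E001101 := h 0 0 1 1 0 1
  have E001110 := h 0 0 1 1 1 0
  have E001111 := h 0 0 1 1 1 1
  have E011000 := h 0 1 1 0 0 0
  have E011001 := h 0 1 1 0 0 1
  have E011010 := h 0 1 1 0 1 0
  have E011011 := h 0 1 1 0 1 1
  have E011101 := h 0 1 1 1 0 1
  have E011111 := h 0 1 1 1 1 1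
  have E101100 := h 1 0 1 1 0 0
  have E101101 := h 1 0 1 1 0 1
  have E101110 := h 1 0 1 1 1 0
  have E101111 := h 1 0 1 1 1 1
  simp [-neg_eq_zero, t1, t2] at E000100 E000101 E000110 E000111 E001000 E001010
  simp [-neg_eq_zero, t1, t2] at E001100 E001101 E001110 E001111 E011000 E011001
  simp [-neg_eq_zero, t1, t2] at E011010 E011011 E011101 E011111 E101100 E101101
  simp [-neg_eq_zero, t1, t2] at E101110 E101111
  fin_cases A <;> fin_cases A' <;> fin_cases B <;> fin_cases X <;>
    simp [-neg_eq_zero, t1]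
  · linear_combination (1) * E000101 + (-2) * E001111 + (1) * E011011 + (-1) * E001010
  · linear_combination (4) * E000111
  · linear_combination (2) * E001000 + (-2) * E101111 + (2) * E001101
  · linear_combination (-1) * E000101 + (2) * E001111 + (-1) * E011011 + (1) * E001010
  · linear_combination (-2) * E011010 + (-1) * E011111 + (1) * E001110 + (-1) * E000100
  · linear_combination (-4) * E000110
  · linear_combination (2) * E011000 + (2) * E101110 + (2) * E011101
  · linear_combination (2) * E011010 + (1) * E011111 + (-1) * E001110 + (1) * E000100
  · linear_combination (-2) * E011001 + (-1) * E101111 + (1) * E001101 + (-1) * E001000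
  · linear_combination (-2) * E001010 + (-2) * E000101 + (-2) * E011011
  · linear_combination (4) * E101101
  · linear_combination (2) * E011001 + (1) * E101111 + (-1) * E001101 + (1) * E001000
  · linear_combination (-2) * E001100 + (-1) * E011101 + (1) * E011000 + (1) * E101110
  · linear_combination (-2) * E001110 + (2) * E000100 + (-2) * E011111
  · linear_combination (-4) * E101100
  · linear_combination (2) * E001100 + (1) * E011101 + (-1) * E011000 + (-1) * E101110

set_option maxHeartbeats 1000000 in
lemma defect_eq_zero (h : IsGauge C C₂ t t') (A A' B E : Fin 2) :
    defect C C₂ t t' A A' B E = 0 := by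
  -- By det t = 1 the inverse matrix has polynomial entries. Multiplying the defect by it gives an
  -- array of the form treated in `eq_zero_of_torsion`.
  have hi : ∀ t : Fin 2 → Fin 2 → R, t 0 0 * t 1 1 - t 0 1 * t 1 0 = 1 → ∀ B X,
      t B 0 * (if X = 0 then t 1 1 else -t 0 1) + t B 1 * (if X = 0 then -t 1 0 else t 0 0) =
        if B = X then 1 else 0 := by
    intro t ht
    simp only [Fin.forall_fin_two]
    simp
    and_intros <;> first | ring1 | linear_combination ht
  have i1 := hi t h.det
  have i2 := hi t' h.det'
  have H := fun A A' B B' E E' => h.defect_torsion A A' B B' E E'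
  have T := h.defect_trace
  have T' := h.swap.defect_trace
  generalize defect C C₂ t t' = Δ at *
  generalize defect C.swap C₂.swap t' t = Δ' at *
  have z := eq_zero_of_torsion C
    (δ := fun A A' B X => Δ A A' B 0 * (if X = 0 then t 1 1 else -t 0 1)
      + Δ A A' B 1 * (if X = 0 then -t 1 0 else t 0 0))
    (δ' := fun A A' B X => Δ' A' A B 0 * (if X = 0 then t' 1 1 else -t' 0 1)
      + Δ' A' A B 1 * (if X = 0 then -t' 1 0 else t' 0 0))
    (fun A A' => by simp; linear_combination T A A')
    (fun A A' => by simp; linear_combination T' A' A)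
    (fun A A' B B' X X' => by
      have H0 := H A A' B B'
      rw [← i1 B X, ← i2 B' X', ← i1 A X, ← i2 A' X']
      set s0 := (if X = 0 then t 1 1 else -t 0 1)
      set s1 := (if X = 0 then -t 1 0 else t 0 0)
      set s0' := (if X' = 0 then t' 1 1 else -t' 0 1)
      set s1' := (if X' = 0 then -t' 1 0 else t' 0 0)
      linear_combination s0 * s0' * H0 0 0 + s0 * s1' * H0 0 1 + s1 * s0' * H0 1 0
        + s1 * s1' * H0 1 1)
  have z0 := z A A' B 0
  have z1 := z A A' B 1
  simp at z0 z1
  have hd := h.det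
  revert E
  simp only [Fin.forall_fin_two]
  constructor
  · linear_combination t 0 0 * z0 + t 1 0 * z1 - Δ A A' B 0 * hd
  · linear_combination t 0 1 * z0 + t 1 1 * z1 - Δ A A' B 1 * hd

/-- The derivative of the change of spin frame. -/
lemma D_t (h : IsGauge C C₂ t t') (A A' B E : Fin 2) :
    C₂.D A A' (t B E) = ∑ X, C₂.γ A A' B X * t X E
      - ∑ Z, ∑ Z', ∑ Y, t A Z * t' A' Z' * t B Y * C.γ Z Z' Y E := by
  have z := h.defect_eq_zero A A' B E
  simp only [defect] at z
  linear_combination z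

lemma D_t' (h : IsGauge C C₂ t t') (A A' B E : Fin 2) :
    C₂.D A A' (t' B E) = ∑ X, C₂.γ' A A' B X * t' X E
      - ∑ Z, ∑ Z', ∑ Y, t A Z * t' A' Z' * t' B Y * C.γ' Z Z' Y E := by
  have z := h.swap.D_t A' A B E
  simp only [SpinCalculus.swap, Fin.sum_univ_two] at z ⊢
  linear_combination z

/-- The change of components of a spinor with two indices. -/
def act (t t' φ : Fin 2 → Fin 2 → R) (A A' : Fin 2) : R := ∑ B, ∑ B', t A B * t' A' B' * φ B B'

set_option maxHeartbeats 4000000 in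
lemma n11_act (h : IsGauge C C₂ t t') (φ : Fin 2 → Fin 2 → R) (A A' B B' : Fin 2) :
    C₂.n11 (act t t' φ) A A' B B' =
      ∑ Z, ∑ Z', t A Z * t' A' Z' * act t t' (C.n11 φ Z Z') B B' := by
  simp only [n11, act, Fin.sum_univ_two, map_add, Derivation.leibniz, smul_eq_mul]
  simp only [h.D_t, h.D_t']
  simp only [h.D_eq, Fin.sum_univ_two]
  ring

set_option maxHeartbeats 4000000 in
lemma n20_act (h : IsGauge C C₂ t t') (φ : Fin 2 → Fin 2 → R) (A A' B E : Fin 2) :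
    C₂.n20 (act t t φ) A A' B E =
      ∑ Z, ∑ Z', t A Z * t' A' Z' * act t t (C.n20 φ Z Z') B E := by
  simp only [n20, act, Fin.sum_univ_two, map_add, Derivation.leibniz, smul_eq_mul]
  simp only [h.D_t]
  simp only [h.D_eq, Fin.sum_univ_two]
  ring

end IsGauge

/-- The covariant derivative of a spinor `φ_B`. -/
def n10 (C : SpinCalculus R) (φ : Fin 2 → R) (A A' B : Fin 2) : R :=
  C.D A A' (φ B) - ∑ X, C.γ A A' B X * φ X

/-- The covariant derivative of a spinor `φ_{PP'Q}`. -/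
def n21 (C : SpinCalculus R) (φ : Fin 2 → Fin 2 → Fin 2 → R) (A A' P P' Q : Fin 2) : R :=
  C.D A A' (φ P P' Q) - ∑ X, C.γ A A' P X * φ X P' Q - ∑ X, C.γ' A A' P' X * φ P X Q
    - ∑ X, C.γ A A' Q X * φ P P' X

lemma ricci10 (C : SpinCalculus R) (φ : Fin 2 → R) (A A' B B' P : Fin 2) :
    C.n21 (C.n10 φ) A A' B B' P - C.n21 (C.n10 φ) B B' A A' P =
      -∑ E, C.curv A A' B B' P E * φ E := by
  have h := C.torsion A A' B B' (φ P)
  simp only [n21, n10, curv, Fin.sum_univ_two, map_sub, map_add, Derivation.leibniz,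
    smul_eq_mul] at *
  linear_combination h

namespace IsGauge

variable {C C₂ : SpinCalculus R} {t t' : Fin 2 → Fin 2 → R}

lemma n10_act (h : IsGauge C C₂ t t') (φ : Fin 2 → R) (A A' B : Fin 2) :
    C₂.n10 (fun B => ∑ E, t B E * φ E) A A' B =
      ∑ Z, ∑ Z', ∑ E, t A Z * t' A' Z' * t B E * C.n10 φ Z Z' E := by
  simp only [n10, Fin.sum_univ_two, map_add, Derivation.leibniz, smul_eq_mul]
  simp only [h.D_t]
  simp only [h.D_eq, Fin.sum_univ_two]
  ring

set_option maxHeartbeats 8000000 in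
lemma n21_act (h : IsGauge C C₂ t t') (φ : Fin 2 → Fin 2 → Fin 2 → R) (A A' P P' Q : Fin 2) :
    C₂.n21 (fun P P' Q => ∑ E, ∑ E', ∑ G, t P E * t' P' E' * t Q G * φ E E' G) A A' P P' Q =
      ∑ Z, ∑ Z', ∑ E, ∑ E', ∑ G, t A Z * t' A' Z' * t P E * t' P' E' * t Q G *
        C.n21 φ Z Z' E E' G := by
  simp only [n21, Fin.sum_univ_two, map_add, Derivation.leibniz, smul_eq_mul]
  simp only [h.D_t, h.D_t']
  simp only [h.D_eq, Fin.sum_univ_two]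
  ring

end IsGauge

end SpinCalculus

/-! ### Frame covariance of the curvature and of the prolonged fields -/

namespace SpinCalculus

variable {R : Type*} [CommRing R]

lemma two_mul_phi (C : SpinCalculus R) (P Q A' B' : Fin 2) :
    C.Phi2 P Q A' B' = 2 * C.phi (P + Q) (A' + B') := by
  have s := C.six_mul_sixth
  have x3 := C.Phi2_symm_left
  have x4 := C.Phi2_symm_right
  revert P Q A' B'
  simp only [x3 1 0, x4 _ _ 1 0, Fin.forall_fin_two]
  simp [phi]
  and_intros <;> linear_combination (-C.Phi2 _ _ _ _) * s

lemma two_mul_X2 (C : SpinCalculus R) (A B P Q : Fin 2) :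
    C.X2 A B P Q = 2 * (C.psi (A + B + P + Q) + C.lam * (ep A P * ep B Q + ep A Q * ep B P)) := by
  simp [X2, curvLow_eq]
  ring

namespace IsGauge

variable {C C₂ : SpinCalculus R} {t t' : Fin 2 → Fin 2 → R}

/-- The spin metric is invariant under SL(2), so contractions do not see the frame. -/
lemma sum_ep_act (ht : t 0 0 * t 1 1 - t 0 1 * t 1 0 = 1) (φ : Fin 2 → Fin 2 → R) :
    ∑ A, ∑ B, ep A B * act t t φ A B = ∑ A, ∑ B, ep A B * φ A B := by
  simp [act]
  linear_combination (φ 0 1 - φ 1 0) * ht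

/-- Apply the Ricci identity to the spinor with constant components δ_E^e and to its transform. The
left-hand sides correspond by covariance of ∇, hence so do the curvatures. -/
lemma curv_act (h : IsGauge C C₂ t t') (X X' A A' B e : Fin 2) :
    ∑ E, C₂.curv X X' A A' B E * t E e =
      ∑ Z, ∑ Z', ∑ Y, ∑ Y', ∑ P, t X Z * t' X' Z' * t A Y * t' A' Y' * t B P *
        C.curv Z Z' Y Y' P e := by
  have h2 := C₂.ricci10 (fun B => ∑ E, t B E * (if E = e then 1 else 0)) X X' A A' B
  have e1 : C₂.n10 (fun B => ∑ E, t B E * (if E = e then 1 else 0)) = fun A A' B =>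
      ∑ Z, ∑ Z', ∑ E, t A Z * t' A' Z' * t B E * C.n10 (fun E => if E = e then 1 else 0) Z Z' E := by
    funext A A' B; exact h.n10_act _ A A' B
  rw [e1, h.n21_act, h.n21_act] at h2
  have h1 := fun Z Z' Y Y' P => congrArg
    (fun x => t X Z * t' X' Z' * t A Y * t' A' Y' * t B P * x)
    (C.ricci10 (fun E => if E = e then 1 else 0) Z Z' Y Y' P)
  have hs : ∑ Z, ∑ Z', ∑ Y, ∑ Y', ∑ P, _ = ∑ Z, ∑ Z', ∑ Y, ∑ Y', ∑ P, _ :=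
    Finset.sum_congr rfl fun Z _ => Finset.sum_congr rfl fun Z' _ => Finset.sum_congr rfl
      fun Y _ => Finset.sum_congr rfl fun Y' _ => Finset.sum_congr rfl fun P _ => h1 Z Z' Y Y' P
  clear e1 h1
  simp only [mul_ite, mul_one, mul_zero, Finset.sum_ite_eq', Finset.mem_univ, if_true] at h2 hs
  generalize C.n21 (C.n10 fun E => if E = e then 1 else 0) = G at *
  simp only [Fin.sum_univ_two] at h2 hs ⊢
  linear_combination h2 - hs

set_option maxHeartbeats 1000000 in
lemma curvLow_act (h : IsGauge C C₂ t t') (A A' B B' P Q : Fin 2) :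
    C₂.curvLow A A' B B' P Q = act t t (fun A B => act t' t' (fun A' B' =>
      act t t (fun P Q => C.curvLow A A' B B' P Q) P Q) A' B') A B := by
  have h0 := h.curv_act A A' B B' P 0
  have h1 := h.curv_act A A' B B' P 1
  have hd := h.det
  revert Q
  simp only [act, curvLow, Fin.sum_univ_two, Fin.forall_fin_two, ep_zero_zero, ep_zero_one,
    ep_one_zero, ep_one_one] at h0 h1 ⊢
  constructor
  · linear_combination t 0 1 * h0 - t 0 0 * h1 + C₂.curv A A' B B' P 1 * hd
  · linear_combination t 1 1 * h0 - t 1 0 * h1 - C₂.curv A A' B B' P 0 * hd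

lemma Phi2_act (h : IsGauge C C₂ t t') (P Q A' B' : Fin 2) :
    C₂.Phi2 P Q A' B' = act t' t' (fun A' B' =>
      act t t (fun P Q => C.Phi2 P Q A' B') P Q) A' B' := by
  simp only [Phi2, h.curvLow_act]
  rw [sum_ep_act h.det]
  simp only [act, Fin.sum_univ_two, ep_zero_zero, ep_zero_one, ep_one_zero, ep_one_one]
  ring

lemma X2_act (h : IsGauge C C₂ t t') (A B P Q : Fin 2) :
    C₂.X2 A B P Q = act t t (fun A B => act t t (fun P Q => C.X2 A B P Q) P Q) A B := by
  have e : ∀ A' B', C₂.curvLow A A' B B' P Q = act t' t' (fun A' B' => act t t (fun A B =>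
      act t t (fun P Q => C.curvLow A A' B B' P Q) P Q) A B) A' B' := fun A' B' => by
    rw [h.curvLow_act]
    simp only [act, Fin.sum_univ_two]
    ring
  simp only [X2, e]
  rw [sum_ep_act h.det']
  simp only [act, Fin.sum_univ_two, ep_zero_zero, ep_zero_one, ep_one_zero, ep_one_one]
  ring

lemma phi_act (h : IsGauge C C₂ t t') (P Q A' B' : Fin 2) :
    C₂.phi (P + Q) (A' + B') = act t' t' (fun A' B' =>
      act t t (fun P Q => C.phi (P + Q) (A' + B')) P Q) A' B' := by
  have z := h.Phi2_act P Q A' B'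
  simp only [two_mul_phi] at z
  apply C.two_cancel
  rw [z]
  simp only [act, Fin.sum_univ_two]
  ring

lemma twelve_mul_lam (C : SpinCalculus R) :
    ∑ A, ∑ P, ep A P * ∑ B, ∑ Q, ep B Q * C.X2 A B P Q = 12 * C.lam := by
  have x1 := C.X2_symm_left
  have x2 := C.X2_symm_right
  have h1 := C.bianchi_first_cons.1.2.2
  simp [lam, x1 1 0, x2 _ _ 1 0]
  linear_combination -h1 - 2 * (C.X2 0 0 1 1 - C.X2 0 1 0 1) * C.six_mul_sixth

/-- The complete contraction of X is a multiple of Λ and does not depend on the frame. -/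
lemma lam_eq (h : IsGauge C C₂ t t') : C₂.lam = C.lam := by
  apply C.two_cancel
  apply C.two_cancel
  apply C.three_cancel
  have e : ∀ A B P Q, C₂.X2 A B P Q = act t t (fun A P => act t t (fun B Q => C.X2 A B P Q) B Q)
      A P := fun A B P Q => by
    rw [h.X2_act]
    simp only [act, Fin.sum_univ_two]
    ring
  have z1 := twelve_mul_lam C
  have z2 := twelve_mul_lam C₂
  have z3 : ∑ A, ∑ P, ep A P * ∑ B, ∑ Q, ep B Q * C₂.X2 A B P Q =
      ∑ B, ∑ Q, ep B Q * ∑ A, ∑ P, ep A P * C₂.X2 A B P Q := by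
    simp only [Fin.sum_univ_two]
    ring
  rw [z3] at z2
  simp only [e, sum_ep_act h.det] at z2
  have z4 : ∀ A P, ∑ B, ∑ Q, ep B Q * act t t (fun B Q => C.X2 A B P Q) B Q =
    ∑ B, ∑ Q, ep B Q * C.X2 A B P Q := fun A P => sum_ep_act h.det _
  have z5 : ∑ B, ∑ Q, ep B Q * ∑ A, ∑ P, ep A P * act t t (fun B Q => C.X2 A B P Q) B Q =
    ∑ A, ∑ P, ep A P * ∑ B, ∑ Q, ep B Q * act t t (fun B Q => C.X2 A B P Q) B Q := by
    simp only [Fin.sum_univ_two]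
    ring
  rw [z5] at z2
  simp only [z4] at z2
  linear_combination z1 - z2

section conformalKilling

variable {ξ F F' F₂ F₂' : Fin 2 → Fin 2 → R} {d d₂ : R}

lemma trace_n11 (hC : C.IsCKV ξ F F' d) (A B : Fin 2) :
    ∑ A', ∑ B', ep A' B' * C.n11 ξ A A' B B' = 2 * F A B + 4 * ep A B * d := by
  have s := hC.symm'
  simp [hC.eqn]
  linear_combination -ep A B * s

lemma n11_act_eq (h : IsGauge C C₂ t t') (φ : Fin 2 → Fin 2 → R) (A A' B B' : Fin 2) :
    C₂.n11 (act t t' φ) A A' B B' = act t' t' (fun A' B' => act t t (fun A B =>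
      C.n11 φ A A' B B') A B) A' B' := by
  rw [h.n11_act]
  simp only [act, Fin.sum_univ_two]
  ring

lemma trace_n11_act (h : IsGauge C C₂ t t') (φ : Fin 2 → Fin 2 → R) (A B : Fin 2) :
    ∑ A', ∑ B', ep A' B' * C₂.n11 (act t t' φ) A A' B B' =
      act t t (fun A B => ∑ A', ∑ B', ep A' B' * C.n11 φ A A' B B') A B := by
  simp only [h.n11_act_eq]
  rw [sum_ep_act h.det']
  simp only [act, Fin.sum_univ_two]
  ring

/-- Being a full contraction of ∇ξ, `d` is a scalar determined by ξ; no choice is left in it. -/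
lemma ckv_trace (h : IsGauge C C₂ t t') (hC : C.IsCKV ξ F F' d)
    (hC₂ : C₂.IsCKV (act t t' ξ) F₂ F₂' d₂) : d₂ = d := by
  have z := h.trace_n11_act ξ
  simp only [trace_n11 hC, trace_n11 hC₂] at z
  have w : ∑ A, ∑ B, ep A B * (2 * F₂ A B + 4 * ep A B * d₂) =
      ∑ A, ∑ B, ep A B * (2 * F A B + 4 * ep A B * d) := by
    simp only [z]
    rw [sum_ep_act h.det]
  have s := hC.symm
  have s₂ := hC₂.symm
  simp at w
  apply C.two_cancel
  apply C.two_cancel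
  apply C.two_cancel
  linear_combination w + 2 * s₂ - 2 * s

/-- The primed contraction of ∇ξ is 2F plus a multiple of ε d, and both it and `d` are already known
to be covariant. -/
lemma ckv_curl (h : IsGauge C C₂ t t') (hC : C.IsCKV ξ F F' d)
    (hC₂ : C₂.IsCKV (act t t' ξ) F₂ F₂' d₂) (A B : Fin 2) : F₂ A B = act t t F A B := by
  have z := h.trace_n11_act ξ A B
  simp only [trace_n11 hC, trace_n11 hC₂] at z
  rw [h.ckv_trace hC hC₂] at z
  have hd := h.det
  apply C.two_cancel
  revert z A B
  simp [Fin.forall_fin_two, act]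
  and_intros <;> intro z
  · linear_combination z
  · linear_combination z + 4 * d * hd
  · linear_combination z - 4 * d * hd
  · linear_combination z

lemma ckv_curl' (h : IsGauge C C₂ t t') (hC : C.IsCKV ξ F F' d)
    (hC₂ : C₂.IsCKV (act t t' ξ) F₂ F₂' d₂) (A B : Fin 2) : F₂' A B = act t' t' F' A B := by
  refine h.swap.ckv_curl hC.swap (F₂ := F₂') (F₂' := F₂) (d₂ := d₂) ?_ A B
  have e : act t' t (fun A A' => ξ A' A) = fun A A' => act t t' ξ A' A := by
    funext A A'
    simp only [act, Fin.sum_univ_two]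
    ring
  rw [e]
  exact hC₂.swap

lemma ckv_omega (h : IsGauge C C₂ t t') (hC : C.IsCKV ξ F F' d)
    (hC₂ : C₂.IsCKV (act t t' ξ) F₂ F₂' d₂) (A A' : Fin 2) :
    C₂.omega (act t t' ξ) d₂ A A' = act t t' (C.omega ξ d) A A' := by
  rw [h.ckv_trace hC hC₂]
  simp only [omega, h.D_eq, h.lam_eq, act, Fin.sum_univ_two]
  ring

end conformalKilling

section killing

variable {κ η η₂ : Fin 2 → Fin 2 → R} {τ τ₂ : ℕ → R}

lemma ks_eta (h : IsGauge C C₂ t t') (hC : C.IsKS20 κ η) (hC₂ : C₂.IsKS20 (act t t κ) η₂)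
    (E A' : Fin 2) : η₂ E A' = act t t' η E A' := by
  have e1 : ∀ E A', ∑ A, ∑ B, ep A B * C.n20 κ A A' B E = 3 * η E A' := fun E A' => by
    revert E; simp [hC.eqn, Fin.forall_fin_two]; constructor <;> ring
  have e2 : ∑ A, ∑ B, ep A B * C₂.n20 (act t t κ) A A' B E = 3 * η₂ E A' := by
    revert E; simp [hC₂.eqn, Fin.forall_fin_two]; constructor <;> ring
  have e3 : ∀ A B, C₂.n20 (act t t κ) A A' B E = act t t (fun A B =>
      act t t' (fun E A' => C.n20 κ A A' B E) E A') A B := fun A B => by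
    rw [h.n20_act]
    simp only [act, Fin.sum_univ_two]
    ring
  simp only [e3] at e2
  rw [sum_ep_act h.det] at e2
  apply C.three_cancel
  rw [← e2]
  have e4 : 3 * act t t' η E A' = act t t' (fun E A' => 3 * η E A') E A' := by
    simp only [act, Fin.sum_univ_two]; ring
  rw [e4]
  simp only [← e1]
  simp only [act, Fin.sum_univ_two]
  ring

lemma sum_phi_act (h : IsGauge C C₂ t t') (κ : Fin 2 → Fin 2 → R) (A' B' : Fin 2) :
    ∑ A, ∑ B, ep A B * ∑ P, ∑ Q, ep P Q * (C₂.phi (A + P) (A' + B') * act t t κ B Q) =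
      act t' t' (fun A' B' => ∑ A, ∑ B, ep A B * ∑ P, ∑ Q, ep P Q *
        (C.phi (A + P) (A' + B') * κ B Q)) A' B' := by
  have e : ∀ A B P Q : Fin 2, C₂.phi (A + P) (A' + B') * act t t κ B Q =
      act t t (fun P Q => act t t (fun A B => act t' t' (fun A' B' =>
        C.phi (A + P) (A' + B')) A' B' * κ B Q) A B) P Q := fun A B P Q => by
    rw [h.phi_act]
    simp only [act, Fin.sum_univ_two]
    ring
  simp only [e, sum_ep_act h.det]
  have e2 : ∀ f : Fin 2 → Fin 2 → Fin 2 → Fin 2 → R, ∑ A, ∑ B, ep A B * ∑ P, ∑ Q, ep P Q *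
      act t t (fun A B => f A B P Q) A B = ∑ P, ∑ Q, ep P Q * ∑ A, ∑ B, ep A B *
      act t t (fun A B => f A B P Q) A B := fun f => by
    simp only [Fin.sum_univ_two]
    ring
  rw [e2]
  simp only [sum_ep_act h.det]
  simp only [act, Fin.sum_univ_two]
  ring

lemma trace_n11_tau (hC : C.IsKS20 κ η) (hτ : C.IsTau κ η τ) (A' B' : Fin 2) :
    ∑ A, ∑ B, ep A B * (4 * C.n11 η A A' B B') =
      -4 * ∑ A, ∑ B, ep A B * ∑ P, ∑ Q, ep P Q * (C.phi (A + P) (A' + B') * κ B Q)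
        + 8 * τ (A' + B') := by
  have s := hC.symm
  simp only [IsTau] at hτ
  simp only [hτ]
  simp [s]
  ring

/-- Contract the unprimed pair of ∇η. The Ψ and Λ terms are symmetric in it and drop out, so τ is
expressed by ∇η, Φ and κ, all of them covariant. -/
lemma ks_tau (h : IsGauge C C₂ t t') (hC : C.IsKS20 κ η) (hC₂ : C₂.IsKS20 (act t t κ) η₂)
    (hτ : C.IsTau κ η τ) (hτ₂ : C₂.IsTau (act t t κ) η₂ τ₂) (A' B' : Fin 2) :
    τ₂ (A' + B') = act t' t' (fun A' B' => τ (A' + B')) A' B' := by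
  have z := trace_n11_tau hC₂ hτ₂ A' B'
  have e : ∀ E A', η₂ E A' = act t t' η E A' := h.ks_eta hC hC₂
  obtain rfl : η₂ = act t t' η := by funext E A'; exact e E A'
  have e1 : ∀ A B, 4 * C₂.n11 (act t t' η) A A' B B' = act t t (fun A B => act t' t' (fun A' B' =>
      4 * C.n11 η A A' B B') A' B') A B := fun A B => by
    rw [h.n11_act_eq]
    simp only [act, Fin.sum_univ_two]
    ring
  rw [h.sum_phi_act] at z
  simp only [e1, sum_ep_act h.det] at z
  have w := fun A' B' => trace_n11_tau hC hτ A' B'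
  have w2 : ∑ A, ∑ B, ep A B * act t' t' (fun A' B' => 4 * C.n11 η A A' B B') A' B' =
      act t' t' (fun A' B' => ∑ A, ∑ B, ep A B * (4 * C.n11 η A A' B B')) A' B' := by
    simp only [act, Fin.sum_univ_two]
    ring
  rw [w2] at z
  simp only [w] at z
  apply C.two_cancel
  apply C.two_cancel
  apply C.two_cancel
  have lin : ∀ K T : Fin 2 → Fin 2 → R, act t' t' (fun A' B' => -4 * K A' B' + 8 * T A' B') A' B' =
      -4 * act t' t' K A' B' + 8 * act t' t' T A' B' := fun K T => by
    simp only [act, Fin.sum_univ_two]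
    ring
  have l := lin (fun A' B' => ∑ A : Fin 2, ∑ B : Fin 2, ep A B * ∑ P : Fin 2, ∑ Q : Fin 2,
    ep P Q * (C.phi (A + P) (A' + B') * κ B Q)) (fun A' B' => τ (A' + B'))
  beta_reduce at l
  rw [l] at z
  linear_combination -z

end killing

end IsGauge

end SpinCalculus

/-! ### Potentials for the product of two conformal Killing vectors -/

/-- The contraction `ε^{AB} f_{AB}`. -/
def ctr {R : Type*} [CommRing R] (f : Fin 2 → Fin 2 → R) : R := f 0 1 - f 1 0

/-- The contraction `ε^{AB} ε^{CD} u_{AC} v_{BD}`. -/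
def dot {R : Type*} [CommRing R] (u v : Fin 2 → Fin 2 → R) : R :=
  u 0 0 * v 1 1 - u 0 1 * v 1 0 - u 1 0 * v 0 1 + u 1 1 * v 0 0

/-- The contraction of the two vectors `u` and `v` with `f_{ABA'B'}`. -/
def quad {R : Type*} [CommRing R] (f : ℕ → ℕ → R) (u v : Fin 2 → Fin 2 → R) : R :=
  ctr fun B P => ctr fun E Q => ctr fun b p => ctr fun e q =>
    f (B + E) (b + e) * u P p * v Q q

namespace SpinCalculus

variable {R : Type*} [CommRing R] (C : SpinCalculus R)

lemma swap_D (A A' : Fin 2) : C.swap.D A A' = C.D A' A := rfl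

lemma D_dot11 (u v : Fin 2 → Fin 2 → R) (A A' : Fin 2) :
    C.D A A' (dot u v) = dot (C.n11 u A A') v + dot u (C.n11 v A A') := by
  have t := C.trace A A'
  have t' := C.trace' A A'
  simp only [dot, n11, Fin.sum_univ_two, map_add, map_sub, Derivation.leibniz, smul_eq_mul, t, t']
  ring

lemma D_dot20 (u v : Fin 2 → Fin 2 → R) (A A' : Fin 2) :
    C.D A A' (dot u v) = dot (C.n20 u A A') v + dot u (C.n20 v A A') := by
  have t := C.trace A A'
  simp only [dot, n20, Fin.sum_univ_two, map_add, map_sub, Derivation.leibniz, smul_eq_mul, t]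
  ring

lemma D_dot02 (u v : Fin 2 → Fin 2 → R) (A A' : Fin 2) :
    C.D A A' (dot u v) = dot (C.swap.n20 u A' A) v + dot u (C.swap.n20 v A' A) :=
  C.swap.D_dot20 u v A' A

lemma D_quad (u v : Fin 2 → Fin 2 → R) (A A' : Fin 2) :
    C.D A A' (quad C.phi u v) = quad (C.nphi A A') u v + quad C.phi (C.n11 u A A') v
      + quad C.phi u (C.n11 v A A') := by
  have t := C.trace A A'
  have t' := C.trace' A A'
  simp [quad, ctr, nphi, n11, t, t']
  ring

/-- The curl of the Ricci spinor. -/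
def curlPhi (A B E A' : Fin 2) : R := C.npsi 1 A' (A + B + E) - C.npsi 0 A' (A + B + E + 1)

/-- A multiple of the right hand side of condition A0, for a Killing spinor `L` whose two curls are
given by `K` and `K'`. -/
def obs0 (K K' L : Fin 2 → Fin 2 → Fin 2 → Fin 2 → R) (A A' : Fin 2) : R :=
  (ctr fun B E => ctr fun X Y => ctr fun Z W => C.psi (A + B + X + Z) * K E Y W A')
  + (ctr fun B E => ctr fun X Y => ctr fun Z W => C.swap.psi (A' + B + X + Z) * K' A E Y W)
  + 3 * (ctr fun B E => ctr fun X Y => ctr fun b e => C.curlPhi A B X b * L E Y A' e)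
  + 3 * (ctr fun B E => ctr fun b e => ctr fun x y => C.swap.curlPhi A' b x B * L A E e y)

/-- A multiple of the right hand side of condition A1. -/
def obs1 (L : Fin 2 → Fin 2 → Fin 2 → Fin 2 → R) (A B A' B' : Fin 2) : R :=
  (ctr fun X Y => ctr fun Z W => C.psi (A + B + X + Z) * L Y W A' B')
  - ctr fun X Y => ctr fun Z W => C.swap.psi (A' + B' + X + Z) * L A B Y W

/-- Symmetrization of `u_{AB} v_C` up to a factor. -/
def cyc (u : Fin 2 → Fin 2 → R) (v : Fin 2 → R) (A B E : Fin 2) : R :=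
  u A B * v E + u A E * v B + u B E * v A

/-- Symmetrization of `ξ_{AA'} ζ_{BB'}` up to a factor. -/
def symPair (ξ ζ : Fin 2 → Fin 2 → R) (A B A' B' : Fin 2) : R :=
  ξ A A' * ζ B B' + ξ B A' * ζ A B' + ξ A B' * ζ B A' + ξ B B' * ζ A A'

section ckv

variable {ξ ζ F F' G G' : Fin 2 → Fin 2 → R} {d e : R}

/-- Twice the potential in condition A0 for the product of two conformal Killing vectors. -/
def ckvPotential (ξ ζ F F' G G' : Fin 2 → Fin 2 → R) (d e : R) : R :=
  dot F G + dot F' G' - 4 * (d * e) + 2 * dot (C.omega ξ d) ζ + 2 * dot ξ (C.omega ζ e)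
    + 2 * quad C.phi ξ ζ + 2 * (C.lam * dot ξ ζ)

set_option maxHeartbeats 4000000 in
lemma D_ckvPotential (hξ : C.IsCKV ξ F F' d) (hζ : C.IsCKV ζ G G' e) (A A' : Fin 2) :
    6 * C.D A A' (C.ckvPotential ξ ζ F F' G G' d e) =
      C.obs0 (fun A B E A' => -2 * (cyc F (fun E => ζ E A') A B E + cyc G (fun E => ξ E A') A B E))
        (fun A A' B' E' => -2 * (cyc F' (ζ A) A' B' E' + cyc G' (ξ A) A' B' E')) (symPair ξ ζ) A A' := by
  have w : ∀ u v : Fin 2 → Fin 2 → R, 2 * dot u v = dot (fun B B' => 2 * u B B') v := fun u v => by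
    simp only [dot]; ring
  have w' : ∀ u v : Fin 2 → Fin 2 → R, 2 * dot u v = dot u (fun B B' => 2 * v B B') := fun u v => by
    simp only [dot]; ring
  have hd : C.D A A' d = C.omega ξ d A A' + C.lam * ξ A A' := by simp only [omega]; ring
  have he : C.D A A' e = C.omega ζ e A A' + C.lam * ζ A A' := by simp only [omega]; ring
  -- The gradient of `d` is rewritten as ω + Λξ, so that only prolonged quantities occur. The
  -- derivatives of ω contracted with ζ or ξ are kept with the factor 2 with which `n11_omega`
  -- provides them.
  have key : C.D A A' (C.ckvPotential ξ ζ F F' G G' d e) =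
      dot (C.n20 F A A') G + dot F (C.n20 G A A') + dot (C.swap.n20 F' A' A) G'
      + dot F' (C.swap.n20 G' A' A)
      - 4 * ((C.omega ξ d A A' + C.lam * ξ A A') * e + d * (C.omega ζ e A A' + C.lam * ζ A A'))
      + dot (fun B B' => 2 * C.n11 (C.omega ξ d) A A' B B') ζ
      + 2 * dot (C.omega ξ d) (C.n11 ζ A A') + 2 * dot (C.n11 ξ A A') (C.omega ζ e)
      + dot ξ (fun B B' => 2 * C.n11 (C.omega ζ e) A A' B B')
      + 2 * (quad (C.nphi A A') ξ ζ + quad C.phi (C.n11 ξ A A') ζ + quad C.phi ξ (C.n11 ζ A A'))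
      + 2 * (C.D A A' C.lam * dot ξ ζ + C.lam * (dot (C.n11 ξ A A') ζ + dot ξ (C.n11 ζ A A'))) := by
    simp only [ckvPotential, map_add, map_sub, D_two, D_four, Derivation.leibniz, smul_eq_mul, hd, he]
    rw [C.D_dot20 F G, C.D_dot02 F' G', C.D_dot11 ξ ζ, C.D_dot11 _ ζ, C.D_dot11 ξ, C.D_quad, ← w, ← w']
    ring
  have s1 := hξ.symm
  have s2 := hξ.symm'
  have s3 := hζ.symm
  have s4 := hζ.symm'
  have hξ' := hξ.swap.n20
  have hζ' := hζ.swap.n20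
  rw [key]
  clear w w' hd he key
  simp only [swap_lam, swap_phi, swap_D] at hξ' hζ'
  simp only [dot, quad, ctr]
  simp only [hξ.n20, hζ.n20, hξ', hζ', hξ.n11_omega, hζ.n11_omega, hξ.eqn, hζ.eqn]
  -- Once the prolonged system is inserted, derivatives of Φ and Λ contracted with ξ and ζ survive.
  -- The contracted Bianchi identities of both chiralities convert them into the Weyl divergences
  -- occurring in `obs0`.
  have c0000 := C.curl_phi 0 0 0 0
  have c0001 := C.curl_phi 0 0 0 1
  have c0010 := C.curl_phi 0 0 1 0
  have c0011 := C.curl_phi 0 0 1 1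
  have c0110 := C.curl_phi 0 1 1 0
  have c0111 := C.curl_phi 0 1 1 1
  have c1000 := C.curl_phi 1 0 0 0
  have c1010 := C.curl_phi 1 0 1 0
  have c1011 := C.curl_phi 1 0 1 1
  have c1110 := C.curl_phi 1 1 1 0
  have c1111 := C.curl_phi 1 1 1 1
  have s0000 := C.swap.curl_phi 0 0 0 0
  have s0001 := C.swap.curl_phi 0 0 0 1
  have s0010 := C.swap.curl_phi 0 0 1 0
  have s0011 := C.swap.curl_phi 0 0 1 1
  have s0110 := C.swap.curl_phi 0 1 1 0
  have s0111 := C.swap.curl_phi 0 1 1 1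
  have s1010 := C.swap.curl_phi 1 0 1 0
  have s1110 := C.swap.curl_phi 1 1 1 0
  have s1111 := C.swap.curl_phi 1 1 1 1
  simp [swap_nphi, swap_lam, swap_D] at c0000 c0001 c0010 c0011 c0110
  simp [swap_nphi, swap_lam, swap_D] at c0111 c1000 c1010 c1011 c1110
  simp [swap_nphi, swap_lam, swap_D] at c1111 s0000 s0001 s0010 s0011
  simp [swap_nphi, swap_lam, swap_D] at s0110 s0111 s1010 s1110 s1111
  clear hξ' hζ' hξ hζ
  revert A A'
  simp only [Fin.forall_fin_two, obs0, curlPhi, cyc, symPair, ctr, swap_D, s1, s2, s3, s4, omega,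
    ep_zero_zero, ep_zero_one, ep_one_zero, ep_one_one, Fin.val_zero, Fin.val_one,
    Nat.reduceAdd, zero_mul, mul_zero, zero_add, add_zero, sub_zero, zero_sub, mul_one, one_mul, neg_zero,
    Fin.sum_univ_two, Fin.isValue]
  refine ⟨⟨?_, ?_⟩, ?_, ?_⟩
  · linear_combination 6 * (ξ 0 1 * ζ 1 1) * s0000 + 6 * (ξ 1 0 * ζ 1 1) * c0000 +
        6 * (ξ 1 1 * ζ 0 1) * s0000 + 6 * (ξ 1 1 * ζ 1 0) * c0000 +
        (-6) * (ξ 0 1 * ζ 1 0) * c0010 + (-6) * (ξ 0 1 * ζ 1 0) * s0010 +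
        (-6) * (ξ 1 0 * ζ 0 1) * c0010 + (-6) * (ξ 1 0 * ζ 0 1) * s0010 +
        (-12) * (ξ 0 1 * ζ 0 1) * s0001 + (-12) * (ξ 1 0 * ζ 1 0) * c0001 +
        12 * (ξ 0 0 * ζ 0 1) * s0011 + 12 * (ξ 0 0 * ζ 1 0) * c0011 +
        12 * (ξ 0 1 * ζ 0 0) * s0011 + 12 * (ξ 1 0 * ζ 0 0) * c0011 +
        (-6) * (ξ 0 0 * ζ 1 1) * c1000 + (-6) * (ξ 0 0 * ζ 1 1) * s0010 +
        (-6) * (ξ 1 1 * ζ 0 0) * c1000 + (-6) * (ξ 1 1 * ζ 0 0) * s0010 +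
        6 * (ξ 0 0 * ζ 0 1) * c1010 + 6 * (ξ 0 0 * ζ 1 0) * s1010 + 6 * (ξ 0 1 * ζ 0 0) * c1010 +
        6 * (ξ 1 0 * ζ 0 0) * s1010 + (-12) * (ξ 0 0 * ζ 0 0) * c1011 +
        (-12) * (ξ 0 0 * ζ 0 0) * s0111
  · linear_combination 12 * (ξ 1 1 * ζ 1 1) * c0000 + (-12) * (ξ 0 1 * ζ 1 1) * c0010 +
        6 * (ξ 0 1 * ζ 1 1) * s0010 + (-12) * (ξ 1 1 * ζ 0 1) * c0010 +
        6 * (ξ 1 1 * ζ 0 1) * s0010 + 12 * (ξ 0 1 * ζ 0 1) * c0110 +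
        (-6) * (ξ 0 1 * ζ 1 0) * s0110 + (-6) * (ξ 1 0 * ζ 0 1) * s0110 +
        (-6) * (ξ 1 0 * ζ 1 1) * c0001 + (-6) * (ξ 1 1 * ζ 1 0) * c0001 +
        6 * (ξ 0 0 * ζ 1 1) * c0011 + (-12) * (ξ 0 1 * ζ 0 1) * s0011 +
        6 * (ξ 0 1 * ζ 1 0) * c0011 + 6 * (ξ 1 0 * ζ 0 1) * c0011 + 6 * (ξ 1 1 * ζ 0 0) * c0011 +
        (-12) * (ξ 0 0 * ζ 0 1) * c0111 + 12 * (ξ 0 0 * ζ 0 1) * s0111 +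
        (-12) * (ξ 0 1 * ζ 0 0) * c0111 + 12 * (ξ 0 1 * ζ 0 0) * s0111 +
        (-6) * (ξ 0 0 * ζ 1 1) * s1010 + (-6) * (ξ 1 1 * ζ 0 0) * s1010 +
        6 * (ξ 0 0 * ζ 1 0) * s1110 + 6 * (ξ 1 0 * ζ 0 0) * s1110 + 6 * (ξ 0 0 * ζ 0 1) * c1011 +
        6 * (ξ 0 1 * ζ 0 0) * c1011 + (-12) * (ξ 0 0 * ζ 0 0) * s1111
  · linear_combination 12 * (ξ 1 1 * ζ 1 1) * s0000 + 6 * (ξ 1 0 * ζ 1 1) * c0010 +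
        (-12) * (ξ 1 0 * ζ 1 1) * s0010 + 6 * (ξ 1 1 * ζ 1 0) * c0010 +
        (-12) * (ξ 1 1 * ζ 1 0) * s0010 + (-6) * (ξ 0 1 * ζ 1 0) * c0110 +
        (-6) * (ξ 1 0 * ζ 0 1) * c0110 + 12 * (ξ 1 0 * ζ 1 0) * s0110 +
        (-6) * (ξ 0 1 * ζ 1 1) * s0001 + (-6) * (ξ 1 1 * ζ 0 1) * s0001 +
        6 * (ξ 0 0 * ζ 1 1) * s0011 + 6 * (ξ 0 1 * ζ 1 0) * s0011 + 6 * (ξ 1 0 * ζ 0 1) * s0011 +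
        (-12) * (ξ 1 0 * ζ 1 0) * c0011 + 6 * (ξ 1 1 * ζ 0 0) * s0011 +
        6 * (ξ 0 0 * ζ 1 0) * c0111 + (-6) * (ξ 0 0 * ζ 1 0) * s0111 +
        6 * (ξ 1 0 * ζ 0 0) * c0111 + (-6) * (ξ 1 0 * ζ 0 0) * s0111 +
        (-6) * (ξ 0 0 * ζ 1 1) * c1010 + (-6) * (ξ 1 1 * ζ 0 0) * c1010 +
        6 * (ξ 0 0 * ζ 0 1) * c1110 + 6 * (ξ 0 1 * ζ 0 0) * c1110 + 6 * (ξ 0 0 * ζ 1 0) * c1011 +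
        6 * (ξ 1 0 * ζ 0 0) * c1011 + (-12) * (ξ 0 0 * ζ 0 0) * c1111
  · linear_combination (-6) * (ξ 0 1 * ζ 1 1) * s0011 + (-6) * (ξ 1 0 * ζ 1 1) * c0011 +
        (-6) * (ξ 1 1 * ζ 0 1) * s0011 + (-6) * (ξ 1 1 * ζ 1 0) * c0011 +
        (-6) * (ξ 0 1 * ζ 1 0) * c0111 + 6 * (ξ 0 1 * ζ 1 0) * s0111 +
        (-6) * (ξ 1 0 * ζ 0 1) * c0111 + 6 * (ξ 1 0 * ζ 0 1) * s0111 +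
        12 * (ξ 1 1 * ζ 1 1) * c1000 + 12 * (ξ 1 1 * ζ 1 1) * s0010 +
        (-12) * (ξ 0 1 * ζ 1 1) * c1010 + (-12) * (ξ 1 0 * ζ 1 1) * s1010 +
        (-12) * (ξ 1 1 * ζ 0 1) * c1010 + (-12) * (ξ 1 1 * ζ 1 0) * s1010 +
        12 * (ξ 0 1 * ζ 0 1) * c1110 + 12 * (ξ 1 0 * ζ 1 0) * s1110 + 6 * (ξ 0 0 * ζ 1 1) * c1011 +
        6 * (ξ 0 0 * ζ 1 1) * s0111 + 12 * (ξ 0 1 * ζ 1 0) * c1011 + 12 * (ξ 1 0 * ζ 0 1) * c1011 +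
        6 * (ξ 1 1 * ζ 0 0) * c1011 + 6 * (ξ 1 1 * ζ 0 0) * s0111 +
        (-6) * (ξ 0 0 * ζ 0 1) * c1111 + (-6) * (ξ 0 0 * ζ 1 0) * s1111 +
        (-6) * (ξ 0 1 * ζ 0 0) * c1111 + (-6) * (ξ 1 0 * ζ 0 0) * s1111

/-- Twice the potential in condition A1 for the product of two conformal Killing vectors. -/
def ckvCopotential (ξ ζ F F' G G' : Fin 2 → Fin 2 → R) (B B' : Fin 2) : R :=
  -(ctr fun X Y => F B X * ζ Y B') - (ctr fun X Y => G B X * ξ Y B')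
    + (ctr fun X Y => F' B' X * ζ B Y) + ctr fun X Y => G' B' X * ξ B Y

lemma n11_ctr20 (u v : Fin 2 → Fin 2 → R) (A A' B B' : Fin 2) :
    C.n11 (fun B B' => ctr fun X Y => u B X * v Y B') A A' B B' =
      ctr fun X Y => C.n20 u A A' B X * v Y B' + u B X * C.n11 v A A' Y B' := by
  have t := C.trace A A'
  simp only [ctr, n11, n20, Fin.sum_univ_two, map_sub, Derivation.leibniz, smul_eq_mul, t]
  ring

lemma n11_ctr02 (u v : Fin 2 → Fin 2 → R) (A A' B B' : Fin 2) :
    C.n11 (fun B B' => ctr fun X Y => u B' X * v B Y) A A' B B' =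
      ctr fun X Y => C.swap.n20 u A' A B' X * v B Y + u B' X * C.n11 v A A' B Y := by
  have t := C.trace' A A'
  simp only [ctr, n11, n20, swap, Fin.sum_univ_two, map_sub, Derivation.leibniz, smul_eq_mul, t]
  ring

lemma n11_add (u v : Fin 2 → Fin 2 → R) (A A' B B' : Fin 2) :
    C.n11 (fun B B' => u B B' + v B B') A A' B B' = C.n11 u A A' B B' + C.n11 v A A' B B' := by
  simp only [n11, Fin.sum_univ_two, map_add]
  ring

lemma n11_neg (u : Fin 2 → Fin 2 → R) (A A' B B' : Fin 2) :
    C.n11 (fun B B' => -u B B') A A' B B' = -C.n11 u A A' B B' := by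
  simp only [n11, Fin.sum_univ_two, map_neg]
  ring

lemma n11_sub (u v : Fin 2 → Fin 2 → R) (A A' B B' : Fin 2) :
    C.n11 (fun B B' => u B B' - v B B') A A' B B' = C.n11 u A A' B B' - C.n11 v A A' B B' := by
  simp only [n11, Fin.sum_univ_two, map_sub]
  ring

set_option maxHeartbeats 4000000 in
-- The opposite signs of the F and F' parts matter: after symmetrization the products of F with G'
-- and of F' with G, the terms in ω and those in Φ cancel between the two parts, and only Ψ and its
-- primed counterpart survive.
lemma twist_ckvCopotential (hξ : C.IsCKV ξ F F' d) (hζ : C.IsCKV ζ G G' e) (A A' B B' : Fin 2) :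
    C.n11 (ckvCopotential ξ ζ F F' G G') A A' B B' + C.n11 (ckvCopotential ξ ζ F F' G G') A B' B A'
      + C.n11 (ckvCopotential ξ ζ F F' G G') B A' A B' + C.n11 (ckvCopotential ξ ζ F F' G G') B B' A A' =
      2 * C.obs1 (symPair ξ ζ) A B A' B' := by
  have s1 := hξ.symm
  have s2 := hξ.symm'
  have s3 := hζ.symm
  have s4 := hζ.symm'
  have hξ' := hξ.swap.n20
  have hζ' := hζ.swap.n20
  simp only [swap_lam, swap_phi, swap_D] at hξ' hζ'
  have key : ∀ A A' B B', C.n11 (ckvCopotential ξ ζ F F' G G') A A' B B' = _ := fun A A' B B' => by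
    unfold ckvCopotential
    rw [n11_add, n11_add, n11_sub, n11_neg, n11_ctr20, n11_ctr20, n11_ctr02, n11_ctr02]
  simp only [key, hξ.n20, hζ.n20, hξ', hζ', hξ.eqn, hζ.eqn]
  clear key hξ' hζ' hξ hζ
  revert A A' B B'
  simp only [Fin.forall_fin_two, obs1, symPair, ctr, s1, s2, s3, s4, ep_zero_zero, ep_zero_one, ep_one_zero, ep_one_one, Fin.val_zero, Fin.val_one,
    Nat.reduceAdd, zero_mul, mul_zero, zero_add, add_zero, sub_zero, zero_sub, mul_one, one_mul, neg_zero,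
    Fin.sum_univ_two, Fin.isValue]
  and_intros <;> ring

end ckv

end SpinCalculus

/-! ### Potential in condition A0 for a (2,0) and a (0,2) Killing spinor -/

namespace SpinCalculus

variable {R : Type*} [CommRing R] (C : SpinCalculus R)

section ks

variable {κ η κ' η' : Fin 2 → Fin 2 → R} {τ τ' : ℕ → R}

/-- Three times the potential in condition A0 for the square of a Killing spinor. -/
def ksPotential (κ η κ' η' : Fin 2 → Fin 2 → R) (τ τ' : ℕ → R) : R :=
  4 * dot η (fun A A' => η' A' A) + 2 * dot (fun A' B' => τ (A' + B')) κ'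
    + 2 * dot (fun A B => τ' (A + B)) κ

set_option maxHeartbeats 4000000 in
-- Here κ' is independent of κ; it is specialized to the conjugate only on the manifold. After
-- doubling, ∇η and ∇τ enter through 4∇η and 4∇τ, the multiples in which they are known.
lemma D_ksPotential (h : C.IsKS20 κ η) (hτ : C.IsTau κ η τ) (h' : C.swap.IsKS20 κ' η')
    (hτ' : C.swap.IsTau κ' η' τ') (A A' : Fin 2) :
    2 * C.D A A' (ksPotential κ η κ' η' τ τ') =
      2 * C.obs0 (fun A B E A' => -cyc κ (η' A') A B E)
        (fun A A' B' E' => -cyc κ' (η A) A' B' E') (fun A B A' B' => κ A B * κ' A' B') A A' := by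
  have w : ∀ u v : Fin 2 → Fin 2 → R, 4 * dot u v = dot (fun B B' => 4 * u B B') v := fun u v => by
    simp only [dot]; ring
  have w' : ∀ u v : Fin 2 → Fin 2 → R, 4 * dot u v = dot u (fun B B' => 4 * v B B') := fun u v => by
    simp only [dot]; ring
  have s1 := h.symm
  have s2 := h'.symm
  have k2 := h'.n_tau hτ'
  have k1 : ∀ X X' A' B', _ := fun X X' A' B' => h.n_tau hτ X X' A' B'
  -- The spinor η' lives in the swapped calculus and lists its primed index first, hence the
  -- transposition.
  have e' : ∀ A A' B B', 4 * C.n11 (fun A A' => η' A' A) A A' B B' = _ := fun A A' B B' => by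
    have : C.n11 (fun A A' => η' A' A) A A' B B' = C.swap.n11 η' A' A B' B := by
      simp only [n11, swap]; ring
    exact (congrArg (4 * ·) this).trans (hτ' A' A B' B)
  have q1 : ∀ A A' B' E', C.swap.n20 κ' A' A B' E' = _ := fun A A' B' E' => h'.eqn A' A B' E'
  have ss : C.swap.swap = C := rfl
  simp only [swap_lam, swap_phi, swap_nphi, ss] at k2 e'
  have key : 2 * C.D A A' (ksPotential κ η κ' η' τ τ') =
      2 * dot (fun B B' => 4 * C.n11 η A A' B B') (fun A A' => η' A' A)
      + 2 * dot η (fun B B' => 4 * C.n11 (fun A A' => η' A' A) A A' B B')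
      + (dot (fun B B' => 4 * C.swap.n20 (fun A' B' => τ (A' + B')) A' A B B') κ'
        + 4 * dot (fun A' B' => τ (A' + B')) (C.swap.n20 κ' A' A))
      + (dot (fun B B' => 4 * C.n20 (fun A' B' => τ' (A' + B')) A A' B B') κ
        + 4 * dot (fun A' B' => τ' (A' + B')) (C.n20 κ A A')) := by
    simp only [ksPotential, map_add, map_sub, D_two, D_four, Derivation.leibniz, smul_eq_mul]
    rw [C.D_dot11, C.D_dot02, C.D_dot20, ← w, ← w', ← w, ← w]
    ring
  rw [key]
  clear w w' key
  simp only [dot]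
  simp only [k1, k2, hτ A, e', q1, h.eqn]
  clear k1 k2 e' q1 hτ hτ' h h'
  have c0000 := C.curl_phi 0 0 0 0
  have c0001 := C.curl_phi 0 0 0 1
  have c0010 := C.curl_phi 0 0 1 0
  have c0011 := C.curl_phi 0 0 1 1
  have c0110 := C.curl_phi 0 1 1 0
  have c0111 := C.curl_phi 0 1 1 1
  have c1000 := C.curl_phi 1 0 0 0
  have c1010 := C.curl_phi 1 0 1 0
  have c1011 := C.curl_phi 1 0 1 1
  have c1110 := C.curl_phi 1 1 1 0
  have c1111 := C.curl_phi 1 1 1 1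
  have s0000 := C.swap.curl_phi 0 0 0 0
  have s0001 := C.swap.curl_phi 0 0 0 1
  have s0010 := C.swap.curl_phi 0 0 1 0
  have s0011 := C.swap.curl_phi 0 0 1 1
  have s0110 := C.swap.curl_phi 0 1 1 0
  have s0111 := C.swap.curl_phi 0 1 1 1
  have s1010 := C.swap.curl_phi 1 0 1 0
  have s1110 := C.swap.curl_phi 1 1 1 0
  have s1111 := C.swap.curl_phi 1 1 1 1
  simp [swap_nphi, swap_lam, swap_D] at c0000 c0001 c0010 c0011 c0110
  simp [swap_nphi, swap_lam, swap_D] at c0111 c1000 c1010 c1011 c1110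
  simp [swap_nphi, swap_lam, swap_D] at c1111 s0000 s0001 s0010 s0011
  simp [swap_nphi, swap_lam, swap_D] at s0110 s0111 s1010 s1110 s1111
  revert A A'
  simp only [Fin.forall_fin_two, obs0, curlPhi, cyc, ctr, swap_D, s1, s2,
    ep_zero_zero, ep_zero_one, ep_one_zero, ep_one_one, Fin.val_zero, Fin.val_one,
    Nat.reduceAdd, zero_mul, mul_zero, zero_add, add_zero, sub_zero, zero_sub, mul_one, one_mul, neg_zero,
    Fin.sum_univ_two, Fin.isValue]
  refine ⟨⟨?_, ?_⟩, ?_, ?_⟩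
  · linear_combination 6 * (κ 1 1 * κ' 0 1) * c0000 + 6 * (κ 0 1 * κ' 1 1) * s0000 +
        (-4) * (κ 0 1 * κ' 0 1) * c0010 + (-12) * (κ 0 1 * κ' 0 1) * s0010 +
        (-2) * (κ 0 1 * κ' 0 0) * s0110 + (-2) * (κ 0 0 * κ' 0 1) * c0110 +
        (-6) * (κ 1 1 * κ' 0 0) * c0001 + (-6) * (κ 0 0 * κ' 1 1) * s0001 +
        12 * (κ 0 1 * κ' 0 0) * c0011 + 12 * (κ 0 0 * κ' 0 1) * s0011 +
        2 * (κ 0 0 * κ' 0 0) * c0111 + (-6) * (κ 0 0 * κ' 0 0) * s0111 +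
        (-8) * (κ 0 1 * κ' 0 1) * c1000 + 8 * (κ 0 1 * κ' 0 0) * s1010 +
        8 * (κ 0 0 * κ' 0 1) * c1010 + (-8) * (κ 0 0 * κ' 0 0) * c1011
  · linear_combination 6 * (κ 1 1 * κ' 1 1) * c0000 + (-10) * (κ 0 1 * κ' 1 1) * c0010 +
        6 * (κ 0 1 * κ' 1 1) * s0010 + (-8) * (κ 0 1 * κ' 0 1) * s0110 +
        4 * (κ 0 0 * κ' 1 1) * c0110 + (-6) * (κ 1 1 * κ' 0 1) * c0001 +
        12 * (κ 0 1 * κ' 0 1) * c0011 + (-6) * (κ 0 0 * κ' 1 1) * s0011 +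
        (-10) * (κ 0 0 * κ' 0 1) * c0111 + 12 * (κ 0 0 * κ' 0 1) * s0111 +
        (-2) * (κ 0 1 * κ' 1 1) * c1000 + (-4) * (κ 0 1 * κ' 0 1) * s1010 +
        2 * (κ 0 0 * κ' 1 1) * c1010 + 6 * (κ 0 1 * κ' 0 0) * s1110 +
        4 * (κ 0 0 * κ' 0 1) * c1011 + (-6) * (κ 0 0 * κ' 0 0) * s1111
  · linear_combination 6 * (κ 1 1 * κ' 1 1) * s0000 + 8 * (κ 1 1 * κ' 0 1) * c0010 +
        (-12) * (κ 1 1 * κ' 0 1) * s0010 + 4 * (κ 1 1 * κ' 0 0) * s0110 +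
        (-8) * (κ 0 1 * κ' 0 1) * c0110 + (-6) * (κ 0 1 * κ' 1 1) * s0001 +
        (-6) * (κ 1 1 * κ' 0 0) * c0011 + 12 * (κ 0 1 * κ' 0 1) * s0011 +
        8 * (κ 0 1 * κ' 0 0) * c0111 + (-6) * (κ 0 1 * κ' 0 0) * s0111 +
        (-2) * (κ 1 1 * κ' 0 1) * c1000 + 2 * (κ 1 1 * κ' 0 0) * s1010 +
        (-4) * (κ 0 1 * κ' 0 1) * c1010 + 6 * (κ 0 0 * κ' 0 1) * c1110 +
        4 * (κ 0 1 * κ' 0 0) * c1011 + (-6) * (κ 0 0 * κ' 0 0) * c1111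
  · linear_combination 2 * (κ 1 1 * κ' 1 1) * c0010 + 6 * (κ 1 1 * κ' 1 1) * s0010 +
        (-2) * (κ 1 1 * κ' 0 1) * s0110 + (-2) * (κ 0 1 * κ' 1 1) * c0110 +
        (-6) * (κ 1 1 * κ' 0 1) * c0011 + (-6) * (κ 0 1 * κ' 1 1) * s0011 +
        (-4) * (κ 0 1 * κ' 0 1) * c0111 + 12 * (κ 0 1 * κ' 0 1) * s0111 +
        4 * (κ 1 1 * κ' 1 1) * c1000 + (-10) * (κ 1 1 * κ' 0 1) * s1010 +
        (-10) * (κ 0 1 * κ' 1 1) * c1010 + 6 * (κ 1 1 * κ' 0 0) * s1110 +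
        6 * (κ 0 0 * κ' 1 1) * c1110 + 16 * (κ 0 1 * κ' 0 1) * c1011 +
        (-6) * (κ 0 1 * κ' 0 0) * s1111 + (-6) * (κ 0 0 * κ' 0 1) * c1111

/-- The potential in condition A1 for the square of a Killing spinor. -/
def ksCopotential (κ η κ' η' : Fin 2 → Fin 2 → R) (B B' : Fin 2) : R :=
  -4 * (ctr fun X Y => κ B X * η' B' Y) + 4 * ctr fun X Y => κ' B' X * η B Y

end ks

end SpinCalculus

/-! ### Condition A1 for κκ' and the algebraic core of condition A1/2* -/

namespace SpinCalculus

variable {R : Type*} [CommRing R] (C : SpinCalculus R)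

section ks

variable {κ η κ' η' : Fin 2 → Fin 2 → R} {τ τ' : ℕ → R}

set_option maxHeartbeats 4000000 in
lemma twist_ksCopotential (h : C.IsKS20 κ η) (hτ : C.IsTau κ η τ) (h' : C.swap.IsKS20 κ' η')
    (hτ' : C.swap.IsTau κ' η' τ') (A A' B B' : Fin 2) :
    C.n11 (ksCopotential κ η κ' η') A A' B B' + C.n11 (ksCopotential κ η κ' η') A B' B A'
      + C.n11 (ksCopotential κ η κ' η') B A' A B' + C.n11 (ksCopotential κ η κ' η') B B' A A' =
      4 * C.obs1 (fun A B A' B' => κ A B * κ' A' B') A B A' B' := by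
  have s1 := h.symm
  have s2 := h'.symm
  have e' : ∀ A A' B B', 4 * C.n11 (fun A A' => η' A' A) A A' B B' = _ := fun A A' B B' => by
    have : C.n11 (fun A A' => η' A' A) A A' B B' = C.swap.n11 η' A' A B' B := by
      simp only [n11, swap]; ring
    exact (congrArg (4 * ·) this).trans (hτ' A' A B' B)
  have q1 : ∀ A A' B' E', C.swap.n20 κ' A' A B' E' = _ := fun A A' B' E' => h'.eqn A' A B' E'
  simp only [swap_lam, swap_phi] at e'
  have key : ∀ A A' B B', C.n11 (ksCopotential κ η κ' η') A A' B B' =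
      -(ctr fun X Y => 4 * (C.n20 κ A A' B X * η' B' Y)
        + κ B X * (4 * C.n11 (fun A A' => η' A' A) A A' Y B'))
      + ctr fun X Y => 4 * (C.swap.n20 κ' A' A B' X * η B Y)
        + κ' B' X * (4 * C.n11 η A A' B Y) := fun A A' B B' => by
    have e1 : ksCopotential κ η κ' η' = fun B B' => -(ctr fun X Y => κ B X * (4 * η' B' Y)) +
        ctr fun X Y => κ' B' X * (4 * η B Y) := by
      funext B B'; simp only [ksCopotential, ctr]; ring
    rw [e1, n11_add, n11_neg, C.n11_ctr20 κ (fun A A' => 4 * η' A' A), C.n11_ctr02 κ' (fun A A' => 4 * η A A')]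
    simp only [ctr, n11, D_four, Fin.sum_univ_two, Derivation.leibniz]
    ring
  simp only [key, h.eqn, hτ A, hτ B, e', q1]
  clear key q1 e' hτ hτ' h h'
  revert A A' B B'
  simp only [Fin.forall_fin_two, obs1, ctr, s1, s2, ep_zero_zero, ep_zero_one, ep_one_zero, ep_one_one, Fin.val_zero, Fin.val_one,
    Nat.reduceAdd, zero_mul, mul_zero, zero_add, add_zero, sub_zero, zero_sub, mul_one, one_mul, neg_zero,
    Fin.sum_univ_two, Fin.isValue]
  and_intros <;> ring

variable {C}

lemma D_three (A A' : Fin 2) : C.D A A' 3 = 0 := by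
  rw [show (3 : R) = 2 + 1 by norm_num, map_add, D_two, Derivation.map_one_eq_zero, add_zero]

/-- The derivative of the integrability condition of the equation for Killing spinors. -/
lemma IsKS20.npsi_eq (h : C.IsKS20 κ η) (X X' : Fin 2) :
    (C.n20 κ X X' 0 0 * C.psi 1 + κ 0 0 * C.npsi X X' 1) =
      (C.n20 κ X X' 0 1 * C.psi 0 + κ 0 1 * C.npsi X X' 0) ∧
    3 * (C.n20 κ X X' 0 0 * C.psi 2 + κ 0 0 * C.npsi X X' 2) =
      2 * (C.n20 κ X X' 0 1 * C.psi 1 + κ 0 1 * C.npsi X X' 1) + (C.n20 κ X X' 1 1 * C.psi 0 + κ 1 1 * C.npsi X X' 0) ∧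
    (C.n20 κ X X' 0 0 * C.psi 3 + κ 0 0 * C.npsi X X' 3) =
      (C.n20 κ X X' 1 1 * C.psi 1 + κ 1 1 * C.npsi X X' 1) ∧
    (C.n20 κ X X' 0 0 * C.psi 4 + κ 0 0 * C.npsi X X' 4) + 2 * (C.n20 κ X X' 0 1 * C.psi 3 + κ 0 1 * C.npsi X X' 3) =
      3 * (C.n20 κ X X' 1 1 * C.psi 2 + κ 1 1 * C.npsi X X' 2) ∧
    (C.n20 κ X X' 0 1 * C.psi 4 + κ 0 1 * C.npsi X X' 4) =
      (C.n20 κ X X' 1 1 * C.psi 3 + κ 1 1 * C.npsi X X' 3) := by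
  obtain ⟨p0, p1, p2, p3, p4⟩ := h.psi_eq
  have t := C.trace X X'
  have s := h.symm
  have s' : C.n20 κ X X' 1 0 = C.n20 κ X X' 0 1 := by
    simp only [n20, Fin.sum_univ_two, s]; ring
  have d0 := congrArg (C.D X X') p0
  have d1 := congrArg (C.D X X') p1
  have d2 := congrArg (C.D X X') p2
  have d3 := congrArg (C.D X X') p3
  have d4 := congrArg (C.D X X') p4
  simp only [map_add, map_sub, D_two, D_three, Derivation.leibniz, smul_eq_mul] at d0 d1 d2 d3 d4
  simp only [n20, npsi, Fin.sum_univ_two, s, t]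
  push_cast
  -- The connection mixes neighbouring components of the integrability condition, so each
  -- differentiated component is corrected by multiples of the undifferentiated ones.
  refine ⟨?_, ?_, ?_, ?_, ?_⟩
  · linear_combination (1) * d0 + (-4) * (C.γ X X' 0 0) * p0 + (-1) * (C.γ X X' 0 1) * p1
  · linear_combination (1) * d1 + (-4) * (C.γ X X' 1 0) * p0 + (-2) * (C.γ X X' 0 0) * p1 + (-6) * (C.γ X X' 0 1) * p2
  · linear_combination (1) * d2 + (-1) * (C.γ X X' 1 0) * p1 + (-1) * (C.γ X X' 0 1) * p3
  · linear_combination (1) * d3 + (-6) * (C.γ X X' 1 0) * p2 + (2) * (C.γ X X' 0 0) * p3 + (-4) * (C.γ X X' 0 1) * p4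
  · linear_combination (1) * d4 + (-1) * (C.γ X X' 1 0) * p3 + (4) * (C.γ X X' 0 0) * p4

variable (C)

end ks

/-- A multiple of the right hand side of condition A1/2*, where `K`, `N`, `L` stand for the
divergence, the curl and the components of the Killing spinor. -/
def obsHalf (K : Fin 2 → Fin 2 → R) (N L : Fin 2 → Fin 2 → Fin 2 → Fin 2 → R) (A B : Fin 2) : R :=
  45 * (ctr fun X Y => ctr fun Z W => C.psi (A + B + X + Z) * K Y W)
  + 50 * (ctr fun X Y => ctr fun Z W => ctr fun P Q => N A X Z P * C.psi (B + Y + W + Q))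
  + 50 * (ctr fun X Y => ctr fun Z W => ctr fun P Q => N B X Z P * C.psi (A + Y + W + Q))
  - 36 * (ctr fun X Y => ctr fun Z W => ctr fun a b => C.curlPhi A X Z a * L B Y W b)
  - 36 * (ctr fun X Y => ctr fun Z W => ctr fun a b => C.curlPhi B X Z a * L A Y W b)
  + 16 * (ctr fun X Y => ctr fun Z W => ctr fun P Q => ctr fun a b =>
      (C.npsi A a (B + X + Z + P) + C.npsi B a (A + X + Z + P) + C.npsi X a (A + B + Z + P)
        + C.npsi Z a (A + B + X + P) + C.npsi P a (A + B + X + Z)) * L Y W Q b)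

set_option maxHeartbeats 4000000 in
-- Three inputs are combined linearly: the Lie derivative of Ψ times κ, the derivative of the
-- integrability condition contracted with ξ, and the integrability condition times F. The second
-- one also supplies the terms with η, through ∇κ.
lemma obsHalf_eq_zero {κ η ξ F F' : Fin 2 → Fin 2 → R} {d : R} (h : C.IsKS20 κ η)
    (hξ : C.IsCKV ξ F F' d) (A B : Fin 2) :
    C.obsHalf (fun A B => 4 * (ctr (fun a b => η A a * ξ B b) + ctr (fun a b => η B a * ξ A b))
        + 2 * (ctr (fun P Q => F A P * κ B Q) + ctr (fun P Q => F B P * κ A Q)) + 16 * (d * κ A B))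
      (fun A B P Q => -(F A B * κ P Q + F A P * κ B Q + F A Q * κ B P + F B P * κ A Q
        + F B Q * κ A P + F P Q * κ A B))
      (fun A B P a => cyc κ (fun P => ξ P a) A B P) A B = 0 := by
  obtain ⟨l0, l1, l2, l3, l4⟩ := hξ.lie_psi
  obtain ⟨p0, p1, p2, p3, p4⟩ := h.psi_eq
  obtain ⟨e000, e001, e002, e003, e004⟩ := h.npsi_eq 0 0
  obtain ⟨e010, e011, e012, e013, e014⟩ := h.npsi_eq 0 1
  obtain ⟨e100, e101, e102, e103, e104⟩ := h.npsi_eq 1 0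
  obtain ⟨e110, e111, e112, e113, e114⟩ := h.npsi_eq 1 1
  have s := h.symm
  have s' := hξ.symm
  simp only [h.eqn, ep_zero_zero, ep_zero_one, ep_one_zero, ep_one_one, Fin.val_zero, Fin.val_one,
    Nat.reduceAdd, zero_mul, mul_zero, zero_add, add_zero, sub_zero, zero_sub, mul_one, one_mul, neg_zero,
    Fin.sum_univ_two, Fin.isValue] at e000 e001 e002 e003 e004
  simp only [h.eqn, ep_zero_zero, ep_zero_one, ep_one_zero, ep_one_one, Fin.val_zero, Fin.val_one,
    Nat.reduceAdd, zero_mul, mul_zero, zero_add, add_zero, sub_zero, zero_sub, mul_one, one_mul, neg_zero,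
    Fin.sum_univ_two, Fin.isValue] at e010 e011 e012 e013 e014
  simp only [h.eqn, ep_zero_zero, ep_zero_one, ep_one_zero, ep_one_one, Fin.val_zero, Fin.val_one,
    Nat.reduceAdd, zero_mul, mul_zero, zero_add, add_zero, sub_zero, zero_sub, mul_one, one_mul, neg_zero,
    Fin.sum_univ_two, Fin.isValue] at e100 e101 e102 e103 e104
  simp only [h.eqn, ep_zero_zero, ep_zero_one, ep_one_zero, ep_one_one, Fin.val_zero, Fin.val_one,
    Nat.reduceAdd, zero_mul, mul_zero, zero_add, add_zero, sub_zero, zero_sub, mul_one, one_mul, neg_zero,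
    Fin.sum_univ_two, Fin.isValue] at e110 e111 e112 e113 e114
  clear h hξ
  revert A B
  simp only [Fin.forall_fin_two, obsHalf, cyc, curlPhi, ctr, s, s', ep_zero_zero, ep_zero_one, ep_one_zero, ep_one_one, Fin.val_zero, Fin.val_one,
    Nat.reduceAdd, zero_mul, mul_zero, zero_add, add_zero, sub_zero, zero_sub, mul_one, one_mul, neg_zero,
    Fin.sum_univ_two, Fin.isValue]
  refine ⟨⟨?_, ?_⟩, ?_, ?_⟩
  · linear_combination 180 * (κ 1 1) * l0 + (-360) * (κ 0 1) * l1 + (-60) * (ξ 1 1) * e001 +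
        180 * (κ 0 0) * l2 + 120 * (ξ 0 1) * e002 + 60 * (ξ 1 0) * e011 + (-120) * (ξ 0 0) * e012 +
        240 * (ξ 1 1) * e100 + (-60) * (ξ 0 1) * e101 + (-240) * (ξ 1 0) * e110 +
        60 * (ξ 0 0) * e111 + (-240) * (F 0 0) * p2 + 240 * (F 0 1) * p1 + (-480) * (F 1 1) * p0
  · linear_combination 180 * (κ 1 1) * l1 + (-360) * (κ 0 1) * l2 + 180 * (κ 0 0) * l3 +
        (-120) * (ξ 1 1) * e002 + 60 * (ξ 0 1) * e003 + 120 * (ξ 1 0) * e012 +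
        (-60) * (ξ 0 0) * e013 + 60 * (ξ 1 1) * e101 + (-120) * (ξ 0 1) * e102 +
        (-60) * (ξ 1 0) * e111 + 120 * (ξ 0 0) * e112 + (-120) * (F 0 0) * p3 +
        480 * (F 0 1) * p2 + (-120) * (F 1 1) * p1
  · linear_combination 180 * (κ 1 1) * l1 + (-360) * (κ 0 1) * l2 + 180 * (κ 0 0) * l3 +
        (-120) * (ξ 1 1) * e002 + 60 * (ξ 0 1) * e003 + 120 * (ξ 1 0) * e012 +
        (-60) * (ξ 0 0) * e013 + 60 * (ξ 1 1) * e101 + (-120) * (ξ 0 1) * e102 +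
        (-60) * (ξ 1 0) * e111 + 120 * (ξ 0 0) * e112 + (-120) * (F 0 0) * p3 +
        480 * (F 0 1) * p2 + (-120) * (F 1 1) * p1
  · linear_combination 180 * (κ 1 1) * l2 + (-360) * (κ 0 1) * l3 + 180 * (κ 0 0) * l4 +
        (-60) * (ξ 1 1) * e003 + 240 * (ξ 0 1) * e004 + 60 * (ξ 1 0) * e013 +
        (-240) * (ξ 0 0) * e014 + 120 * (ξ 1 1) * e102 + (-60) * (ξ 0 1) * e103 +
        (-120) * (ξ 1 0) * e112 + 60 * (ξ 0 0) * e113 + (-480) * (F 0 0) * p4 +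
        240 * (F 0 1) * p3 + (-240) * (F 1 1) * p2

end SpinCalculus

/-! ### Killing equation, curls and divergence of the products -/

lemma ep_antisymm {R : Type*} [CommRing R] (A B : Fin 2) : (ep A B : R) = -ep B A := by
  revert A B
  simp [Fin.forall_fin_two]

lemma symm_of_eq {R : Type*} {F : Fin 2 → Fin 2 → R} (h : F 1 0 = F 0 1) (A B : Fin 2) :
    F A B = F B A := by
  revert A B
  simp [Fin.forall_fin_two, h]

namespace SpinCalculus

variable {R : Type*} [CommRing R] {C : SpinCalculus R}

lemma n22_natCast_mul (c : ℕ) (f : Fin 2 → Fin 2 → Fin 2 → Fin 2 → R) (A A' P P' Q Q' : Fin 2) :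
    c * C.n22 f A A' P P' Q Q' = C.n22 (fun P P' Q Q' => c * f P P' Q Q') A A' P P' Q Q' := by
  simp only [n22, Fin.sum_univ_two, Derivation.leibniz, Derivation.map_natCast, smul_eq_mul]
  ring

lemma n31_natCast_mul (c : ℕ) (f : Fin 2 → Fin 2 → Fin 2 → Fin 2 → R) (A A' P P' Q Q' : Fin 2) :
    c * C.n31 f A A' P P' Q Q' = C.n31 (fun P P' Q Q' => c * f P P' Q Q') A A' P P' Q Q' := by
  simp only [n31, Fin.sum_univ_two, Derivation.leibniz, Derivation.map_natCast, smul_eq_mul]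
  ring

lemma n40_natCast_mul (c : ℕ) (f : Fin 2 → Fin 2 → Fin 2 → Fin 2 → R) (A A' P P' Q Q' : Fin 2) :
    c * C.n40 f A A' P P' Q Q' = C.n40 (fun P P' Q Q' => c * f P P' Q Q') A A' P P' Q Q' := by
  simp only [n40, Fin.sum_univ_two, Derivation.leibniz, Derivation.map_natCast, smul_eq_mul]
  ring

section ckv

variable {ξ ζ F F' G G' : Fin 2 → Fin 2 → R} {d e : R}

lemma n22_symPair (A A' P P' Q Q' : Fin 2) :
    C.n22 (fun P P' Q Q' => symPair ξ ζ P Q P' Q') A A' P P' Q Q' =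
      symPair (C.n11 ξ A A') ζ P Q P' Q' + symPair ξ (C.n11 ζ A A') P Q P' Q' := by
  simp only [n22, n11, symPair, Fin.sum_univ_two, map_add, Derivation.leibniz, smul_eq_mul]
  ring

set_option maxHeartbeats 1000000 in
-- The nine terms are the choices of the unprimed and of the primed index carried by ∇. Each summand
-- of ∇ξ and ∇ζ contains an ε in two symmetrized indices, so all cancel; bringing the index pairs
-- into a fixed order makes this visible to `ring`.
lemma twist_symPair (hξ : C.IsCKV ξ F F' d) (hζ : C.IsCKV ζ G G' e) (a0 a1 a2 b0 b1 b2 : Fin 2) :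
    C.n22 (fun P P' Q Q' => symPair ξ ζ P Q P' Q') a0 b0 a1 b1 a2 b2
      + C.n22 (fun P P' Q Q' => symPair ξ ζ P Q P' Q') a0 b1 a1 b0 a2 b2
      + C.n22 (fun P P' Q Q' => symPair ξ ζ P Q P' Q') a0 b2 a1 b1 a2 b0
      + C.n22 (fun P P' Q Q' => symPair ξ ζ P Q P' Q') a1 b0 a0 b1 a2 b2
      + C.n22 (fun P P' Q Q' => symPair ξ ζ P Q P' Q') a1 b1 a0 b0 a2 b2
      + C.n22 (fun P P' Q Q' => symPair ξ ζ P Q P' Q') a1 b2 a0 b1 a2 b0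
      + C.n22 (fun P P' Q Q' => symPair ξ ζ P Q P' Q') a2 b0 a1 b1 a0 b2
      + C.n22 (fun P P' Q Q' => symPair ξ ζ P Q P' Q') a2 b1 a1 b0 a0 b2
      + C.n22 (fun P P' Q Q' => symPair ξ ζ P Q P' Q') a2 b2 a1 b1 a0 b0 = 0 := by
  have a01 : (ep a1 a0 : R) = -ep a0 a1 := ep_antisymm _ _
  have a02 : (ep a2 a0 : R) = -ep a0 a2 := ep_antisymm _ _
  have a12 : (ep a2 a1 : R) = -ep a1 a2 := ep_antisymm _ _
  have b01 : (ep b1 b0 : R) = -ep b0 b1 := ep_antisymm _ _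
  have b02 : (ep b2 b0 : R) = -ep b0 b2 := ep_antisymm _ _
  have b12 : (ep b2 b1 : R) = -ep b1 b2 := ep_antisymm _ _
  have f := symm_of_eq hξ.symm
  have f' := symm_of_eq hξ.symm'
  have g := symm_of_eq hζ.symm
  have g' := symm_of_eq hζ.symm'
  have f01 : F a1 a0 = F a0 a1 := f _ _
  have f02 : F a2 a0 = F a0 a2 := f _ _
  have f12 : F a2 a1 = F a1 a2 := f _ _
  have f'01 : F' b1 b0 = F' b0 b1 := f' _ _
  have f'02 : F' b2 b0 = F' b0 b2 := f' _ _
  have f'12 : F' b2 b1 = F' b1 b2 := f' _ _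
  have g01 : G a1 a0 = G a0 a1 := g _ _
  have g02 : G a2 a0 = G a0 a2 := g _ _
  have g12 : G a2 a1 = G a1 a2 := g _ _
  have g'01 : G' b1 b0 = G' b0 b1 := g' _ _
  have g'02 : G' b2 b0 = G' b0 b2 := g' _ _
  have g'12 : G' b2 b1 = G' b1 b2 := g' _ _
  simp only [n22_symPair]
  simp only [symPair, hξ.eqn, hζ.eqn, a01, a02, a12, b01, b02, b12, f01, f02, f12,
    f'01, f'02, f'12, g01, g02, g12, g'01, g'02, g'12]
  ring

lemma curl_symPair (hξ : C.IsCKV ξ F F' d) (hζ : C.IsCKV ζ G G' e) (A B E A' : Fin 2) :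
    (ctr fun b c => C.n22 (fun P P' Q Q' => symPair ξ ζ P Q P' Q') A c B b E A')
      + (ctr fun b c => C.n22 (fun P P' Q Q' => symPair ξ ζ P Q P' Q') B c A b E A')
      + (ctr fun b c => C.n22 (fun P P' Q Q' => symPair ξ ζ P Q P' Q') E c B b A A') =
      3 * (-2 * (cyc F (fun E => ζ E A') A B E + cyc G (fun E => ξ E A') A B E)) := by
  have s1 := hξ.symm
  have s2 := hξ.symm'
  have s3 := hζ.symm
  have s4 := hζ.symm'
  simp only [n22_symPair]
  simp only [symPair, hξ.eqn, hζ.eqn]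
  clear hξ hζ
  revert A B E A'
  simp only [Fin.forall_fin_two, cyc, ctr, s1, s2, s3, s4, ep_zero_zero, ep_zero_one, ep_one_zero, ep_one_one, Fin.val_zero, Fin.val_one,
    Nat.reduceAdd, zero_mul, mul_zero, zero_add, add_zero, sub_zero, zero_sub, mul_one, one_mul, neg_zero,
    Fin.sum_univ_two, Fin.isValue]
  and_intros <;> ring

lemma n22_swap (f : Fin 2 → Fin 2 → Fin 2 → Fin 2 → R) (A A' P P' Q Q' : Fin 2) :
    C.n22 f A A' P P' Q Q' = C.swap.n22 (fun P' P Q' Q => f P P' Q Q') A' A P' P Q' Q := by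
  simp only [n22, swap]
  ring

lemma symPair_swap (A B A' B' : Fin 2) :
    symPair ξ ζ A B A' B' = symPair (fun A' A => ξ A A') (fun A' A => ζ A A') A' B' A B := by
  simp only [symPair]
  ring

/-- The mirror image of `curl_symPair` in the swapped calculus. -/
lemma curlDagger_symPair (hξ : C.IsCKV ξ F F' d) (hζ : C.IsCKV ζ G G' e) (A A' B' E' : Fin 2) :
    (ctr fun b c => C.n22 (fun P P' Q Q' => symPair ξ ζ P Q P' Q') c A' b B' A E')
      + (ctr fun b c => C.n22 (fun P P' Q Q' => symPair ξ ζ P Q P' Q') c B' b A' A E')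
      + (ctr fun b c => C.n22 (fun P P' Q Q' => symPair ξ ζ P Q P' Q') c E' b B' A A') =
      3 * (-2 * (cyc F' (ζ A) A' B' E' + cyc G' (ξ A) A' B' E')) := by
  rw [← curl_symPair hξ.swap hζ.swap]
  simp only [n22_swap (C := C), symPair_swap (ξ := ξ)]

end ckv

section ks

variable {κ η κ' η' : Fin 2 → Fin 2 → R}

lemma n22_mul (A A' P P' Q Q' : Fin 2) :
    C.n22 (fun P P' Q Q' => κ P Q * κ' P' Q') A A' P P' Q Q' =
      C.n20 κ A A' P Q * κ' P' Q' + κ P Q * C.swap.n20 κ' A' A P' Q' := by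
  simp only [n22, n20, swap, Fin.sum_univ_two, Derivation.leibniz, smul_eq_mul]
  ring

lemma twist_mul (h : C.IsKS20 κ η) (h' : C.swap.IsKS20 κ' η') (a0 a1 a2 b0 b1 b2 : Fin 2) :
    C.n22 (fun P P' Q Q' => κ P Q * κ' P' Q') a0 b0 a1 b1 a2 b2
      + C.n22 (fun P P' Q Q' => κ P Q * κ' P' Q') a0 b1 a1 b0 a2 b2
      + C.n22 (fun P P' Q Q' => κ P Q * κ' P' Q') a0 b2 a1 b1 a2 b0
      + C.n22 (fun P P' Q Q' => κ P Q * κ' P' Q') a1 b0 a0 b1 a2 b2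
      + C.n22 (fun P P' Q Q' => κ P Q * κ' P' Q') a1 b1 a0 b0 a2 b2
      + C.n22 (fun P P' Q Q' => κ P Q * κ' P' Q') a1 b2 a0 b1 a2 b0
      + C.n22 (fun P P' Q Q' => κ P Q * κ' P' Q') a2 b0 a1 b1 a0 b2
      + C.n22 (fun P P' Q Q' => κ P Q * κ' P' Q') a2 b1 a1 b0 a0 b2
      + C.n22 (fun P P' Q Q' => κ P Q * κ' P' Q') a2 b2 a1 b1 a0 b0 = 0 := by
  have a01 : (ep a1 a0 : R) = -ep a0 a1 := ep_antisymm _ _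
  have a02 : (ep a2 a0 : R) = -ep a0 a2 := ep_antisymm _ _
  have a12 : (ep a2 a1 : R) = -ep a1 a2 := ep_antisymm _ _
  have b01 : (ep b1 b0 : R) = -ep b0 b1 := ep_antisymm _ _
  have b02 : (ep b2 b0 : R) = -ep b0 b2 := ep_antisymm _ _
  have b12 : (ep b2 b1 : R) = -ep b1 b2 := ep_antisymm _ _
  have f := symm_of_eq h.symm
  have g := symm_of_eq h'.symm
  have f01 : κ a1 a0 = κ a0 a1 := f _ _
  have f02 : κ a2 a0 = κ a0 a2 := f _ _
  have f12 : κ a2 a1 = κ a1 a2 := f _ _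
  have g01 : κ' b1 b0 = κ' b0 b1 := g _ _
  have g02 : κ' b2 b0 = κ' b0 b2 := g _ _
  have g12 : κ' b2 b1 = κ' b1 b2 := g _ _
  have q1 : ∀ A A' B' E', C.swap.n20 κ' A' A B' E' = _ := fun A A' B' E' => h'.eqn A' A B' E'
  simp only [n22_mul, h.eqn, q1, a01, a02, a12, b01, b02, b12, f01, f02, f12, g01, g02, g12]
  ring

lemma curl_mul (h : C.IsKS20 κ η) (h' : C.swap.IsKS20 κ' η') (A B E A' : Fin 2) :
    (ctr fun b c => C.n22 (fun P P' Q Q' => κ P Q * κ' P' Q') A c B b E A')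
      + (ctr fun b c => C.n22 (fun P P' Q Q' => κ P Q * κ' P' Q') B c A b E A')
      + (ctr fun b c => C.n22 (fun P P' Q Q' => κ P Q * κ' P' Q') E c B b A A') =
      3 * -cyc κ (η' A') A B E := by
  have s1 := h.symm
  have s2 := h'.symm
  have q1 : ∀ A A' B' E', C.swap.n20 κ' A' A B' E' = _ := fun A A' B' E' => h'.eqn A' A B' E'
  simp only [n22_mul, h.eqn, q1]
  clear h h' q1
  revert A B E A'
  simp only [Fin.forall_fin_two, cyc, ctr, s1, s2, ep_zero_zero, ep_zero_one, ep_one_zero, ep_one_one, Fin.val_zero, Fin.val_one,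
    Nat.reduceAdd, zero_mul, mul_zero, zero_add, add_zero, sub_zero, zero_sub, mul_one, one_mul, neg_zero,
    Fin.sum_univ_two, Fin.isValue]
  and_intros <;> ring

lemma curlDagger_mul (h : C.IsKS20 κ η) (h' : C.swap.IsKS20 κ' η') (A A' B' E' : Fin 2) :
    (ctr fun b c => C.n22 (fun P P' Q Q' => κ P Q * κ' P' Q') c A' b B' A E')
      + (ctr fun b c => C.n22 (fun P P' Q Q' => κ P Q * κ' P' Q') c B' b A' A E')
      + (ctr fun b c => C.n22 (fun P P' Q Q' => κ P Q * κ' P' Q') c E' b B' A A') =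
      3 * -cyc κ' (η A) A' B' E' := by
  rw [← curl_mul h' (η' := η) h]
  simp only [n22_swap (C := C), mul_comm (κ _ _)]

lemma n31_cyc {ξ : Fin 2 → Fin 2 → R} (A A' P P' Q T : Fin 2) :
    C.n31 (fun P P' Q T => cyc κ (fun T => ξ T P') P Q T) A A' P P' Q T =
      cyc (C.n20 κ A A') (fun T => ξ T P') P Q T + cyc κ (fun T => C.n11 ξ A A' T P') P Q T := by
  simp only [n31, n20, n11, cyc, Fin.sum_univ_two, map_add, Derivation.leibniz, smul_eq_mul]
  ring

variable {ξ F F' : Fin 2 → Fin 2 → R} {d : R}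

set_option maxHeartbeats 1000000 in
lemma twist_cyc (h : C.IsKS20 κ η) (hξ : C.IsCKV ξ F F' d) (a0 a1 a2 a3 b0 b1 : Fin 2) :
    C.n31 (fun P P' Q T => cyc κ (fun T => ξ T P') P Q T) a0 b0 a1 b1 a2 a3
      + C.n31 (fun P P' Q T => cyc κ (fun T => ξ T P') P Q T) a0 b1 a1 b0 a2 a3
      + C.n31 (fun P P' Q T => cyc κ (fun T => ξ T P') P Q T) a1 b0 a0 b1 a2 a3
      + C.n31 (fun P P' Q T => cyc κ (fun T => ξ T P') P Q T) a1 b1 a0 b0 a2 a3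
      + C.n31 (fun P P' Q T => cyc κ (fun T => ξ T P') P Q T) a2 b0 a1 b1 a0 a3
      + C.n31 (fun P P' Q T => cyc κ (fun T => ξ T P') P Q T) a2 b1 a1 b0 a0 a3
      + C.n31 (fun P P' Q T => cyc κ (fun T => ξ T P') P Q T) a3 b0 a1 b1 a2 a0
      + C.n31 (fun P P' Q T => cyc κ (fun T => ξ T P') P Q T) a3 b1 a1 b0 a2 a0 = 0 := by
  have a01 : (ep a1 a0 : R) = -ep a0 a1 := ep_antisymm _ _
  have a02 : (ep a2 a0 : R) = -ep a0 a2 := ep_antisymm _ _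
  have a03 : (ep a3 a0 : R) = -ep a0 a3 := ep_antisymm _ _
  have a12 : (ep a2 a1 : R) = -ep a1 a2 := ep_antisymm _ _
  have a13 : (ep a3 a1 : R) = -ep a1 a3 := ep_antisymm _ _
  have a23 : (ep a3 a2 : R) = -ep a2 a3 := ep_antisymm _ _
  have b01 : (ep b1 b0 : R) = -ep b0 b1 := ep_antisymm _ _
  have f := symm_of_eq hξ.symm
  have f' := symm_of_eq hξ.symm'
  have g := symm_of_eq h.symm
  have f01 : F a1 a0 = F a0 a1 := f _ _
  have f02 : F a2 a0 = F a0 a2 := f _ _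
  have f03 : F a3 a0 = F a0 a3 := f _ _
  have f12 : F a2 a1 = F a1 a2 := f _ _
  have f13 : F a3 a1 = F a1 a3 := f _ _
  have f23 : F a3 a2 = F a2 a3 := f _ _
  have f'01 : F' b1 b0 = F' b0 b1 := f' _ _
  have g01 : κ a1 a0 = κ a0 a1 := g _ _
  have g02 : κ a2 a0 = κ a0 a2 := g _ _
  have g03 : κ a3 a0 = κ a0 a3 := g _ _
  have g12 : κ a2 a1 = κ a1 a2 := g _ _
  have g13 : κ a3 a1 = κ a1 a3 := g _ _
  have g23 : κ a3 a2 = κ a2 a3 := g _ _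
  simp only [n31_cyc]
  simp only [cyc, h.eqn, hξ.eqn, a01, a02, a03, a12, a13, a23, b01, f01, f02, f03, f12, f13, f23,
    f'01, g01, g02, g03, g12, g13, g23]
  ring

/-- Among the terms of ∇κ and ∇ξ only ε_{A'B'} F_{AB} carries no unprimed ε, so it alone survives
the symmetrization. -/
lemma curl_cyc (h : C.IsKS20 κ η) (hξ : C.IsCKV ξ F F' d) (A B P Q : Fin 2) :
    (ctr fun b c => C.n31 (fun P P' Q T => cyc κ (fun T => ξ T P') P Q T) A c B b P Q)
      + (ctr fun b c => C.n31 (fun P P' Q T => cyc κ (fun T => ξ T P') P Q T) B c A b P Q)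
      + (ctr fun b c => C.n31 (fun P P' Q T => cyc κ (fun T => ξ T P') P Q T) P c B b A Q)
      + (ctr fun b c => C.n31 (fun P P' Q T => cyc κ (fun T => ξ T P') P Q T) Q c B b P A) =
      4 * -(F A B * κ P Q + F A P * κ B Q + F A Q * κ B P + F B P * κ A Q + F B Q * κ A P
        + F P Q * κ A B) := by
  have s1 := h.symm
  have s2 := hξ.symm
  have s3 := hξ.symm'
  simp only [n31_cyc]
  simp only [cyc, h.eqn, hξ.eqn]
  clear h hξ
  revert A B P Q
  simp only [Fin.forall_fin_two, ctr, s1, s2, s3, ep_zero_zero, ep_zero_one, ep_one_zero, ep_one_one, Fin.val_zero, Fin.val_one,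
    Nat.reduceAdd, zero_mul, mul_zero, zero_add, add_zero, sub_zero, zero_sub, mul_one, one_mul, neg_zero,
    Fin.sum_univ_two, Fin.isValue]
  and_intros <;> ring

lemma div_cyc (h : C.IsKS20 κ η) (hξ : C.IsCKV ξ F F' d) (A B : Fin 2) :
    (ctr fun X Y => ctr fun b c => C.n31 (fun P P' Q T => cyc κ (fun T => ξ T P') P Q T) Y c X b A B) =
      4 * (ctr (fun a b => η A a * ξ B b) + ctr (fun a b => η B a * ξ A b))
        + 2 * (ctr (fun P Q => F A P * κ B Q) + ctr (fun P Q => F B P * κ A Q)) + 16 * (d * κ A B) := by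
  have s1 := h.symm
  have s2 := hξ.symm
  have s3 := hξ.symm'
  simp only [n31_cyc]
  simp only [cyc, h.eqn, hξ.eqn]
  clear h hξ
  revert A B
  simp only [Fin.forall_fin_two, ctr, s1, s2, s3, ep_zero_zero, ep_zero_one, ep_one_zero, ep_one_one, Fin.val_zero, Fin.val_one,
    Nat.reduceAdd, zero_mul, mul_zero, zero_add, add_zero, sub_zero, zero_sub, mul_one, one_mul, neg_zero,
    Fin.sum_univ_two, Fin.isValue]
  and_intros <;> ring

/-- Symmetrization of `κ_{AB} κ_{PQ}` up to a factor. -/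
def symSq (κ : Fin 2 → Fin 2 → R) (A B P Q : Fin 2) : R :=
  κ A B * κ P Q + κ A P * κ B Q + κ A Q * κ B P

lemma twist_symSq (h : C.IsKS20 κ η) (a0 a1 a2 a3 a4 A' : Fin 2) :
    C.n40 (symSq κ) a0 A' a1 a2 a3 a4
      + C.n40 (symSq κ) a1 A' a0 a2 a3 a4
      + C.n40 (symSq κ) a2 A' a1 a0 a3 a4
      + C.n40 (symSq κ) a3 A' a1 a2 a0 a4
      + C.n40 (symSq κ) a4 A' a1 a2 a3 a0 = 0 := by
  have key : ∀ A A' B P Q T, C.n40 (symSq κ) A A' B P Q T =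
      C.n20 κ A A' B P * κ Q T + C.n20 κ A A' B Q * κ P T + C.n20 κ A A' B T * κ P Q
      + (κ B P * C.n20 κ A A' Q T + κ B Q * C.n20 κ A A' P T + κ B T * C.n20 κ A A' P Q) := by
    intro A A' B P Q T
    simp only [symSq, n40, n20, Fin.sum_univ_two, map_add, Derivation.leibniz, smul_eq_mul]
    ring
  have a01 : (ep a1 a0 : R) = -ep a0 a1 := ep_antisymm _ _
  have a02 : (ep a2 a0 : R) = -ep a0 a2 := ep_antisymm _ _
  have a03 : (ep a3 a0 : R) = -ep a0 a3 := ep_antisymm _ _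
  have a04 : (ep a4 a0 : R) = -ep a0 a4 := ep_antisymm _ _
  have a12 : (ep a2 a1 : R) = -ep a1 a2 := ep_antisymm _ _
  have a13 : (ep a3 a1 : R) = -ep a1 a3 := ep_antisymm _ _
  have a14 : (ep a4 a1 : R) = -ep a1 a4 := ep_antisymm _ _
  have a23 : (ep a3 a2 : R) = -ep a2 a3 := ep_antisymm _ _
  have a24 : (ep a4 a2 : R) = -ep a2 a4 := ep_antisymm _ _
  have a34 : (ep a4 a3 : R) = -ep a3 a4 := ep_antisymm _ _
  have g := symm_of_eq h.symm
  have g01 : κ a1 a0 = κ a0 a1 := g _ _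
  have g02 : κ a2 a0 = κ a0 a2 := g _ _
  have g03 : κ a3 a0 = κ a0 a3 := g _ _
  have g04 : κ a4 a0 = κ a0 a4 := g _ _
  have g12 : κ a2 a1 = κ a1 a2 := g _ _
  have g13 : κ a3 a1 = κ a1 a3 := g _ _
  have g14 : κ a4 a1 = κ a1 a4 := g _ _
  have g23 : κ a3 a2 = κ a2 a3 := g _ _
  have g24 : κ a4 a2 = κ a2 a4 := g _ _
  have g34 : κ a4 a3 = κ a3 a4 := g _ _
  simp only [key, h.eqn, a01, a02, a03, a04, a12, a13, a14, a23, a24, a34, g01, g02, g03, g04, g12, g13, g14, g23, g24, g34]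
  ring

end ks

end SpinCalculus

/-! ### Frame covariance of the potentials -/

namespace SpinCalculus

variable {R : Type*} [CommRing R]

namespace IsGauge

variable {C C₂ : SpinCalculus R} {t t' : Fin 2 → Fin 2 → R}

lemma dot_act (ht : t 0 0 * t 1 1 - t 0 1 * t 1 0 = 1) (ht' : t' 0 0 * t' 1 1 - t' 0 1 * t' 1 0 = 1)
    (u v : Fin 2 → Fin 2 → R) : dot (act t t' u) (act t t' v) = dot u v := by
  have e : dot (act t t' u) (act t t' v) = (t 0 0 * t 1 1 - t 0 1 * t 1 0) *
      (t' 0 0 * t' 1 1 - t' 0 1 * t' 1 0) * dot u v := by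
    simp only [dot, act, Fin.sum_univ_two]
    ring
  rw [e, ht, ht', one_mul, one_mul]

lemma ctr_act (ht : t 0 0 * t 1 1 - t 0 1 * t 1 0 = 1) (f : Fin 2 → Fin 2 → R) :
    ctr (act t t f) = ctr f := by
  have e : ctr (act t t f) = (t 0 0 * t 1 1 - t 0 1 * t 1 0) * ctr f := by
    simp only [ctr, act, Fin.sum_univ_two]
    ring
  rw [e, ht, one_mul]

lemma ctr_act_comm (f : Fin 2 → Fin 2 → Fin 2 → Fin 2 → R) (P Q : Fin 2) :
    (ctr fun A B => act t t' (f A B) P Q) = act t t' (fun P Q => ctr fun A B => f A B P Q) P Q := by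
  simp only [ctr, act, Fin.sum_univ_two]
  ring

lemma quad_act (h : IsGauge C C₂ t t') (u v : Fin 2 → Fin 2 → R) :
    quad C₂.phi (act t t' u) (act t t' v) = quad C.phi u v := by
  have e : ∀ B P E Q b p e q : Fin 2,
      C₂.phi (B + E) (b + e) * act t t' u P p * act t t' v Q q =
        act t' t' (fun e q => act t' t' (fun b p => act t t (fun E Q => act t t (fun B P =>
          C.phi (B + E) (b + e) * u P p * v Q q) B P) E Q) b p) e q := by
    intro B P E Q b p e q
    rw [h.phi_act]
    simp only [act, Fin.sum_univ_two]
    ring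
  simp only [quad, e, ctr_act h.det, ctr_act h.det', ctr_act_comm]

lemma act_flip (u : Fin 2 → Fin 2 → R) :
    (fun A A' => act t' t u A' A) = act t t' fun A A' => u A' A := by
  funext A A'
  simp only [act, Fin.sum_univ_two]
  ring

lemma ctr_act_act (ht : t 0 0 * t 1 1 - t 0 1 * t 1 0 = 1) (u v : Fin 2 → Fin 2 → R) (B B' : Fin 2) :
    (ctr fun X Y => act t t u B X * act t t' v Y B') =
      act t t' (fun B B' => ctr fun X Y => u B X * v Y B') B B' := by
  have e : (ctr fun X Y => act t t u B X * act t t' v Y B') = (t 0 0 * t 1 1 - t 0 1 * t 1 0) *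
      act t t' (fun B B' => ctr fun X Y => u B X * v Y B') B B' := by
    simp only [ctr, act, Fin.sum_univ_two]
    ring
  rw [e, ht, one_mul]

lemma ctr_act_act' (ht : t' 0 0 * t' 1 1 - t' 0 1 * t' 1 0 = 1) (u v : Fin 2 → Fin 2 → R)
    (B B' : Fin 2) :
    (ctr fun X Y => act t' t' u B' X * act t t' v B Y) =
      act t t' (fun B B' => ctr fun X Y => u B' X * v B Y) B B' := by
  have e : (ctr fun X Y => act t' t' u B' X * act t t' v B Y) =
      (t' 0 0 * t' 1 1 - t' 0 1 * t' 1 0) *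
      act t t' (fun B B' => ctr fun X Y => u B' X * v B Y) B B' := by
    simp only [ctr, act, Fin.sum_univ_two]
    ring
  rw [e, ht, one_mul]

section conformalKilling

variable {ξ ζ F F' F₂ F₂' G G' G₂ G₂' : Fin 2 → Fin 2 → R} {d d₂ e e₂ : R}

/-- The prolonged data in the two frames are necessarily related by the frame change, as they are
determined by ξ and ζ. The potential contracts all of their indices. -/
lemma ckvPotential_eq (h : IsGauge C C₂ t t') (hξ : C.IsCKV ξ F F' d) (hζ : C.IsCKV ζ G G' e)
    (hξ₂ : C₂.IsCKV (act t t' ξ) F₂ F₂' d₂) (hζ₂ : C₂.IsCKV (act t t' ζ) G₂ G₂' e₂) :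
    C₂.ckvPotential (act t t' ξ) (act t t' ζ) F₂ F₂' G₂ G₂' d₂ e₂ =
      C.ckvPotential ξ ζ F F' G G' d e := by
  have eF : F₂ = act t t F := by funext A B; exact h.ckv_curl hξ hξ₂ A B
  have eF' : F₂' = act t' t' F' := by funext A B; exact h.ckv_curl' hξ hξ₂ A B
  have eG : G₂ = act t t G := by funext A B; exact h.ckv_curl hζ hζ₂ A B
  have eG' : G₂' = act t' t' G' := by funext A B; exact h.ckv_curl' hζ hζ₂ A B
  obtain rfl := h.ckv_trace hξ hξ₂
  obtain rfl := h.ckv_trace hζ hζ₂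
  have hω : C₂.omega (act t t' ξ) d₂ = act t t' (C.omega ξ d₂) := by
    funext A B; exact h.ckv_omega hξ hξ₂ A B
  have hω' : C₂.omega (act t t' ζ) e₂ = act t t' (C.omega ζ e₂) := by
    funext A B; exact h.ckv_omega hζ hζ₂ A B
  simp only [ckvPotential, hω, hω', eF, eF', eG, eG', h.quad_act, h.lam_eq, dot_act h.det h.det,
    dot_act h.det h.det', dot_act h.det' h.det']

lemma ckvCopotential_eq (h : IsGauge C C₂ t t') (hξ : C.IsCKV ξ F F' d) (hζ : C.IsCKV ζ G G' e)
    (hξ₂ : C₂.IsCKV (act t t' ξ) F₂ F₂' d₂) (hζ₂ : C₂.IsCKV (act t t' ζ) G₂ G₂' e₂)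
    (B B' : Fin 2) :
    ckvCopotential (act t t' ξ) (act t t' ζ) F₂ F₂' G₂ G₂' B B' =
      act t t' (ckvCopotential ξ ζ F F' G G') B B' := by
  have eF : F₂ = act t t F := by funext A B; exact h.ckv_curl hξ hξ₂ A B
  have eF' : F₂' = act t' t' F' := by funext A B; exact h.ckv_curl' hξ hξ₂ A B
  have eG : G₂ = act t t G := by funext A B; exact h.ckv_curl hζ hζ₂ A B
  have eG' : G₂' = act t' t' G' := by funext A B; exact h.ckv_curl' hζ hζ₂ A B
  simp only [ckvCopotential, eF, eF', eG, eG', ctr_act_act h.det, ctr_act_act' h.det']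
  simp only [act, ckvCopotential, ctr, Fin.sum_univ_two]
  ring

end conformalKilling

section killing

variable {κ η η₂ κ' η' η₂' : Fin 2 → Fin 2 → R} {τ τ₂ τ' τ₂' : ℕ → R}

lemma ksPotential_eq (h : IsGauge C C₂ t t') (hκ : C.IsKS20 κ η) (hκ₂ : C₂.IsKS20 (act t t κ) η₂)
    (hτ : C.IsTau κ η τ) (hτ₂ : C₂.IsTau (act t t κ) η₂ τ₂) (hκ' : C.swap.IsKS20 κ' η')
    (hκ₂' : C₂.swap.IsKS20 (act t' t' κ') η₂') (hτ' : C.swap.IsTau κ' η' τ')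
    (hτ₂' : C₂.swap.IsTau (act t' t' κ') η₂' τ₂') :
    ksPotential (act t t κ) η₂ (act t' t' κ') η₂' τ₂ τ₂' = ksPotential κ η κ' η' τ τ' := by
  have e1 : η₂ = act t t' η := by funext A B; exact h.ks_eta hκ hκ₂ A B
  have e2 : η₂' = act t' t η' := by funext A B; exact h.swap.ks_eta hκ' hκ₂' A B
  have e3 : (fun A' B' : Fin 2 => τ₂ (A' + B')) = act t' t' fun A' B' => τ (A' + B') := by
    funext A B; exact h.ks_tau hκ hκ₂ hτ hτ₂ A B
  have e4 : (fun A B : Fin 2 => τ₂' (A + B)) = act t t fun A B => τ' (A + B) := by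
    funext A B; exact h.swap.ks_tau hκ' hκ₂' hτ' hτ₂' A B
  simp only [ksPotential, e1, e2, e3, e4, act_flip, dot_act h.det h.det, dot_act h.det h.det',
    dot_act h.det' h.det']

lemma ksCopotential_eq (h : IsGauge C C₂ t t') (hκ : C.IsKS20 κ η)
    (hκ₂ : C₂.IsKS20 (act t t κ) η₂) (hκ' : C.swap.IsKS20 κ' η')
    (hκ₂' : C₂.swap.IsKS20 (act t' t' κ') η₂') (B B' : Fin 2) :
    ksCopotential (act t t κ) η₂ (act t' t' κ') η₂' B B' =
      act t t' (ksCopotential κ η κ' η') B B' := by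
  have e1 : η₂ = act t t' η := by funext A B; exact h.ks_eta hκ hκ₂ A B
  have e2 : η₂' = act t' t η' := by funext A B; exact h.swap.ks_eta hκ' hκ₂' A B
  have e3 := ctr_act_act' (t := t') (t' := t) h.det κ η' B' B
  simp only [ksCopotential, e1, e2, e3, ctr_act_act' h.det']
  simp only [act, ksCopotential, ctr, Fin.sum_univ_two]
  ring

end killing

end IsGauge

end SpinCalculus

/-! ### The Lie bracket as a commutator of directional derivatives -/

section Commutator

variable {M : Type*} [TopologicalSpace M] [ChartedSpace (EuclideanSpace ℝ (Fin 4)) M]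
  [IsManifold (𝓡 4) ∞ M]

/-- The derivative of `f` along a vector, read in the preferred chart at `x`. -/
lemma fderiv_comp_extChartAt_symm {F : Type*} [NormedAddCommGroup F] [NormedSpace ℝ F]
    {f : M → F} {x : M} {u : EuclideanSpace ℝ (Fin 4)}
    (hu : u ∈ (extChartAt (𝓡 4) x).target)
    (hf : MDifferentiableAt (𝓡 4) 𝓘(ℝ, F) f ((extChartAt (𝓡 4) x).symm u))
    (w : EuclideanSpace ℝ (Fin 4)) :
    fderiv ℝ (f ∘ (extChartAt (𝓡 4) x).symm) u w =
      mfderiv (𝓡 4) 𝓘(ℝ, F) f ((extChartAt (𝓡 4) x).symm u)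
        (mfderivWithin 𝓘(ℝ, EuclideanSpace ℝ (Fin 4)) (𝓡 4) (extChartAt (𝓡 4) x).symm
          (Set.range (𝓡 4)) u w) := by
  have h1 : MDifferentiableWithinAt 𝓘(ℝ, EuclideanSpace ℝ (Fin 4)) (𝓡 4)
      (extChartAt (𝓡 4) x).symm (Set.range (𝓡 4)) u :=
    mdifferentiableWithinAt_extChartAt_symm hu
  rw [ModelWithCorners.range_eq_univ, mfderivWithin_univ] at *
  rw [mdifferentiableWithinAt_univ] at h1
  have := mfderiv_comp u hf h1
  rw [mfderiv_eq_fderiv] at this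
  rw [this]
  rfl

/-- The vector field `V` read in the preferred chart at `x`. -/
abbrev chartField (x : M) (V : (y : M) → TangentSpace (𝓡 4) y) :
    EuclideanSpace ℝ (Fin 4) → EuclideanSpace ℝ (Fin 4) :=
  VectorField.mpullbackWithin 𝓘(ℝ, EuclideanSpace ℝ (Fin 4)) (𝓡 4) (extChartAt (𝓡 4) x).symm V
    (Set.range (𝓡 4))

lemma fderiv_chartField {f : M → ℂ} {x : M} {u : EuclideanSpace ℝ (Fin 4)}
    (V : (y : M) → TangentSpace (𝓡 4) y)
    (hu : u ∈ (extChartAt (𝓡 4) x).target)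
    (hf : MDifferentiableAt (𝓡 4) 𝓘(ℝ, ℂ) f ((extChartAt (𝓡 4) x).symm u)) :
    fderiv ℝ (f ∘ (extChartAt (𝓡 4) x).symm) u (chartField x V u) =
      mfderiv (𝓡 4) 𝓘(ℝ, ℂ) f ((extChartAt (𝓡 4) x).symm u)
        (V ((extChartAt (𝓡 4) x).symm u)) := by
  rw [fderiv_comp_extChartAt_symm hu hf]
  congr 1
  rw [chartField, VectorField.mpullbackWithin_apply]
  exact (isInvertible_mfderivWithin_extChartAt_symm hu).self_apply_inverse _

/-- The derivative of a complex function along a vector field. -/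
def dirDeriv (V : (y : M) → TangentSpace (𝓡 4) y) (f : M → ℂ) (x : M) : ℂ :=
  (mfderiv (𝓡 4) 𝓘(ℝ, ℂ) f x (V x) : ℂ)

/-- Everything is read in the preferred chart at the point. There the bracket is the Euclidean one,
for which symmetry of second derivatives gives the commutator formula. -/
lemma dirDeriv_mlieBracket {f : M → ℂ} {x : M} {V W : (y : M) → TangentSpace (𝓡 4) y}
    (hf' : ∀ᶠ y in nhds x, ContMDiffAt (𝓡 4) 𝓘(ℝ, ℂ) ∞ f y)
    (hV : MDifferentiableAt (𝓡 4) (𝓡 4).tangent (fun y => (V y : TangentBundle (𝓡 4) M)) x)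
    (hW : MDifferentiableAt (𝓡 4) (𝓡 4).tangent (fun y => (W y : TangentBundle (𝓡 4) M)) x)
    (hVf : MDifferentiableAt (𝓡 4) 𝓘(ℝ, ℂ) (dirDeriv V f) x)
    (hWf : MDifferentiableAt (𝓡 4) 𝓘(ℝ, ℂ) (dirDeriv W f) x) :
    dirDeriv (VectorField.mlieBracket (𝓡 4) V W) f x =
      dirDeriv V (dirDeriv W f) x - dirDeriv W (dirDeriv V f) x := by
  have : IsManifold (𝓡 4) 2 M := IsManifold.of_le (n := ∞) (by norm_cast)
  have hx : (extChartAt (𝓡 4) x).symm (extChartAt (𝓡 4) x x) = x := extChartAt_to_inv x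
  have hxt := mem_extChartAt_target (I := 𝓡 4) x
  have hf := hf'.self_of_nhds
  have hmd : ∀ᶠ u in nhds (extChartAt (𝓡 4) x x), u ∈ (extChartAt (𝓡 4) x).target ∧
      MDifferentiableAt (𝓡 4) 𝓘(ℝ, ℂ) f ((extChartAt (𝓡 4) x).symm u) := by
    refine Filter.Eventually.and (extChartAt_target_mem_nhds (I := 𝓡 4) x) ?_
    have h1 : ∀ᶠ y in nhds x, MDifferentiableAt (𝓡 4) 𝓘(ℝ, ℂ) f y := by
      filter_upwards [hf'] with y hy using hy.mdifferentiableAt (by simp)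
    have h3 : Filter.Tendsto (extChartAt (𝓡 4) x).symm (nhds (extChartAt (𝓡 4) x x)) (nhds x) := by
      have := (continuousAt_extChartAt_symm (I := 𝓡 4) x)
      rwa [ContinuousAt, hx] at this
    exact h3.eventually h1
  have hsmooth : ContDiffAt ℝ ∞ (f ∘ (extChartAt (𝓡 4) x).symm) (extChartAt (𝓡 4) x x) := by
    have h1 := (contMDiffAt_iff.1 hf).2
    rw [ModelWithCorners.range_eq_univ, contDiffWithinAt_univ] at h1
    exact h1
  have key : ∀ V : (y : M) → TangentSpace (𝓡 4) y,
      (fun u => fderiv ℝ (f ∘ (extChartAt (𝓡 4) x).symm) u (chartField x V u)) =ᶠ[nhds (extChartAt (𝓡 4) x x)]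
        (dirDeriv V f ∘ (extChartAt (𝓡 4) x).symm) := fun V => by
    filter_upwards [hmd] with u hu
    rw [fderiv_chartField V hu.1 hu.2]
    rfl
  have hd : ∀ V : (y : M) → TangentSpace (𝓡 4) y,
      MDifferentiableAt (𝓡 4) (𝓡 4).tangent (fun y => (V y : TangentBundle (𝓡 4) M)) x →
      DifferentiableAt ℝ (chartField x V) (extChartAt (𝓡 4) x x) := fun V hV => by
    have := (mdifferentiableWithinAt_univ.2 hV).differentiableWithinAt_mpullbackWithin_vectorField
    rw [Set.preimage_univ, Set.univ_inter] at this
    exact this.differentiableAt (by simp)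
  have main := VectorField.fderiv_apply_lieBracket hsmooth (by simp; norm_cast) (hd W hW) (hd V hV)
  rw [(key V).fderiv_eq, (key W).fderiv_eq] at main
  have e2 : ∀ (V : (y : M) → TangentSpace (𝓡 4) y) (h : M → ℂ), MDifferentiableAt (𝓡 4) 𝓘(ℝ, ℂ) h x →
      fderiv ℝ (h ∘ (extChartAt (𝓡 4) x).symm) (extChartAt (𝓡 4) x x) (chartField x V (extChartAt (𝓡 4) x x))
       = dirDeriv V h x := fun V h hh => by
    rw [fderiv_chartField V hxt (by rwa [hx])]
    unfold dirDeriv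
    rw [hx]
  rw [e2 V _ hWf, e2 W _ hVf] at main
  rw [← main]
  have hxx : MDifferentiableAt (𝓡 4) 𝓘(ℝ, ℂ) f x := hf.mdifferentiableAt (by simp)
  rw [fderiv_comp_extChartAt_symm hxt (by rwa [hx]), hx]
  unfold dirDeriv
  congr 1
  rw [← VectorField.mlieBracketWithin_univ, VectorField.mlieBracketWithin_apply]
  have hs : x ∈ (extChartAt (𝓡 4) x).source := mem_extChartAt_source x
  have h2 := mfderiv_extChartAt_comp_mfderivWithin_extChartAt_symm' hs
  -- The manifold bracket is pulled back with the inverse of the derivative of the chart; this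
  -- inverse is the derivative of the inverse chart.
  have h3 : ∀ v : EuclideanSpace ℝ (Fin 4),
      (mfderivWithin 𝓘(ℝ, EuclideanSpace ℝ (Fin 4)) (𝓡 4) (extChartAt (𝓡 4) x).symm
          (Set.range (𝓡 4)) (extChartAt (𝓡 4) x x) v : EuclideanSpace ℝ (Fin 4)) =
        (mfderiv (𝓡 4) 𝓘(ℝ, EuclideanSpace ℝ (Fin 4)) (extChartAt (𝓡 4) x) x).inverse v := by
    intro v
    have h4 := congrArg (mfderiv (𝓡 4) 𝓘(ℝ, EuclideanSpace ℝ (Fin 4)) (extChartAt (𝓡 4) x) x).inverse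
      (DFunLike.congr_fun h2 v)
    have h5 := (isInvertible_mfderiv_extChartAt hs).inverse_apply_self
      (mfderivWithin 𝓘(ℝ, EuclideanSpace ℝ (Fin 4)) (𝓡 4) (extChartAt (𝓡 4) x).symm
          (Set.range (𝓡 4)) (extChartAt (𝓡 4) x x) v)
    exact h5.symm.trans h4
  have h6 : VectorField.lieBracketWithin ℝ (chartField x V) (chartField x W)
      ((extChartAt (𝓡 4) x).symm ⁻¹' Set.univ ∩ Set.range (𝓡 4)) (extChartAt (𝓡 4) x x) =
      VectorField.lieBracket ℝ (chartField x V) (chartField x W) (extChartAt (𝓡 4) x x) := by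
    have h7 : (extChartAt (𝓡 4) x).symm ⁻¹' Set.univ ∩ Set.range (𝓡 4) = Set.univ := by simp
    rw [h7, VectorField.lieBracketWithin_univ]
  exact (congrArg (mfderiv (𝓡 4) 𝓘(ℝ, EuclideanSpace ℝ (Fin 4)) (extChartAt (𝓡 4) x) x).inverse
    h6).trans (h3 _).symm

end Commutator

/-! ### Smoothness and rules for directional derivatives -/

section Smoothness

variable {M : Type*} [TopologicalSpace M] [ChartedSpace (EuclideanSpace ℝ (Fin 4)) M]
  [IsManifold (𝓡 4) ∞ M]

lemma contMDiffOn_dirDeriv {U : Set M} (hU : IsOpen U) {V : (y : M) → TangentSpace (𝓡 4) y}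
    {f : M → ℂ}
    (hV : ContMDiffOn (𝓡 4) (𝓡 4).tangent ∞ (fun y => (V y : TangentBundle (𝓡 4) M)) U)
    (hf : ContMDiffOn (𝓡 4) 𝓘(ℝ, ℂ) ∞ f U) :
    ContMDiffOn (𝓡 4) 𝓘(ℝ, ℂ) ∞ (dirDeriv V f) U := by
  have h1 := hf.contMDiffOn_tangentMapWithin (m := ∞) (by simp) hU.uniqueMDiffOn
  have h2 := h1.comp hV (fun x hx => by simpa using hx)
  have h3 := (contMDiff_snd_tangentBundle_modelSpace ℂ 𝓘(ℝ, ℂ) (n := ∞)).comp_contMDiffOn h2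
  refine h3.congr fun x hx => ?_
  exact congrArg (fun L : TangentSpace (𝓡 4) x →L[ℝ] ℂ => L (V x))
    (mfderivWithin_of_isOpen hU hx).symm

lemma contMDiffOn_metric (g : LorentzMetric M) {U : Set M} {V W : (y : M) → TangentSpace (𝓡 4) y}
    (hV : ContMDiffOn (𝓡 4) (𝓡 4).tangent ∞ (fun y => (V y : TangentBundle (𝓡 4) M)) U)
    (hW : ContMDiffOn (𝓡 4) (𝓡 4).tangent ∞ (fun y => (W y : TangentBundle (𝓡 4) M)) U) :
    ContMDiffOn (𝓡 4) 𝓘(ℝ, ℝ) ∞ (fun x => g.val x (V x) (W x)) U := by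
  intro x hx
  have : ContMDiffWithinAt (𝓡 4) ((𝓡 4).prod 𝓘(ℝ)) ∞
      (fun m ↦ Bundle.TotalSpace.mk' ℝ (E := Bundle.Trivial M ℝ) m (g.val m (V m) (W m))) U x := by
    apply ContMDiffWithinAt.clm_bundle_apply₂ (F₁ := EuclideanSpace ℝ (Fin 4))
      (F₂ := EuclideanSpace ℝ (Fin 4))
    · exact g.smooth.contMDiffAt.contMDiffWithinAt
    · exact hV x hx
    · exact hW x hx
  simp only [Bundle.contMDiffWithinAt_totalSpace] at this
  exact this.2

lemma contMDiffOn_mlieBracket {U : Set M} (hU : IsOpen U)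
    {V W : (y : M) → TangentSpace (𝓡 4) y}
    (hV : ContMDiffOn (𝓡 4) (𝓡 4).tangent ∞ (fun y => (V y : TangentBundle (𝓡 4) M)) U)
    (hW : ContMDiffOn (𝓡 4) (𝓡 4).tangent ∞ (fun y => (W y : TangentBundle (𝓡 4) M)) U) :
    ContMDiffOn (𝓡 4) (𝓡 4).tangent ∞
      (fun y => (VectorField.mlieBracket (𝓡 4) V W y : TangentBundle (𝓡 4) M)) U := by
  intro x hx
  have hn := hU.mem_nhds hx
  have : IsManifold (𝓡 4) ((⊤ : ℕ∞) + 1) M := by simpa using (inferInstance : IsManifold (𝓡 4) ∞ M)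
  have : IsManifold (𝓡 4) (minSmoothness ℝ 2) M :=
    IsManifold.of_le (n := ∞) (by simp; norm_cast)
  exact (ContMDiffAt.mlieBracket_vectorField (m := ⊤) (n := ⊤) (hV.contMDiffAt hn)
    (hW.contMDiffAt hn) (by simp)).contMDiffWithinAt

lemma ContMDiffOn.ofReal {U : Set M} {f : M → ℝ} (hf : ContMDiffOn (𝓡 4) 𝓘(ℝ, ℝ) ∞ f U) :
    ContMDiffOn (𝓡 4) 𝓘(ℝ, ℂ) ∞ (fun x => (f x : ℂ)) U :=
  Complex.ofRealCLM.contMDiff.comp_contMDiffOn hf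

lemma ContMDiffOn.star {U : Set M} {f : M → ℂ} (hf : ContMDiffOn (𝓡 4) 𝓘(ℝ, ℂ) ∞ f U) :
    ContMDiffOn (𝓡 4) 𝓘(ℝ, ℂ) ∞ (fun x => star (f x)) U :=
  Complex.conjCLE.toContinuousLinearMap.contMDiff.comp_contMDiffOn hf

lemma dirDeriv_congr {f h : M → ℂ} {x : M} (V : (y : M) → TangentSpace (𝓡 4) y)
    (e : f =ᶠ[nhds x] h) : dirDeriv V f x = dirDeriv V h x := by
  unfold dirDeriv
  exact congrArg (fun L : TangentSpace (𝓡 4) x →L[ℝ] ℂ => L (V x)) e.mfderiv_eq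

lemma dirDeriv_add {f h : M → ℂ} {x : M} (V : (y : M) → TangentSpace (𝓡 4) y)
    (hf : MDifferentiableAt (𝓡 4) 𝓘(ℝ, ℂ) f x) (hh : MDifferentiableAt (𝓡 4) 𝓘(ℝ, ℂ) h x) :
    dirDeriv V (f + h) x = dirDeriv V f x + dirDeriv V h x := by
  unfold dirDeriv
  rw [mfderiv_add hf hh]; rfl

lemma dirDeriv_mul {f h : M → ℂ} {x : M} (V : (y : M) → TangentSpace (𝓡 4) y)
    (hf : MDifferentiableAt (𝓡 4) 𝓘(ℝ, ℂ) f x) (hh : MDifferentiableAt (𝓡 4) 𝓘(ℝ, ℂ) h x) :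
    dirDeriv V (f * h) x = f x * dirDeriv V h x + h x * dirDeriv V f x := by
  unfold dirDeriv
  rw [(hf.hasMFDerivAt.mul hh.hasMFDerivAt).mfderiv]
  rfl

lemma dirDeriv_const (c : ℂ) (x : M) (V : (y : M) → TangentSpace (𝓡 4) y) :
    dirDeriv V (fun _ => c) x = 0 := by
  unfold dirDeriv
  rw [mfderiv_const]; rfl

lemma dirDeriv_star {f : M → ℂ} {x : M} (V : (y : M) → TangentSpace (𝓡 4) y)
    (hf : MDifferentiableAt (𝓡 4) 𝓘(ℝ, ℂ) f x) :
    dirDeriv V (fun y => star (f y)) x = star (dirDeriv V f x) := by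
  unfold dirDeriv
  have h := (Complex.conjCLE.toContinuousLinearMap.hasMFDerivAt (x := f x)).comp x hf.hasMFDerivAt
  exact congrArg (fun L : TangentSpace (𝓡 4) x →L[ℝ] ℂ => L (V x)) h.mfderiv

end Smoothness

/-! ### Pauli matrices and the spin lift of infinitesimal Lorentz transformations -/

lemma eps_eq : (eps 0 0 = 0 ∧ eps 0 1 = 1) ∧ eps 1 0 = -1 ∧ eps 1 1 = 0 := by
  simp [eps]

@[simp] lemma eps_zero_zero : eps 0 0 = 0 := eps_eq.1.1
@[simp] lemma eps_zero_one : eps 0 1 = 1 := eps_eq.1.2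
@[simp] lemma eps_one_zero : eps 1 0 = -1 := eps_eq.2.1
@[simp] lemma eps_one_one : eps 1 1 = 0 := eps_eq.2.2

lemma inv_sqrt_two_sq : (((Real.sqrt 2 : ℝ) : ℂ)⁻¹) ^ 2 = 1 / 2 := by
  rw [inv_pow, ← Complex.ofReal_pow, Real.sq_sqrt (by norm_num)]
  norm_num

lemma star_inv_sqrt_two : (starRingEnd ℂ) (((Real.sqrt 2 : ℝ) : ℂ)⁻¹) = ((Real.sqrt 2 : ℝ) : ℂ)⁻¹ := by
  rw [map_inv₀, Complex.conj_ofReal]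

lemma sigma_star (a : Fin 4) (A A' : Fin 2) : star (sigma a A A') = sigma a A' A := by
  fin_cases a <;> fin_cases A <;> fin_cases A' <;> simp [sigma, star_inv_sqrt_two]

/-- The action on spinors of an infinitesimal Lorentz transformation. -/
def spinLift (L : Fin 4 → Fin 4 → ℝ) (B C : Fin 2) : ℂ :=
  ∑ D, eps C D * ((1 / 2) * ∑ B', ∑ D', eps B' D' *
    ∑ b, ∑ c, sigma b B B' * sigma c D D' * (L b c : ℂ))

/-- Exchanging b and c exchanges the two spinor index pairs. Skewness of `L` thus makes the lift
symmetric with its index lowered, that is, trace-free. -/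
lemma spinLift_trace {L : Fin 4 → Fin 4 → ℝ} (hL : ∀ b c, L b c = -L c b) :
    spinLift L 1 1 = -spinLift L 0 0 := by
  have h : ∀ A A' B B', ∑ b, ∑ c, sigma b A A' * sigma c B B' * (L b c : ℂ) =
      -∑ b, ∑ c, sigma b B B' * sigma c A A' * (L b c : ℂ) := by
    intro A A' B B'
    rw [Finset.sum_comm]
    simp only [← Finset.sum_neg_distrib]
    refine Finset.sum_congr rfl fun b _ => Finset.sum_congr rfl fun c _ => ?_
    rw [hL c b]
    push_cast
    ring
  simp [spinLift]
  rw [h 1 0 0 1, h 1 1 0 0]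
  ring

set_option maxHeartbeats 4000000 in
-- The lift is the infinitesimal inverse of the double cover of the Lorentz group: acting on both
-- indices of σ it reproduces `L` on the vector index. This connects the spin connection with the
-- Levi-Civita connection.
lemma spinLift_vector {L : Fin 4 → Fin 4 → ℝ} (hL : ∀ b c, L b c = -L c b) (w : Fin 4 → ℂ)
    (B B' : Fin 2) :
    ∑ X, spinLift L B X * ∑ c, sigma c X B' * w c
      + ∑ X, star (spinLift L B' X) * ∑ c, sigma c B X * w c =
    ∑ b, sigma b B B' * ∑ c, ∑ d, ((eta c d * L b d : ℝ) : ℂ) * w c := by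
  have h0 : ∀ b, L b b = 0 := fun b => by linarith [hL b b]
  have h1 := hL 1 0
  have h2 := hL 2 0
  have h3 := hL 3 0
  have h4 := hL 2 1
  have h5 := hL 3 1
  have h6 := hL 3 2
  have s2 := inv_sqrt_two_sq
  simp only [spinLift, sigma, eta]
  generalize hs : ((Real.sqrt 2 : ℝ) : ℂ)⁻¹ = s at *
  have ss : (starRingEnd ℂ) s = s := by rw [← hs]; exact star_inv_sqrt_two
  have I2 := Complex.I_sq
  fin_cases B <;> fin_cases B' <;>
    simp [Fin.sum_univ_four, h0, h1, h2, h3, h4, h5, h6, ss] <;> ring_nf <;>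
    simp only [I2, show s ^ 3 = s * s ^ 2 by ring, s2] <;> ring_nf

/-! ### Orthonormal frames and Levi-Civita coefficients -/

section Patch

variable {M : Type*} [TopologicalSpace M] [ChartedSpace (EuclideanSpace ℝ (Fin 4)) M]
  [IsManifold (𝓡 4) ∞ M] {g : LorentzMetric M} {ι : Type*} (S : SpinStructure g ι)

lemma contMDiffOn_mul {V : Set M} {f h : M → ℂ} (hf : ContMDiffOn (𝓡 4) 𝓘(ℝ, ℂ) ∞ f V)
    (hh : ContMDiffOn (𝓡 4) 𝓘(ℝ, ℂ) ∞ h V) :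
    ContMDiffOn (𝓡 4) 𝓘(ℝ, ℂ) ∞ (fun x => f x * h x) V :=
  (ContDiff.contMDiff (contDiff_mul (𝕜 := ℝ) (𝔸 := ℂ) (n := ∞))).comp_contMDiffOn (hf.prodMk_space hh)

namespace SpinStructure

lemma sum_smul_eq_zero {S : SpinStructure g ι} {i : ι} {x : M} (hx : x ∈ S.U i) {k : Fin 4 → ℝ}
    (h : ∑ a, k a • S.e i a x = 0) (a : Fin 4) : k a = 0 := by
  have h1 := congrArg (fun v => g.val x v (S.e i a x)) h
  simp only [map_sum, map_smul, sum_apply, smul_apply,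
    S.orthonormal i x hx, map_zero, zero_apply, smul_eq_mul] at h1
  fin_cases a <;> simpa [eta, Fin.sum_univ_four] using h1

lemma frame_decomp {i : ι} {x : M} (hx : x ∈ S.U i) (v : TangentSpace (𝓡 4) x) :
    v = ∑ c, (∑ d, eta c d * g.val x v (S.e i d x)) • S.e i c x := by
  have hli : LinearIndependent ℝ (fun a => (S.e i a x : EuclideanSpace ℝ (Fin 4))) := by
    rw [Fintype.linearIndependent_iff]
    intro k hk
    exact sum_smul_eq_zero hx hk
  have hspan := hli.span_eq_top_of_card_eq_finrank
    (show _ = Module.finrank ℝ (EuclideanSpace ℝ (Fin 4)) by simp)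
  have hv : (v : EuclideanSpace ℝ (Fin 4)) ∈
      Submodule.span ℝ (Set.range fun a => (S.e i a x : EuclideanSpace ℝ (Fin 4))) := by
    rw [hspan]; trivial
  obtain ⟨k, hk⟩ := (Submodule.mem_span_range_iff_exists_fun ℝ).1 hv
  have hk' : ∑ a, k a • S.e i a x = v := hk
  have key : ∀ d, g.val x v (S.e i d x) = k d * eta d d := by
    intro d
    rw [← hk']
    simp only [map_sum, map_smul, sum_apply, smul_apply,
      S.orthonormal i x hx, smul_eq_mul]
    fin_cases d <;> simp [eta, Fin.sum_univ_four]
  have key2 : ∀ c, ∑ d, eta c d * g.val x v (S.e i d x) = k c := by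
    intro c
    simp only [key]
    fin_cases c <;> simp [eta, Fin.sum_univ_four]
  simp only [key2]
  exact hk'.symm

lemma bracket_antisymm (i : ι) (a b c : Fin 4) (x : M) :
    S.bracket i a b c x = -S.bracket i b a c x := by
  simp only [bracket]
  rw [VectorField.mlieBracket_swap_apply]
  simp

/-- This is metric compatibility. Together with `leviCivita_torsion` it is, apart from smoothness,
all that is used of the Koszul formula. -/
lemma leviCivita_antisymm (i : ι) (a b c : Fin 4) (x : M) :
    S.leviCivita i a b c x = -S.leviCivita i a c b x := by
  simp only [leviCivita]
  rw [S.bracket_antisymm i b c a x]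
  ring

lemma leviCivita_torsion (i : ι) (a b c : Fin 4) (x : M) :
    S.leviCivita i a b c x - S.leviCivita i b a c x = S.bracket i a b c x := by
  simp only [leviCivita]
  rw [S.bracket_antisymm i b a c x]
  ring

lemma spinConn_eq (i : ι) (a : Fin 4) (B C : Fin 2) (x : M) :
    S.spinConn i a B C x = spinLift (fun b c => S.leviCivita i a b c x) B C := rfl

variable {i : ι} {V : Set M}

lemma contMDiffOn_bracket (hV : IsOpen V) (hVU : V ⊆ S.U i) (a b c : Fin 4) :
    ContMDiffOn (𝓡 4) 𝓘(ℝ, ℝ) ∞ (S.bracket i a b c) V :=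
  contMDiffOn_metric g (contMDiffOn_mlieBracket hV ((S.smooth_e i a).mono hVU)
    ((S.smooth_e i b).mono hVU)) ((S.smooth_e i c).mono hVU)

lemma contMDiffOn_leviCivita (hV : IsOpen V) (hVU : V ⊆ S.U i) (a b c : Fin 4) :
    ContMDiffOn (𝓡 4) 𝓘(ℝ, ℝ) ∞ (S.leviCivita i a b c) V := by
  unfold leviCivita
  exact contMDiffOn_const.mul (((S.contMDiffOn_bracket hV hVU a b c).sub
    (S.contMDiffOn_bracket hV hVU a c b)).sub (S.contMDiffOn_bracket hV hVU b c a))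

lemma contMDiffOn_spinConn (hV : IsOpen V) (hVU : V ⊆ S.U i) (a : Fin 4) (B C : Fin 2) :
    ContMDiffOn (𝓡 4) 𝓘(ℝ, ℂ) ∞ (S.spinConn i a B C) V := by
  unfold spinConn
  refine contMDiffOn_finsetSum fun D _ => contMDiffOn_mul contMDiffOn_const
    (contMDiffOn_mul contMDiffOn_const ?_)
  refine contMDiffOn_finsetSum fun B' _ => contMDiffOn_finsetSum fun D' _ =>
    contMDiffOn_mul contMDiffOn_const ?_
  refine contMDiffOn_finsetSum fun b _ => contMDiffOn_finsetSum fun c _ =>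
    contMDiffOn_mul contMDiffOn_const (ContMDiffOn.ofReal (S.contMDiffOn_leviCivita hV hVU a b c))

lemma contMDiffOn_spinCoeff (hV : IsOpen V) (hVU : V ⊆ S.U i) (A A' B C : Fin 2) :
    ContMDiffOn (𝓡 4) 𝓘(ℝ, ℂ) ∞ (S.spinCoeff i A A' B C) V := by
  unfold spinCoeff
  exact contMDiffOn_finsetSum fun a _ => contMDiffOn_mul contMDiffOn_const (S.contMDiffOn_spinConn hV hVU a B C)

lemma contMDiffOn_frameDeriv (hV : IsOpen V) (hVU : V ⊆ S.U i) (a : Fin 4) {f : M → ℂ}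
    (hf : ContMDiffOn (𝓡 4) 𝓘(ℝ, ℂ) ∞ f V) :
    ContMDiffOn (𝓡 4) 𝓘(ℝ, ℂ) ∞ (S.frameDeriv i a f) V :=
  contMDiffOn_dirDeriv hV ((S.smooth_e i a).mono hVU) hf

lemma contMDiffOn_nablaFun (hV : IsOpen V) (hVU : V ⊆ S.U i) (A A' : Fin 2) {f : M → ℂ}
    (hf : ContMDiffOn (𝓡 4) 𝓘(ℝ, ℂ) ∞ f V) :
    ContMDiffOn (𝓡 4) 𝓘(ℝ, ℂ) ∞ (S.nablaFun i A A' f) V := by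
  unfold nablaFun
  exact contMDiffOn_finsetSum fun a _ => contMDiffOn_mul contMDiffOn_const (S.contMDiffOn_frameDeriv hV hVU a hf)

lemma nablaFun_congr {A A' : Fin 2} {f h : M → ℂ} (hV : IsOpen V) (e : Set.EqOn f h V) {x : M}
    (hx : x ∈ V) : S.nablaFun i A A' f x = S.nablaFun i A A' h x := by
  have e' : f =ᶠ[nhds x] h := Filter.eventuallyEq_of_mem (hV.mem_nhds hx) e
  unfold nablaFun
  exact Finset.sum_congr rfl fun a _ => congrArg _ (dirDeriv_congr (S.e i a) e')

lemma frameDeriv_comm (hV : IsOpen V) (hVU : V ⊆ S.U i) (a b : Fin 4) {f : M → ℂ}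
    (hf : ContMDiffOn (𝓡 4) 𝓘(ℝ, ℂ) ∞ f V) {x : M} (hx : x ∈ V) :
    S.frameDeriv i a (S.frameDeriv i b f) x - S.frameDeriv i b (S.frameDeriv i a f) x =
      ∑ c, ∑ d, ((eta c d * S.bracket i a b d x : ℝ) : ℂ) * S.frameDeriv i c f x := by
  have hn := hV.mem_nhds hx
  have hd : ∀ a, MDifferentiableAt (𝓡 4) (𝓡 4).tangent
      (fun y => (S.e i a y : TangentBundle (𝓡 4) M)) x := fun a =>
    (((S.smooth_e i a).mono hVU).contMDiffAt hn).mdifferentiableAt (by simp)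
  have hf' : ∀ a, MDifferentiableAt (𝓡 4) 𝓘(ℝ, ℂ) (dirDeriv (S.e i a) f) x := fun a =>
    ((S.contMDiffOn_frameDeriv hV hVU a hf).contMDiffAt hn).mdifferentiableAt (by simp)
  have h := dirDeriv_mlieBracket (f := f) (x := x) (by
    filter_upwards [hn] with y hy using hf.contMDiffAt (hV.mem_nhds hy)) (hd a) (hd b) (hf' a) (hf' b)
  refine h.symm.trans ?_
  unfold dirDeriv
  have h1 := congrArg (fun v => (mfderiv (𝓡 4) 𝓘(ℝ, ℂ) f x v : ℂ))
    (S.frame_decomp (hVU hx) (VectorField.mlieBracket (𝓡 4) (S.e i a) (S.e i b) x))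
  refine h1.trans ?_
  simp only [map_sum, map_smul, Finset.sum_smul]
  refine Finset.sum_congr rfl fun c _ => Finset.sum_congr rfl fun d _ => ?_
  exact Complex.real_smul

end SpinStructure

end Patch

/-! ### The ring of smooth functions on a set -/

section Ring

variable {M : Type*} [TopologicalSpace M] [ChartedSpace (EuclideanSpace ℝ (Fin 4)) M]
  [IsManifold (𝓡 4) ∞ M]

open Classical in
/-- The extension by zero of a function on a subset. -/
def extend {V : Set M} (f : V → ℂ) (x : M) : ℂ := if h : x ∈ V then f ⟨x, h⟩ else 0

lemma extend_apply {V : Set M} (f : V → ℂ) {x : M} (hx : x ∈ V) : extend f x = f ⟨x, hx⟩ := by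
  simp [extend, hx]

lemma extend_eqOn {V : Set M} (f : M → ℂ) : Set.EqOn (extend (fun x : V => f x)) f V :=
  fun _ hx => extend_apply _ hx

/-- The ring of smooth complex functions on a set. -/
def smoothRing (V : Set M) : Subring (V → ℂ) where
  -- Elements are functions on the subtype, so equality means equality on `V`. The extension by zero
  -- is tested for smoothness on `V` only.
  carrier := {f | ContMDiffOn (𝓡 4) 𝓘(ℝ, ℂ) ∞ (extend f) V}
  mul_mem' {f h} hf hh := (contMDiffOn_mul hf hh).congr fun x hx => by
    simp only [extend_apply _ hx]; rfl
  one_mem' := (contMDiffOn_const (c := (1 : ℂ))).congr fun x hx => by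
    simp only [extend_apply _ hx]; rfl
  add_mem' {f h} hf hh := (ContMDiffOn.add hf hh).congr fun x hx => by
    simp only [Pi.add_apply, extend_apply _ hx]
  zero_mem' := (contMDiffOn_const (c := (0 : ℂ))).congr fun x hx => by
    simp only [extend_apply _ hx]; rfl
  neg_mem' {f} hf := (ContMDiffOn.neg hf).congr fun x hx => by
    simp only [Pi.neg_apply, extend_apply _ hx]

/-- The element of the ring of smooth functions given by a function smooth on `V`. -/
def toRing {V : Set M} (f : M → ℂ) (hf : ContMDiffOn (𝓡 4) 𝓘(ℝ, ℂ) ∞ f V) : smoothRing V :=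
  ⟨fun x => f x, hf.congr (extend_eqOn f)⟩

/-- Evaluation at a point. -/
def evalAt {V : Set M} (x : V) : smoothRing V →+* ℂ := (Pi.evalRingHom (fun _ : V => ℂ) x).comp
  (smoothRing V).subtype

lemma evalAt_toRing {V : Set M} (x : V) (f : M → ℂ) (hf : ContMDiffOn (𝓡 4) 𝓘(ℝ, ℂ) ∞ f V) :
    evalAt x (toRing f hf) = f x := rfl

lemma ext_evalAt {V : Set M} {f h : smoothRing V} (e : ∀ x, evalAt x f = evalAt x h) : f = h :=
  Subtype.ext (funext e)

end Ring

/-! ### Frame derivatives as derivations of the ring -/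

section Patch

variable {M : Type*} [TopologicalSpace M] [ChartedSpace (EuclideanSpace ℝ (Fin 4)) M]
  [IsManifold (𝓡 4) ∞ M] {g : LorentzMetric M} {ι : Type*} {S : SpinStructure g ι}

namespace SpinStructure

variable {i : ι} {V : Set M}

lemma frameDeriv_eq (i : ι) (a : Fin 4) (f : M → ℂ) : S.frameDeriv i a f = dirDeriv (S.e i a) f := rfl

/-- The derivative along `e_{AA'}` as a derivation. -/
def nablaDer (S : SpinStructure g ι) (hV : IsOpen V) (hVU : V ⊆ S.U i) (A A' : Fin 2) :
    Derivation ℤ (smoothRing V) (smoothRing V) :=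
  Derivation.mk' (AddMonoidHom.toIntLinearMap
    { toFun := fun f => toRing (S.nablaFun i A A' (extend f.1)) (S.contMDiffOn_nablaFun hV hVU A A' f.2)
      map_zero' := ext_evalAt fun x => by
        rw [evalAt_toRing, S.nablaFun_congr hV (h := fun _ => 0) (fun y hy => extend_apply _ hy) x.2]
        simp [nablaFun, frameDeriv_eq, dirDeriv_const]
      map_add' := fun f h => ext_evalAt fun x => by
        have hn := hV.mem_nhds x.2
        rw [map_add, evalAt_toRing, evalAt_toRing, evalAt_toRing,
          S.nablaFun_congr hV (h := extend f.1 + extend h.1) (fun y hy => by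
            simp only [Pi.add_apply, extend_apply _ hy]; rfl) x.2]
        simp only [nablaFun, frameDeriv_eq, ← Finset.sum_add_distrib, ← mul_add]
        refine Finset.sum_congr rfl fun a _ => congrArg _ (dirDeriv_add _
          ((ContMDiffOn.contMDiffAt f.2 hn).mdifferentiableAt (by simp))
          ((ContMDiffOn.contMDiffAt h.2 hn).mdifferentiableAt (by simp))) })
    fun f h => ext_evalAt fun x => by
        have hn := hV.mem_nhds x.2
        simp only [AddMonoidHom.coe_toIntLinearMap, AddMonoidHom.coe_mk, ZeroHom.coe_mk]
        rw [map_add, smul_eq_mul, smul_eq_mul, map_mul, map_mul, evalAt_toRing, evalAt_toRing,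
          evalAt_toRing, S.nablaFun_congr hV (h := extend f.1 * extend h.1) (fun y hy => by
            simp only [Pi.mul_apply, extend_apply _ hy]; rfl) x.2]
        simp only [nablaFun, frameDeriv_eq, Finset.mul_sum, ← Finset.sum_add_distrib]
        refine Finset.sum_congr rfl fun a _ => ?_
        rw [dirDeriv_mul _
          ((ContMDiffOn.contMDiffAt f.2 hn).mdifferentiableAt (by simp))
          ((ContMDiffOn.contMDiffAt h.2 hn).mdifferentiableAt (by simp))]
        rw [extend_apply _ x.2, extend_apply _ x.2]
        change _ = f.1 x * _ + h.1 x * _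
        ring

lemma evalAt_nablaDer (S : SpinStructure g ι) (hV : IsOpen V) (hVU : V ⊆ S.U i) (A A' : Fin 2) (x : V)
    (f : smoothRing V) : evalAt x (S.nablaDer hV hVU A A' f) = S.nablaFun i A A' (extend f.1) x := rfl

lemma evalAt_nablaDer_toRing (S : SpinStructure g ι) (hV : IsOpen V) (hVU : V ⊆ S.U i) (A A' : Fin 2)
    (x : V) {f : M → ℂ} (hf : ContMDiffOn (𝓡 4) 𝓘(ℝ, ℂ) ∞ f V) :
    evalAt x (S.nablaDer hV hVU A A' (toRing f hf)) = S.nablaFun i A A' f x := by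
  rw [evalAt_nablaDer]
  exact S.nablaFun_congr hV (extend_eqOn f) x.2

/-- The derivation along a coordinate of a chart detects tangent vectors. -/
lemma eq_zero_of_frameDeriv (S : SpinStructure g ι) (hVU : V ⊆ S.U i) {x₀ : M}
    (hc : V ⊆ (chartAt (EuclideanSpace ℝ (Fin 4)) x₀).source) {x : M} (hx : x ∈ V) {c : Fin 4 → ℂ}
    (h : ∀ f : M → ℂ, ContMDiffOn (𝓡 4) 𝓘(ℝ, ℂ) ∞ f V → ∑ a, c a * S.frameDeriv i a f x = 0)
    (a : Fin 4) : c a = 0 := by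
  have hs : x ∈ (extChartAt (𝓡 4) x₀).source := by
    rw [extChartAt_source]; exact hc hx
  have hsm : ContMDiffOn (𝓡 4) 𝓘(ℝ, EuclideanSpace ℝ (Fin 4)) ∞ (extChartAt (𝓡 4) x₀) V :=
    (contMDiffOn_extChartAt (n := ∞) (x := x₀)).mono hc
  have hd : MDifferentiableAt (𝓡 4) 𝓘(ℝ, EuclideanSpace ℝ (Fin 4)) (extChartAt (𝓡 4) x₀) x :=
    mdifferentiableAt_extChartAt (hc hx)
  set L : TangentSpace (𝓡 4) x →L[ℝ] EuclideanSpace ℝ (Fin 4) :=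
    mfderiv (𝓡 4) 𝓘(ℝ, EuclideanSpace ℝ (Fin 4)) (extChartAt (𝓡 4) x₀) x with hL
  have hLi : ∀ v, L v = 0 → v = 0 := by
    intro v hv
    have := (isInvertible_mfderiv_extChartAt hs).inverse_apply_self v
    exact this.symm.trans ((congrArg L.inverse hv).trans (map_zero _))
  have key : ∀ k : Fin 4, ∑ a, c a * ((L (S.e i a x) k : ℝ) : ℂ) = 0 := by
    intro k
    let P : EuclideanSpace ℝ (Fin 4) →L[ℝ] ℂ :=
      Complex.ofRealCLM.comp (EuclideanSpace.proj k)
    have hP := h (fun y => P (extChartAt (𝓡 4) x₀ y)) (P.contMDiff.comp_contMDiffOn hsm)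
    rw [← hP]
    refine Finset.sum_congr rfl fun a _ => congrArg _ ?_
    have h2 := (P.hasMFDerivAt (x := extChartAt (𝓡 4) x₀ x)).comp x hd.hasMFDerivAt
    exact (congrArg (fun T : TangentSpace (𝓡 4) x →L[ℝ] ℂ => T (S.e i a x)) h2.mfderiv).symm
  have hzero : ∀ r : Fin 4 → ℝ, (∀ k : Fin 4, ∑ a, r a * L (S.e i a x) k = 0) → r a = 0 := by
    intro r hr
    refine sum_smul_eq_zero (hVU hx) (hLi _ ?_) a
    rw [map_sum]
    ext k
    simp only [map_smul]
    refine Eq.trans ?_ (hr k)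
    simp
  -- The frame is independent over the reals, so the real and imaginary parts of the coefficients
  -- are treated separately.
  apply Complex.ext
  · refine hzero (fun a => (c a).re) fun k => ?_
    simpa using congrArg Complex.re (key k)
  · refine hzero (fun a => (c a).im) fun k => ?_
    simpa using congrArg Complex.im (key k)

end SpinStructure

end Patch

/-! ### The spin calculus of a patch -/

section Patch

variable {M : Type*} [TopologicalSpace M] [ChartedSpace (EuclideanSpace ℝ (Fin 4)) M]
  [IsManifold (𝓡 4) ∞ M] {g : LorentzMetric M} {ι : Type*} {S : SpinStructure g ι}

lemma dirDeriv_sum_mul {β : Type*} (s : Finset β) (k : β → ℂ) {f : β → M → ℂ} {x : M}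
    (W : (y : M) → TangentSpace (𝓡 4) y)
    (hf : ∀ b, MDifferentiableAt (𝓡 4) 𝓘(ℝ, ℂ) (f b) x) :
    MDifferentiableAt (𝓡 4) 𝓘(ℝ, ℂ) (fun y => ∑ b ∈ s, k b * f b y) x ∧
    dirDeriv W (fun y => ∑ b ∈ s, k b * f b y) x = ∑ b ∈ s, k b * dirDeriv W (f b) x := by
  classical
  induction s using Finset.induction_on with
  | empty => simpa [dirDeriv_const] using mdifferentiableAt_const
  | insert b s hb ih =>
    have hk : MDifferentiableAt (𝓡 4) 𝓘(ℝ, ℂ) (fun _ : M => k b) x := mdifferentiableAt_const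
    have h1 : MDifferentiableAt (𝓡 4) 𝓘(ℝ, ℂ) ((fun _ : M => k b) * f b) x := hk.mul (hf b)
    have e : (fun y => ∑ b ∈ insert b s, k b * f b y) =
        ((fun _ : M => k b) * f b) + fun y => ∑ b ∈ s, k b * f b y := by
      funext y
      simp [Finset.sum_insert hb]
    rw [e]
    refine ⟨h1.add ih.1, ?_⟩
    rw [dirDeriv_add W h1 ih.1, ih.2, dirDeriv_mul W hk (hf b), dirDeriv_const,
      Finset.sum_insert hb]
    ring

namespace SpinStructure

variable {i : ι} {V : Set M}

/-- An open set on which the spin frame with index `i` and some chart are defined. -/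
structure IsPatch (S : SpinStructure g ι) (i : ι) (V : Set M) : Prop where
  isOpen : IsOpen V
  subset : V ⊆ S.U i
  -- Coordinate functions smooth on all of `V` supply the test functions for `separating`.
  chart : ∃ x₀ : M, V ⊆ (chartAt (EuclideanSpace ℝ (Fin 4)) x₀).source

lemma frameDeriv_nablaFun (hV : IsOpen V) (hVU : V ⊆ S.U i) (a : Fin 4) (B B' : Fin 2) {f : M → ℂ}
    (hf : ContMDiffOn (𝓡 4) 𝓘(ℝ, ℂ) ∞ f V) {x : M} (hx : x ∈ V) :
    S.frameDeriv i a (S.nablaFun i B B' f) x =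
      ∑ b, sigma b B B' * S.frameDeriv i a (S.frameDeriv i b f) x :=
  (dirDeriv_sum_mul Finset.univ (fun b => sigma b B B') (f := fun b => S.frameDeriv i b f) (S.e i a)
    fun b => ((S.contMDiffOn_frameDeriv hV hVU b hf).contMDiffAt
      (hV.mem_nhds hx)).mdifferentiableAt (by simp)).2

lemma frameDeriv_spinCoeff (hV : IsOpen V) (hVU : V ⊆ S.U i) (a : Fin 4) (B B' C E : Fin 2)
    {x : M} (hx : x ∈ V) :
    S.frameDeriv i a (S.spinCoeff i B B' C E) x =
      ∑ b, sigma b B B' * S.frameDeriv i a (S.spinConn i b C E) x :=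
  (dirDeriv_sum_mul Finset.univ (fun b => sigma b B B') (f := fun b => S.spinConn i b C E) (S.e i a)
    fun b => ((S.contMDiffOn_spinConn hV hVU b C E).contMDiffAt
      (hV.mem_nhds hx)).mdifferentiableAt (by simp)).2

lemma spinCoeff_trace (i : ι) (A A' : Fin 2) (x : M) :
    S.spinCoeff i A A' 1 1 x = -S.spinCoeff i A A' 0 0 x := by
  simp only [spinCoeff, spinConn_eq, ← Finset.sum_neg_distrib]
  refine Finset.sum_congr rfl fun a _ => ?_
  rw [spinLift_trace fun b c => S.leviCivita_antisymm i a b c x]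
  ring

lemma spinCoeff_vector (i : ι) (A A' B B' : Fin 2) (x : M) (w : Fin 4 → ℂ) :
    ∑ X, S.spinCoeff i A A' B X x * ∑ c, sigma c X B' * w c
      + ∑ X, star (S.spinCoeff i A' A B' X x) * ∑ c, sigma c B X * w c =
    ∑ a, ∑ b, sigma a A A' * sigma b B B' * ∑ c, ∑ d,
      ((eta c d * S.leviCivita i a b d x : ℝ) : ℂ) * w c := by
  have h := fun a => spinLift_vector (fun b c => S.leviCivita_antisymm i a b c x) w B B'
  have e : ∀ a : Fin 4, ∑ b, sigma a A A' * sigma b B B' * ∑ c, ∑ d,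
      ((eta c d * S.leviCivita i a b d x : ℝ) : ℂ) * w c = sigma a A A' *
      ∑ b, sigma b B B' * ∑ c, ∑ d, ((eta c d * S.leviCivita i a b d x : ℝ) : ℂ) * w c := fun a => by
    rw [Finset.mul_sum]
    exact Finset.sum_congr rfl fun b _ => by ring
  simp only [e, ← h]
  simp only [spinCoeff, spinConn_eq, star_sum, star_mul', sigma_star, mul_add,
    Finset.sum_add_distrib]
  congr 1 <;>
  · simp only [Finset.sum_mul]
    rw [Finset.sum_comm]
    refine Finset.sum_congr rfl fun a _ => ?_
    rw [Finset.mul_sum]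
    exact Finset.sum_congr rfl fun X _ => by ring

/-- Vanishing torsion in spinor form. The array `w` is arbitrary so that the formula serves both for
derivatives of functions and for the bracket term of the curvature. -/
lemma sum_bracket (i : ι) (A A' B B' : Fin 2) (x : M) (w : Fin 4 → ℂ) :
    (∑ X, S.spinCoeff i A A' B X x * ∑ c, sigma c X B' * w c
      + ∑ X, star (S.spinCoeff i A' A B' X x) * ∑ c, sigma c B X * w c)
    - (∑ X, S.spinCoeff i B B' A X x * ∑ c, sigma c X A' * w c
      + ∑ X, star (S.spinCoeff i B' B A' X x) * ∑ c, sigma c A X * w c) =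
    ∑ a, ∑ b, sigma a A A' * sigma b B B' * ∑ c, ∑ d,
      ((eta c d * S.bracket i a b d x : ℝ) : ℂ) * w c := by
  rw [spinCoeff_vector, spinCoeff_vector, Finset.sum_comm (f := fun a b => sigma a B B' * _ * _)]
  simp only [← Finset.sum_sub_distrib]
  refine Finset.sum_congr rfl fun a _ => Finset.sum_congr rfl fun b _ => ?_
  rw [mul_comm (sigma b B B'), ← mul_sub]
  simp only [← Finset.sum_sub_distrib]
  congr 1
  refine Finset.sum_congr rfl fun c _ => Finset.sum_congr rfl fun d _ => ?_
  rw [← leviCivita_torsion]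
  push_cast
  ring

/-- The spin calculus on a patch. -/
def IsPatch.calculus (p : S.IsPatch i V) : SpinCalculus (smoothRing V) where
  D := S.nablaDer p.isOpen p.subset
  γ A A' B C := toRing (S.spinCoeff i A A' B C) (S.contMDiffOn_spinCoeff p.isOpen p.subset A A' B C)
  -- The Pauli matrices are Hermitian, so conjugation exchanges the two indices of the derivative.
  γ' A A' B C := toRing (fun x => star (S.spinCoeff i A' A B C x))
    (ContMDiffOn.star (S.contMDiffOn_spinCoeff p.isOpen p.subset A' A B C))
  trace A A' := ext_evalAt fun x => by
    rw [map_neg, evalAt_toRing, evalAt_toRing, spinCoeff_trace i A A' (x : M)]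
  trace' A A' := ext_evalAt fun x => by
    rw [map_neg, evalAt_toRing, evalAt_toRing, spinCoeff_trace i A' A (x : M), star_neg]
  torsion A A' B B' f := by
    refine ext_evalAt fun x => ?_
    have h2 : ∀ A A' B B', evalAt x (S.nablaDer p.isOpen p.subset A A'
        (S.nablaDer p.isOpen p.subset B B' f)) = ∑ a, ∑ b, sigma a A A' * sigma b B B' *
          S.frameDeriv i a (S.frameDeriv i b (extend f.1)) x := by
      intro A A' B B'
      refine (S.nablaFun_congr p.isOpen (extend_eqOn (V := V) (S.nablaFun i B B' (extend f.1)))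
        x.2).trans ?_
      unfold nablaFun
      refine Finset.sum_congr rfl fun a _ => ?_
      have := frameDeriv_nablaFun p.isOpen p.subset a B B' f.2 x.2
      unfold nablaFun at this
      rw [this, Finset.mul_sum]
      exact Finset.sum_congr rfl fun b _ => by ring
    have h3 := sum_bracket (S := S) i A A' B B' (x : M) (fun c => S.frameDeriv i c (extend f.1) x)
    have h4 : ∑ a, ∑ b, sigma a A A' * sigma b B B' *
          S.frameDeriv i a (S.frameDeriv i b (extend f.1)) x - ∑ a, ∑ b, sigma a B B' * sigma b A A' *
          S.frameDeriv i a (S.frameDeriv i b (extend f.1)) x = ∑ a, ∑ b, sigma a A A' * sigma b B B' *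
          ∑ c, ∑ d, ((eta c d * S.bracket i a b d x : ℝ) : ℂ) * S.frameDeriv i c (extend f.1) x := by
      rw [Finset.sum_comm (f := fun a b => sigma a B B' * _ * _)]
      simp only [← Finset.sum_sub_distrib]
      refine Finset.sum_congr rfl fun a _ => Finset.sum_congr rfl fun b _ => ?_
      rw [mul_comm (sigma b B B'), ← mul_sub, S.frameDeriv_comm p.isOpen p.subset a b f.2 x.2]
    simp only [map_sub, map_sum, map_mul, h2, evalAt_toRing, evalAt_nablaDer]
    unfold nablaFun
    linear_combination h4 - h3
  separating v h := by
    obtain ⟨x₀, hc⟩ := p.chart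
    have key : ∀ x : V, ∀ A A', evalAt x (v A A') = 0 := by
      intro x
      have h0 := S.eq_zero_of_frameDeriv p.subset hc x.2
        (c := fun a => ∑ A, ∑ A', evalAt x (v A A') * sigma a A A') (fun f hf => by
          have h1 := congrArg (evalAt x) (h (toRing f hf))
          simp only [map_sum, map_mul, map_zero, evalAt_nablaDer_toRing] at h1
          rw [← h1]
          simp only [nablaFun, Fin.sum_univ_two, Fin.sum_univ_four]
          ring)
      have e0 := h0 0
      have e1 := h0 1
      have e2 := h0 2
      have e3 := h0 3
      have s2 := inv_sqrt_two_sq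
      clear h0
      simp only [sigma] at e0 e1 e2 e3
      generalize ((Real.sqrt 2 : ℝ) : ℂ)⁻¹ = s at *
      have I2 := Complex.I_sq
      simp [Fin.sum_univ_two] at e0 e1 e2 e3
      simp only [Fin.forall_fin_two]
      -- The four equations are inverted with the Pauli matrices, using 2s² = 1 for the
      -- normalization s.
      refine ⟨⟨?_, ?_⟩, ?_, ?_⟩
      · linear_combination s * e0 + s * e3 - 2 * evalAt x (v 0 0) * s2
      · linear_combination s * e1 + s * Complex.I * e2 - 2 * evalAt x (v 0 1) * s2
          + s ^ 2 * (evalAt x (v 0 1) - evalAt x (v 1 0)) * I2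
      · linear_combination s * e1 - s * Complex.I * e2 - 2 * evalAt x (v 1 0) * s2
          + s ^ 2 * (evalAt x (v 1 0) - evalAt x (v 0 1)) * I2
      · linear_combination s * e0 - s * e3 - 2 * evalAt x (v 1 1) * s2
    intro A A'
    exact ext_evalAt fun x => by rw [key x, map_zero]
  sixth := toRing (fun _ => 1 / 6) contMDiffOn_const
  six_mul_sixth := ext_evalAt fun x => by
    rw [map_mul, evalAt_toRing, map_ofNat, map_one]
    norm_num

end SpinStructure

end Patch

/-! ### Curvature spinors on a patch -/

lemma eps_eq_ep (A B : Fin 2) : eps A B = ep A B := by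
  revert A B
  simp [Fin.forall_fin_two]

@[simp] lemma map_ep {R R' : Type*} [CommRing R] [CommRing R'] (f : R →+* R') (A B : Fin 2) :
    f (ep A B) = ep A B := by
  revert A B
  simp [Fin.forall_fin_two]

/-- Reindexing the sum by a transposition changes its sign. -/
lemma sum_perm_eq_zero {k : ℕ} (h : (Fin k → Fin 2) → ℂ) (p q : Fin k)
    (hh : ∀ A, h (A ∘ Equiv.swap p q) = -h A) (A : Fin k → Fin 2) :
    ∑ s : Equiv.Perm (Fin k), h (A ∘ s) = 0 := by
  have e := Equiv.sum_comp (Equiv.mulRight (Equiv.swap p q))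
    (fun s : Equiv.Perm (Fin k) => h (A ∘ s))
  have e2 : ∀ s : Equiv.Perm (Fin k), h (A ∘ (Equiv.mulRight (Equiv.swap p q) s)) = -h (A ∘ s) :=
    fun s => hh (A ∘ s)
  simp only [e2, Finset.sum_neg_distrib] at e
  linear_combination (-1 / 2) * e

lemma symU_of_symm {k l : ℕ} {φ : Comp k l} (h : ∀ A A' (s : Equiv.Perm (Fin k)), φ (A ∘ s) A' = φ A A') :
    symU φ = φ := by
  funext A A'
  have : (k.factorial : ℂ) ≠ 0 := by exact_mod_cast k.factorial_ne_zero
  simp [symU, h, Fintype.card_perm, this]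

lemma symU_add {k l : ℕ} (φ ψ : Comp k l) : symU (φ + ψ) = symU φ + symU ψ := by
  funext A A'
  simp [symU, Finset.sum_add_distrib, mul_add]

section Patch

variable {M : Type*} [TopologicalSpace M] [ChartedSpace (EuclideanSpace ℝ (Fin 4)) M]
  [IsManifold (𝓡 4) ∞ M] {g : LorentzMetric M} {ι : Type*} {S : SpinStructure g ι}

namespace SpinStructure

variable {i : ι} {V : Set M}

namespace IsPatch

variable (p : S.IsPatch i V)

lemma eval_γ (A A' B C : Fin 2) (x : V) :
    evalAt x (p.calculus.γ A A' B C) = S.spinCoeff i A A' B C x := rfl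

lemma eval_γ' (A A' B C : Fin 2) (x : V) :
    evalAt x (p.calculus.γ' A A' B C) = star (S.spinCoeff i A' A B C x) := rfl

lemma eval_D (A A' : Fin 2) {f : M → ℂ} (hf : ContMDiffOn (𝓡 4) 𝓘(ℝ, ℂ) ∞ f V) (x : V) :
    evalAt x (p.calculus.D A A' (toRing f hf)) = S.nablaFun i A A' f x :=
  evalAt_nablaDer_toRing S p.isOpen p.subset A A' x hf

lemma eval_sixth (x : V) : evalAt x p.calculus.sixth = 1 / 6 := rfl

/-- The calculus subtracts connection terms on the derivative indices where `spinCurv` subtracts the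
bracket; `sum_bracket` identifies the two. -/
lemma eval_curv (A A' B B' P E : Fin 2) (x : V) :
    evalAt x (p.calculus.curv A A' B B' P E) =
      ∑ a, ∑ b, sigma a A A' * sigma b B B' * S.spinCurv i a b P E x := by
  have h1 := sum_bracket (S := S) i A A' B B' (x : M) (fun c => S.spinConn i c P E x)
  have h2 : ∀ A A' B B' : Fin 2, evalAt x (p.calculus.D A A' (p.calculus.γ B B' P E)) =
      ∑ a, ∑ b, sigma a A A' * sigma b B B' * S.frameDeriv i a (S.spinConn i b P E) x := by
    intro A A' B B'
    refine (p.eval_D A A' (S.contMDiffOn_spinCoeff p.isOpen p.subset B B' P E) x).trans ?_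
    unfold nablaFun
    refine Finset.sum_congr rfl fun a _ => ?_
    rw [frameDeriv_spinCoeff p.isOpen p.subset a B B' P E x.2, Finset.mul_sum]
    exact Finset.sum_congr rfl fun b _ => by ring
  have h3 : ∑ a, ∑ b, sigma a B B' * sigma b A A' * S.frameDeriv i a (S.spinConn i b P E) x =
      ∑ a, ∑ b, sigma a A A' * sigma b B B' * S.frameDeriv i b (S.spinConn i a P E) x := by
    rw [Finset.sum_comm]
    exact Finset.sum_congr rfl fun a _ => Finset.sum_congr rfl fun b _ => by ring
  have h4 : ∀ Q, S.spinCoeff i B B' P Q x * S.spinCoeff i A A' Q E x =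
      ∑ a, ∑ b, sigma a A A' * sigma b B B' * (S.spinConn i b P Q x * S.spinConn i a Q E x) := by
    intro Q
    unfold spinCoeff
    rw [mul_comm, Finset.sum_mul_sum]
    exact Finset.sum_congr rfl fun a _ => Finset.sum_congr rfl fun b _ => by ring
  have h5 : ∀ Q, S.spinCoeff i A A' P Q x * S.spinCoeff i B B' Q E x =
      ∑ a, ∑ b, sigma a A A' * sigma b B B' * (S.spinConn i a P Q x * S.spinConn i b Q E x) := by
    intro Q
    unfold spinCoeff
    rw [Finset.sum_mul_sum]
    exact Finset.sum_congr rfl fun a _ => Finset.sum_congr rfl fun b _ => by ring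
  have h6 : ∑ Q, (S.spinCoeff i B B' P Q x * S.spinCoeff i A A' Q E x
      - S.spinCoeff i A A' P Q x * S.spinCoeff i B B' Q E x) =
      ∑ a, ∑ b, sigma a A A' * sigma b B B' * ∑ Q, (S.spinConn i b P Q x * S.spinConn i a Q E x
        - S.spinConn i a P Q x * S.spinConn i b Q E x) := by
    simp only [h4, h5, Fin.sum_univ_two, ← Finset.sum_sub_distrib, ← Finset.sum_add_distrib]
    exact Finset.sum_congr rfl fun a _ => Finset.sum_congr rfl fun b _ => by ring
  simp only [SpinCalculus.curv, map_sub, map_add, map_sum, map_mul, h2, h3, eval_γ, eval_γ', h6]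
  simp only [← sub_sub] at h1 ⊢
  have h7 : ∑ a, ∑ b, sigma a A A' * sigma b B B' * S.spinCurv i a b P E x =
      ∑ a, ∑ b, sigma a A A' * sigma b B B' * S.frameDeriv i a (S.spinConn i b P E) x
      - ∑ a, ∑ b, sigma a A A' * sigma b B B' * S.frameDeriv i b (S.spinConn i a P E) x
      + ∑ a, ∑ b, sigma a A A' * sigma b B B' * ∑ Q, (S.spinConn i b P Q x * S.spinConn i a Q E x
        - S.spinConn i a P Q x * S.spinConn i b Q E x)
      - ∑ a, ∑ b, sigma a A A' * sigma b B B' * ∑ c, ∑ d,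
          ((eta c d * S.bracket i a b d x : ℝ) : ℂ) * S.spinConn i c P E x := by
    simp only [← Finset.sum_sub_distrib, ← Finset.sum_add_distrib]
    refine Finset.sum_congr rfl fun a _ => Finset.sum_congr rfl fun b _ => ?_
    rw [spinCurv]
    ring
  rw [h7, ← h1]
  unfold spinCoeff
  ring

lemma eval_curvLow (A A' B B' P Q : Fin 2) (x : V) :
    evalAt x (p.calculus.curvLow A A' B B' P Q) = S.spinCurvLow i A A' B B' P Q x := by
  simp only [SpinCalculus.curvLow, map_sum, map_mul, eval_curv, map_ep, spinCurvLow, eps_eq_ep,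
    Finset.sum_mul]
  rw [Finset.sum_comm]
  exact Finset.sum_congr rfl fun a _ => Finset.sum_comm

lemma curvX_eq (A : Fin 4 → Fin 2) (v : Fin 0 → Fin 2) (x : V) :
    S.curvX i x A v = evalAt x (p.calculus.psi (∑ r, (A r : ℕ))) + evalAt x p.calculus.lam *
      (eps (A 0) (A 2) * eps (A 1) (A 3) + eps (A 0) (A 3) * eps (A 1) (A 2)) := by
  have h := p.calculus.two_mul_X2 (A 0) (A 1) (A 2) (A 3)
  have h1 := congrArg (evalAt x) h
  rw [map_mul, map_add, map_mul, map_ofNat, map_add, map_mul, map_mul] at h1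
  have h2 : S.curvX i x A v = (1 / 2) * evalAt x (p.calculus.X2 (A 0) (A 1) (A 2) (A 3)) := by
    simp only [SpinCalculus.X2, map_sum, map_mul, eval_curvLow, map_ep, curvX, eps_eq_ep]
  rw [h2, h1, Fin.sum_univ_four]
  simp only [map_ep, eps_eq_ep]
  ring

/-- The two products of ε in the Λ part of X are skew under the transpositions (0 2) and (0 3)
respectively, so symmetrization kills them. -/
lemma Psi_eq (A : Fin 4 → Fin 2) (v : Fin 0 → Fin 2) (x : V) :
    S.Psi i x A v = evalAt x (p.calculus.psi (∑ r, (A r : ℕ))) := by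
  have hX : S.curvX i x = (fun A _ => evalAt x (p.calculus.psi (∑ r, (A r : ℕ)))) +
      fun A _ => evalAt x p.calculus.lam *
      (eps (A 0) (A 2) * eps (A 1) (A 3) + eps (A 0) (A 3) * eps (A 1) (A 2)) := by
    funext A v
    exact p.curvX_eq A v x
  have e : ∀ A B, eps A B = -eps B A := fun A B => by
    simp only [eps_eq_ep]
    revert A B; simp [Fin.forall_fin_two]
  unfold Psi
  rw [hX, symU_add, symU_of_symm (φ := fun A _ => evalAt x (p.calculus.psi (∑ r, (A r : ℕ))))
    (fun A A' s => by
      simp only [Function.comp_apply, Equiv.sum_comp s (fun r => (A r : ℕ))])]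
  simp only [Pi.add_apply, symU, mul_add, Finset.sum_add_distrib]
  have h1 := sum_perm_eq_zero (fun A : Fin 4 → Fin 2 => evalAt x p.calculus.lam *
    (eps (A 0) (A 2) * eps (A 1) (A 3))) 0 2 (fun A => by
      have a0 : Equiv.swap (0 : Fin 4) 2 0 = 2 := by decide
      have a1 : Equiv.swap (0 : Fin 4) 2 1 = 1 := by decide
      have a2 : Equiv.swap (0 : Fin 4) 2 2 = 0 := by decide
      have a3 : Equiv.swap (0 : Fin 4) 2 3 = 3 := by decide
      simp only [Function.comp_apply, a0, a1, a2, a3]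
      rw [e (A 2) (A 0)]; ring) A
  have h2 := sum_perm_eq_zero (fun A : Fin 4 → Fin 2 => evalAt x p.calculus.lam *
    (eps (A 0) (A 3) * eps (A 1) (A 2))) 0 3 (fun A => by
      have a0 : Equiv.swap (0 : Fin 4) 3 0 = 3 := by decide
      have a1 : Equiv.swap (0 : Fin 4) 3 1 = 1 := by decide
      have a2 : Equiv.swap (0 : Fin 4) 3 2 = 2 := by decide
      have a3 : Equiv.swap (0 : Fin 4) 3 3 = 0 := by decide
      simp only [Function.comp_apply, a0, a1, a2, a3]
      rw [e (A 3) (A 0)]; ring) A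
  rw [h1, h2]
  ring

lemma Phi_eq (A A' : Fin 2 → Fin 2) (x : V) :
    S.Phi i x A A' = evalAt x (p.calculus.phi (A 0 + A 1) (A' 0 + A' 1)) := by
  have h := congrArg (evalAt x) (p.calculus.two_mul_phi (A 0) (A 1) (A' 0) (A' 1))
  rw [map_mul, map_ofNat] at h
  have h2 : S.Phi i x A A' = (1 / 2) * evalAt x (p.calculus.Phi2 (A 0) (A 1) (A' 0) (A' 1)) := by
    simp only [SpinCalculus.Phi2, map_sum, map_mul, eval_curvLow, map_ep, Phi, eps_eq_ep]
  rw [h2, h]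
  ring

end IsPatch

end SpinStructure

end Patch

/-! ### Homomorphisms of spin calculi -/

namespace SpinCalculus

section Hom

variable {R R' : Type*} [CommRing R] [CommRing R'] {C : SpinCalculus R} {C' : SpinCalculus R'}
  {θ : R →+* R'}

/-- A ring homomorphism is compatible with two spin calculi. -/
structure IsHom (C : SpinCalculus R) (C' : SpinCalculus R') (θ : R →+* R') : Prop where
  map_D : ∀ A A' f, θ (C.D A A' f) = C'.D A A' (θ f)
  map_γ : ∀ A A' B E, θ (C.γ A A' B E) = C'.γ A A' B E
  map_γ' : ∀ A A' B E, θ (C.γ' A A' B E) = C'.γ' A A' B E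
  map_sixth : θ C.sixth = C'.sixth

namespace IsHom

lemma map_curvLow (h : C.IsHom C' θ) (A A' B B' P Q : Fin 2) :
    θ (C.curvLow A A' B B' P Q) = C'.curvLow A A' B B' P Q := by
  simp only [curvLow, curv, map_sum, map_mul, map_sub, map_add, h.map_D, h.map_γ, h.map_γ', map_ep]

lemma map_psi (h : C.IsHom C' θ) (n : ℕ) : θ (C.psi n) = C'.psi n := by
  rcases n with _ | _ | _ | _ | n <;>
  simp only [psi, X2, map_sum, map_mul, map_add, h.map_curvLow, h.map_sixth, map_ep, map_ofNat]

lemma map_phi (h : C.IsHom C' θ) (m n : ℕ) : θ (C.phi m n) = C'.phi m n := by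
  simp only [phi, Phi2, map_sum, map_mul, map_add, h.map_curvLow, h.map_sixth, map_ep, map_ofNat]

lemma map_lam (h : C.IsHom C' θ) : θ C.lam = C'.lam := by
  simp only [lam, X2, map_sum, map_mul, map_sub, h.map_curvLow, h.map_sixth, map_ep]

lemma map_n11 (h : C.IsHom C' θ) (φ : Fin 2 → Fin 2 → R) (A A' B B' : Fin 2) :
    θ (C.n11 φ A A' B B') = C'.n11 (fun A A' => θ (φ A A')) A A' B B' := by
  simp only [n11, map_sum, map_mul, map_sub, h.map_D, h.map_γ, h.map_γ']

lemma map_n20 (h : C.IsHom C' θ) (φ : Fin 2 → Fin 2 → R) (A A' B E : Fin 2) :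
    θ (C.n20 φ A A' B E) = C'.n20 (fun A A' => θ (φ A A')) A A' B E := by
  simp only [n20, map_sum, map_mul, map_sub, h.map_D, h.map_γ]

lemma isCKV (h : C.IsHom C' θ) {ξ F F' : Fin 2 → Fin 2 → R} {d : R} (hξ : C.IsCKV ξ F F' d) :
    C'.IsCKV (fun A A' => θ (ξ A A')) (fun A B => θ (F A B)) (fun A B => θ (F' A B)) (θ d) where
  eqn A A' B B' := by
    rw [← h.map_n11, hξ.eqn]
    simp only [map_mul, map_add, map_ep, map_ofNat]
  symm := congrArg θ hξ.symm
  symm' := congrArg θ hξ.symm'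

lemma isKS20 (h : C.IsHom C' θ) {κ η : Fin 2 → Fin 2 → R} (hκ : C.IsKS20 κ η) :
    C'.IsKS20 (fun A B => θ (κ A B)) (fun A A' => θ (η A A')) where
  eqn A A' B E := by
    rw [← h.map_n20, hκ.eqn]
    simp only [map_mul, map_add, map_ep]
  symm := congrArg θ hκ.symm

lemma isTau (h : C.IsHom C' θ) {κ η : Fin 2 → Fin 2 → R} {τ : ℕ → R} (hτ : C.IsTau κ η τ) :
    C'.IsTau (fun A B => θ (κ A B)) (fun A A' => θ (η A A')) (fun n => θ (τ n)) := by
  intro A A' B B'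
  have e := congrArg θ (hτ A A' B B')
  simpa only [map_sum, map_mul, map_sub, map_add, map_neg, map_ofNat, map_ep, h.map_n11, h.map_phi,
    h.map_psi, h.map_lam] using e

lemma map_omega (h : C.IsHom C' θ) (ξ : Fin 2 → Fin 2 → R) (d : R) (A A' : Fin 2) :
    θ (C.omega ξ d A A') = C'.omega (fun A A' => θ (ξ A A')) (θ d) A A' := by
  simp only [omega, map_sub, map_mul, h.map_D, h.map_lam]

end IsHom

end Hom

end SpinCalculus

/-! ### Complex conjugation and restriction as homomorphisms -/

section Patch

variable {M : Type*} [TopologicalSpace M] [ChartedSpace (EuclideanSpace ℝ (Fin 4)) M]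
  [IsManifold (𝓡 4) ∞ M] {g : LorentzMetric M} {ι : Type*} {S : SpinStructure g ι}

lemma extend_star {V : Set M} (f : V → ℂ) : extend (fun x => star (f x)) = fun x => star (extend f x) := by
  funext x
  by_cases hx : x ∈ V <;> simp [extend, hx]

/-- Complex conjugation of smooth functions. -/
def conjRing (V : Set M) : smoothRing V →+* smoothRing V where
  toFun f := ⟨fun x => star (f.1 x), by
    have := ContMDiffOn.star f.2
    rw [← extend_star] at this
    exact this⟩
  map_one' := ext_evalAt fun x => star_one ℂ
  map_mul' f h := ext_evalAt fun x => star_mul' (f.1 x) (h.1 x)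
  map_zero' := ext_evalAt fun x => star_zero ℂ
  map_add' f h := ext_evalAt fun x => star_add (f.1 x) (h.1 x)

lemma evalAt_conjRing {V : Set M} (f : smoothRing V) (x : V) :
    evalAt x (conjRing V f) = star (evalAt x f) := rfl

lemma extend_res {V W : Set M} (hW : W ⊆ V) (f : V → ℂ) :
    Set.EqOn (extend (fun x : W => f ⟨x, hW x.2⟩)) (extend f) W := fun x hx => by
  rw [extend_apply _ hx, extend_apply _ (hW hx)]

/-- Restriction of smooth functions. -/
def resRing {V W : Set M} (hW : W ⊆ V) : smoothRing V →+* smoothRing W where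
  toFun f := ⟨fun x => f.1 ⟨x, hW x.2⟩, (ContMDiffOn.mono (s := V) f.2 hW).congr (extend_res hW f.1)⟩
  map_one' := rfl
  map_mul' f h := rfl
  map_zero' := rfl
  map_add' f h := rfl

namespace SpinStructure

lemma nablaFun_star (i : ι) (A A' : Fin 2) {f : M → ℂ} {x : M}
    (hf : MDifferentiableAt (𝓡 4) 𝓘(ℝ, ℂ) f x) :
    S.nablaFun i A A' (fun y => star (f y)) x = star (S.nablaFun i A' A f x) := by
  simp only [nablaFun, star_sum, star_mul', sigma_star]
  refine Finset.sum_congr rfl fun a _ => congrArg _ ?_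
  rw [frameDeriv_eq, dirDeriv_star _ hf]
  rfl

variable {i : ι} {V W : Set M}

namespace IsPatch

/-- Since the Pauli matrices are Hermitian, conjugation exchanges primed and unprimed indices. All
that is proved for κ thereby holds for its conjugate in the swapped calculus. -/
lemma isHom_conj (p : S.IsPatch i V) : p.calculus.IsHom p.calculus.swap (conjRing V) where
  map_D A A' f := ext_evalAt fun x => by
    rw [evalAt_conjRing]
    have h2 : MDifferentiableAt (𝓡 4) 𝓘(ℝ, ℂ) (extend f.1) (x : M) :=
      (ContMDiffOn.contMDiffAt f.2 (p.isOpen.mem_nhds x.2)).mdifferentiableAt (by simp)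
    have h1 := nablaFun_star (S := S) i A' A h2
    rw [← extend_star] at h1
    exact h1.symm
  map_γ A A' B E := rfl
  map_γ' A A' B E := ext_evalAt fun x => star_star _
  map_sixth := ext_evalAt fun x => by
    rw [evalAt_conjRing, eval_sixth]
    exact (by simp : star (1 / 6 : ℂ) = 1 / 6)

lemma isHom_res (p : S.IsPatch i V) (p' : S.IsPatch i W) (hW : W ⊆ V) :
    p.calculus.IsHom p'.calculus (resRing hW) where
  map_D A A' f := ext_evalAt fun x =>
    (S.nablaFun_congr p'.isOpen (extend_res hW f.1) x.2).symm
  map_γ A A' B E := rfl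
  map_γ' A A' B E := rfl
  map_sixth := rfl

lemma PsiBar_eq (p : S.IsPatch i V) (v : Fin 0 → Fin 2) (A : Fin 4 → Fin 2) (x : V) :
    S.PsiBar i x v A = evalAt x (p.calculus.swap.psi (∑ r, (A r : ℕ))) := by
  rw [PsiBar, bar, p.Psi_eq, ← p.isHom_conj.map_psi]
  rfl

end IsPatch

end SpinStructure

end Patch

/-! ### Reduction of symmetrizations to transpositions -/

section Symmetrization

lemma decomposeFin_symm_mul {k : ℕ} (p : Fin (k + 1)) (s : Equiv.Perm (Fin k)) :
    Equiv.Perm.decomposeFin.symm (p, s) =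
      Equiv.swap 0 p * Equiv.Perm.decomposeFin.symm ((0 : Fin (k + 1)), s) := by
  ext r
  refine Fin.cases ?_ (fun r => ?_) r
  · simp [Equiv.Perm.decomposeFin_symm_apply_zero]
  · simp [Equiv.Perm.decomposeFin_symm_apply_succ]

lemma comp_decomposeFin {k : ℕ} {α : Type*} (A : Fin (k + 1) → α) (s : Equiv.Perm (Fin k)) :
    A ∘ Equiv.Perm.decomposeFin.symm ((0 : Fin (k + 1)), s) = Fin.cons (A 0) (Fin.tail A ∘ s) := by
  funext r
  refine Fin.cases ?_ (fun r => ?_) r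
  · simp [Equiv.Perm.decomposeFin_symm_apply_zero]
  · simp [Equiv.Perm.decomposeFin_symm_apply_succ, Fin.tail]

/-- The sum over all permutations of a function that is symmetric in all but its first argument. -/
lemma sum_perm_succ {k : ℕ} (h : (Fin (k + 1) → Fin 2) → ℂ)
    (hh : ∀ a A (s : Equiv.Perm (Fin k)), h (Fin.cons a (A ∘ s)) = h (Fin.cons a A))
    (A : Fin (k + 1) → Fin 2) :
    (((k + 1).factorial : ℂ))⁻¹ * ∑ s : Equiv.Perm (Fin (k + 1)), h (A ∘ s) =
      ((k : ℂ) + 1)⁻¹ * ∑ p, h (A ∘ Equiv.swap 0 p) := by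
  -- Every permutation is a transposition of 0 with `p` composed with a permutation fixing 0, and
  -- the latter does not affect `h`.
  have e : ∀ p (s : Equiv.Perm (Fin k)), h (A ∘ Equiv.Perm.decomposeFin.symm (p, s)) =
      h (A ∘ Equiv.swap 0 p) := by
    intro p s
    rw [decomposeFin_symm_mul, Equiv.Perm.coe_mul, ← Function.comp_assoc, comp_decomposeFin, hh,
      Fin.cons_self_tail]
  rw [← Equiv.sum_comp Equiv.Perm.decomposeFin.symm, Fintype.sum_prod_type]
  simp only [e, Finset.sum_const, Finset.card_univ, Fintype.card_perm, Fintype.card_fin,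
    nsmul_eq_mul, ← Finset.mul_sum]
  have h1 : (k.factorial : ℂ) ≠ 0 := by exact_mod_cast k.factorial_ne_zero
  have h2 : (k : ℂ) + 1 ≠ 0 := by exact_mod_cast k.succ_ne_zero
  rw [Nat.factorial_succ]
  push_cast
  field_simp

lemma symU_succ {k l : ℕ} {φ : Comp (k + 1) l}
    (hh : ∀ a A A' (s : Equiv.Perm (Fin k)), φ (Fin.cons a (A ∘ s)) A' = φ (Fin.cons a A) A')
    (A : Fin (k + 1) → Fin 2) (A' : Fin l → Fin 2) :
    symU φ A A' = ((k : ℂ) + 1)⁻¹ * ∑ p, φ (A ∘ Equiv.swap 0 p) A' :=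
  sum_perm_succ (fun A => φ A A') (fun a A s => hh a A A' s) A

lemma symP_succ {k l : ℕ} {φ : Comp k (l + 1)}
    (hh : ∀ a A A' (s : Equiv.Perm (Fin l)), φ A (Fin.cons a (A' ∘ s)) = φ A (Fin.cons a A'))
    (A : Fin k → Fin 2) (A' : Fin (l + 1) → Fin 2) :
    symP φ A A' = ((l : ℂ) + 1)⁻¹ * ∑ p, φ A (A' ∘ Equiv.swap 0 p) :=
  sum_perm_succ (fun A' => φ A A') (fun a A' s => hh a A A' s) A'

variable {N : Type*} [AddCommMonoid N] {α : Type*}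

lemma sum_swap_two (G : (Fin 2 → α) → N) (A : Fin 2 → α) : ∑ p, G (A ∘ Equiv.swap 0 p) =
    G ![A 0, A 1] + G ![A 1, A 0] := by
  rw [Fin.sum_univ_two]
  congr 2 <;> funext r <;> fin_cases r <;> rfl

lemma sum_swap_three (G : (Fin 3 → α) → N) (A : Fin 3 → α) : ∑ p, G (A ∘ Equiv.swap 0 p) =
    G ![A 0, A 1, A 2] + G ![A 1, A 0, A 2] + G ![A 2, A 1, A 0] := by
  have e : ∀ p : Fin 3, A ∘ Equiv.swap 0 p = ![![A 0, A 1, A 2], ![A 1, A 0, A 2],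
      ![A 2, A 1, A 0]] p := by
    intro p
    funext r
    fin_cases p <;> fin_cases r <;> rfl
  simp only [e, Fin.sum_univ_three]
  rfl

lemma sum_swap_four (G : (Fin 4 → α) → N) (A : Fin 4 → α) : ∑ p, G (A ∘ Equiv.swap 0 p) =
    G ![A 0, A 1, A 2, A 3] + G ![A 1, A 0, A 2, A 3] + G ![A 2, A 1, A 0, A 3]
      + G ![A 3, A 1, A 2, A 0] := by
  have e : ∀ p : Fin 4, A ∘ Equiv.swap 0 p = ![![A 0, A 1, A 2, A 3], ![A 1, A 0, A 2, A 3],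
      ![A 2, A 1, A 0, A 3], ![A 3, A 1, A 2, A 0]] p := by
    intro p
    funext r
    fin_cases p <;> fin_cases r <;> rfl
  simp only [e, Fin.sum_univ_four]
  rfl

lemma sum_swap_five (G : (Fin 5 → α) → N) (A : Fin 5 → α) : ∑ p, G (A ∘ Equiv.swap 0 p) =
    G ![A 0, A 1, A 2, A 3, A 4] + G ![A 1, A 0, A 2, A 3, A 4] + G ![A 2, A 1, A 0, A 3, A 4]
      + G ![A 3, A 1, A 2, A 0, A 4] + G ![A 4, A 1, A 2, A 3, A 0] := by
  have e : ∀ p : Fin 5, A ∘ Equiv.swap 0 p = ![![A 0, A 1, A 2, A 3, A 4],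
      ![A 1, A 0, A 2, A 3, A 4], ![A 2, A 1, A 0, A 3, A 4], ![A 3, A 1, A 2, A 0, A 4],
      ![A 4, A 1, A 2, A 3, A 0]] p := by
    intro p
    funext r
    fin_cases p <;> fin_cases r <;> rfl
  simp only [e, Fin.sum_univ_five]
  rfl

end Symmetrization

/-! ### Covariant derivatives and their irreducible parts in components -/

section Patch

variable {M : Type*} [TopologicalSpace M] [ChartedSpace (EuclideanSpace ℝ (Fin 4)) M]
  [IsManifold (𝓡 4) ∞ M] {g : LorentzMetric M} {ι : Type*} {S : SpinStructure g ι}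

namespace SpinStructure

lemma update_comp_perm {k : ℕ} {α : Type*} (A : Fin k → α) (s : Equiv.Perm (Fin k)) (r : Fin k) (a : α) :
    Function.update (A ∘ s) r a = Function.update A (s r) a ∘ s := by
  funext q
  by_cases hq : q = r
  · subst hq; simp
  · have : s q ≠ s r := fun e => hq (s.injective e)
    simp [Function.update_of_ne, hq, this]

lemma nabla_symm {k l : ℕ} {φ : S.Field k l} (hφ : S.IsSymmetric φ) {i : ι} {x : M} (hx : x ∈ S.U i)
    (a a' : Fin 2) (A : Fin k → Fin 2) (A' : Fin l → Fin 2) (s : Equiv.Perm (Fin k))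
    (s' : Equiv.Perm (Fin l)) :
    S.nabla φ i x (Fin.cons a (A ∘ s)) (Fin.cons a' (A' ∘ s')) =
      S.nabla φ i x (Fin.cons a A) (Fin.cons a' A') := by
  simp only [nabla, Fin.tail_cons, Fin.cons_zero, update_comp_perm]
  rw [S.nablaFun_congr (S.isOpen_U i) (h := fun y => φ i y A A') (fun y hy => hφ i y hy s s' A A') hx]
  have h1 : ∀ B, φ i x (B ∘ s) (A' ∘ s') = φ i x B A' := fun B => hφ i x hx s s' B A'
  have h2 : ∀ B, φ i x (A ∘ s) (B ∘ s') = φ i x A B := fun B => hφ i x hx s s' A B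
  simp only [h1, h2, Function.comp_apply]
  have s1 := Equiv.sum_comp s (fun r => ∑ C, S.spinCoeff i a a' (A r) C x *
    φ i x (Function.update A r C) A')
  have s2 := Equiv.sum_comp s' (fun r => ∑ C, star (S.spinCoeff i a' a (A' r) C x) *
    φ i x A (Function.update A' r C))
  rw [s1, s2]

lemma nabla_symm_left {k l : ℕ} {φ : S.Field k l} (hφ : S.IsSymmetric φ) {i : ι} {x : M}
    (hx : x ∈ S.U i) (a : Fin 2) (A : Fin k → Fin 2) (A' : Fin (l + 1) → Fin 2)
    (s : Equiv.Perm (Fin k)) :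
    S.nabla φ i x (Fin.cons a (A ∘ s)) A' = S.nabla φ i x (Fin.cons a A) A' := by
  have := nabla_symm hφ hx a (A' 0) A (Fin.tail A') s 1
  simpa only [Equiv.Perm.coe_one, Function.comp_id, Fin.cons_self_tail] using this

lemma nabla_symm_right {k l : ℕ} {φ : S.Field k l} (hφ : S.IsSymmetric φ) {i : ι} {x : M}
    (hx : x ∈ S.U i) (a' : Fin 2) (A : Fin (k + 1) → Fin 2) (A' : Fin l → Fin 2)
    (s : Equiv.Perm (Fin l)) :
    S.nabla φ i x A (Fin.cons a' (A' ∘ s)) = S.nabla φ i x A (Fin.cons a' A') := by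
  have := nabla_symm hφ hx (A 0) a' (Fin.tail A) A' 1 s
  simpa only [Equiv.Perm.coe_one, Function.comp_id, Fin.cons_self_tail] using this

/-- Apart from the derivative indices ∇φ is already symmetric, so it suffices to average over the
positions of these. -/
lemma twist_eq {k l : ℕ} {φ : S.Field k l} (hφ : S.IsSymmetric φ) {i : ι} {x : M} (hx : x ∈ S.U i)
    (A : Fin (k + 1) → Fin 2) (A' : Fin (l + 1) → Fin 2) :
    S.twist φ i x A A' = ((k : ℂ) + 1)⁻¹ * (((l : ℂ) + 1)⁻¹ *
      ∑ p, ∑ q, S.nabla φ i x (A ∘ Equiv.swap 0 p) (A' ∘ Equiv.swap 0 q)) := by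
  have h : symP (S.nabla φ i x) = fun A A' => ((l : ℂ) + 1)⁻¹ *
      ∑ q, S.nabla φ i x A (A' ∘ Equiv.swap 0 q) := by
    funext A A'
    exact symP_succ (fun a A A' s => nabla_symm_right hφ hx a A A' s) A A'
  unfold twist
  rw [h, symU_succ (fun a A A' s => by simp only [nabla_symm_left hφ hx]), ← Finset.mul_sum]

lemma curl_eq {k l : ℕ} {φ : S.Field k (l + 1)} (hφ : S.IsSymmetric φ) {i : ι} {x : M}
    (hx : x ∈ S.U i) (A : Fin (k + 1) → Fin 2) (A' : Fin l → Fin 2) :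
    S.curl φ i x A A' = ((k : ℂ) + 1)⁻¹ * ∑ p, tr fun B' C' =>
      S.nabla φ i x (A ∘ Equiv.swap 0 p) (Matrix.vecCons C' (Matrix.vecCons B' A')) :=
  symU_succ (fun a A A' s => by simp only [nabla_symm_left hφ hx]) A A'

lemma curlDagger_eq {k l : ℕ} {φ : S.Field (k + 1) l} (hφ : S.IsSymmetric φ) {i : ι} {x : M}
    (hx : x ∈ S.U i) (A : Fin k → Fin 2) (A' : Fin (l + 1) → Fin 2) :
    S.curlDagger φ i x A A' = ((l : ℂ) + 1)⁻¹ * ∑ p, tr fun B C =>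
      S.nabla φ i x (Matrix.vecCons C (Matrix.vecCons B A)) (A' ∘ Equiv.swap 0 p) :=
  symP_succ (fun a A A' s => by simp only [nabla_symm_right hφ hx]) A A'

variable {i : ι} {V : Set M}

namespace IsPatch

variable (p : S.IsPatch i V)

lemma nablaFun_eq {f : M → ℂ} {h : smoothRing V} (e : ∀ y : V, f y = evalAt y h) (A A' : Fin 2)
    (x : V) : S.nablaFun i A A' f x = evalAt x (p.calculus.D A A' h) :=
  S.nablaFun_congr p.isOpen (fun y hy => (e ⟨y, hy⟩).trans (extend_apply h.1 hy).symm) x.2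

lemma nabla11_eq {φ : S.Field 1 1} {f : Fin 2 → Fin 2 → smoothRing V}
    (e : ∀ (y : V) B B', φ i y ![B] ![B'] = evalAt y (f B B')) (A A' B B' : Fin 2) (x : V) :
    S.nabla φ i x ![A, B] ![A', B'] = evalAt x (p.calculus.n11 f A A' B B') := by
  have h1 : ∀ C : Fin 2, Function.update ![B] 0 C = ![C] := fun C => by
    funext r; fin_cases r; rfl
  have h2 : ∀ C : Fin 2, Function.update ![B'] 0 C = ![C] := fun C => by
    funext r; fin_cases r; rfl
  have t1 : Fin.tail ![A, B] = ![B] := rfl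
  have t2 : Fin.tail ![A', B'] = ![B'] := rfl
  simp only [nabla, SpinCalculus.n11, map_sub, map_add, map_sum, map_mul, eval_γ, eval_γ', t1, t2,
    ← p.nablaFun_eq (f := fun y => φ i y ![B] ![B']) (fun y => e y B B'), ← e, Fin.sum_univ_succ (n := 0), h1, h2]
  simp

lemma nabla20_eq {φ : S.Field 2 0} {f : Fin 2 → Fin 2 → smoothRing V}
    (e : ∀ (y : V) B E, φ i y ![B, E] ![] = evalAt y (f B E)) (A A' B E : Fin 2) (x : V) :
    S.nabla φ i x ![A, B, E] ![A'] = evalAt x (p.calculus.n20 f A A' B E) := by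
  have h1 : ∀ C : Fin 2, Function.update ![B, E] 0 C = ![C, E] := fun C => by
    funext r; fin_cases r <;> rfl
  have h2 : ∀ C : Fin 2, Function.update ![B, E] 1 C = ![B, C] := fun C => by
    funext r; fin_cases r <;> rfl
  have t1 : Fin.tail ![A, B, E] = ![B, E] := rfl
  have t2 : Fin.tail ![A'] = ![] := rfl
  simp only [nabla, SpinCalculus.n20, map_sub, map_add, map_sum, map_mul, eval_γ, eval_γ', t1, t2,
    ← p.nablaFun_eq (f := fun y => φ i y ![B, E] ![]) (fun y => e y B E), ← e, Fin.sum_univ_two, h1, h2]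
  simp
  ring

lemma nabla22_eq {φ : S.Field 2 2} {f : Fin 2 → Fin 2 → Fin 2 → Fin 2 → smoothRing V}
    (e : ∀ (y : V) P P' Q Q', φ i y ![P, Q] ![P', Q'] = evalAt y (f P P' Q Q'))
    (A A' P P' Q Q' : Fin 2) (x : V) :
    S.nabla φ i x ![A, P, Q] ![A', P', Q'] = evalAt x (p.calculus.n22 f A A' P P' Q Q') := by
  have h1 : ∀ B E C : Fin 2, Function.update ![B, E] 0 C = ![C, E] := fun B E C => by
    funext r; fin_cases r <;> rfl
  have h2 : ∀ B E C : Fin 2, Function.update ![B, E] 1 C = ![B, C] := fun B E C => by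
    funext r; fin_cases r <;> rfl
  have t1 : ∀ A B E : Fin 2, Fin.tail ![A, B, E] = ![B, E] := fun _ _ _ => rfl
  simp only [nabla, SpinCalculus.n22, map_sub, map_add, map_sum, map_mul, eval_γ, eval_γ', t1,
    ← p.nablaFun_eq (f := fun y => φ i y ![P, Q] ![P', Q']) (fun y => e y P P' Q Q'), ← e, Fin.sum_univ_two, h1, h2]
  simp
  ring

lemma nabla31_eq {φ : S.Field 3 1} {f : Fin 2 → Fin 2 → Fin 2 → Fin 2 → smoothRing V}
    (e : ∀ (y : V) P P' Q T, φ i y ![P, Q, T] ![P'] = evalAt y (f P P' Q T))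
    (A A' P P' Q T : Fin 2) (x : V) :
    S.nabla φ i x ![A, P, Q, T] ![A', P'] = evalAt x (p.calculus.n31 f A A' P P' Q T) := by
  have h1 : ∀ C : Fin 2, Function.update ![P, Q, T] 0 C = ![C, Q, T] := fun C => by
    funext r; fin_cases r <;> rfl
  have h2 : ∀ C : Fin 2, Function.update ![P, Q, T] 1 C = ![P, C, T] := fun C => by
    funext r; fin_cases r <;> rfl
  have h3 : ∀ C : Fin 2, Function.update ![P, Q, T] 2 C = ![P, Q, C] := fun C => by
    funext r; fin_cases r <;> rfl
  have h4 : ∀ C : Fin 2, Function.update ![P'] 0 C = ![C] := fun C => by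
    funext r; fin_cases r; rfl
  have t1 : Fin.tail ![A, P, Q, T] = ![P, Q, T] := rfl
  have t2 : Fin.tail ![A', P'] = ![P'] := rfl
  simp only [nabla, SpinCalculus.n31, map_sub, map_add, map_sum, map_mul, eval_γ, eval_γ', t1, t2,
    ← p.nablaFun_eq (f := fun y => φ i y ![P, Q, T] ![P']) (fun y => e y P P' Q T), ← e, Fin.sum_univ_two, Fin.sum_univ_succ (n := 0),
    Fin.sum_univ_three, h1, h2, h3, h4]
  simp
  ring

lemma nabla40_eq {φ : S.Field 4 0} {f : Fin 2 → Fin 2 → Fin 2 → Fin 2 → smoothRing V}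
    (e : ∀ (y : V) P Q T U, φ i y ![P, Q, T, U] ![] = evalAt y (f P Q T U))
    (A A' P Q T U : Fin 2) (x : V) :
    S.nabla φ i x ![A, P, Q, T, U] ![A'] = evalAt x (p.calculus.n40 f A A' P Q T U) := by
  have h1 : ∀ C : Fin 2, Function.update ![P, Q, T, U] 0 C = ![C, Q, T, U] := fun C => by
    funext r; fin_cases r <;> rfl
  have h2 : ∀ C : Fin 2, Function.update ![P, Q, T, U] 1 C = ![P, C, T, U] := fun C => by
    funext r; fin_cases r <;> rfl
  have h3 : ∀ C : Fin 2, Function.update ![P, Q, T, U] 2 C = ![P, Q, C, U] := fun C => by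
    funext r; fin_cases r <;> rfl
  have h4 : ∀ C : Fin 2, Function.update ![P, Q, T, U] 3 C = ![P, Q, T, C] := fun C => by
    funext r; fin_cases r <;> rfl
  have t1 : Fin.tail ![A, P, Q, T, U] = ![P, Q, T, U] := rfl
  have t2 : Fin.tail ![A'] = ![] := rfl
  simp only [nabla, SpinCalculus.n40, map_sub, map_add, map_sum, map_mul, eval_γ, eval_γ', t1, t2,
    ← p.nablaFun_eq (f := fun y => φ i y ![P, Q, T, U] ![]) (fun y => e y P Q T U), ← e, Fin.sum_univ_two, Fin.sum_univ_four, h1, h2, h3, h4]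
  simp
  ring

lemma nabla_Psi (A A' P Q T U : Fin 2) (x : V) :
    S.nabla S.Psi i x ![A, P, Q, T, U] ![A'] = evalAt x (p.calculus.npsi A A' (P + Q + T + U)) := by
  rw [← SpinCalculus.n40_psi]
  exact p.nabla40_eq (fun y P Q T U => by rw [p.Psi_eq, Fin.sum_univ_four]; rfl) A A' P Q T U x

lemma nabla_Phi (A A' P P' Q Q' : Fin 2) (x : V) :
    S.nabla S.Phi i x ![A, P, Q] ![A', P', Q'] = evalAt x (p.calculus.nphi A A' (P + Q) (P' + Q')) := by
  rw [← SpinCalculus.n22_phi]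
  exact p.nabla22_eq (fun y P P' Q Q' => by rw [p.Phi_eq]; rfl) A A' P P' Q Q' x

end IsPatch

end SpinStructure

end Patch

/-! ### From the Killing equations to the first-order systems -/

namespace SpinCalculus

variable {R : Type*} [CommRing R] (C : SpinCalculus R)

lemma exists_isCKV {ξ : Fin 2 → Fin 2 → R}
    (h : ∀ A A' B B', C.n11 ξ A A' B B' + C.n11 ξ A B' B A' + C.n11 ξ B A' A B'
      + C.n11 ξ B B' A A' = 0) : ∃ F F' d, C.IsCKV ξ F F' d := by
  obtain ⟨t, ht⟩ : ∃ t : R, 2 * t = 1 := ⟨3 * C.sixth, by linear_combination C.six_mul_sixth⟩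
  set N := C.n11 ξ
  obtain ⟨F, F', d, h1, h2, h3⟩ : ∃ (F F' : Fin 2 → Fin 2 → R) (d : R), (∀ A A' B B', N A A' B B' =
      ep A' B' * F A B + ep A B * F' A' B' + 2 * (ep A B * ep A' B' * d)) ∧ F 1 0 = F 0 1 ∧
        F' 1 0 = F' 0 1 := by
    -- With t = 1/2, these are the three irreducible parts of ∇ξ left when the totally symmetric one
    -- vanishes. The powers of t normalize contractions and symmetrizations.
    refine ⟨fun A B => t ^ 2 * (N A 0 B 1 - N A 1 B 0 + N B 0 A 1 - N B 1 A 0),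
      fun A B => t ^ 2 * (N 0 A 1 B - N 1 A 0 B + N 0 B 1 A - N 1 B 0 A),
      t ^ 3 * (N 0 0 1 1 - N 0 1 1 0 - N 1 0 0 1 + N 1 1 0 0), ?_, by ring, by ring⟩
    have k : ∀ A A' B B', N A A' B B' = t ^ 2 * (4 * N A A' B B') := fun A A' B B' => by
      linear_combination (-(N A A' B B') * (2 * t + 1)) * ht
    have k3 : ∀ a : R, 2 * (t ^ 3 * a) = t ^ 2 * a := fun a => by linear_combination t ^ 2 * a * ht
    intro A A' B B'
    rw [mul_left_comm (2 : R), k3, k]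
    have e := h A A' B B'
    revert A A' B B'
    simp only [Fin.forall_fin_two, ep_zero_zero, ep_zero_one, ep_one_zero, ep_one_one]
    and_intros <;> intro e <;> linear_combination t ^ 2 * e
  exact ⟨F, F', d, h1, h2, h3⟩

lemma exists_isKS20 {κ : Fin 2 → Fin 2 → R} (hκ : κ 1 0 = κ 0 1)
    (h : ∀ A A' B E, C.n20 κ A A' B E + C.n20 κ B A' A E + C.n20 κ E A' B A = 0) :
    ∃ η, C.IsKS20 κ η := by
  have hs : ∀ A A', C.n20 κ A A' 1 0 = C.n20 κ A A' 0 1 := fun A A' => by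
    simp only [n20, Fin.sum_univ_two, hκ]
    ring
  -- Contracting the claimed formula over its first unprimed pair gives 3η, and `2 * C.sixth` is one
  -- third.
  refine ⟨fun E A' => 2 * C.sixth * (C.n20 κ 0 A' 1 E - C.n20 κ 1 A' 0 E), fun A A' B E => ?_, hκ⟩
  generalize C.n20 κ = N at h hs ⊢
  have e := h A A' B E
  have e1 := hs 0 A'
  have e2 := hs 1 A'
  have k : ∀ A A' B E, N A A' B E = 2 * C.sixth * (3 * N A A' B E) := fun A A' B E => by
    linear_combination (-(N A A' B E)) * C.six_mul_sixth
  rw [k]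
  revert A B E
  simp only [Fin.forall_fin_two, ep_zero_zero, ep_zero_one, ep_one_zero, ep_one_one, e1, e2]
  and_intros <;> intro e <;> linear_combination 2 * C.sixth * e

end SpinCalculus

section Patch

variable {M : Type*} [TopologicalSpace M] [ChartedSpace (EuclideanSpace ℝ (Fin 4)) M]
  [IsManifold (𝓡 4) ∞ M] {g : LorentzMetric M} {ι : Type*} {S : SpinStructure g ι}

namespace SpinStructure

/-- A single open set serves two spin frames, so that they can be compared in one ring; the case i =
j is the ordinary local patch. -/
lemma exists_isPatch {i j : ι} {x : M} (hi : x ∈ S.U i) (hj : x ∈ S.U j) :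
    ∃ V, x ∈ V ∧ S.IsPatch i V ∧ S.IsPatch j V := by
  refine ⟨S.U i ∩ S.U j ∩ (chartAt (EuclideanSpace ℝ (Fin 4)) x).source,
    ⟨⟨hi, hj⟩, mem_chart_source _ x⟩, ⟨?_, ?_, x, ?_⟩, ⟨?_, ?_, x, ?_⟩⟩
  · exact ((S.isOpen_U i).inter (S.isOpen_U j)).inter (chartAt _ x).open_source
  · exact fun y hy => hy.1.1
  · exact fun y hy => hy.2
  · exact ((S.isOpen_U i).inter (S.isOpen_U j)).inter (chartAt _ x).open_source
  · exact fun y hy => hy.1.2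
  · exact fun y hy => hy.2

lemma IsPatch.mono {i : ι} {V W : Set M} (p : S.IsPatch i V) (hW : IsOpen W) (h : W ⊆ V) :
    S.IsPatch i W := by
  obtain ⟨x₀, hx⟩ := p.chart
  exact ⟨hW, h.trans p.subset, x₀, h.trans hx⟩

variable {i : ι} {V : Set M}

namespace IsPatch

variable (p : S.IsPatch i V)

/-- The components of a spinor field on a patch. -/
def comp {k l : ℕ} {φ : S.Field k l} (p : S.IsPatch i V) (h : S.IsSpinorField φ) (A : Fin k → Fin 2)
    (A' : Fin l → Fin 2) : smoothRing V :=
  toRing (fun x => φ i x A A') ((h.smooth i A A').mono p.subset)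

lemma twist11_eq {φ : S.Field 1 1} {f : Fin 2 → Fin 2 → smoothRing V}
    (e : ∀ (y : V) B B', φ i y ![B] ![B'] = evalAt y (f B B')) (A A' B B' : Fin 2) (x : V) :
    4 * S.twist φ i x ![A, B] ![A', B'] = evalAt x (p.calculus.n11 f A A' B B'
      + p.calculus.n11 f A B' B A' + p.calculus.n11 f B A' A B' + p.calculus.n11 f B B' A A') := by
  have hs : S.IsSymmetric φ := fun i x _ s s' A A' => by
    rw [Subsingleton.elim s 1, Subsingleton.elim s' 1]
    rfl
  have h1 : ∀ G : (Fin 2 → Fin 2) → (Fin 2 → Fin 2) → ℂ,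
      ∑ p, ∑ q, G (![A, B] ∘ Equiv.swap 0 p) (![A', B'] ∘ Equiv.swap 0 q) =
      G ![A, B] ![A', B'] + G ![A, B] ![B', A'] + (G ![B, A] ![A', B'] + G ![B, A] ![B', A']) := by
    intro G
    rw [sum_swap_two (fun a => ∑ q, G a (![A', B'] ∘ Equiv.swap 0 q))]
    simp only [sum_swap_two (G _)]
    rfl
  rw [twist_eq hs (p.subset x.2), h1, p.nabla11_eq e, p.nabla11_eq e, p.nabla11_eq e,
    p.nabla11_eq e]
  simp only [map_add]
  push_cast
  ring

lemma exists_isCKV {ξ : S.Field 1 1} (h : S.IsKillingSpinor ξ) : ∃ F F' d,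
    p.calculus.IsCKV (fun A A' => p.comp h.isSpinorField ![A] ![A']) F F' d := by
  refine p.calculus.exists_isCKV fun A A' B B' => ext_evalAt fun x => ?_
  have e := p.twist11_eq (f := fun A A' => p.comp h.isSpinorField ![A] ![A']) (fun _ _ _ => rfl)
    A A' B B' x
  rw [h.twist_eq_zero i x (p.subset x.2)] at e
  rw [← e, mul_zero, map_zero]

lemma comp_symm {κ : S.Field 2 0} (h : S.IsSpinorField κ) (hs : S.IsSymmetric κ) :
    p.comp h ![1, 0] ![] = p.comp h ![0, 1] ![] := ext_evalAt fun x => by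
  have e := hs i x (p.subset x.2) (Equiv.swap 0 1) 1 ![0, 1] ![]
  have e2 : ![(0 : Fin 2), 1] ∘ Equiv.swap 0 1 = ![1, 0] := by
    funext r; fin_cases r <;> rfl
  rw [e2] at e
  exact e

lemma exists_isKS20 {κ : S.Field 2 0} (h : S.IsKillingSpinor κ) : ∃ η,
    p.calculus.IsKS20 (fun A B => p.comp h.isSpinorField ![A, B] ![]) η := by
  refine p.calculus.exists_isKS20 (p.comp_symm h.isSpinorField h.isSymmetric) fun A A' B E =>
    ext_evalAt fun x => ?_
  have e := h.twist_eq_zero i x (p.subset x.2) ![A, B, E] ![A']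
  rw [twist_eq h.isSymmetric (p.subset x.2)] at e
  have u : ![A'] ∘ Equiv.swap (0 : Fin 1) 0 = ![A'] := by funext r; fin_cases r; rfl
  simp only [Fin.sum_univ_succ (n := 0), Fin.sum_univ_zero, add_zero, u,
    sum_swap_three (fun A => S.nabla κ i x A ![A'])] at e
  have q := p.nabla20_eq (f := fun A B => p.comp h.isSpinorField ![A, B] ![]) (fun _ _ _ => rfl)
  have q1 := q A A' B E x
  have q2 := q B A' A E x
  have q3 := q E A' B A x
  simp only [map_add, map_zero, ← q1, ← q2, ← q3]
  simp only [Matrix.cons_val_zero, Matrix.cons_val_one, Matrix.cons_val_two, Matrix.head_cons,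
    Matrix.tail_cons] at e
  push_cast at e
  linear_combination 3 * e

end IsPatch

end SpinStructure

end Patch

/-! ### Frame changes between patches -/

section Patch

variable {M : Type*} [TopologicalSpace M] [ChartedSpace (EuclideanSpace ℝ (Fin 4)) M]
  [IsManifold (𝓡 4) ∞ M] {g : LorentzMetric M} {ι : Type*} {S : SpinStructure g ι}

namespace SpinStructure

variable {i j : ι} {V : Set M}

/-- The lift condition speaks of the components of a vector. Evaluating it on the frame vectors and
expanding one frame in the other converts it into the transformation law of e_{AA'} itself. -/
lemma sum_sigma_change {x : M} (hi : x ∈ S.U i) (hj : x ∈ S.U j) (A A' : Fin 2)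
    (w : TangentSpace (𝓡 4) x →ₗ[ℝ] ℂ) :
    ∑ a, sigma a A A' * w (S.e j a x) = ∑ B, ∑ B',
      (S.t i j x : Matrix (Fin 2) (Fin 2) ℂ) A B *
        star ((S.t i j x : Matrix (Fin 2) (Fin 2) ℂ) A' B') * ∑ a, sigma a B B' * w (S.e i a x) := by
  have h1 : ∀ b, ∑ a, ((g.val x (S.e j a x) (S.e i b x) : ℝ) : ℂ) * sigma a A A' =
      ∑ B, ∑ B', (S.t i j x : Matrix (Fin 2) (Fin 2) ℂ) A B *
        star ((S.t i j x : Matrix (Fin 2) (Fin 2) ℂ) A' B') * ((eta b b : ℝ) * sigma b B B') := by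
    intro b
    have h := congrFun (congrFun (S.frame_change i j x ⟨hi, hj⟩ (S.e i b x)) A) A'
    have e2 : ∀ B B', hermitianMatrix g x (fun a => S.e i a x) (S.e i b x) B B' =
        (eta b b : ℝ) * sigma b B B' := by
      intro B B'
      simp only [hermitianMatrix, S.orthonormal i x hi, Matrix.sum_apply, Matrix.smul_apply,
        smul_eq_mul]
      rw [Finset.sum_eq_single b]
      · intro a _ hab
        simp [eta, hab]
      · simp
    simp only [Matrix.mul_apply, Matrix.conjTranspose_apply, e2, Finset.sum_mul] at h
    rw [Finset.sum_comm] at h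
    simp only [hermitianMatrix, Matrix.sum_apply, Matrix.smul_apply, smul_eq_mul] at h
    rw [h]
    exact Finset.sum_congr rfl fun B _ => Finset.sum_congr rfl fun B' _ => by ring
  have h2 : ∀ a, w (S.e j a x) = ∑ c, (eta c c : ℝ) *
      ((g.val x (S.e j a x) (S.e i c x) : ℝ) : ℂ) * w (S.e i c x) := by
    intro a
    have h := congrArg w (S.frame_decomp hi (S.e j a x))
    rw [h, map_sum]
    refine Finset.sum_congr rfl fun c _ => ?_
    rw [map_smul, Finset.sum_eq_single c]
    · rw [Complex.real_smul]
      push_cast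
      ring
    · intro d _ hd
      simp [eta, Ne.symm hd]
    · simp
  have h3 : ∀ c, (((eta c c : ℝ) : ℂ)) * (eta c c : ℝ) = 1 := fun c => by
    fin_cases c <;> simp [eta]
  calc ∑ a, sigma a A A' * w (S.e j a x)
      = ∑ c, (eta c c : ℝ) * w (S.e i c x) *
          ∑ a, ((g.val x (S.e j a x) (S.e i c x) : ℝ) : ℂ) * sigma a A A' := by
        simp only [h2, Finset.mul_sum]
        rw [Finset.sum_comm]
        exact Finset.sum_congr rfl fun B _ => Finset.sum_congr rfl fun B' _ => by ring
    _ = _ := by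
        simp only [h1, Finset.mul_sum]
        rw [Finset.sum_comm]
        refine Finset.sum_congr rfl fun B _ => ?_
        rw [Finset.sum_comm]
        refine Finset.sum_congr rfl fun B' _ => Finset.sum_congr rfl fun c _ => ?_
        linear_combination (w (S.e i c x) * sigma c B B' *
          (S.t i j x : Matrix (Fin 2) (Fin 2) ℂ) A B *
            star ((S.t i j x : Matrix (Fin 2) (Fin 2) ℂ) A' B')) * h3 c

lemma nablaFun_change {x : M} (hi : x ∈ S.U i) (hj : x ∈ S.U j) (A A' : Fin 2) (f : M → ℂ) :
    S.nablaFun j A A' f x = ∑ B, ∑ B', (S.t i j x : Matrix (Fin 2) (Fin 2) ℂ) A B *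
        star ((S.t i j x : Matrix (Fin 2) (Fin 2) ℂ) A' B') * S.nablaFun i B B' f x :=
  sum_sigma_change hi hj A A' (mfderiv (𝓡 4) 𝓘(ℝ, ℂ) f x).toLinearMap

lemma t_self {x : M} (hi : x ∈ S.U i) : S.t i i x = 1 := by
  simpa using S.cocycle i i i x ⟨⟨hi, hi⟩, hi⟩

namespace IsPatch

variable {p : S.IsPatch i V} {q : S.IsPatch j V}

/-- The change of spin frame as a matrix of smooth functions. -/
def frameChange (p : S.IsPatch i V) (q : S.IsPatch j V) (A B : Fin 2) : smoothRing V :=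
  toRing (fun x => (S.t i j x : Matrix (Fin 2) (Fin 2) ℂ) A B)
    ((S.smooth_t i j A B).mono (Set.subset_inter p.subset q.subset))

lemma det_frameChange (p : S.IsPatch i V) (q : S.IsPatch j V) :
    p.frameChange q 0 0 * p.frameChange q 1 1 - p.frameChange q 0 1 * p.frameChange q 1 0 = 1 :=
  ext_evalAt fun x => by
    have h := (S.t i j x).det_coe
    rw [Matrix.det_fin_two] at h
    exact h

lemma isGauge (p : S.IsPatch i V) (q : S.IsPatch j V) :
    p.calculus.IsGauge q.calculus (p.frameChange q) (fun A B => conjRing V (p.frameChange q A B)) where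
  det := p.det_frameChange q
  det' := by
    have h := congrArg (conjRing V) (p.det_frameChange q)
    simpa only [map_sub, map_mul, map_one] using h
  D_eq A A' f := ext_evalAt fun x => by
    simp only [map_sum, map_mul]
    exact nablaFun_change (p.subset x.2) (q.subset x.2) A A' (extend f.1)

lemma comp_change11 {ξ : S.Field 1 1} (h : S.IsSpinorField ξ) (p : S.IsPatch i V)
    (q : S.IsPatch j V) : (fun A A' => q.comp h ![A] ![A']) =
      SpinCalculus.IsGauge.act (p.frameChange q) (fun A B => conjRing V (p.frameChange q A B))
        (fun A A' => p.comp h ![A] ![A']) := by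
  funext A A'
  refine ext_evalAt fun x => ?_
  refine (h.transform i j x ⟨p.subset x.2, q.subset x.2⟩ ![A] ![A']).trans ?_
  simp only [SpinCalculus.IsGauge.act, map_sum, map_mul, Fin.prod_univ_succ (n := 0), Fin.prod_univ_zero,
    mul_one]
  rw [← Equiv.sum_comp (Equiv.funUnique (Fin 1) (Fin 2)).symm]
  refine Finset.sum_congr rfl fun B _ => ?_
  rw [← Equiv.sum_comp (Equiv.funUnique (Fin 1) (Fin 2)).symm]
  refine Finset.sum_congr rfl fun B' _ => ?_
  have e : ∀ B : Fin 2, (Equiv.funUnique (Fin 1) (Fin 2)).symm B = ![B] := fun B => by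
    funext r; fin_cases r; rfl
  rw [e, e]
  rfl

lemma comp_change20 {κ : S.Field 2 0} (h : S.IsSpinorField κ) (p : S.IsPatch i V)
    (q : S.IsPatch j V) : (fun A B => q.comp h ![A, B] ![]) =
      SpinCalculus.IsGauge.act (p.frameChange q) (p.frameChange q) (fun A B => p.comp h ![A, B] ![]) := by
  funext A B
  refine ext_evalAt fun x => ?_
  refine (h.transform i j x ⟨p.subset x.2, q.subset x.2⟩ ![A, B] ![]).trans ?_
  simp only [SpinCalculus.IsGauge.act, map_sum, map_mul]
  rw [← Equiv.sum_comp (finTwoArrowEquiv (Fin 2)).symm, Fintype.sum_prod_type]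
  refine Finset.sum_congr rfl fun P _ => Finset.sum_congr rfl fun Q _ => ?_
  simp only [Fin.prod_univ_two, Finset.univ_eq_empty, Finset.prod_empty, Fintype.sum_unique, mul_one]
  exact congrArg (_ * _ * κ i x ![P, Q] ·) (Subsingleton.elim _ _)

end IsPatch

end SpinStructure

end Patch

/-! ### Gluing of local potentials -/

section Patch

variable {M : Type*} [TopologicalSpace M] [ChartedSpace (EuclideanSpace ℝ (Fin 4)) M]
  [IsManifold (𝓡 4) ∞ M] {g : LorentzMetric M} {ι : Type*} {S : SpinStructure g ι}

namespace SpinStructure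

/-- Gluing of functions that are characterized by a local condition. -/
lemma exists_function (𝒬 : ∀ i (V : Set M), S.IsPatch i V → smoothRing V → Prop)
    (ex : ∀ i V p, ∃ q, 𝒬 i V p q)
    (res : ∀ i V W p p' (hW : W ⊆ V) q, 𝒬 i V p q → 𝒬 i W p' (resRing hW q))
    (uniq : ∀ i j V p p' q q', 𝒬 i V p q → 𝒬 j V p' q' → q = q') :
    ∃ Q : M → ℂ, ContMDiff (𝓡 4) 𝓘(ℝ, ℂ) ∞ Q ∧
      ∀ i V p q, 𝒬 i V p q → ∀ x : V, Q x = evalAt x q := by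
  -- Both functions are restricted to the overlap, where uniqueness applies even across different
  -- frames.
  have agree : ∀ i j V W p p' q q', 𝒬 i V p q → 𝒬 j W p' q' → ∀ (x : M) (hx : x ∈ V) (hx' : x ∈ W),
      evalAt (⟨x, hx⟩ : V) q = evalAt (⟨x, hx'⟩ : W) q' := by
    intro i j V W p p' q q' h h' x hx hx'
    have o : IsOpen (V ∩ W) := p.isOpen.inter p'.isOpen
    have r := res i V (V ∩ W) p (p.mono o Set.inter_subset_left) Set.inter_subset_left q h
    have r' := res j W (V ∩ W) p' (p'.mono o Set.inter_subset_right) Set.inter_subset_right q' h'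
    exact congrArg (evalAt (⟨x, hx, hx'⟩ : (V ∩ W : Set M))) (uniq i j _ _ _ _ _ r r')
  have loc : ∀ x : M, ∃ c : ℂ, ∀ i V p q, 𝒬 i V p q → ∀ hx : x ∈ V, c = evalAt (⟨x, hx⟩ : V) q := by
    intro x
    obtain ⟨i, hi⟩ := S.cover x
    obtain ⟨V, hx, p, -⟩ := exists_isPatch hi hi
    obtain ⟨q, hq⟩ := ex i V p
    exact ⟨evalAt (⟨x, hx⟩ : V) q, fun j W p' q' h' hx' => agree i j V W p p' q q' hq h' x hx hx'⟩
  choose Q hQ using loc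
  refine ⟨Q, fun x => ?_, fun i V p q h x => hQ x i V p q h x.2⟩
  obtain ⟨i, hi⟩ := S.cover x
  obtain ⟨V, hx, p, -⟩ := exists_isPatch hi hi
  obtain ⟨q, hq⟩ := ex i V p
  have e : Set.EqOn Q (extend q.1) V := fun y hy => by
    rw [hQ y i V p q hq hy, extend_apply _ hy]
    rfl
  exact (ContMDiffOn.congr (f := extend q.1) q.2 e).contMDiffAt (p.isOpen.mem_nhds hx)

/-- Gluing of vector fields that are characterized by a local condition. -/
lemma exists_vectorField (𝒱 : ∀ i (V : Set M), S.IsPatch i V → (Fin 2 → Fin 2 → smoothRing V) → Prop)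
    (ex : ∀ i V p, ∃ q, 𝒱 i V p q)
    (res : ∀ i V W p p' (hW : W ⊆ V) q, 𝒱 i V p q → 𝒱 i W p' (fun A A' => resRing hW (q A A')))
    (uniq : ∀ i j V (p : S.IsPatch i V) (p' : S.IsPatch j V) q q', 𝒱 i V p q → 𝒱 j V p' q' →
      q' = SpinCalculus.IsGauge.act (p.frameChange p')
        (fun A B => conjRing V (p.frameChange p' A B)) q) :
    ∃ P : S.Field 1 1, S.IsSpinorField P ∧
      ∀ i V p q, 𝒱 i V p q → ∀ (x : V) A A', P i x ![A] ![A'] = evalAt x (q A A') := by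
  have agree : ∀ i j V W p p' q q', 𝒱 i V p q → 𝒱 j W p' q' → ∀ (x : M) (hx : x ∈ V) (hx' : x ∈ W)
      (A A' : Fin 2), evalAt (⟨x, hx'⟩ : W) (q' A A') = ∑ B, ∑ B',
        (S.t i j x : Matrix (Fin 2) (Fin 2) ℂ) A B *
          star ((S.t i j x : Matrix (Fin 2) (Fin 2) ℂ) A' B') * evalAt (⟨x, hx⟩ : V) (q B B') := by
    intro i j V W p p' q q' h h' x hx hx' A A'
    have o : IsOpen (V ∩ W) := p.isOpen.inter p'.isOpen
    have r := res i V (V ∩ W) p (p.mono o Set.inter_subset_left) Set.inter_subset_left q h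
    have r' := res j W (V ∩ W) p' (p'.mono o Set.inter_subset_right) Set.inter_subset_right q' h'
    have e := congrArg (evalAt (⟨x, hx, hx'⟩ : (V ∩ W : Set M)))
      (congrFun (congrFun (uniq i j _ _ _ _ _ r r') A) A')
    simp only [SpinCalculus.IsGauge.act, map_sum, map_mul] at e
    exact e
  have agree' : ∀ i V W p p' q q', 𝒱 i V p q → 𝒱 i W p' q' → ∀ (x : M) (hx : x ∈ V) (hx' : x ∈ W)
      (A A' : Fin 2), evalAt (⟨x, hx'⟩ : W) (q' A A') = evalAt (⟨x, hx⟩ : V) (q A A') := by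
    intro i V W p p' q q' h h' x hx hx' A A'
    -- Within one frame the cocycle condition forces the transition matrix to be the identity.
    rw [agree i i V W p p' q q' h h' x hx hx', t_self (p.subset hx)]
    revert A A'
    simp [Fin.forall_fin_two]
  have loc : ∀ i (x : M), ∃ c : Fin 2 → Fin 2 → ℂ, ∀ V p q, 𝒱 i V p q → ∀ hx : x ∈ V, ∀ A A',
      c A A' = evalAt (⟨x, hx⟩ : V) (q A A') := by
    intro i x
    by_cases hi : x ∈ S.U i
    · obtain ⟨V, hx, p, -⟩ := exists_isPatch hi hi
      obtain ⟨q, hq⟩ := ex i V p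
      exact ⟨fun A A' => evalAt (⟨x, hx⟩ : V) (q A A'),
        fun W p' q' h' hx' A A' => agree' i W V p' p q' q h' hq x hx' hx A A'⟩
    -- Outside `U i` there is no patch with this frame, and any value will do.
    · exact ⟨0, fun V p q h hx => absurd (p.subset hx) hi⟩
  choose P hP using loc
  refine ⟨fun i x A A' => P i x (A 0) (A' 0), ⟨fun i A A' x hi => ?_, fun i j x hx A A' => ?_⟩,
    fun i V p q h x A A' => hP i x V p q h x.2 A A'⟩
  · obtain ⟨V, hx, p, -⟩ := exists_isPatch hi hi
    obtain ⟨q, hq⟩ := ex i V p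
    have e : Set.EqOn (fun x => P i x (A 0) (A' 0)) (extend (q (A 0) (A' 0)).1) V := fun y hy => by
      simp only [hP i y V p q hq hy, extend_apply _ hy]
      rfl
    exact ((ContMDiffOn.congr (f := extend (q (A 0) (A' 0)).1) (q (A 0) (A' 0)).2 e).contMDiffAt
      (p.isOpen.mem_nhds hx)).contMDiffWithinAt
  · obtain ⟨V, hV, p, p'⟩ := exists_isPatch hx.1 hx.2
    obtain ⟨q, hq⟩ := ex i V p
    obtain ⟨q', hq'⟩ := ex j V p'
    rw [hP j x V p' q' hq' hV, agree i j V V p p' q q' hq hq' x hV hV]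
    rw [← Equiv.sum_comp (Equiv.funUnique (Fin 1) (Fin 2)).symm]
    refine Finset.sum_congr rfl fun B _ => ?_
    rw [← Equiv.sum_comp (Equiv.funUnique (Fin 1) (Fin 2)).symm]
    refine Finset.sum_congr rfl fun B' _ => ?_
    simp only [Fin.prod_univ_succ (n := 0), Fin.prod_univ_zero, mul_one]
    exact congrArg (_ * _ * ·) (hP i x V p q hq hV B B').symm

end SpinStructure

end Patch

/-! ### Products, symmetrizations and conjugates of spinor fields -/

section Patch

variable {M : Type*} [TopologicalSpace M] [ChartedSpace (EuclideanSpace ℝ (Fin 4)) M]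
  [IsManifold (𝓡 4) ∞ M] {g : LorentzMetric M} {ι : Type*} {S : SpinStructure g ι}

namespace SpinStructure

variable {k l m n : ℕ}

lemma IsSpinorField.tprod {φ : S.Field k l} {ψ : S.Field m n} (hφ : S.IsSpinorField φ)
    (hψ : S.IsSpinorField ψ) :
    S.IsSpinorField (k := k + m) (l := l + n) (fun i x => SpinGeometry.tprod (φ i x) (ψ i x)) where
  smooth i A A' := contMDiffOn_mul (hφ.smooth i _ _) (hψ.smooth i _ _)
  transform i j x hx A A' := by
    simp only [SpinGeometry.tprod]
    rw [hφ.transform i j x hx, hψ.transform i j x hx, ← Equiv.sum_comp (Fin.appendEquiv k m),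
      Fintype.sum_prod_type, Finset.sum_mul_sum]
    refine Finset.sum_congr rfl fun B _ => Finset.sum_congr rfl fun C _ => ?_
    rw [← Equiv.sum_comp (Fin.appendEquiv l n), Fintype.sum_prod_type, Finset.sum_mul_sum]
    refine Finset.sum_congr rfl fun B' _ => Finset.sum_congr rfl fun C' _ => ?_
    have e1 : (Fin.appendEquiv k m) (B, C) ∘ Fin.castAdd m = B := by funext r; simp [Fin.appendEquiv]
    have e2 : (Fin.appendEquiv k m) (B, C) ∘ Fin.natAdd k = C := by funext r; simp [Fin.appendEquiv]
    have e3 : (Fin.appendEquiv l n) (B', C') ∘ Fin.castAdd n = B' := by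
      funext r; simp [Fin.appendEquiv]
    have e4 : (Fin.appendEquiv l n) (B', C') ∘ Fin.natAdd l = C' := by
      funext r; simp [Fin.appendEquiv]
    rw [e1, e2, e3, e4]
    simp only [Fin.prod_univ_add, Function.comp_apply]
    simp only [Fin.appendEquiv, Equiv.coe_fn_mk, Fin.append_left, Fin.append_right]
    ring

lemma IsSpinorField.perm {φ : S.Field k l} (hφ : S.IsSpinorField φ) (s : Equiv.Perm (Fin k))
    (s' : Equiv.Perm (Fin l)) : S.IsSpinorField (fun i x A A' => φ i x (A ∘ s) (A' ∘ s')) where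
  smooth i A A' := hφ.smooth i _ _
  transform i j x hx A A' := by
    rw [hφ.transform i j x hx]
    refine Fintype.sum_equiv (Equiv.arrowCongr s (Equiv.refl _)) _ _ fun B => ?_
    refine Fintype.sum_equiv (Equiv.arrowCongr s' (Equiv.refl _)) _ _ fun B' => ?_
    have e1 : ∀ {r : ℕ} (s : Equiv.Perm (Fin r)) (B : Fin r → Fin 2),
        (Equiv.arrowCongr s (Equiv.refl _)) B ∘ s = B := fun s B => by
      funext r; simp [Equiv.arrowCongr]
    rw [e1, e1]
    congr 2
    · rw [← Equiv.prod_comp s (fun r => (S.t i j x : Matrix (Fin 2) (Fin 2) ℂ) (A r) _)]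
      exact Finset.prod_congr rfl fun r _ => by simp [Equiv.arrowCongr]
    · rw [← Equiv.prod_comp s' (fun r => star ((S.t i j x : Matrix (Fin 2) (Fin 2) ℂ) (A' r) _))]
      exact Finset.prod_congr rfl fun r _ => by simp [Equiv.arrowCongr]

lemma IsSpinorField.sum {β : Type*} {c : ℂ} (u : Finset β) {φ : β → S.Field k l}
    (hφ : ∀ b ∈ u, S.IsSpinorField (φ b)) :
    S.IsSpinorField (fun i x A A' => c * ∑ b ∈ u, φ b i x A A') where
  smooth i A A' := contMDiffOn_mul contMDiffOn_const
    (contMDiffOn_finsetSum fun b hb => (hφ b hb).smooth i A A')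
  transform i j x hx A A' := by
    have e : ∑ b ∈ u, φ b j x A A' = ∑ b ∈ u, ∑ B : Fin k → Fin 2, ∑ B' : Fin l → Fin 2,
      (∏ r, (S.t i j x : Matrix (Fin 2) (Fin 2) ℂ) (A r) (B r)) *
      (∏ r, star ((S.t i j x : Matrix (Fin 2) (Fin 2) ℂ) (A' r) (B' r))) * φ b i x B B' :=
      Finset.sum_congr rfl fun b hb => (hφ b hb).transform i j x hx A A'
    rw [e, Finset.sum_comm, Finset.mul_sum]
    refine Finset.sum_congr rfl fun B _ => ?_
    rw [Finset.sum_comm, Finset.mul_sum]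
    refine Finset.sum_congr rfl fun B' _ => ?_
    simp only [Finset.mul_sum]
    exact Finset.sum_congr rfl fun b _ => by ring

lemma IsSpinorField.symProd {φ : S.Field k l} {ψ : S.Field m n} (hφ : S.IsSpinorField φ)
    (hψ : S.IsSpinorField ψ) :
    S.IsSpinorField (k := k + m) (l := l + n) (fun i x => SpinGeometry.symProd (φ i x) (ψ i x)) := by
  have h : ∀ s : Equiv.Perm (Fin (k + m)), S.IsSpinorField (k := k + m) (l := l + n)
      (fun i x A A' => symP (SpinGeometry.tprod (φ i x) (ψ i x)) (A ∘ s) A') := fun s =>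
    IsSpinorField.sum (k := k + m) (l := l + n) Finset.univ
      fun s' _ => (hφ.tprod hψ).perm s s'
  exact IsSpinorField.sum (k := k + m) (l := l + n) Finset.univ fun s _ => h s

lemma IsSpinorField.bar {φ : S.Field k l} (hφ : S.IsSpinorField φ) :
    S.IsSpinorField (fun i x => SpinGeometry.bar (φ i x)) where
  smooth i A A' := ContMDiffOn.star (hφ.smooth i A' A)
  transform i j x hx A A' := by
    simp only [SpinGeometry.bar]
    rw [hφ.transform i j x hx, Finset.sum_comm]
    simp only [star_sum, star_mul', star_prod, star_star]
    exact Finset.sum_congr rfl fun B _ => Finset.sum_congr rfl fun B' _ => by ring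

lemma symP_symm (φ : Comp k l) (A : Fin k → Fin 2) (A' : Fin l → Fin 2) (s' : Equiv.Perm (Fin l)) :
    symP φ A (A' ∘ s') = symP φ A A' := by
  simp only [symP, Function.comp_assoc]
  exact congrArg _ (Equiv.sum_comp (Equiv.mulLeft s') (fun t => φ A (A' ∘ t)))

lemma symU_symm (φ : Comp k l) (A : Fin k → Fin 2) (A' : Fin l → Fin 2) (s : Equiv.Perm (Fin k)) :
    symU φ (A ∘ s) A' = symU φ A A' := by
  simp only [symU, Function.comp_assoc]
  exact congrArg _ (Equiv.sum_comp (Equiv.mulLeft s) (fun t => φ (A ∘ t) A'))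

lemma isSymmetric_symProd (φ : S.Field k l) (ψ : S.Field m n) :
    S.IsSymmetric (k := k + m) (l := l + n) (fun i x => symProd (φ i x) (ψ i x)) := by
  intro i x _ s s' A A'
  simp only [symProd]
  rw [symU_symm]
  simp only [symU, symP_symm]

lemma isSymmetric_tprod_bar {κ : S.Field k 0} (h : S.IsSymmetric κ) :
    S.IsSymmetric (k := k + 0) (l := 0 + k) (fun i x => tprod (κ i x) (bar (κ i x))) := by
  intro i x hx s s' A A'
  simp only [tprod, bar]
  have h1 := h i x hx s 1 (A ∘ Fin.castAdd 0) (A' ∘ Fin.castAdd k)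
  -- The primed indices of the product are counted by 0 + k and the indices of κ by k, so the
  -- permutation is transported along this equality.
  have h2 := h i x hx ((finCongr (Nat.zero_add k)).symm.trans (s'.trans (finCongr (Nat.zero_add k)))) 1
    (A' ∘ Fin.natAdd 0) (A ∘ Fin.natAdd k)
  refine congrArg₂ _ ?_ (congrArg star ?_)
  · refine Eq.trans (congrArg₂ (κ i x) rfl (Subsingleton.elim _ _)) h1
  · refine Eq.trans (congrArg₂ (κ i x) ?_ (Subsingleton.elim _ _)) h2
    funext r
    simp only [Function.comp_apply]
    congr 1
    ext
    simp [finCongr]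

end SpinStructure

end Patch

/-! ### Explicit symmetrized products -/

section Symmetrization

lemma sum_perm_cons {k : ℕ} {α : Type*} (h : (Fin (k + 1) → α) → ℂ) (A : Fin (k + 1) → α) :
    ∑ s : Equiv.Perm (Fin (k + 1)), h (A ∘ s) = ∑ p, (fun B : Fin (k + 1) → α =>
      ∑ s : Equiv.Perm (Fin k), h (Fin.cons (B 0) (Fin.tail B ∘ s))) (A ∘ Equiv.swap 0 p) := by
  rw [← Equiv.sum_comp Equiv.Perm.decomposeFin.symm, Fintype.sum_prod_type]
  refine Finset.sum_congr rfl fun p _ => Finset.sum_congr rfl fun s _ => ?_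
  rw [decomposeFin_symm_mul, Equiv.Perm.coe_mul, ← Function.comp_assoc, comp_decomposeFin]

variable {α : Type*}

lemma sum_perm_one (h : (Fin 1 → α) → ℂ) (A : Fin 1 → α) :
    ∑ s : Equiv.Perm (Fin 1), h (A ∘ s) = h A := by
  rw [Fintype.sum_unique]
  exact congrArg h (by funext r; exact congrArg A (Subsingleton.elim _ _))

lemma sum_perm_two (h : (Fin 2 → α) → ℂ) (a b : α) :
    ∑ s : Equiv.Perm (Fin 2), h (![a, b] ∘ s) = h ![a, b] + h ![b, a] := by
  refine (sum_perm_cons h ![a, b]).trans ((sum_swap_two (fun B =>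
    ∑ s : Equiv.Perm (Fin 1), h (Fin.cons (B 0) (Fin.tail B ∘ s))) ![a, b]).trans ?_)
  exact congrArg₂ _ (sum_perm_one (fun B => h (Fin.cons a B)) ![b])
    (sum_perm_one (fun B => h (Fin.cons b B)) ![a])

lemma sum_perm_three (h : (Fin 3 → α) → ℂ) (a b c : α) :
    ∑ s : Equiv.Perm (Fin 3), h (![a, b, c] ∘ s) = h ![a, b, c] + h ![a, c, b]
      + (h ![b, a, c] + h ![b, c, a]) + (h ![c, b, a] + h ![c, a, b]) := by
  refine (sum_perm_cons h ![a, b, c]).trans ((sum_swap_three (fun B =>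
    ∑ s : Equiv.Perm (Fin 2), h (Fin.cons (B 0) (Fin.tail B ∘ s))) ![a, b, c]).trans ?_)
  exact congrArg₂ _ (congrArg₂ _ (sum_perm_two (fun B => h (Fin.cons a B)) b c)
    (sum_perm_two (fun B => h (Fin.cons b B)) a c)) (sum_perm_two (fun B => h (Fin.cons c B)) b a)

lemma sum_perm_four (h : (Fin 4 → α) → ℂ) (a b c d : α) :
    ∑ s : Equiv.Perm (Fin 4), h (![a, b, c, d] ∘ s) =
      (h ![a, b, c, d] + h ![a, b, d, c] + (h ![a, c, b, d] + h ![a, c, d, b])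
        + (h ![a, d, c, b] + h ![a, d, b, c]))
      + (h ![b, a, c, d] + h ![b, a, d, c] + (h ![b, c, a, d] + h ![b, c, d, a])
        + (h ![b, d, c, a] + h ![b, d, a, c]))
      + (h ![c, b, a, d] + h ![c, b, d, a] + (h ![c, a, b, d] + h ![c, a, d, b])
        + (h ![c, d, a, b] + h ![c, d, b, a]))
      + (h ![d, b, c, a] + h ![d, b, a, c] + (h ![d, c, b, a] + h ![d, c, a, b])
        + (h ![d, a, c, b] + h ![d, a, b, c])) := by
  refine (sum_perm_cons h ![a, b, c, d]).trans ((sum_swap_four (fun B =>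
    ∑ s : Equiv.Perm (Fin 3), h (Fin.cons (B 0) (Fin.tail B ∘ s))) ![a, b, c, d]).trans ?_)
  exact congrArg₂ _ (congrArg₂ _ (congrArg₂ _ (sum_perm_three (fun B => h (Fin.cons a B)) b c d)
    (sum_perm_three (fun B => h (Fin.cons b B)) a c d))
    (sum_perm_three (fun B => h (Fin.cons c B)) b a d))
    (sum_perm_three (fun B => h (Fin.cons d B)) b c a)

lemma symProd_one_one (φ ψ : Comp 1 1) (A B A' B' : Fin 2) :
    4 * symProd φ ψ ![A, B] ![A', B'] = φ ![A] ![A'] * ψ ![B] ![B'] + φ ![B] ![A'] * ψ ![A] ![B']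
      + φ ![A] ![B'] * ψ ![B] ![A'] + φ ![B] ![B'] * ψ ![A] ![A'] := by
  have e : ∀ A B A' B' : Fin 2, tprod φ ψ ![A, B] ![A', B'] = φ ![A] ![A'] * ψ ![B] ![B'] := by
    intro A B A' B'
    refine congrArg₂ _ (congrArg₂ φ ?_ ?_) (congrArg₂ ψ ?_ ?_) <;> (funext r; fin_cases r; rfl)
  have h1 : ∀ A A' B', symP (l := 2) (tprod φ ψ) A ![A', B'] =
      (1 / 2) * (tprod φ ψ A ![A', B'] + tprod φ ψ A ![B', A']) := fun A A' B' => by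
    have := sum_perm_two (fun A' => tprod φ ψ A A') A' B'
    simp only [symP, this, Nat.factorial]
    norm_num
  have h2 : symProd φ ψ ![A, B] ![A', B'] = (1 / 2) * (symP (l := 2) (tprod φ ψ) ![A, B] ![A', B']
      + symP (l := 2) (tprod φ ψ) ![B, A] ![A', B']) := by
    have := sum_perm_two (fun A => symP (l := 2) (tprod φ ψ) A ![A', B']) A B
    refine (congrArg (((Nat.factorial 2 : ℕ) : ℂ)⁻¹ * ·) this).trans ?_
    norm_num [Nat.factorial]
  rw [h2, h1, h1, e, e, e, e]
  ring

lemma tprod_bar (κ : Comp 2 0) (A B A' B' : Fin 2) :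
    tprod κ (bar κ) ![A, B] ![A', B'] = κ ![A, B] ![] * star (κ ![A', B'] ![]) := by
  refine congrArg₂ _ (congrArg₂ κ ?_ (Subsingleton.elim _ _)) (congrArg star
    (congrArg₂ κ ?_ (Subsingleton.elim _ _))) <;> (funext r; fin_cases r <;> rfl)

/-- Symmetry of κ identifies the six permutations in pairs, which leaves the three cyclic terms. -/
lemma symProd_two_one {κ : Comp 2 0} (hκ : ∀ A B, κ ![A, B] ![] = κ ![B, A] ![]) (ξ : Comp 1 1)
    (A B E A' : Fin 2) :
    3 * symProd κ ξ ![A, B, E] ![A'] =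
      SpinCalculus.cyc (fun A B => κ ![A, B] ![]) (fun E => ξ ![E] ![A']) A B E := by
  have e : ∀ A B E A' : Fin 2, tprod κ ξ ![A, B, E] ![A'] = κ ![A, B] ![] * ξ ![E] ![A'] := by
    intro A B E A'
    refine congrArg₂ _ (congrArg₂ κ ?_ (Subsingleton.elim _ _)) (congrArg₂ ξ ?_ ?_) <;>
      (funext r; fin_cases r <;> rfl)
  have h1 : ∀ A, symP (l := 1) (tprod κ ξ) A ![A'] = tprod κ ξ A ![A'] := fun A => by
    have := sum_perm_one (fun A' => tprod κ ξ A A') ![A']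
    simp only [symP, this, Nat.factorial]
    norm_num
  have h2 := sum_perm_three (fun A => symP (l := 1) (tprod κ ξ) A ![A']) A B E
  have h3 : symProd κ ξ ![A, B, E] ![A'] = ((Nat.factorial 3 : ℕ) : ℂ)⁻¹ * _ :=
    congrArg (((Nat.factorial 3 : ℕ) : ℂ)⁻¹ * ·) h2
  rw [h3, h1, h1, h1, h1, h1, h1, e, e, e, e, e, e, SpinCalculus.cyc, hκ E A, hκ B A, hκ E B]
  norm_num [Nat.factorial]
  ring

lemma symProd_two_two {κ : Comp 2 0} (hκ : ∀ A B, κ ![A, B] ![] = κ ![B, A] ![])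
    (A B P Q : Fin 2) :
    3 * symProd κ κ ![A, B, P, Q] ![] = SpinCalculus.symSq (fun A B => κ ![A, B] ![]) A B P Q := by
  have e : ∀ A B P Q : Fin 2, tprod κ κ ![A, B, P, Q] ![] = κ ![A, B] ![] * κ ![P, Q] ![] := by
    intro A B E A'
    refine congrArg₂ _ (congrArg₂ κ ?_ (Subsingleton.elim _ _))
      (congrArg₂ κ ?_ (Subsingleton.elim _ _)) <;> (funext r; fin_cases r <;> rfl)
  have h1 : ∀ A, symP (l := 0) (tprod κ κ) A ![] = tprod κ κ A ![] := fun A => by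
    simp only [symP, Fintype.sum_unique, Nat.factorial]
    norm_num
  have h2 := sum_perm_four (fun A => symP (l := 0) (tprod κ κ) A ![]) A B P Q
  have h3 : symProd κ κ ![A, B, P, Q] ![] = ((Nat.factorial 4 : ℕ) : ℂ)⁻¹ * _ :=
    congrArg (((Nat.factorial 4 : ℕ) : ℂ)⁻¹ * ·) h2
  simp only [h3, h1, e]
  rw [SpinCalculus.symSq, hκ B A, hκ P A, hκ Q A, hκ P B, hκ Q B, hκ Q P]
  norm_num [Nat.factorial]
  ring

end Symmetrization

lemma tr_eq_ctr (f : Fin 2 → Fin 2 → ℂ) : tr f = ctr f := by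
  simp [tr, ctr, eps]
  ring

lemma map_ctr {R R' : Type*} [CommRing R] [CommRing R'] (θ : R →+* R') (f : Fin 2 → Fin 2 → R) :
    θ (ctr f) = ctr fun A B => θ (f A B) := map_sub θ _ _

lemma mul_ctr {R : Type*} [CommRing R] (c : R) (f : Fin 2 → Fin 2 → R) :
    c * ctr f = ctr fun A B => c * f A B := mul_sub _ _ _

/-! ### Curls and obstructions on a patch -/

section Patch

variable {M : Type*} [TopologicalSpace M] [ChartedSpace (EuclideanSpace ℝ (Fin 4)) M]
  [IsManifold (𝓡 4) ∞ M] {g : LorentzMetric M} {ι : Type*} {S : SpinStructure g ι}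

namespace SpinStructure

lemma isSymmetric_Psi : S.IsSymmetric S.Psi := by
  intro i x hx s s' A A'
  obtain ⟨V, hV, p, -⟩ := exists_isPatch hx hx
  refine (p.Psi_eq _ _ ⟨x, hV⟩).trans (Eq.trans ?_ (p.Psi_eq _ _ ⟨x, hV⟩).symm)
  exact congrArg (fun n => evalAt _ (p.calculus.psi n)) (Equiv.sum_comp s fun r => (A r : ℕ))

lemma isSymmetric_Phi : S.IsSymmetric S.Phi := by
  intro i x hx s s' A A'
  obtain ⟨V, hV, p, -⟩ := exists_isPatch hx hx
  refine (p.Phi_eq _ _ ⟨x, hV⟩).trans (Eq.trans ?_ (p.Phi_eq _ _ ⟨x, hV⟩).symm)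
  have h : ∀ (s : Equiv.Perm (Fin 2)) (A : Fin 2 → Fin 2),
      (((A ∘ s) 0 : ℕ) + (A ∘ s) 1) = (A 0 : ℕ) + A 1 := fun s A => by
    have := Equiv.sum_comp s fun r => (A r : ℕ)
    rwa [Fin.sum_univ_two, Fin.sum_univ_two] at this
  rw [h, h]

variable {i : ι} {V : Set M}

namespace IsPatch

variable (p : S.IsPatch i V) (x : V)

lemma Psi_vec (A B P Q : Fin 2) :
    S.Psi i x ![A, B, P, Q] ![] = evalAt x (p.calculus.psi (A + B + P + Q)) := by
  rw [p.Psi_eq, Fin.sum_univ_four]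
  rfl

lemma PsiBar_vec (A B P Q : Fin 2) :
    S.PsiBar i x ![] ![A, B, P, Q] = evalAt x (p.calculus.swap.psi (A + B + P + Q)) := by
  rw [p.PsiBar_eq, Fin.sum_univ_four]
  rfl

/-- By the contracted Bianchi identity the curl is a Weyl divergence plus ε times ∇Λ, and the
symmetrization removes the latter. -/
lemma curl_Phi (A B E A' : Fin 2) :
    S.curl S.Phi i x ![A, B, E] ![A'] = evalAt x (p.calculus.curlPhi A B E A') := by
  rw [curl_eq isSymmetric_Phi (p.subset x.2), sum_swap_three (fun a => tr fun B' C' =>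
    S.nabla S.Phi i x a (Matrix.vecCons C' (Matrix.vecCons B' ![A'])))]
  have e : ∀ A B E : Fin 2, (tr fun B' C' =>
      S.nabla S.Phi i x ![A, B, E] (Matrix.vecCons C' (Matrix.vecCons B' ![A']))) =
      evalAt x (p.calculus.nphi A 1 (B + E) A' - p.calculus.nphi A 0 (B + E) (1 + A')) := by
    intro A B E
    rw [tr_eq_ctr, ctr, p.nabla_Phi, p.nabla_Phi, map_sub]
    simp
  have e1 : (B + A + E : ℕ) = A + B + E := by omega
  have e2 : (E + B + A : ℕ) = A + B + E := by omega
  have s1 : (ep B A : smoothRing V) = -ep A B := ep_antisymm _ _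
  have s2 : (ep E A : smoothRing V) = -ep A E := ep_antisymm _ _
  have s3 : (ep E B : smoothRing V) = -ep B E := ep_antisymm _ _
  simp only [Matrix.cons_val_zero, Matrix.cons_val_one, Matrix.cons_val_two, Matrix.head_cons,
    Matrix.tail_cons, e, p.calculus.curl_phi, e1, e2, s1, s2, s3, SpinCalculus.curlPhi, map_add,
    map_sub, map_neg, map_mul]
  push_cast
  ring

lemma curlDagger_Phi (A A' B' E' : Fin 2) :
    S.curlDagger S.Phi i x ![A] ![A', B', E'] =
      evalAt x (p.calculus.swap.curlPhi A' B' E' A) := by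
  rw [curlDagger_eq isSymmetric_Phi (p.subset x.2), sum_swap_three (fun a => tr fun B C =>
    S.nabla S.Phi i x (Matrix.vecCons C (Matrix.vecCons B ![A])) a)]
  have e : ∀ A' B' E' : Fin 2, (tr fun B C =>
      S.nabla S.Phi i x (Matrix.vecCons C (Matrix.vecCons B ![A])) ![A', B', E']) =
      evalAt x (p.calculus.swap.nphi A' 1 (B' + E') A
        - p.calculus.swap.nphi A' 0 (B' + E') (1 + A)) := by
    intro A' B' E'
    rw [tr_eq_ctr, ctr, p.nabla_Phi, p.nabla_Phi, map_sub, SpinCalculus.swap_nphi,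
      SpinCalculus.swap_nphi]
    simp
  have e1 : (B' + A' + E' : ℕ) = A' + B' + E' := by omega
  have e2 : (E' + B' + A' : ℕ) = A' + B' + E' := by omega
  have s1 : (ep B' A' : smoothRing V) = -ep A' B' := ep_antisymm _ _
  have s2 : (ep E' A' : smoothRing V) = -ep A' E' := ep_antisymm _ _
  have s3 : (ep E' B' : smoothRing V) = -ep B' E' := ep_antisymm _ _
  simp only [Matrix.cons_val_zero, Matrix.cons_val_one, Matrix.cons_val_two, Matrix.head_cons,
    Matrix.tail_cons, e, p.calculus.swap.curl_phi, e1, e2, s1, s2, s3, SpinCalculus.curlPhi, map_add,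
    map_sub, map_neg, map_mul]
  push_cast
  ring

lemma twist_Psi (A B P Q T A' : Fin 2) :
    5 * S.twist S.Psi i x ![A, B, P, Q, T] ![A'] = evalAt x
      (p.calculus.npsi A A' (B + P + Q + T) + p.calculus.npsi B A' (A + P + Q + T)
        + p.calculus.npsi P A' (A + B + Q + T) + p.calculus.npsi Q A' (A + B + P + T)
        + p.calculus.npsi T A' (A + B + P + Q)) := by
  have u : ![A'] ∘ Equiv.swap (0 : Fin 1) 0 = ![A'] := by funext r; fin_cases r; rfl
  have e1 : (B + A + Q + T : ℕ) = A + B + Q + T := by omega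
  have e2 : (B + P + A + T : ℕ) = A + B + P + T := by omega
  have e3 : (B + P + Q + A : ℕ) = A + B + P + Q := by omega
  rw [twist_eq isSymmetric_Psi (p.subset x.2)]
  simp only [Fin.sum_univ_succ (n := 0), Fin.sum_univ_zero, add_zero, u,
    sum_swap_five (fun A => S.nabla S.Psi i x A ![A'])]
  have v : ∀ a b c d e : Fin 2, ![a, b, c, d, e] 0 = a ∧ ![a, b, c, d, e] 1 = b ∧
    ![a, b, c, d, e] 2 = c ∧ ![a, b, c, d, e] 3 = d ∧ ![a, b, c, d, e] 4 = e :=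
    fun _ _ _ _ _ => ⟨rfl, rfl, rfl, rfl, rfl⟩
  simp only [(v _ _ _ _ _).1, (v _ _ _ _ _).2.1, (v _ _ _ _ _).2.2.1, (v _ _ _ _ _).2.2.2.1,
    (v _ _ _ _ _).2.2.2.2, p.nabla_Psi, map_add]
  simp only [e1, e2, e3]
  push_cast
  ring

section valence22

variable {L : S.Field 2 2} {c : ℕ} {l K K' : Fin 2 → Fin 2 → Fin 2 → Fin 2 → smoothRing V}

/-- The integer `c` clears the denominators of symmetrization, so that `l` is polynomial in the
components of the factors. -/
lemma nabla22_mul (hL : S.IsSpinorField L)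
    (hl : ∀ (y : V) P Q P' Q', c * L i y ![P, Q] ![P', Q'] = evalAt y (l P Q P' Q'))
    (A A' P P' Q Q' : Fin 2) :
    c * S.nabla L i x ![A, P, Q] ![A', P', Q'] =
      evalAt x (p.calculus.n22 (fun P P' Q Q' => l P Q P' Q') A A' P P' Q Q') := by
  rw [p.nabla22_eq (f := fun P P' Q Q' => p.comp hL ![P, Q] ![P', Q']) (fun _ _ _ _ _ => rfl)]
  have h : (fun P P' Q Q' => l P Q P' Q') = fun P P' Q Q' => c * p.comp hL ![P, Q] ![P', Q'] := by
    funext P P' Q Q'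
    refine ext_evalAt fun y => ?_
    rw [← hl, map_mul, map_natCast]
    rfl
  rw [h, ← SpinCalculus.n22_natCast_mul, map_mul, map_natCast]

lemma twist22_eq_zero (hc : c ≠ 0) (hL : S.IsSpinorField L) (hs : S.IsSymmetric L)
    (hl : ∀ (y : V) P Q P' Q', c * L i y ![P, Q] ![P', Q'] = evalAt y (l P Q P' Q'))
    (h : ∀ a0 a1 a2 b0 b1 b2, p.calculus.n22 (fun P P' Q Q' => l P Q P' Q') a0 b0 a1 b1 a2 b2
      + p.calculus.n22 (fun P P' Q Q' => l P Q P' Q') a0 b1 a1 b0 a2 b2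
      + p.calculus.n22 (fun P P' Q Q' => l P Q P' Q') a0 b2 a1 b1 a2 b0
      + p.calculus.n22 (fun P P' Q Q' => l P Q P' Q') a1 b0 a0 b1 a2 b2
      + p.calculus.n22 (fun P P' Q Q' => l P Q P' Q') a1 b1 a0 b0 a2 b2
      + p.calculus.n22 (fun P P' Q Q' => l P Q P' Q') a1 b2 a0 b1 a2 b0
      + p.calculus.n22 (fun P P' Q Q' => l P Q P' Q') a2 b0 a1 b1 a0 b2
      + p.calculus.n22 (fun P P' Q Q' => l P Q P' Q') a2 b1 a1 b0 a0 b2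
      + p.calculus.n22 (fun P P' Q Q' => l P Q P' Q') a2 b2 a1 b1 a0 b0 = 0)
    (A A' : Fin 3 → Fin 2) : S.twist L i x A A' = 0 := by
  have h1 : ∀ G : (Fin 3 → Fin 2) → (Fin 3 → Fin 2) → ℂ,
      ∑ p, ∑ q, G (A ∘ Equiv.swap 0 p) (A' ∘ Equiv.swap 0 q) =
      G ![A 0, A 1, A 2] ![A' 0, A' 1, A' 2] + G ![A 0, A 1, A 2] ![A' 1, A' 0, A' 2]
      + G ![A 0, A 1, A 2] ![A' 2, A' 1, A' 0] + (G ![A 1, A 0, A 2] ![A' 0, A' 1, A' 2]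
      + G ![A 1, A 0, A 2] ![A' 1, A' 0, A' 2] + G ![A 1, A 0, A 2] ![A' 2, A' 1, A' 0])
      + (G ![A 2, A 1, A 0] ![A' 0, A' 1, A' 2] + G ![A 2, A 1, A 0] ![A' 1, A' 0, A' 2]
      + G ![A 2, A 1, A 0] ![A' 2, A' 1, A' 0]) := by
    intro G
    rw [sum_swap_three (fun a => ∑ q, G a (A' ∘ Equiv.swap 0 q))]
    simp only [sum_swap_three (G _)]
  have hc' : (c : ℂ) ≠ 0 := by exact_mod_cast hc
  have h2 := congrArg (evalAt x) (h (A 0) (A 1) (A 2) (A' 0) (A' 1) (A' 2))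
  simp only [map_add, map_zero, ← p.nabla22_mul x hL hl] at h2
  have h3 : (c : ℂ) * S.twist L i x A A' = 0 := by
    rw [twist_eq hs (p.subset x.2), h1]
    linear_combination ((2 + 1 : ℂ)⁻¹ * (2 + 1 : ℂ)⁻¹) * h2
  exact (mul_eq_zero.mp h3).resolve_left hc'

lemma curl22_mul (hL : S.IsSpinorField L) (hs : S.IsSymmetric L)
    (hl : ∀ (y : V) P Q P' Q', c * L i y ![P, Q] ![P', Q'] = evalAt y (l P Q P' Q'))
    (hK : ∀ A B E A',
      (ctr fun b c => p.calculus.n22 (fun P P' Q Q' => l P Q P' Q') A c B b E A')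
      + (ctr fun b c => p.calculus.n22 (fun P P' Q Q' => l P Q P' Q') B c A b E A')
      + (ctr fun b c => p.calculus.n22 (fun P P' Q Q' => l P Q P' Q') E c B b A A') =
      3 * K A B E A') (A B E A' : Fin 2) :
    c * S.curl L i x ![A, B, E] ![A'] = evalAt x (K A B E A') := by
  have h := congrArg (evalAt x) (hK A B E A')
  simp only [map_add, map_ctr, map_mul, map_ofNat, ← p.nabla22_mul x hL hl, ← mul_ctr,
    ← tr_eq_ctr] at h
  rw [curl_eq hs (p.subset x.2), sum_swap_three (fun a => tr fun B' C' =>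
    S.nabla L i x a (Matrix.vecCons C' (Matrix.vecCons B' ![A'])))]
  simp only [Matrix.cons_val_zero, Matrix.cons_val_one, Matrix.cons_val_two, Matrix.head_cons,
    Matrix.tail_cons]
  push_cast
  linear_combination (1 / 3) * h

lemma curlDagger22_mul (hL : S.IsSpinorField L) (hs : S.IsSymmetric L)
    (hl : ∀ (y : V) P Q P' Q', c * L i y ![P, Q] ![P', Q'] = evalAt y (l P Q P' Q'))
    (hK : ∀ A A' B' E',
      (ctr fun b c => p.calculus.n22 (fun P P' Q Q' => l P Q P' Q') c A' b B' A E')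
      + (ctr fun b c => p.calculus.n22 (fun P P' Q Q' => l P Q P' Q') c B' b A' A E')
      + (ctr fun b c => p.calculus.n22 (fun P P' Q Q' => l P Q P' Q') c E' b B' A A') =
      3 * K' A A' B' E') (A A' B' E' : Fin 2) :
    c * S.curlDagger L i x ![A] ![A', B', E'] = evalAt x (K' A A' B' E') := by
  have h := congrArg (evalAt x) (hK A A' B' E')
  simp only [map_add, map_ctr, map_mul, map_ofNat, ← p.nabla22_mul x hL hl, ← mul_ctr,
    ← tr_eq_ctr] at h
  rw [curlDagger_eq hs (p.subset x.2), sum_swap_three (fun a => tr fun B C =>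
    S.nabla L i x (Matrix.vecCons C (Matrix.vecCons B ![A])) a)]
  simp only [Matrix.cons_val_zero, Matrix.cons_val_one, Matrix.cons_val_two, Matrix.head_cons,
    Matrix.tail_cons]
  push_cast
  linear_combination (1 / 3) * h

lemma obstruction0_mul
    (hl : ∀ (y : V) P Q P' Q', c * L i y ![P, Q] ![P', Q'] = evalAt y (l P Q P' Q'))
    (hK : ∀ A B E A', c * S.curl L i x ![A, B, E] ![A'] = evalAt x (K A B E A'))
    (hK' : ∀ A A' B' E', c * S.curlDagger L i x ![A] ![A', B', E'] = evalAt x (K' A A' B' E'))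
    (A A' : Fin 2) :
    3 * c * S.obstruction0 L i x A A' = evalAt x (p.calculus.obs0 K K' l A A') := by
  simp only [obstruction0, SpinCalculus.obs0, map_add, map_mul, map_ofNat, map_ctr, ← hK, ← hK',
    ← hl, ← p.Psi_vec, ← p.PsiBar_vec, ← p.curl_Phi, ← p.curlDagger_Phi, tr_eq_ctr]
  simp only [ctr]
  ring

lemma obstruction1_mul
    (hl : ∀ (y : V) P Q P' Q', c * L i y ![P, Q] ![P', Q'] = evalAt y (l P Q P' Q'))
    (A B A' B' : Fin 2) :
    c * S.obstruction1 L i x A B A' B' = evalAt x (p.calculus.obs1 l A B A' B') := by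
  simp only [obstruction1, SpinCalculus.obs1, map_sub, map_mul, map_ctr,
    ← hl, ← p.Psi_vec, ← p.PsiBar_vec, tr_eq_ctr]
  simp only [ctr]
  ring

end valence22

section valence31

variable {L : S.Field 3 1} {c : ℕ} {l N : Fin 2 → Fin 2 → Fin 2 → Fin 2 → smoothRing V}
  {K : Fin 2 → Fin 2 → smoothRing V}

lemma nabla31_mul (hL : S.IsSpinorField L)
    (hl : ∀ (y : V) P Q T P', c * L i y ![P, Q, T] ![P'] = evalAt y (l P Q T P'))
    (A A' P P' Q T : Fin 2) :
    c * S.nabla L i x ![A, P, Q, T] ![A', P'] =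
      evalAt x (p.calculus.n31 (fun P P' Q T => l P Q T P') A A' P P' Q T) := by
  rw [p.nabla31_eq (f := fun P P' Q T => p.comp hL ![P, Q, T] ![P']) (fun _ _ _ _ _ => rfl)]
  have h : (fun P P' Q T => l P Q T P') = fun P P' Q T => c * p.comp hL ![P, Q, T] ![P'] := by
    funext P P' Q Q'
    refine ext_evalAt fun y => ?_
    rw [← hl, map_mul, map_natCast]
    rfl
  rw [h, ← SpinCalculus.n31_natCast_mul, map_mul, map_natCast]

lemma twist31_eq_zero (hc : c ≠ 0) (hL : S.IsSpinorField L) (hs : S.IsSymmetric L)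
    (hl : ∀ (y : V) P Q T P', c * L i y ![P, Q, T] ![P'] = evalAt y (l P Q T P'))
    (h : ∀ a0 a1 a2 a3 b0 b1, p.calculus.n31 (fun P P' Q T => l P Q T P') a0 b0 a1 b1 a2 a3
      + p.calculus.n31 (fun P P' Q T => l P Q T P') a0 b1 a1 b0 a2 a3
      + p.calculus.n31 (fun P P' Q T => l P Q T P') a1 b0 a0 b1 a2 a3
      + p.calculus.n31 (fun P P' Q T => l P Q T P') a1 b1 a0 b0 a2 a3
      + p.calculus.n31 (fun P P' Q T => l P Q T P') a2 b0 a1 b1 a0 a3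
      + p.calculus.n31 (fun P P' Q T => l P Q T P') a2 b1 a1 b0 a0 a3
      + p.calculus.n31 (fun P P' Q T => l P Q T P') a3 b0 a1 b1 a2 a0
      + p.calculus.n31 (fun P P' Q T => l P Q T P') a3 b1 a1 b0 a2 a0 = 0)
    (A : Fin 4 → Fin 2) (A' : Fin 2 → Fin 2) : S.twist L i x A A' = 0 := by
  have h1 : ∀ G : (Fin 4 → Fin 2) → (Fin 2 → Fin 2) → ℂ,
      ∑ p, ∑ q, G (A ∘ Equiv.swap 0 p) (A' ∘ Equiv.swap 0 q) =
      G ![A 0, A 1, A 2, A 3] ![A' 0, A' 1] + G ![A 0, A 1, A 2, A 3] ![A' 1, A' 0]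
      + (G ![A 1, A 0, A 2, A 3] ![A' 0, A' 1] + G ![A 1, A 0, A 2, A 3] ![A' 1, A' 0])
      + (G ![A 2, A 1, A 0, A 3] ![A' 0, A' 1] + G ![A 2, A 1, A 0, A 3] ![A' 1, A' 0])
      + (G ![A 3, A 1, A 2, A 0] ![A' 0, A' 1] + G ![A 3, A 1, A 2, A 0] ![A' 1, A' 0]) := by
    intro G
    rw [sum_swap_four (fun a => ∑ q, G a (A' ∘ Equiv.swap 0 q))]
    simp only [sum_swap_two (G _)]
  have hc' : (c : ℂ) ≠ 0 := by exact_mod_cast hc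
  have h2 := congrArg (evalAt x) (h (A 0) (A 1) (A 2) (A 3) (A' 0) (A' 1))
  simp only [map_add, map_zero, ← p.nabla31_mul x hL hl] at h2
  have h3 : (c : ℂ) * S.twist L i x A A' = 0 := by
    rw [twist_eq hs (p.subset x.2), h1]
    push_cast
    linear_combination ((3 + 1 : ℂ)⁻¹ * (1 + 1 : ℂ)⁻¹) * h2
  exact (mul_eq_zero.mp h3).resolve_left hc'

lemma curl31_mul (hL : S.IsSpinorField L) (hs : S.IsSymmetric L)
    (hl : ∀ (y : V) P Q T P', c * L i y ![P, Q, T] ![P'] = evalAt y (l P Q T P'))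
    (hN : ∀ A B P Q, (ctr fun b c => p.calculus.n31 (fun P P' Q T => l P Q T P') A c B b P Q)
      + (ctr fun b c => p.calculus.n31 (fun P P' Q T => l P Q T P') B c A b P Q)
      + (ctr fun b c => p.calculus.n31 (fun P P' Q T => l P Q T P') P c B b A Q)
      + (ctr fun b c => p.calculus.n31 (fun P P' Q T => l P Q T P') Q c B b P A) = 4 * N A B P Q)
    (A B P Q : Fin 2) :
    c * S.curl L i x ![A, B, P, Q] ![] = evalAt x (N A B P Q) := by
  have h := congrArg (evalAt x) (hN A B P Q)
  simp only [map_add, map_ctr, map_mul, map_ofNat, ← p.nabla31_mul x hL hl, ← mul_ctr,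
    ← tr_eq_ctr] at h
  rw [curl_eq hs (p.subset x.2), sum_swap_four (fun a => tr fun B' C' =>
    S.nabla L i x a (Matrix.vecCons C' (Matrix.vecCons B' ![])))]
  have v : ∀ a b c d : Fin 2, ![a, b, c, d] 0 = a ∧ ![a, b, c, d] 1 = b ∧
    ![a, b, c, d] 2 = c ∧ ![a, b, c, d] 3 = d := fun _ _ _ _ => ⟨rfl, rfl, rfl, rfl⟩
  simp only [(v _ _ _ _).1, (v _ _ _ _).2.1, (v _ _ _ _).2.2.1, (v _ _ _ _).2.2.2]
  push_cast
  linear_combination (1 / 4) * h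

lemma div31_mul (hL : S.IsSpinorField L)
    (hl : ∀ (y : V) P Q T P', c * L i y ![P, Q, T] ![P'] = evalAt y (l P Q T P'))
    (hK : ∀ A B, (ctr fun X Y => ctr fun b c =>
      p.calculus.n31 (fun P P' Q T => l P Q T P') Y c X b A B) = K A B) (A B : Fin 2) :
    c * S.divOp L i x ![A, B] ![] = evalAt x (K A B) := by
  rw [← hK]
  simp only [map_ctr, ← p.nabla31_mul x hL hl, ← mul_ctr, ← tr_eq_ctr]
  rfl

/-- The factor 60 clears the denominators 4, 6, 5 and 3·5; the last 5 comes from symmetrizing ∇Ψ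
over five indices. -/
lemma obstructionHalf_mul
    (hl : ∀ (y : V) P Q T P', c * L i y ![P, Q, T] ![P'] = evalAt y (l P Q T P'))
    (hK : ∀ A B, c * S.divOp L i x ![A, B] ![] = evalAt x (K A B))
    (hN : ∀ A B P Q, c * S.curl L i x ![A, B, P, Q] ![] = evalAt x (N A B P Q)) (A B : Fin 2) :
    60 * c * S.obstructionHalf L i x A B = evalAt x (p.calculus.obsHalf K N l A B) := by
  have t : ∀ A B P Q T A' : Fin 2, _ := fun A B P Q T A' => p.twist_Psi x A B P Q T A'
  simp only [map_add] at t
  simp only [obstructionHalf, SpinCalculus.obsHalf, map_add, map_sub, map_mul, map_ofNat, map_ctr,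
    ← hK, ← hN, ← hl, ← p.Psi_vec, ← p.curl_Phi, tr_eq_ctr, ← t]
  simp only [ctr]
  ring

end valence31

section valence40

variable {L : S.Field 4 0} {c : ℕ} {l : Fin 2 → Fin 2 → Fin 2 → Fin 2 → smoothRing V}

lemma nabla40_mul (hL : S.IsSpinorField L)
    (hl : ∀ (y : V) P Q T U, c * L i y ![P, Q, T, U] ![] = evalAt y (l P Q T U))
    (A A' P Q T U : Fin 2) :
    c * S.nabla L i x ![A, P, Q, T, U] ![A'] = evalAt x (p.calculus.n40 l A A' P Q T U) := by
  rw [p.nabla40_eq (f := fun P Q T U => p.comp hL ![P, Q, T, U] ![]) (fun _ _ _ _ _ => rfl)]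
  have h : l = fun P Q T U => c * p.comp hL ![P, Q, T, U] ![] := by
    funext P P' Q Q'
    refine ext_evalAt fun y => ?_
    rw [← hl, map_mul, map_natCast]
    rfl
  rw [h, ← SpinCalculus.n40_natCast_mul, map_mul, map_natCast]

lemma twist40_eq_zero (hc : c ≠ 0) (hL : S.IsSpinorField L) (hs : S.IsSymmetric L)
    (hl : ∀ (y : V) P Q T U, c * L i y ![P, Q, T, U] ![] = evalAt y (l P Q T U))
    (h : ∀ a0 a1 a2 a3 a4 A', p.calculus.n40 l a0 A' a1 a2 a3 a4
      + p.calculus.n40 l a1 A' a0 a2 a3 a4 + p.calculus.n40 l a2 A' a1 a0 a3 a4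
      + p.calculus.n40 l a3 A' a1 a2 a0 a4 + p.calculus.n40 l a4 A' a1 a2 a3 a0 = 0)
    (A : Fin 5 → Fin 2) (A' : Fin 1 → Fin 2) : S.twist L i x A A' = 0 := by
  have u : A' ∘ Equiv.swap (0 : Fin 1) 0 = ![A' 0] := by funext r; fin_cases r; rfl
  have hc' : (c : ℂ) ≠ 0 := by exact_mod_cast hc
  have h2 := congrArg (evalAt x) (h (A 0) (A 1) (A 2) (A 3) (A 4) (A' 0))
  simp only [map_add, map_zero, ← p.nabla40_mul x hL hl] at h2
  have h3 : (c : ℂ) * S.twist L i x A A' = 0 := by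
    rw [twist_eq hs (p.subset x.2)]
    simp only [Fin.sum_univ_succ (n := 0), Fin.sum_univ_zero, add_zero, u,
      sum_swap_five (fun A => S.nabla L i x A ![A' 0])]
    push_cast
    linear_combination ((4 + 1 : ℂ)⁻¹ * (0 + 1 : ℂ)⁻¹) * h2
  exact (mul_eq_zero.mp h3).resolve_left hc'

end valence40

end IsPatch

end SpinStructure

end Patch

/-! ### Products of conformal Killing vectors -/

lemma SpinCalculus.exists_two_mul {R : Type*} [CommRing R] (C : SpinCalculus R) (a : R) :
    ∃ q, 2 * q = a :=
  ⟨3 * C.sixth * a, by linear_combination a * C.six_mul_sixth⟩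

lemma SpinCalculus.exists_three_mul {R : Type*} [CommRing R] (C : SpinCalculus R) (a : R) :
    ∃ q, 3 * q = a :=
  ⟨2 * C.sixth * a, by linear_combination a * C.six_mul_sixth⟩

namespace SpinCalculus.IsHom

variable {R R' : Type*} [CommRing R] [CommRing R'] {C : SpinCalculus R} {C' : SpinCalculus R'}
  {θ : R →+* R'}

lemma map_ckvPotential (h : C.IsHom C' θ) (ξ ζ F F' G G' : Fin 2 → Fin 2 → R) (d e : R) :
    θ (C.ckvPotential ξ ζ F F' G G' d e) = C'.ckvPotential (fun A B => θ (ξ A B))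
      (fun A B => θ (ζ A B)) (fun A B => θ (F A B)) (fun A B => θ (F' A B)) (fun A B => θ (G A B))
      (fun A B => θ (G' A B)) (θ d) (θ e) := by
  simp only [ckvPotential, dot, quad, map_ctr, map_add, map_sub, map_mul, map_ofNat, h.map_omega,
    h.map_lam, h.map_phi]

end SpinCalculus.IsHom

section Patch

variable {M : Type*} [TopologicalSpace M] [ChartedSpace (EuclideanSpace ℝ (Fin 4)) M]
  [IsManifold (𝓡 4) ∞ M] {g : LorentzMetric M} {ι : Type*} {S : SpinStructure g ι}

namespace SpinStructure

section conformalKilling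

variable {ξ ζ : S.Field 1 1}

namespace IsPatch

variable {i : ι} {V : Set M} (p : S.IsPatch i V)

lemma symProd_one_one (hξ : S.IsSpinorField ξ) (hζ : S.IsSpinorField ζ) (y : V) (P Q P' Q' : Fin 2) :
    ((4 : ℕ) : ℂ) * symProd (ξ i y) (ζ i y) ![P, Q] ![P', Q'] =
      evalAt y (SpinCalculus.symPair (fun A A' => p.comp hξ ![A] ![A'])
        (fun A A' => p.comp hζ ![A] ![A']) P Q P' Q') := by
  rw [Nat.cast_ofNat, SpinGeometry.symProd_one_one]
  rfl

end IsPatch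

lemma isKillingSpinor_symProd_one_one (hξ : S.IsKillingSpinor ξ) (hζ : S.IsKillingSpinor ζ) :
    S.IsKillingSpinor (fun i x => symProd (ξ i x) (ζ i x)) where
  isSpinorField := hξ.isSpinorField.symProd hζ.isSpinorField
  isSymmetric := isSymmetric_symProd ξ ζ
  twist_eq_zero i x hx A A' := by
    obtain ⟨V, hV, p, -⟩ := exists_isPatch hx hx
    obtain ⟨F, F', d, h⟩ := p.exists_isCKV hξ
    obtain ⟨G, G', e, h'⟩ := p.exists_isCKV hζ
    exact p.twist22_eq_zero ⟨x, hV⟩ (L := fun i x => symProd (ξ i x) (ζ i x)) four_ne_zero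
      (hξ.isSpinorField.symProd hζ.isSpinorField) (isSymmetric_symProd ξ ζ)
      (p.symProd_one_one hξ.isSpinorField hζ.isSpinorField) (SpinCalculus.twist_symPair h h') A A'

lemma conditionA0_symProd (hξ : S.IsKillingSpinor ξ) (hζ : S.IsKillingSpinor ζ) :
    S.ConditionA0 (fun i x => symProd (ξ i x) (ζ i x)) := by
  -- The prolonged data are quantified existentially, so no compatible choices are required;
  -- uniqueness is supplied by `ckvPotential_eq`.
  let 𝒬 : ∀ i (V : Set M), S.IsPatch i V → smoothRing V → Prop := fun i V p q =>
    ∃ F F' d G G' e, p.calculus.IsCKV (fun A A' => p.comp hξ.isSpinorField ![A] ![A']) F F' d ∧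
      p.calculus.IsCKV (fun A A' => p.comp hζ.isSpinorField ![A] ![A']) G G' e ∧
      2 * q = p.calculus.ckvPotential (fun A A' => p.comp hξ.isSpinorField ![A] ![A'])
        (fun A A' => p.comp hζ.isSpinorField ![A] ![A']) F F' G G' d e
  have ex : ∀ i V p, ∃ q, 𝒬 i V p q := by
    intro i V p
    obtain ⟨F, F', d, k⟩ := p.exists_isCKV hξ
    obtain ⟨G, G', e, k'⟩ := p.exists_isCKV hζ
    obtain ⟨q, hq⟩ := p.calculus.exists_two_mul (p.calculus.ckvPotential
      (fun A A' => p.comp hξ.isSpinorField ![A] ![A'])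
      (fun A A' => p.comp hζ.isSpinorField ![A] ![A']) F F' G G' d e)
    exact ⟨q, F, F', d, G, G', e, k, k', hq⟩
  have glue := exists_function 𝒬 ex (by
    rintro i V W p p' hW q ⟨F, F', d, G, G', e, k, k', hq⟩
    have r := p.isHom_res p' hW
    refine ⟨_, _, _, _, _, _, r.isCKV k, r.isCKV k', ?_⟩
    have hq' := congrArg (resRing hW) hq
    rw [map_mul, map_ofNat, r.map_ckvPotential] at hq'
    exact hq') (by
    rintro i j V p p' q q' ⟨F, F', d, G, G', e, k, k', hq⟩ ⟨F₂, F₂', d₂, G₂, G₂', e₂, k₂, k₂', hq₂⟩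
    apply p.calculus.two_cancel
    rw [hq, hq₂]
    rw [IsPatch.comp_change11 hξ.isSpinorField p p'] at k₂ ⊢
    rw [IsPatch.comp_change11 hζ.isSpinorField p p'] at k₂' ⊢
    exact ((p.isGauge p').ckvPotential_eq k k' k₂ k₂').symm)
  obtain ⟨Q, hQ, h⟩ := glue
  refine ⟨Q, hQ, fun i x hx A A' => ?_⟩
  obtain ⟨V, hV, p, -⟩ := exists_isPatch hx hx
  obtain ⟨q, hq⟩ := ex i V p
  have hn := p.nablaFun_eq (h i V p q hq) A A' ⟨x, hV⟩
  obtain ⟨F, F', d, G, G', e, k, k', hq⟩ := hq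
  have ho := p.obstruction0_mul ⟨x, hV⟩ (L := fun i x => symProd (ξ i x) (ζ i x))
    (p.symProd_one_one hξ.isSpinorField hζ.isSpinorField)
    (p.curl22_mul ⟨x, hV⟩ (L := fun i x => symProd (ξ i x) (ζ i x))
      (hξ.isSpinorField.symProd hζ.isSpinorField)
      (isSymmetric_symProd ξ ζ) (p.symProd_one_one hξ.isSpinorField hζ.isSpinorField)
      (SpinCalculus.curl_symPair k k'))
    (p.curlDagger22_mul ⟨x, hV⟩ (L := fun i x => symProd (ξ i x) (ζ i x))
      (hξ.isSpinorField.symProd hζ.isSpinorField)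
      (isSymmetric_symProd ξ ζ) (p.symProd_one_one hξ.isSpinorField hζ.isSpinorField)
      (SpinCalculus.curlDagger_symPair k k')) A A'
  rw [← p.calculus.D_ckvPotential k k', ← hq] at ho
  simp only [Derivation.leibniz, SpinCalculus.D_two, smul_eq_mul, mul_zero, add_zero, map_mul,
    map_ofNat, ← hn] at ho
  push_cast at ho
  -- The obstruction comes with 3·4, and the derivative with 6·2 because the potential is 2q.
  linear_combination (-1 / 12) * ho

lemma conditionA1_symProd (hξ : S.IsKillingSpinor ξ) (hζ : S.IsKillingSpinor ζ) :
    S.ConditionA1 (fun i x => symProd (ξ i x) (ζ i x)) := by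
  let 𝒱 : ∀ i (V : Set M), S.IsPatch i V → (Fin 2 → Fin 2 → smoothRing V) → Prop := fun i V p q =>
    ∃ F F' d G G' e, p.calculus.IsCKV (fun A A' => p.comp hξ.isSpinorField ![A] ![A']) F F' d ∧
      p.calculus.IsCKV (fun A A' => p.comp hζ.isSpinorField ![A] ![A']) G G' e ∧
      ∀ A A', 2 * q A A' = SpinCalculus.ckvCopotential
        (fun A A' => p.comp hξ.isSpinorField ![A] ![A'])
        (fun A A' => p.comp hζ.isSpinorField ![A] ![A']) F F' G G' A A'
  have ex : ∀ i V p, ∃ q, 𝒱 i V p q := by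
    intro i V p
    obtain ⟨F, F', d, k⟩ := p.exists_isCKV hξ
    obtain ⟨G, G', e, k'⟩ := p.exists_isCKV hζ
    choose q hq using fun A A' => p.calculus.exists_two_mul (SpinCalculus.ckvCopotential
      (fun A A' => p.comp hξ.isSpinorField ![A] ![A'])
      (fun A A' => p.comp hζ.isSpinorField ![A] ![A']) F F' G G' A A')
    exact ⟨q, F, F', d, G, G', e, k, k', hq⟩
  have glue := exists_vectorField 𝒱 ex (by
    rintro i V W p p' hW q ⟨F, F', d, G, G', e, k, k', hq⟩
    have r := p.isHom_res p' hW
    refine ⟨_, _, _, _, _, _, r.isCKV k, r.isCKV k', fun A A' => ?_⟩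
    have hq' := congrArg (resRing hW) (hq A A')
    simp only [SpinCalculus.ckvCopotential, map_ctr, map_mul, map_add, map_sub, map_neg,
      map_ofNat] at hq'
    exact hq') (by
    rintro i j V p p' q q' ⟨F, F', d, G, G', e, k, k', hq⟩ ⟨F₂, F₂', d₂, G₂, G₂', e₂, k₂, k₂', hq₂⟩
    funext A A'
    apply p.calculus.two_cancel
    rw [hq₂]
    rw [IsPatch.comp_change11 hξ.isSpinorField p p'] at k₂ ⊢
    rw [IsPatch.comp_change11 hζ.isSpinorField p p'] at k₂' ⊢
    rw [(p.isGauge p').ckvCopotential_eq k k' k₂ k₂']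
    simp only [SpinCalculus.IsGauge.act, ← hq, Fin.sum_univ_two]
    ring)
  obtain ⟨P, hP, h⟩ := glue
  refine ⟨P, hP, fun i x hx A B A' B' => ?_⟩
  obtain ⟨V, hV, p, -⟩ := exists_isPatch hx hx
  obtain ⟨q, hq⟩ := ex i V p
  have hn := p.twist11_eq (h i V p q hq) A A' B B' ⟨x, hV⟩
  obtain ⟨F, F', d, G, G', e, k, k', hq⟩ := hq
  have ho := p.obstruction1_mul ⟨x, hV⟩ (L := fun i x => symProd (ξ i x) (ζ i x))
    (p.symProd_one_one hξ.isSpinorField hζ.isSpinorField) A B A' B'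
  -- Writing 2q as q + q reduces the factor to additivity of the covariant derivative.
  have hc : SpinCalculus.ckvCopotential (fun A A' => p.comp hξ.isSpinorField ![A] ![A'])
      (fun A A' => p.comp hζ.isSpinorField ![A] ![A']) F F' G G' = fun A A' => q A A' + q A A' := by
    funext A A'
    rw [← hq, two_mul]
  have ht := congrArg (evalAt ⟨x, hV⟩) (p.calculus.twist_ckvCopotential k k' A A' B B')
  rw [hc] at ht
  simp only [SpinCalculus.n11_add, map_add, map_mul, map_ofNat, ← ho] at ht hn
  push_cast at ht
  linear_combination (1 / 4) * hn + (1 / 8) * ht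

end conformalKilling

end SpinStructure

end Patch

/-! ### Products involving a Killing spinor of valence (2,0) -/

section Patch

variable {M : Type*} [TopologicalSpace M] [ChartedSpace (EuclideanSpace ℝ (Fin 4)) M]
  [IsManifold (𝓡 4) ∞ M] {g : LorentzMetric M} {ι : Type*} {S : SpinStructure g ι}

namespace SpinStructure

variable {κ : S.Field 2 0} {ξ : S.Field 1 1}

namespace IsPatch

variable {i : ι} {V : Set M} (p : S.IsPatch i V)

lemma tprod_bar (hκ : S.IsSpinorField κ) (y : V) (P Q P' Q' : Fin 2) :
    ((1 : ℕ) : ℂ) * tprod (κ i y) (bar (κ i y)) ![P, Q] ![P', Q'] =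
      evalAt y (p.comp hκ ![P, Q] ![] * conjRing V (p.comp hκ ![P', Q'] ![])) := by
  rw [Nat.cast_one, one_mul, SpinGeometry.tprod_bar]
  rfl

lemma comp_comm (p : S.IsPatch i V) (h : S.IsKillingSpinor κ) (y : V) (A B : Fin 2) :
    κ i y ![A, B] ![] = κ i y ![B, A] ![] := by
  obtain ⟨η, k⟩ := p.exists_isKS20 h
  exact congrArg (evalAt y) (symm_of_eq (F := fun A B => p.comp h.isSpinorField ![A, B] ![]) k.symm A B)

lemma symProd_two_one (hκ : S.IsKillingSpinor κ) (hξ : S.IsKillingSpinor ξ) (y : V)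
    (P Q T P' : Fin 2) :
    ((3 : ℕ) : ℂ) * symProd (κ i y) (ξ i y) ![P, Q, T] ![P'] =
      evalAt y (SpinCalculus.cyc (fun A B => p.comp hκ.isSpinorField ![A, B] ![])
        (fun T => p.comp hξ.isSpinorField ![T] ![P']) P Q T) := by
  rw [Nat.cast_ofNat, SpinGeometry.symProd_two_one (p.comp_comm hκ y)]
  rfl

lemma symProd_two_two (hκ : S.IsKillingSpinor κ) (y : V) (P Q T U : Fin 2) :
    ((3 : ℕ) : ℂ) * symProd (κ i y) (κ i y) ![P, Q, T, U] ![] =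
      evalAt y (SpinCalculus.symSq (fun A B => p.comp hκ.isSpinorField ![A, B] ![]) P Q T U) := by
  rw [Nat.cast_ofNat, SpinGeometry.symProd_two_two (p.comp_comm hκ y)]
  rfl

end IsPatch

lemma isKillingSpinor_tprod_bar (hκ : S.IsKillingSpinor κ) :
    S.IsKillingSpinor (fun i x => tprod (κ i x) (bar (κ i x))) where
  isSpinorField := hκ.isSpinorField.tprod hκ.isSpinorField.bar
  isSymmetric := isSymmetric_tprod_bar hκ.isSymmetric
  twist_eq_zero i x hx A A' := by
    obtain ⟨V, hV, p, -⟩ := exists_isPatch hx hx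
    obtain ⟨η, k⟩ := p.exists_isKS20 hκ
    exact p.twist22_eq_zero ⟨x, hV⟩ (L := fun i x => tprod (κ i x) (bar (κ i x))) one_ne_zero
      (hκ.isSpinorField.tprod hκ.isSpinorField.bar) (isSymmetric_tprod_bar hκ.isSymmetric)
      (p.tprod_bar hκ.isSpinorField) (SpinCalculus.twist_mul k (p.isHom_conj.isKS20 k)) A A'

lemma conditionA0_tprod_bar (hκ : S.IsKillingSpinor κ) :
    S.ConditionA0 (fun i x => tprod (κ i x) (bar (κ i x))) := by
  -- Only η and τ for κ are chosen; the data of the conjugate spinor are their conjugates.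
  let 𝒬 : ∀ i (V : Set M), S.IsPatch i V → smoothRing V → Prop := fun i V p q =>
    ∃ η τ, p.calculus.IsKS20 (fun A B => p.comp hκ.isSpinorField ![A, B] ![]) η ∧
      p.calculus.IsTau (fun A B => p.comp hκ.isSpinorField ![A, B] ![]) η τ ∧
      3 * q = SpinCalculus.ksPotential (fun A B => p.comp hκ.isSpinorField ![A, B] ![]) η
        (fun A B => conjRing V (p.comp hκ.isSpinorField ![A, B] ![]))
        (fun A A' => conjRing V (η A A')) τ (fun n => conjRing V (τ n))
  have ex : ∀ i V p, ∃ q, 𝒬 i V p q := by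
    intro i V p
    obtain ⟨η, k⟩ := p.exists_isKS20 hκ
    obtain ⟨τ, hτ⟩ := k.exists_n11
    obtain ⟨q, hq⟩ := p.calculus.exists_three_mul (SpinCalculus.ksPotential
      (fun A B => p.comp hκ.isSpinorField ![A, B] ![]) η
      (fun A B => conjRing V (p.comp hκ.isSpinorField ![A, B] ![]))
      (fun A A' => conjRing V (η A A')) τ (fun n => conjRing V (τ n)))
    exact ⟨q, η, τ, k, hτ, hq⟩
  have glue := exists_function 𝒬 ex (by
    rintro i V W p p' hW q ⟨η, τ, k, hτ, hq⟩
    have r := p.isHom_res p' hW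
    refine ⟨fun A A' => resRing hW (η A A'), fun n => resRing hW (τ n), r.isKS20 k, ?_, ?_⟩
    · have e : (fun A B => p'.comp hκ.isSpinorField ![A, B] ![]) =
          fun A B => resRing hW (p.comp hκ.isSpinorField ![A, B] ![]) := rfl
      rw [e]
      exact r.isTau hτ
    have hq' := congrArg (resRing hW) hq
    simp only [SpinCalculus.ksPotential, dot, map_mul, map_add, map_sub, map_ofNat] at hq'
    exact hq') (by
    rintro i j V p p' q q' ⟨η, τ, k, hτ, hq⟩ ⟨η₂, τ₂, k₂, hτ₂, hq₂⟩
    have k' := p.isHom_conj.isKS20 k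
    have hτ' := p.isHom_conj.isTau hτ
    have k₂' := p'.isHom_conj.isKS20 k₂
    have hτ₂' := p'.isHom_conj.isTau hτ₂
    apply p.calculus.three_cancel
    rw [hq, hq₂]
    have c := IsPatch.comp_change20 hκ.isSpinorField p p'
    have c' : (fun A B => conjRing V (p'.comp hκ.isSpinorField ![A, B] ![])) =
        SpinCalculus.IsGauge.act (fun A B => conjRing V (p.frameChange p' A B))
          (fun A B => conjRing V (p.frameChange p' A B))
          (fun A B => conjRing V (p.comp hκ.isSpinorField ![A, B] ![])) := by
      funext A B
      have := congrArg (conjRing V) (congrFun (congrFun c A) B)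
      simpa only [SpinCalculus.IsGauge.act, map_sum, map_mul] using this
    rw [c] at k₂ hτ₂ ⊢
    rw [c'] at k₂' hτ₂' ⊢
    exact ((p.isGauge p').ksPotential_eq k k₂ hτ hτ₂ k' k₂' hτ' hτ₂').symm)
  obtain ⟨Q, hQ, h⟩ := glue
  refine ⟨Q, hQ, fun i x hx A A' => ?_⟩
  obtain ⟨V, hV, p, -⟩ := exists_isPatch hx hx
  obtain ⟨q, hq⟩ := ex i V p
  have hn := p.nablaFun_eq (h i V p q hq) A A' ⟨x, hV⟩
  obtain ⟨η, τ, k, hτ, hq⟩ := hq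
  have k' := p.isHom_conj.isKS20 k
  have hτ' := p.isHom_conj.isTau hτ
  have ho := p.obstruction0_mul ⟨x, hV⟩ (L := fun i x => tprod (κ i x) (bar (κ i x)))
    (p.tprod_bar hκ.isSpinorField)
    (p.curl22_mul ⟨x, hV⟩ (L := fun i x => tprod (κ i x) (bar (κ i x)))
      (hκ.isSpinorField.tprod hκ.isSpinorField.bar)
      (isSymmetric_tprod_bar hκ.isSymmetric) (p.tprod_bar hκ.isSpinorField)
      (SpinCalculus.curl_mul k k'))
    (p.curlDagger22_mul ⟨x, hV⟩ (L := fun i x => tprod (κ i x) (bar (κ i x)))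
      (hκ.isSpinorField.tprod hκ.isSpinorField.bar)
      (isSymmetric_tprod_bar hκ.isSymmetric) (p.tprod_bar hκ.isSpinorField)
      (SpinCalculus.curlDagger_mul k k')) A A'
  have hd := congrArg (evalAt ⟨x, hV⟩) (p.calculus.D_ksPotential k hτ k' hτ' A A')
  rw [← hq] at hd
  simp only [Derivation.leibniz, SpinCalculus.D_three, smul_eq_mul, mul_zero, add_zero, map_mul,
    map_ofNat, ← hn] at hd
  rw [← ho] at hd
  push_cast at hd
  -- With 3q as potential, 2·3 appears on the left; on the right it is 2 times the factor 3 of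
  -- `obstruction0_mul`.
  linear_combination (1 / 6) * hd

lemma conditionA1_tprod_bar (hκ : S.IsKillingSpinor κ) :
    S.ConditionA1 (fun i x => tprod (κ i x) (bar (κ i x))) := by
  let 𝒱 : ∀ i (V : Set M), S.IsPatch i V → (Fin 2 → Fin 2 → smoothRing V) → Prop := fun i V p q =>
    ∃ η, p.calculus.IsKS20 (fun A B => p.comp hκ.isSpinorField ![A, B] ![]) η ∧
      q = SpinCalculus.ksCopotential (fun A B => p.comp hκ.isSpinorField ![A, B] ![]) η
        (fun A B => conjRing V (p.comp hκ.isSpinorField ![A, B] ![]))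
        (fun A A' => conjRing V (η A A'))
  have ex : ∀ i V p, ∃ q, 𝒱 i V p q := by
    intro i V p
    obtain ⟨η, k⟩ := p.exists_isKS20 hκ
    exact ⟨_, η, k, rfl⟩
  have glue := exists_vectorField 𝒱 ex (by
    rintro i V W p p' hW q ⟨η, k, hq⟩
    have r := p.isHom_res p' hW
    refine ⟨_, r.isKS20 k, ?_⟩
    funext A A'
    have hq' := congrArg (resRing hW) (congrFun (congrFun hq A) A')
    simp only [SpinCalculus.ksCopotential, map_ctr, map_mul, map_add, map_neg,
      map_ofNat] at hq'
    exact hq') (by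
    rintro i j V p p' q q' ⟨η, k, hq⟩ ⟨η₂, k₂, hq₂⟩
    have k' := p.isHom_conj.isKS20 k
    have k₂' := p'.isHom_conj.isKS20 k₂
    have c := IsPatch.comp_change20 hκ.isSpinorField p p'
    have c' : (fun A B => conjRing V (p'.comp hκ.isSpinorField ![A, B] ![])) =
        SpinCalculus.IsGauge.act (fun A B => conjRing V (p.frameChange p' A B))
          (fun A B => conjRing V (p.frameChange p' A B))
          (fun A B => conjRing V (p.comp hκ.isSpinorField ![A, B] ![])) := by
      funext A B
      have := congrArg (conjRing V) (congrFun (congrFun c A) B)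
      simpa only [SpinCalculus.IsGauge.act, map_sum, map_mul] using this
    rw [hq, hq₂]
    rw [c] at k₂ ⊢
    rw [c'] at k₂' ⊢
    funext A A'
    exact (p.isGauge p').ksCopotential_eq k k₂ k' k₂' A A')
  obtain ⟨P, hP, h⟩ := glue
  refine ⟨P, hP, fun i x hx A B A' B' => ?_⟩
  obtain ⟨V, hV, p, -⟩ := exists_isPatch hx hx
  obtain ⟨q, hq⟩ := ex i V p
  have hn := p.twist11_eq (h i V p q hq) A A' B B' ⟨x, hV⟩
  obtain ⟨η, k, rfl⟩ := hq
  -- The vector field does not involve τ; τ enters only the computation of its derivative.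
  obtain ⟨τ, hτ⟩ := k.exists_n11
  have k' := p.isHom_conj.isKS20 k
  have hτ' := p.isHom_conj.isTau hτ
  have ho := p.obstruction1_mul ⟨x, hV⟩ (L := fun i x => tprod (κ i x) (bar (κ i x)))
    (p.tprod_bar hκ.isSpinorField) A B A' B'
  rw [p.calculus.twist_ksCopotential k hτ k' hτ', map_mul, map_ofNat, ← ho] at hn
  push_cast at hn
  linear_combination (1 / 4) * hn

lemma isKillingSpinor_symProd_two_one (hκ : S.IsKillingSpinor κ) (hξ : S.IsKillingSpinor ξ) :
    S.IsKillingSpinor (fun i x => symProd (κ i x) (ξ i x)) where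
  isSpinorField := hκ.isSpinorField.symProd hξ.isSpinorField
  isSymmetric := isSymmetric_symProd κ ξ
  twist_eq_zero i x hx A A' := by
    obtain ⟨V, hV, p, -⟩ := exists_isPatch hx hx
    obtain ⟨η, k⟩ := p.exists_isKS20 hκ
    obtain ⟨F, F', d, h⟩ := p.exists_isCKV hξ
    exact p.twist31_eq_zero ⟨x, hV⟩ (L := fun i x => symProd (κ i x) (ξ i x)) three_ne_zero
      (hκ.isSpinorField.symProd hξ.isSpinorField) (isSymmetric_symProd κ ξ)
      (p.symProd_two_one hκ hξ) (SpinCalculus.twist_cyc k h) A A'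

lemma conditionHalf_symProd (hκ : S.IsKillingSpinor κ) (hξ : S.IsKillingSpinor ξ) :
    S.ConditionHalf (fun i x => symProd (κ i x) (ξ i x)) := by
  intro i x hx A B
  obtain ⟨V, hV, p, -⟩ := exists_isPatch hx hx
  obtain ⟨η, k⟩ := p.exists_isKS20 hκ
  obtain ⟨F, F', d, h⟩ := p.exists_isCKV hξ
  have ho := p.obstructionHalf_mul ⟨x, hV⟩ (L := fun i x => symProd (κ i x) (ξ i x))
    (p.symProd_two_one hκ hξ)
    (p.div31_mul ⟨x, hV⟩ (L := fun i x => symProd (κ i x) (ξ i x))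
      (hκ.isSpinorField.symProd hξ.isSpinorField)
      (p.symProd_two_one hκ hξ) (SpinCalculus.div_cyc k h))
    (p.curl31_mul ⟨x, hV⟩ (L := fun i x => symProd (κ i x) (ξ i x))
      (hκ.isSpinorField.symProd hξ.isSpinorField) (isSymmetric_symProd κ ξ)
      (p.symProd_two_one hκ hξ) (SpinCalculus.curl_cyc k h)) A B
  rw [p.calculus.obsHalf_eq_zero k h, map_zero] at ho
  push_cast at ho
  -- Here 180 is the 60 of `obstructionHalf_mul` times the 3 of the symmetrized product.
  linear_combination (1 / 180) * ho

lemma isKillingSpinor_symProd_two_two (hκ : S.IsKillingSpinor κ) :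
    S.IsKillingSpinor (fun i x => symProd (κ i x) (κ i x)) where
  isSpinorField := hκ.isSpinorField.symProd hκ.isSpinorField
  isSymmetric := isSymmetric_symProd κ κ
  twist_eq_zero i x hx A A' := by
    obtain ⟨V, hV, p, -⟩ := exists_isPatch hx hx
    obtain ⟨η, k⟩ := p.exists_isKS20 hκ
    exact p.twist40_eq_zero ⟨x, hV⟩ (L := fun i x => symProd (κ i x) (κ i x)) three_ne_zero
      (hκ.isSpinorField.symProd hκ.isSpinorField) (isSymmetric_symProd κ κ)
      (p.symProd_two_two hκ) (SpinCalculus.twist_symSq k) A A'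

end SpinStructure

end Patch

end SpinGeometry

end

theorem proposition1p4 {M : Type*} [TopologicalSpace M]
    [ChartedSpace (EuclideanSpace ℝ (Fin 4)) M] [IsManifold (𝓡 4) ∞ M]
    (g : SpinGeometry.LorentzMetric M) {ι : Type*} (S : SpinGeometry.SpinStructure g ι)
    (ξ ζ : S.Field 1 1) (hξ : S.IsKillingSpinor ξ) (hζ : S.IsKillingSpinor ζ)
    (κ : S.Field 2 0) (hκ : S.IsKillingSpinor κ) :
    (S.IsKillingSpinor (fun i x => SpinGeometry.symProd (ξ i x) (ζ i x)) ∧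
      S.ConditionA0 (fun i x => SpinGeometry.symProd (ξ i x) (ζ i x)) ∧
      S.ConditionA1 (fun i x => SpinGeometry.symProd (ξ i x) (ζ i x))) ∧
    (S.IsKillingSpinor (fun i x => SpinGeometry.tprod (κ i x) (SpinGeometry.bar (κ i x))) ∧
      S.ConditionA0 (fun i x => SpinGeometry.tprod (κ i x) (SpinGeometry.bar (κ i x))) ∧
      S.ConditionA1 (fun i x => SpinGeometry.tprod (κ i x) (SpinGeometry.bar (κ i x)))) ∧
    (S.IsKillingSpinor (fun i x => SpinGeometry.symProd (κ i x) (ξ i x)) ∧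
      S.ConditionHalf (fun i x => SpinGeometry.symProd (κ i x) (ξ i x))) ∧
    S.IsKillingSpinor (fun i x => SpinGeometry.symProd (κ i x) (κ i x)) := by
  open SpinGeometry.SpinStructure in
  exact ⟨⟨isKillingSpinor_symProd_one_one hξ hζ, conditionA0_symProd hξ hζ,
    conditionA1_symProd hξ hζ⟩, ⟨isKillingSpinor_tprod_bar hκ, conditionA0_tprod_bar hκ,
    conditionA1_tprod_bar hκ⟩, ⟨isKillingSpinor_symProd_two_one hκ hξ,
    conditionHalf_symProd hκ hξ⟩, isKillingSpinor_symProd_two_two hκ⟩
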